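/- Let $n,k\ge 2$ and $\alpha,\beta\in(0,1)$. All vector and tensor fields live on the punctured closed unit ball $\overline{\mathbb B}^n\setminus\{0\}\subset\mathbb C^n$; a real tangent vector with $(1,0)$-part $h^j\partial/\partial z^j$ is written $h\in\mathbb C^n$, and $C^{r,\alpha}$ is meant up to the boundary, with locally Hölder continuous $r$-th derivatives. Put $\mathcal Z_z=\mathbb C z$ and $\mathcal H_z=\mathcal Z_z^{\perp}$. **Normal forms.** A complex structure of class $C^{r,\alpha}$ (on the blow-up) is an integrable $J$ with $J^2=-1$ that extends to a $C^{r,\alpha}$ tensor field on the blow-up of $\overline{\mathbb B}^n$ at $0$. It is an L-complex structure of class $C^{r,\alpha}$ if $J=i$ on $\mathcal Z$, $J\mathcal H\subset\mathcal H$, and $J$ is joined to the standard structure by a homotopy, of class $C^{r,\alpha}$ in the parameter and the point, of complex structures of class $C^{r,\alpha}$ with these two properties. $J$ is a *normal form of class $C^{k,\alpha}$* if it is an L-complex structure of class $C^{k-1,\alpha}$ (the exhaustion being $\tau_o=\|\cdot\|^2$). **Circular representations, polar frames.** A circular representation of $J$ is a bijection $\Psi:\mathbb C^n\to\mathbb C^n$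 with $\Psi(cz)=c\Psi(z)$ for $c\in\mathbb C$, of class $C^{k+1,\alpha}$ with invertible differential off $0$, mapping the complex tangent spaces of the level sets of $\mu=\|\Psi\|$ into $\mathcal H$, and inducing a holomorphic map from $\mathbb{CP}^{n-1}$ to the exceptional divisor with the complex structure given by $J$. Then $\{\mu\le 1\}$ is the indicatrix of $J$ at $0$, in linear coordinates of $T_0$ that depend on the choice of $\Psi$; values of vector fields at $0$ are taken in the coordinates $\Psi^{-1}$. For $1\le i\le n$ the polar coordinates $w^a=z^a/z^i$ ($a\ne i$), $\zeta=\|z\|z^i/|z^i|$ are used on the indicatrix and carried to the ball by $\Psi$. Put $N=1+\sum_a|w^a|^2$, define $\rho(w)$ by $\mu=|\zeta|\rho$, and put $f=\log\rho^2+\log N$, $g_{a\bar b}=\partial_a\partial_{\bar b}f$, with inverse $g^{a\bar b}$ ($g^{a\bar b}g_{c\bar b}=\delta^a_c$), $Z=z^j\partial/\partial z^j$, $e_a=z^i\,\partial/\partial z^a-(\partial_af)Z$. For $v\in\mathbb C^n$ put $$Y^a=(v^a-v^iw^a)\sqrt N,\quad Y^0=v^i\sqrt N+Y^a\partial_af,\quad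 H_b=Y^a(\partial_a\partial_bf+\partial_af\,\partial_bf),\quad H_{\bar b}=Y^ag_{a\bar b}.$$ **Quasi-regular and special fields.** A vector field $X$ is quasi-regular of class $C^{k,\alpha}$, pointed at $0$, with $X|_0=v$, if it is $C^{k,\alpha}$ on $\overline{\mathbb B}^n\setminus\{0\}$, tangent to $\partial\mathbb B^n$, and tends to $v$ at $0$ along some open dense subset of $\overline{\mathbb B}^n\setminus\{0\}$. It is the *special vector field* $X^{[\rho](v,\sigma,\widetilde Y^a)}$ if $\sigma$ is a real $C^{k,\alpha}$ function on $\mathbb{CP}^{n-1}$, and in each polar chart the $\widetilde Y^a$ are $C^{k,\alpha}$ functions of $(w,\zeta)$ for $0<|\zeta|\le1/\rho(w)$ with $\zeta\widetilde Y^a\to0$ at every $(w,0)$, and $$X=X^0Z+X^ae_a+\text{complex conjugate},\qquad X^0=\frac{Y^0}{\zeta}+i\sigma-\rho^2\,\overline{Y^0}\,\zeta,\qquad X^a=\frac{Y^a}{\zeta}+\widetilde Y^a .$$ **Explicit functions.** Let $J_{\rm st}$ be the standard complex structure of the indicatrix carried to the ball by $\Psi$, and let $(J-J_{\rm st})^a_d$,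 $(J-J_{\rm st})^a_{\bar d}$ be the $e_a$-components of $(J-J_{\rm st})(e_d)$, $(J-J_{\rm st})(e_{\bar d})$. With $$K_c=\tfrac{H_c}{\zeta}+\tfrac{\overline{H_{\bar c}}}{\bar\zeta}-\rho^2\big(\overline{H_{\bar c}}\,\zeta+H_c\bar\zeta\big),\qquad K_{\bar c}=\tfrac{H_{\bar c}}{\zeta}+\tfrac{\overline{H_c}}{\bar\zeta}-\rho^2\big(\overline{H_c}\,\zeta+H_{\bar c}\bar\zeta\big),$$ consider the condition $$(\ast)\qquad \widetilde Y^a=i\,g^{a\bar b}\,\partial_{\bar b}\sigma-\rho^2\zeta\,g^{a\bar b}\,\overline{H_b}+\tfrac i2(J-J_{\rm st})^a_{\bar d}\,g^{c\bar d}K_c-\tfrac i2(J-J_{\rm st})^a_d\,g^{d\bar c}K_{\bar c}\quad\text{in every polar chart}.$$ **Fundamental pairs.** Let $J$ be a normal form of class $C^{k,\alpha}$. A fundamental pair of class $C^{k,\alpha}$ on $J$, guided by vectors $v_t\ne0$ of class $C^{1,\beta}$ in $t\in[0,1]$, is a pair $(J_t,X_t)$, of class $C^{1,\beta}$ in $(t,x)$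 (on the blow-up for $J_t$, on $\overline{\mathbb B}^n\setminus\{0\}$ for $X_t$), where $J_t$ is a normal form of class $C^{k,\alpha}$ whose tensor field is of class $C^{k,\alpha}$ on the blow-up, $X_t$ is quasi-regular of class $C^{k,\alpha}$, pointed at $0$, with $X_t|_0=v_t$ (read in the coordinates of a circular representation $\Psi_t$ of $J_t$), and $$\frac{dJ_t}{dt}=-\mathcal L_{X_t}J_t,\qquad J_0=J .\tag{E}$$ **Theorem.** Let $J$ be a normal form of class $C^{k,\alpha}$. 1. Let $\Psi$ be a circular representation of $J$ and $v\in\mathbb C^n$. A vector field $X$ is quasi-regular of class $C^{k,\alpha}$, pointed at $0$, with $X|_0=v$ and $((\mathcal L_XJ)|_{\mathcal Z})^{\mathcal Z}=0$, if and only if it is a special vector field $X^{[\rho](v,\sigma,\widetilde Y^a)}$ for some $\sigma,\widetilde Y^a$. 2. Let $(J_t,X_t)$ be a fundamental pair of class $C^{k,\alpha}$ on $J$, guided by $v_t$. Then, for every $t\in[0,1]$, $X_t$ is a special vector field $X^{[\rho_t](v_t,\sigma_t,\widetilde Y^a_t)}$ with $\widetilde Y^a_t$ given by $(\ast)$ for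 $J_t,v_t,\sigma_t,\rho_t$; moreover $$[\overline Z,X_t^{\mathcal H}]\in T^{01}_{J_t},\tag{O}$$ where $X^{\mathcal H}_t$ is the $\mathcal H$-component of $X_t$. 3. Conversely, let $v_t\neq 0$ be of class $C^{1,\beta}$, let $J_t$ be complex structures of class $C^{k,\alpha}$ on the blow-up with $J_t\mathcal H\subset\mathcal H$, of classes $C^{1,\beta}$ and $C^{k-1,\alpha}$ in $(t,x)$ on the blow-up, let $\Psi_t$ be circular representations of $J_t$ (as defined above) whose derivatives in $z$ up to order $k+1$ are continuous in $(t,z)$, and let $X_t=X^{[\rho_t](v_t,\sigma_t,\widetilde Y^a_t)}$ be special vector fields, of class $C^{1,\beta}$ in $(t,x)$ on $\overline{\mathbb B}^n\setminus\{0\}$, with $\widetilde Y^a_t$ as in $(\ast)$. If (O) and (E) hold, then $(J_t,X_t)$ is a fundamental pair of class $C^{k,\alpha}$ on $J$ guided by $v_t$; in particular $J_t$ is the standard structure on $\mathcal Z$ and is an L-complex structure for every $t$. -/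

import Mathlib

open Set Filter Topology

noncomputable section

/-! ## Regularity classes -/

/-- `f` is of class `C^{r,a}` on `S`, up to the points of the boundary that belong to `S`: it is
`C^r`, and its `r`-th derivative is locally Hölder continuous of exponent `a`. -/
def HolderClassOn {V F : Type*} [NormedAddCommGroup V] [NormedSpace ℝ V]
    [NormedAddCommGroup F] [NormedSpace ℝ F] (r : ℕ) (a : ℝ) (f : V → F) (S : Set V) : Prop :=
  ContDiffOn ℝ r f S ∧
    ∀ x ∈ S, ∃ C : ℝ, ∀ᶠ p in (𝓝[S] x) ×ˢ (𝓝[S] x),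
      ‖iteratedFDerivWithin ℝ r f S p.1 - iteratedFDerivWithin ℝ r f S p.2‖
        ≤ C * ‖p.1 - p.2‖ ^ a

/-! ## The closed ball, the blow-up at the origin, tensor fields

A real tangent vector of `ℂⁿ` with `(1,0)`-part `hʲ ∂/∂zʲ` is written as the vector `h` of `ℂⁿ`. -/

/-- `ℂⁿ`. -/
abbrev Cn (n : ℕ) : Type := EuclideanSpace ℂ (Fin n)

/-- A real vector field on `ℂⁿ` (only its values on the punctured closed ball matter). -/
abbrev VField (n : ℕ) : Type := Cn n → Cn n

/-- A real `(1,1)`-tensor field on `ℂⁿ` (only its values on the punctured closed ball matter). -/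
abbrev EndField (n : ℕ) : Type := Cn n → (Cn n →L[ℝ] Cn n)

/-- The punctured closed unit ball. -/
def puncturedBall (n : ℕ) : Set (Cn n) := {z | z ≠ 0 ∧ ‖z‖ ≤ 1}

/-- The punctured open unit ball. -/
def puncturedOpenBall (n : ℕ) : Set (Cn n) := {z | z ≠ 0 ∧ ‖z‖ < 1}

/-- Multiplication by `i`: the standard complex structure of `ℂⁿ`. -/
def stdJ (n : ℕ) : Cn n →L[ℝ] Cn n :=
  (Complex.I • ContinuousLinearMap.id ℂ (Cn n)).restrictScalars ℝ

/-- The pull-back `F^* J` of a `(1,1)`-tensor field. -/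
def pullEnd {n : ℕ} (F : Cn n → Cn n) (J : EndField n) : EndField n :=
  fun u => (fderiv ℝ F u).inverse ∘L (J (F u) ∘L fderiv ℝ F u)

/-- The `i`-th affine chart of the blow-up of `ℂⁿ` at the origin, followed by the blow-down map:
`zⁱ = uⁱ` and `zʲ = uⁱ uʲ` for `j ≠ i`. The exceptional divisor is `uⁱ = 0`. -/
def blowChart {n : ℕ} (i : Fin n) (u : Cn n) : Cn n :=
  WithLp.toLp 2 fun j => if j = i then u i else u i * u j

/-- The part of the closed ball's blow-up that lies in the `i`-th affine chart. -/
def blowDom {n : ℕ} (i : Fin n) : Set (Cn n) := {u | ‖blowChart i u‖ ≤ 1}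

/-- `J`, given on the punctured closed ball, extends to a tensor field of class `C^{r,a}` on the
blow-up of the closed ball. -/
def ClassOnBlowUp {n : ℕ} (r : ℕ) (a : ℝ) (J : EndField n) : Prop :=
  ∀ i : Fin n, ∃ G : EndField n, HolderClassOn r a G (blowDom i) ∧
    ∀ u ∈ blowDom i, u i ≠ 0 → G u = pullEnd (blowChart i) J u

/-- `Jt`, `t ∈ [0,1]`, extends to a family of tensor fields on the blow-up of the closed ball,
of class `C^{r,a}` in the point and the parameter. -/
def FamilyClassOnBlowUp {n : ℕ} (r : ℕ) (a : ℝ) (Jt : ℝ → EndField n) : Prop :=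
  ∀ i : Fin n, ∃ G : ℝ × Cn n → (Cn n →L[ℝ] Cn n),
    HolderClassOn r a G (Icc (0 : ℝ) 1 ×ˢ blowDom i) ∧
    ∀ t ∈ Icc (0 : ℝ) 1, ∀ u ∈ blowDom i, u i ≠ 0 →
      G (t, u) = pullEnd (blowChart i) (Jt t) u

/-- The Nijenhuis tensor `N_J(p, q)` at `z`. -/
def nijenhuis {n : ℕ} (J : EndField n) (z p q : Cn n) : Cn n :=
  VectorField.lieBracket ℝ (fun _ => p) (fun _ => q) z
    - VectorField.lieBracket ℝ (fun y => J y p) (fun y => J y q) z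
    + J z (VectorField.lieBracket ℝ (fun _ => p) (fun y => J y q) z)
    + J z (VectorField.lieBracket ℝ (fun y => J y p) (fun _ => q) z)

/-- The Lie derivative `(𝓛_X J)(p) = [X, J p] - J [X, p]` at `z`. -/
def lieDer {n : ℕ} (X : VField n) (J : EndField n) (z p : Cn n) : Cn n :=
  VectorField.lieBracket ℝ X (fun y => J y p) z - J z (VectorField.lieBracket ℝ X (fun _ => p) z)

/-! ## L-complex structures and manifolds in normal form -/

/-- An integrable complex structure of class `C^{r,a}` on the blow-up of the closed ball (given by
its restriction to the complement of the exceptional divisor). -/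
structure IsComplexStructure {n : ℕ} (r : ℕ) (a : ℝ) (J : EndField n) : Prop where
  regular : ClassOnBlowUp r a J
  sq : ∀ z ∈ puncturedBall n, ∀ h, J z (J z h) = -h
  integrable : ∀ z ∈ puncturedOpenBall n, ∀ p q, nijenhuis J z p q = 0

/-- `J` agrees with the standard structure on the distribution `𝓩_z = ℂ z`. -/
def StandardOnZ {n : ℕ} (J : EndField n) : Prop :=
  ∀ z ∈ puncturedBall n, ∀ c : ℂ, J z (c • z) = (Complex.I * c) • z

/-- `J` leaves invariant the distribution `𝓗_z = 𝓩_z^⊥`. -/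
def PreservesH {n : ℕ} (J : EndField n) : Prop :=
  ∀ z ∈ puncturedBall n, ∀ h, inner ℂ z h = 0 → inner ℂ z (J z h) = 0

/-- L-complex structures of class `C^{r,a}`. -/
structure IsLStructure {n : ℕ} (r : ℕ) (a : ℝ) (J : EndField n) : Prop where
  complexStructure : IsComplexStructure r a J
  standardOnZ : StandardOnZ J
  preservesH : PreservesH J
  homotopy : ∃ K : ℝ → EndField n, FamilyClassOnBlowUp r a K ∧
    (∀ z ∈ puncturedBall n, K 0 z = stdJ n) ∧
    (∀ z ∈ puncturedBall n, K 1 z = J z) ∧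
    ∀ s ∈ Icc (0 : ℝ) 1, IsComplexStructure r a (K s) ∧ StandardOnZ (K s) ∧ PreservesH (K s)

/-- The closed ball with the blow-down of `J`, and with the exhaustion `τ_o = ‖·‖²`, is a manifold
of circular type in normal form of class `C^{k,a}`. -/
def IsNormalForm {n : ℕ} (k : ℕ) (a : ℝ) (J : EndField n) : Prop :=
  IsLStructure (k - 1) a J

/-! ## Circular representations and adapted polar coordinates -/

/-- `Ψ` is the circular representation of the normal form `J`, for a choice of linear coordinates
`T₀ ≃ ℂⁿ`: it maps the closed indicatrix `{μ ≤ 1} ⊆ ℂⁿ`, `μ = ‖Ψ ·‖`, onto the closed ball, and it is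
extended to `ℂⁿ` by homogeneity. The discs `ζ ↦ Ψ (ζ z)` are the straight discs; the complex tangent
spaces of the level sets of `μ` are mapped to `𝓗`; and the induced map between the exceptional
divisors of the blow-ups is holomorphic (last condition, where `r → 0⁺`). -/
structure IsCircularRep {n : ℕ} (k : ℕ) (a : ℝ) (J : EndField n) (Ψ : Cn n ≃ Cn n) : Prop where
  map_smul : ∀ (c : ℂ) (z : Cn n), Ψ (c • z) = c • Ψ z
  regular : HolderClassOn (k + 1) a Ψ {0}ᶜ
  invertible : ∀ z, z ≠ 0 → (fderiv ℝ Ψ z).IsInvertible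
  map_H : ∀ z, z ≠ 0 → ∀ h : Cn n,
    fderiv ℝ (fun y => ‖Ψ y‖ ^ 2) z h = 0 →
    fderiv ℝ (fun y => ‖Ψ y‖ ^ 2) z (Complex.I • h) = 0 →
    inner ℂ (Ψ z) (fderiv ℝ Ψ z h) = 0
  exceptional : ∀ z, z ≠ 0 → ∀ h : Cn n,
    fderiv ℝ (fun y => ‖Ψ y‖ ^ 2) z h = 0 →
    fderiv ℝ (fun y => ‖Ψ y‖ ^ 2) z (Complex.I • h) = 0 →
    Tendsto (fun r : ℝ => pullEnd Ψ J (r • z) h) (𝓝[>] 0) (𝓝 (Complex.I • h))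

/-- The affine coordinates `w = (w^α)`, `α ≠ i`, on `{zⁱ ≠ 0} ⊆ ℂPⁿ⁻¹`. -/
abbrev Aff {n : ℕ} (i : Fin n) : Type := {j : Fin n // j ≠ i} → ℂ

/-- The vector with `i`-th coordinate `1` and the other coordinates `w`. -/
def affPt {n : ℕ} (i : Fin n) (w : Aff i) : Cn n :=
  WithLp.toLp 2 fun j => if h : j = i then 1 else w ⟨j, h⟩

/-- `1 + ∑ |w^γ|²`. -/
def affNorm {n : ℕ} (i : Fin n) (w : Aff i) : ℝ := 1 + ∑ γ, ‖w γ‖ ^ 2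

/-- The point with generalized polar coordinates `(w, ζ)`. -/
def polarPt {n : ℕ} (i : Fin n) (p : Aff i × ℂ) : Cn n :=
  (p.2 / (Real.sqrt (affNorm i p.1) : ℂ)) • affPt i p.1

section Polar

variable {n : ℕ} (Ψ : Cn n ≃ Cn n) (i : Fin n)

/-- The function `ρ` with `μ = |ζ| ρ(w)`. -/
def rho (w : Aff i) : ℝ := ‖Ψ (polarPt i (w, 1))‖

/-- The adapted polar coordinates of the points of the punctured closed ball: `0 < |ζ| ≤ 1 / ρ`. -/
def polarDom : Set (Aff i × ℂ) := {p | p.2 ≠ 0 ∧ ‖p.2‖ * rho Ψ i p.1 ≤ 1}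

/-- `log ρ² + log (1 + ∑ |w^γ|²)`. -/
def pot (w : Aff i) : ℂ := ((Real.log (rho Ψ i w ^ 2) + Real.log (affNorm i w) : ℝ) : ℂ)

/-- `∂u/∂w^α`. -/
def dW (α : {j : Fin n // j ≠ i}) (u : Aff i → ℂ) (w : Aff i) : ℂ :=
  (fderiv ℝ u w (Pi.single α 1) - Complex.I * fderiv ℝ u w (Pi.single α Complex.I)) / 2

/-- `∂u/∂w̄^α`. -/
def dWbar (α : {j : Fin n // j ≠ i}) (u : Aff i → ℂ) (w : Aff i) : ℂ :=
  (fderiv ℝ u w (Pi.single α 1) + Complex.I * fderiv ℝ u w (Pi.single α Complex.I)) / 2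

/-- The matrix `g_{α β̄} = ∂² (log ρ² + log (1 + ∑ |w|²)) / ∂w^α ∂w̄^β`. -/
def gMat (w : Aff i) : Matrix {j : Fin n // j ≠ i} {j : Fin n // j ≠ i} ℂ :=
  Matrix.of fun α β => dW i α (dWbar i β (pot Ψ i)) w

/-- The inverse matrix `g^{α β̄}`, normalized by `∑_β g^{α β̄} g_{γ β̄} = δ^α_γ`. -/
def gInv (w : Aff i) (α β : {j : Fin n // j ≠ i}) : ℂ := (gMat Ψ i w)⁻¹ β α

/-- The vector `e_α`, of type `(1,0)`, of the adapted polar frame at the point with polar coordinates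
`p = (w, ζ)`: `e_α = zⁱ ∂/∂z^α - ∂_α (log ρ² + log (1 + ∑ |w|²)) Z`, where `Z = zʲ ∂/∂zʲ`. -/
def frameE (p : Aff i × ℂ) (α : {j : Fin n // j ≠ i}) : Cn n :=
  (p.2 / (Real.sqrt (affNorm i p.1) : ℂ)) • EuclideanSpace.single α.1 (1 : ℂ)
    - dW i α (pot Ψ i) p.1 • polarPt i p

/-- The component along `e_α` of a vector of type `(1,0)` expanded in the frame `Z`, `e_α`, at
the point `p = (w, ζ)`, that is, `dw^α (h)`. -/
def compE (p : Aff i × ℂ) (α : {j : Fin n // j ≠ i}) (h : Cn n) : ℂ :=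
  (h α.1 - p.1 α * h i) / (p.2 / (Real.sqrt (affNorm i p.1) : ℂ))

/-- `Y^α = (v^α - vⁱ w^α) √(1 + ∑ |w|²)`. -/
def YH (v : Cn n) (w : Aff i) (α : {j : Fin n // j ≠ i}) : ℂ :=
  (v α.1 - v i * w α) * (Real.sqrt (affNorm i w) : ℂ)

/-- `Y⁰ = vⁱ √(1 + ∑ |w|²) + Y^α ∂_α (log ρ² + log (1 + ∑ |w|²))`. -/
def YZ (v : Cn n) (w : Aff i) : ℂ :=
  v i * (Real.sqrt (affNorm i w) : ℂ) + ∑ α, YH i v w α * dW i α (pot Ψ i) w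

/-- `H_β = Y^α (∂_α ∂_β f + ∂_α f ∂_β f)`, where `f = log ρ² + log (1 + ∑ |w|²)`. -/
def Hlow (v : Cn n) (w : Aff i) (β : {j : Fin n // j ≠ i}) : ℂ :=
  ∑ α, YH i v w α *
    (dW i α (dW i β (pot Ψ i)) w + dW i α (pot Ψ i) w * dW i β (pot Ψ i) w)

/-- `H_β̄ = Y^α g_{α β̄}`. -/
def Hbar (v : Cn n) (w : Aff i) (β : {j : Fin n // j ≠ i}) : ℂ :=
  ∑ α, YH i v w α * gMat Ψ i w α β

/-- The component `X⁰ = Y⁰/ζ + i σ - ρ² conj(Y⁰) ζ` of a special vector field. -/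
def specialX0 (v : Cn n) (σ : Cn n → ℝ) (p : Aff i × ℂ) : ℂ :=
  YZ Ψ i v p.1 / p.2 + Complex.I * (σ (affPt i p.1) : ℂ)
    - (rho Ψ i p.1 : ℂ) ^ 2 * star (YZ Ψ i v p.1) * p.2

/-- `J - J_st` in the coordinates `Ψ⁻¹`, at the point with polar coordinates `p`; here `J_st` is the
standard complex structure of the indicatrix, transported by `Ψ`. -/
def deltaJ (J : EndField n) (p : Aff i × ℂ) (h : Cn n) : Cn n :=
  pullEnd Ψ J (polarPt i p) h - Complex.I • h

/-- The component `(J - J_st)^α_δ`, along `e_α`, of `(J - J_st)(e_δ)`. -/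
def deltaHol (J : EndField n) (p : Aff i × ℂ) (α δ : {j : Fin n // j ≠ i}) : ℂ :=
  compE i p α ((1 / 2 : ℂ) • (deltaJ Ψ i J p (frameE Ψ i p δ)
    - Complex.I • deltaJ Ψ i J p (Complex.I • frameE Ψ i p δ)))

/-- The component `(J - J_st)^α_δ̄`, along `e_α`, of `(J - J_st)(e_δ̄)`. -/
def deltaAnti (J : EndField n) (p : Aff i × ℂ) (α δ : {j : Fin n // j ≠ i}) : ℂ :=
  compE i p α ((1 / 2 : ℂ) • (deltaJ Ψ i J p (frameE Ψ i p δ)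
    + Complex.I • deltaJ Ψ i J p (Complex.I • frameE Ψ i p δ)))

/-- `K_γ = H_γ/ζ + conj(H_γ̄)/ζ̄ - ρ² (conj(H_γ̄) ζ + H_γ ζ̄)`. -/
def Klow (v : Cn n) (p : Aff i × ℂ) (γ : {j : Fin n // j ≠ i}) : ℂ :=
  Hlow Ψ i v p.1 γ / p.2 + star (Hbar Ψ i v p.1 γ) / star p.2
    - (rho Ψ i p.1 : ℂ) ^ 2 *
      (star (Hbar Ψ i v p.1 γ) * p.2 + Hlow Ψ i v p.1 γ * star p.2)

/-- `K_γ̄ = H_γ̄/ζ + conj(H_γ)/ζ̄ - ρ² (conj(H_γ) ζ + H_γ̄ ζ̄)`. -/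
def Kbar (v : Cn n) (p : Aff i × ℂ) (γ : {j : Fin n // j ≠ i}) : ℂ :=
  Hbar Ψ i v p.1 γ / p.2 + star (Hlow Ψ i v p.1 γ) / star p.2
    - (rho Ψ i p.1 : ℂ) ^ 2 *
      (star (Hlow Ψ i v p.1 γ) * p.2 + Hbar Ψ i v p.1 γ * star p.2)

/-- The explicit functions `Ỹ^α` determined by `v`, `σ` and `J - J_st`:
`i g^{α β̄} ∂_β̄ σ - ρ² ζ g^{α β̄} conj(H_β) + (i/2) (J - J_st)^α_δ̄ g^{γ δ̄} K_γ
  - (i/2) (J - J_st)^α_δ g^{δ γ̄} K_γ̄`. -/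
def explicitY (J : EndField n) (v : Cn n) (σ : Cn n → ℝ) (p : Aff i × ℂ)
    (α : {j : Fin n // j ≠ i}) : ℂ :=
  Complex.I * ∑ β, gInv Ψ i p.1 α β * dWbar i β (fun w => (σ (affPt i w) : ℂ)) p.1
    - (rho Ψ i p.1 : ℂ) ^ 2 * p.2 * ∑ β, gInv Ψ i p.1 α β * star (Hlow Ψ i v p.1 β)
    + Complex.I / 2 *
      ∑ δ, ∑ γ, deltaAnti Ψ i J p α δ * gInv Ψ i p.1 γ δ * Klow Ψ i v p γ
    - Complex.I / 2 *
      ∑ δ, ∑ γ, deltaHol Ψ i J p α δ * gInv Ψ i p.1 δ γ * Kbar Ψ i v p γ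

end Polar

/-! ## Quasi-regular and special vector fields -/

/-- Quasi-regular vector fields of class `C^{k,a}`, pointed at `0`, with value `v` at `0`; the limit
at `0` is taken in the coordinates `Ψ⁻¹`. -/
structure IsQuasiRegular {n : ℕ} (k : ℕ) (a : ℝ) (Ψ : Cn n ≃ Cn n) (v : Cn n) (X : VField n) :
    Prop where
  regular : HolderClassOn k a X (puncturedBall n)
  tangent : ∀ z : Cn n, ‖z‖ = 1 → (inner ℂ z (X z)).re = 0
  limit : ∃ U : Set (Cn n), (∃ O, IsOpen O ∧ U = O ∩ puncturedBall n) ∧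
    puncturedBall n ⊆ closure U ∧
    Tendsto (fun y => (fderiv ℝ Ψ (Ψ.symm y)).inverse (X y)) (𝓝[U] 0) (𝓝 v)

/-- `X` is the special vector field determined by `v`, by the function `σ` on `ℂPⁿ⁻¹` (given as a
function on `ℂⁿ` that is constant on complex lines) and by the functions `Ỹ^α = Y i · α` of the adapted
polar coordinates (one collection for each of the charts `i`). -/
structure IsSpecial {n : ℕ} (k : ℕ) (a : ℝ) (Ψ : Cn n ≃ Cn n) (v : Cn n) (σ : Cn n → ℝ)
    (Y : (i : Fin n) → Aff i × ℂ → {j : Fin n // j ≠ i} → ℂ) (X : VField n) : Prop where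
  sigma_smul : ∀ (c : ℂ) (z : Cn n), c ≠ 0 → σ (c • z) = σ z
  sigma_regular : HolderClassOn k a σ {0}ᶜ
  Y_regular : ∀ i α, HolderClassOn k a (fun p => Y i p α) (polarDom Ψ i)
  Y_limit : ∀ i α, ∀ w : Aff i,
    Tendsto (fun p : Aff i × ℂ => Y i p α * p.2) (𝓝[polarDom Ψ i] (w, 0)) (𝓝 0)
  expansion : ∀ i, ∀ p ∈ polarDom Ψ i,
    X (Ψ (polarPt i p)) = fderiv ℝ Ψ (polarPt i p)
      (specialX0 Ψ i v σ p • polarPt i p +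
        ∑ α, (YH i v p.1 α / p.2 + Y i p α) • frameE Ψ i p α)

/-- `((𝓛_X J)|_𝓩)^𝓩 = 0`. -/
def LieDerZZVanishes {n : ℕ} (J : EndField n) (X : VField n) : Prop :=
  ∀ z ∈ puncturedOpenBall n, ∀ c : ℂ, inner ℂ z (lieDer X J z (c • z)) = 0

/-- The component in `𝓗` of a vector field. -/
def hPart {n : ℕ} (X : VField n) : VField n :=
  fun z => X z - (inner ℂ z (X z) / ((‖z‖ : ℂ) ^ 2)) • z

/-- `[Z̄, X^𝓗]` takes values in the `(-i)`-eigenspaces of `J`. Since `2 Z̄ = A + i B`, where `A`, `B` are the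
real fields `A_z = z`, `B_z = i z`, this is `J [A, X^𝓗] = [B, X^𝓗]`. -/
def ZbarCondition {n : ℕ} (J : EndField n) (X : VField n) : Prop :=
  ∀ z ∈ puncturedOpenBall n,
    J z (VectorField.lieBracket ℝ (fun y => y) (hPart X) z)
      = VectorField.lieBracket ℝ (fun y => Complex.I • y) (hPart X) z

/-! ## Fundamental pairs -/

/-- The differential problem `dJ_t/dt = - 𝓛_{X_t} J_t`, `J_0 = J`, for `t ∈ [0,1]`. -/
def SolvesEvolution {n : ℕ} (J : EndField n) (Jt : ℝ → EndField n) (X : ℝ → VField n) : Prop :=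
  (∀ z ∈ puncturedBall n, Jt 0 z = J z) ∧
  ∀ t ∈ Icc (0 : ℝ) 1, ∀ z ∈ puncturedOpenBall n, ∀ h : Cn n,
    HasDerivWithinAt (fun s => Jt s z h) (-lieDer (X t) (Jt t) z h) (Icc 0 1) t

/-- `(Jt, X)` is an abstract fundamental pair of class `C^{k,a}` on the manifold in normal form `J`,
guided by the vectors `v t`. The tangent space at `0` of the manifold in normal form `Jt t` is identified
with `ℂⁿ` by means of the circular representation `Ψ t`. -/
structure IsFundamentalPair {n : ℕ} (k : ℕ) (a b : ℝ) (J : EndField n) (Jt : ℝ → EndField n)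
    (X : ℝ → VField n) (v : ℝ → Cn n) (Ψ : ℝ → Cn n ≃ Cn n) : Prop where
  guide_regular : HolderClassOn 1 b v (Icc 0 1)
  guide_ne_zero : ∀ t ∈ Icc (0 : ℝ) 1, v t ≠ 0
  J_isotopy : FamilyClassOnBlowUp 1 b Jt
  X_isotopy : HolderClassOn 1 b (fun q : ℝ × Cn n => X q.1 q.2) (Icc (0 : ℝ) 1 ×ˢ puncturedBall n)
  J_normalForm : ∀ t ∈ Icc (0 : ℝ) 1, IsNormalForm k a (Jt t) ∧ ClassOnBlowUp k a (Jt t)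
  circular : ∀ t ∈ Icc (0 : ℝ) 1, IsCircularRep k a (Jt t) (Ψ t)
  X_quasiRegular : ∀ t ∈ Icc (0 : ℝ) 1, IsQuasiRegular k a (Ψ t) (v t) (X t)
  evolution : SolvesEvolution J Jt X

end

/-! Everything is read through the connection form θ of the ball, the component of a vector along z
in ℂz ⊕ 𝓗_z, and through its pull-back by Ψ. The pull-back is of type (1,0), because Ψ maps the
complex tangent spaces of the levels of μ into 𝓗. It is homogeneous of degree −1 in the base point,
and f is a potential for it: the ∂_a f are its components in affine coordinates. Hence Y⁰/ζ = θ(v),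
and a special field is one whose 𝓩-component is θ(v) + iσ − μ² conj θ(v), while Ỹ records what is
left of the 𝓗-component.

Part 1. As J is standard on 𝓩 and preserves 𝓗, the condition on 𝓛_X J is the Cauchy-Riemann equation
for θ(X) along the straight discs (`ballTheta_lieDer`). The value v at the origin prescribes the
pole t/ζ with t = θ(v), and tangency makes θ(X) imaginary on the unit circle. Subtracting t/ζ − t̄ζ
leaves a holomorphic function whose real part vanishes on the circle, that is, an imaginary constant
iσ (`exists_eq_imaginary_const`, `exists_remainder_eq`).

Part 2. Along a fundamental pair every J_t is standard on 𝓩 and preserves 𝓗. By (E), 𝓛_X J vanishes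
on 𝓩, which yields (O), and preserves 𝓗, which is a linear equation for the 𝓗-component of X paired
with the Levi form (`im_inner_of_lieDer`). Integrability makes J skew for the Levi form
(`im_inner_J_of_nijenhuis`). In the polar frame the Levi form is given by the invertible Hermitian
matrix g, so the equation has exactly one solution, and this is (∗) (`hermitian_solve_iff`,
`leviCondition_iff`).

Part 3. The crux is that J_t stays standard on 𝓩. By (O), the defect E_t(y) = J_t y − i y satisfies
a linear transport equation along X_t (`neg_lieDer_self`), and E_0 = 0. Uniqueness is not automatic:
v_t ≠ 0, so trajectories of X_t come out of the origin, where no data are prescribed and the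
coefficients are singular. The remedy is a maximum principle for the squared defect on the annuli m
≤ μ ≤ 1, with weights (`weighted_defect_le`). The factor 1 − μ² disposes of the outer sphere, and
the inner sphere is treated in two steps.

In the double cover (r, y) ↦ r y of a neighbourhood of the exceptional divisor, J_t and X_t extend
as C¹ families through r = 0 to negative r (`exists_extension`); in the coordinates of Ψ_T they are
close to i and v_T near the origin for t near T (`exists_near`). A weight that is positive only
outside a cone confines the defect, for a short time, to a narrow cone about v_T (`defect_support`).
If z lies in this cone then −z does not, so J_t is standard at the opposite point, and regularity
across the divisor makes the squared defect o(μ³) at the origin (`exists_reflect`). In the cone Re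
θ(v) is at least a positive multiple of 1/μ; the weight μ⁻³ decays along X faster than the squared
defect grows, and its boundary term tends to 0 with m (`defect_eq_zero`). A continuity argument in t
covers [0,1] (`standardOnZ`), and concatenating homotopies gives L-complex structures
(`IsLStructure.of_family`). -/

noncomputable section

set_option linter.unusedSectionVars false

/-! ### Hölder classes: sums, products, compositions -/

section HolderCalculus

variable {V W F G H : Type} [NormedAddCommGroup V] [NormedSpace ℝ V]
  [NormedAddCommGroup W] [NormedSpace ℝ W] [NormedAddCommGroup F] [NormedSpace ℝ F]
  [NormedAddCommGroup G] [NormedSpace ℝ G] [NormedAddCommGroup H] [NormedSpace ℝ H]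

/-- `f` is Hölder continuous of exponent `a` on a neighbourhood of `x` in `S`. -/
def HolderNear (a : ℝ) (f : V → F) (S : Set V) (x : V) : Prop :=
  ∃ C : ℝ, ∀ᶠ p in (𝓝[S] x) ×ˢ (𝓝[S] x), ‖f p.1 - f p.2‖ ≤ C * ‖p.1 - p.2‖ ^ a

/-- `f` is Lipschitz continuous on a neighbourhood of `x` in `S`. -/
def LipNear (f : V → F) (S : Set V) (x : V) : Prop :=
  ∃ C : ℝ, 0 ≤ C ∧ ∀ᶠ p in (𝓝[S] x) ×ˢ (𝓝[S] x), ‖f p.1 - f p.2‖ ≤ C * ‖p.1 - p.2‖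

/-- Sets with unique derivatives on which `C¹` functions are locally Lipschitz. -/
structure GoodSet (S : Set V) : Prop where
  unique : UniqueDiffOn ℝ S
  lip : ∀ {F : Type} [NormedAddCommGroup F] [NormedSpace ℝ F] (f : V → F), ∀ x ∈ S,
    ContDiffWithinAt ℝ 1 f S x → LipNear f S x

lemma lipNear_of_lipschitzOnWith {f : V → F} {S t : Set V} {x : V} {K : NNReal}
    (ht : t ∈ 𝓝[S] x) (h : LipschitzOnWith K f t) : LipNear f S x := by
  refine ⟨K, K.2, ?_⟩
  filter_upwards [prod_mem_prod ht ht] with p hp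
  simpa [dist_eq_norm] using h.dist_le_mul p.1 hp.1 p.2 hp.2

lemma ContDiffAt.lipNear {f : V → F} {S : Set V} {x : V} (hf : ContDiffAt ℝ 1 f x) :
    LipNear f S x := by
  obtain ⟨K, t, ht, hK⟩ := hf.exists_lipschitzOnWith
  exact lipNear_of_lipschitzOnWith (mem_nhdsWithin_of_mem_nhds ht) hK

lemma GoodSet.inter {S O : Set V} (hS : GoodSet S) (hO : IsOpen O) : GoodSet (S ∩ O) := by
  refine ⟨hS.unique.inter hO, fun f x hx hf => ?_⟩
  have hn : 𝓝[S ∩ O] x = 𝓝[S] x := nhdsWithin_inter_of_mem' (mem_nhdsWithin_of_mem_nhds (hO.mem_nhds hx.2))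
  have := hS.lip f x hx.1 ((contDiffWithinAt_inter (hO.mem_nhds hx.2)).1 hf)
  unfold LipNear at *
  rwa [hn]

/-- On convex sets the mean value inequality is available. The domains of the problem are obtained
from convex sets by intersection with open sets and by diffeomorphisms, two operations under which
the property is stable. -/
lemma Convex.goodSet {S : Set V} (hS : Convex ℝ S) (hi : (interior S).Nonempty) : GoodSet S :=
  ⟨uniqueDiffOn_convex hS hi, fun f x _ hf => by
    obtain ⟨K, t, ht, hK⟩ := hf.exists_lipschitzOnWith hS
    exact lipNear_of_lipschitzOnWith ht hK⟩

lemma IsOpen.goodSet {O : Set V} (hO : IsOpen O) : GoodSet O := by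
  have := (convex_univ (𝕜 := ℝ) (E := V)).goodSet (by simp)
  simpa using this.inter hO

lemma LipNear.holderNear {f : V → F} {S : Set V} {x : V} {a : ℝ} (ha : a ≤ 1)
    (h : LipNear f S x) : HolderNear a f S x := by
  obtain ⟨C, hC, h⟩ := h
  refine ⟨C, ?_⟩
  have hb : ∀ᶠ p in (𝓝[S] x) ×ˢ (𝓝[S] x), ‖p.1 - p.2‖ < 1 := by
    have : Tendsto (fun p : V × V => ‖p.1 - p.2‖) (𝓝 (x, x)) (𝓝 ‖x - x‖) :=
      (continuous_fst.sub continuous_snd).norm.tendsto (x, x)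
    rw [sub_self, norm_zero, nhds_prod_eq] at this
    exact (this.mono_left (prod_mono nhdsWithin_le_nhds nhdsWithin_le_nhds)).eventually
      (gt_mem_nhds one_pos)
  filter_upwards [h, hb] with p hp hp'
  refine hp.trans (mul_le_mul_of_nonneg_left ?_ hC)
  rcases (norm_nonneg (p.1 - p.2)).eq_or_lt with h0 | h0
  · rw [← h0]; exact Real.rpow_nonneg le_rfl _
  · simpa using Real.rpow_le_rpow_of_exponent_ge h0 hp'.le ha

/-- Pull-back of good sets by global diffeomorphisms. -/
lemma GoodSet.preimage {S : Set W} (hS : GoodSet S) (e : V ≃ W) (h1 : ContDiff ℝ 1 e)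
    (h2 : ContDiff ℝ 1 e.symm) : GoodSet (e ⁻¹' S) := by
  constructor
  · intro x hx
    have hx' : HasFDerivWithinAt e.symm (fderiv ℝ e.symm (e x)) S (e x) :=
      (h2.differentiable one_ne_zero _).hasFDerivAt.hasFDerivWithinAt
    have := hx'.uniqueDiffWithinAt (hS.unique _ hx) (by
      apply Function.Surjective.denseRange
      have hc : HasFDerivAt (e.symm ∘ e) ((fderiv ℝ e.symm (e x)).comp (fderiv ℝ e x)) x :=
        (h2.differentiable one_ne_zero _).hasFDerivAt.comp x
          (h1.differentiable one_ne_zero _).hasFDerivAt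
      rw [show (e.symm ∘ e : V → V) = id from funext e.symm_apply_apply] at hc
      intro v
      exact ⟨fderiv ℝ e x v, by
        have := congrArg (fun L => L v) (hc.unique (hasFDerivAt_id x)); simpa using this⟩)
    rwa [e.symm_apply_apply, Equiv.image_symm_eq_preimage] at this
  · intro F _ _ f x hx hf
    have hg : ContDiffWithinAt ℝ 1 (f ∘ e.symm) S (e x) := by
      have hf' : ContDiffWithinAt ℝ 1 f (e ⁻¹' S) (e.symm (e x)) := by simpa using hf
      exact hf'.comp (e x) h2.contDiffAt.contDiffWithinAt (fun y hy => by simpa using hy)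
    obtain ⟨C, hC, h⟩ := hS.lip _ _ hx hg
    obtain ⟨C', hC', h'⟩ := (h1.contDiffAt (x := x)).lipNear (S := e ⁻¹' S)
    refine ⟨C * C', by positivity, ?_⟩
    have ht : Tendsto e (𝓝[e ⁻¹' S] x) (𝓝[S] (e x)) :=
      h1.continuous.continuousWithinAt.tendsto_nhdsWithin (fun y hy => hy)
    filter_upwards [(ht.prodMap ht).eventually h, h'] with p hp hp'
    simp only [Function.comp, Prod.map, e.symm_apply_apply] at hp
    calc _ ≤ _ := hp
      _ ≤ C * (C' * ‖p.1 - p.2‖) := by gcongr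
      _ = _ := by ring

lemma HolderNear.congr_iso {f : V → F} {g : V → G} {S : Set V} {x : V} {a : ℝ} (e : G ≃ₗᵢ[ℝ] F)
    (h : ∀ y ∈ S, f y = e (g y)) : HolderNear a f S x ↔ HolderNear a g S x := by
  unfold HolderNear
  refine exists_congr fun C => ?_
  have hs : S ×ˢ S ∈ (𝓝[S] x) ×ˢ (𝓝[S] x) := prod_mem_prod self_mem_nhdsWithin self_mem_nhdsWithin
  refine eventually_congr ?_
  filter_upwards [hs] with p hp
  rw [h _ hp.1, h _ hp.2, ← map_sub, e.norm_map]

lemma holderClassOn_zero {a : ℝ} {f : V → F} {S : Set V} :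
    HolderClassOn 0 a f S ↔ ContinuousOn f S ∧ ∀ x ∈ S, HolderNear a f S x := by
  unfold HolderClassOn
  simp only [Nat.cast_zero, contDiffOn_zero]
  refine and_congr_right fun _ => forall₂_congr fun x _ => ?_
  exact HolderNear.congr_iso (continuousMultilinearCurryFin0 ℝ V F).symm
    (fun y _ => by rw [iteratedFDerivWithin_zero_eq_comp]; rfl)

/-- Currying is an isometry between the derivatives of order r + 1 of f and those of order r of its
derivative, so the Hölder quotients agree. The closure properties of the classes follow from this by
induction on r. -/
lemma holderClassOn_succ {r : ℕ} {a : ℝ} {f : V → F} {S : Set V} (hS : UniqueDiffOn ℝ S) :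
    HolderClassOn (r + 1) a f S ↔
      DifferentiableOn ℝ f S ∧ HolderClassOn r a (fderivWithin ℝ f S) S := by
  unfold HolderClassOn
  rw [Nat.cast_add, Nat.cast_one, contDiffOn_succ_iff_fderivWithin hS, and_assoc, and_assoc]
  simp only [WithTop.natCast_ne_top, false_imp_iff, true_and]
  refine and_congr_right fun _ => and_congr_right fun _ => forall₂_congr fun x _ => ?_
  exact HolderNear.congr_iso (continuousMultilinearCurryRightEquiv' ℝ r V F).symm
    (fun y hy => by rw [iteratedFDerivWithin_succ_eq_comp_right hS hy]; rfl)

namespace HolderClassOn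

variable {r : ℕ} {a : ℝ} {f : V → F} {S : Set V}

lemma contDiffOn (h : HolderClassOn r a f S) : ContDiffOn ℝ r f S := h.1

lemma continuousOn (h : HolderClassOn r a f S) : ContinuousOn f S := h.1.continuousOn

lemma congr (h : HolderClassOn r a f S) {g : V → F} (hg : ∀ x ∈ S, g x = f x) :
    HolderClassOn r a g S := by
  refine ⟨h.1.congr hg, fun x hx => ?_⟩
  obtain ⟨C, hC⟩ := h.2 x hx
  refine ⟨C, ?_⟩
  have hs : S ×ˢ S ∈ (𝓝[S] x) ×ˢ (𝓝[S] x) := prod_mem_prod self_mem_nhdsWithin self_mem_nhdsWithin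
  filter_upwards [hs, hC] with p hp hC
  rwa [iteratedFDerivWithin_congr hg hp.1, iteratedFDerivWithin_congr hg hp.2]

end HolderClassOn

/-- Both the filter 𝓝[S] x and the derivatives within S at x depend only on S near x. -/
lemma holderClassOn_of_locally {r : ℕ} {a : ℝ} {f : V → F} {S : Set V}
    (h : ∀ x ∈ S, ∃ O, IsOpen O ∧ x ∈ O ∧ HolderClassOn r a f (S ∩ O)) : HolderClassOn r a f S := by
  constructor
  · intro x hx
    obtain ⟨O, hO, hxO, h⟩ := h x hx
    exact (contDiffWithinAt_inter (hO.mem_nhds hxO)).1 (h.1 x ⟨hx, hxO⟩)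
  · intro x hx
    obtain ⟨O, hO, hxO, h⟩ := h x hx
    obtain ⟨C, hC⟩ := h.2 x ⟨hx, hxO⟩
    refine ⟨C, ?_⟩
    have hn : 𝓝[S ∩ O] x = 𝓝[S] x :=
      nhdsWithin_inter_of_mem' (mem_nhdsWithin_of_mem_nhds (hO.mem_nhds hxO))
    rw [hn] at hC
    have ho : O ×ˢ O ∈ (𝓝[S] x) ×ˢ (𝓝[S] x) :=
      prod_mem_prod (mem_nhdsWithin_of_mem_nhds (hO.mem_nhds hxO))
        (mem_nhdsWithin_of_mem_nhds (hO.mem_nhds hxO))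
    filter_upwards [hC, ho] with p hp ho
    rwa [iteratedFDerivWithin_inter_open hO ho.1, iteratedFDerivWithin_inter_open hO ho.2] at hp

lemma HolderNear.add {a : ℝ} {f g : V → F} {S : Set V} {x : V} (hf : HolderNear a f S x)
    (hg : HolderNear a g S x) : HolderNear a (fun y => f y + g y) S x := by
  obtain ⟨C, hC⟩ := hf
  obtain ⟨D, hD⟩ := hg
  refine ⟨C + D, ?_⟩
  filter_upwards [hC, hD] with p h1 h2
  calc ‖f p.1 + g p.1 - (f p.2 + g p.2)‖ = ‖(f p.1 - f p.2) + (g p.1 - g p.2)‖ := by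
        congr 1; abel
    _ ≤ _ := norm_add_le _ _
    _ ≤ _ := add_le_add h1 h2
    _ = _ := by ring

lemma HolderNear.bilin {a : ℝ} {f : V → F} {g : V → G} {S : Set V} {x : V} (B : F →L[ℝ] G →L[ℝ] H)
    (hf : HolderNear a f S x) (hg : HolderNear a g S x) (hfc : ContinuousWithinAt f S x)
    (hgc : ContinuousWithinAt g S x) : HolderNear a (fun y => B (f y) (g y)) S x := by
  obtain ⟨C, hC⟩ := hf
  obtain ⟨D, hD⟩ := hg
  refine ⟨‖B‖ * (‖f x‖ + 1) * D + ‖B‖ * C * (‖g x‖ + 1), ?_⟩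
  have h1 : ∀ᶠ y in 𝓝[S] x, ‖f y‖ ≤ ‖f x‖ + 1 :=
    (hfc.norm.eventually (gt_mem_nhds (lt_add_one _))).mono fun _ h => h.le
  have h2 : ∀ᶠ y in 𝓝[S] x, ‖g y‖ ≤ ‖g x‖ + 1 :=
    (hgc.norm.eventually (gt_mem_nhds (lt_add_one _))).mono fun _ h => h.le
  filter_upwards [hC, hD, h1.prod_mk h2] with p h1 h2 h3
  have e : B (f p.1) (g p.1) - B (f p.2) (g p.2)
      = B (f p.1) (g p.1 - g p.2) + B (f p.1 - f p.2) (g p.2) := by simp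
  have hn : 0 ≤ ‖p.1 - p.2‖ ^ a := by positivity
  calc ‖B (f p.1) (g p.1) - B (f p.2) (g p.2)‖
      ≤ ‖B (f p.1) (g p.1 - g p.2)‖ + ‖B (f p.1 - f p.2) (g p.2)‖ := by rw [e]; exact norm_add_le _ _
    _ ≤ ‖B‖ * ‖f p.1‖ * ‖g p.1 - g p.2‖ + ‖B‖ * ‖f p.1 - f p.2‖ * ‖g p.2‖ :=
        add_le_add (B.le_opNorm₂ _ _) (B.le_opNorm₂ _ _)
    _ ≤ ‖B‖ * (‖f x‖ + 1) * (D * ‖p.1 - p.2‖ ^ a)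
        + ‖B‖ * (C * ‖p.1 - p.2‖ ^ a) * (‖g x‖ + 1) := by
        have h4 : 0 ≤ C * ‖p.1 - p.2‖ ^ a := (norm_nonneg _).trans h1
        have h5 := h3.1
        have h6 := h3.2
        gcongr
    _ = _ := by ring

namespace HolderClassOn

variable {a : ℝ} {S : Set V}

/-- One derivative to spare makes the top derivative locally Lipschitz, hence Hölder of any exponent
a ≤ 1. On a general set with unique derivatives this can fail, which is the reason for the Lipschitz
clause of `GoodSet`. -/
lemma of_contDiffOn (ha : a ≤ 1) (hS : GoodSet S) : ∀ (r : ℕ) {F : Type} [NormedAddCommGroup F]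
    [NormedSpace ℝ F] {f : V → F}, ContDiffOn ℝ (r + 1) f S → HolderClassOn r a f S := by
  intro r
  induction r with
  | zero =>
    intro F _ _ f hf
    rw [holderClassOn_zero]
    exact ⟨hf.continuousOn, fun x hx => (hS.lip f x hx (by simpa using hf x hx)).holderNear ha⟩
  | succ r ih =>
    intro F _ _ f hf
    rw [holderClassOn_succ hS.unique]
    rw [contDiffOn_succ_iff_fderivWithin hS.unique] at hf
    exact ⟨hf.1, ih (by exact_mod_cast hf.2.2)⟩

lemma of_succ (ha : a ≤ 1) (hS : GoodSet S) {r : ℕ} {f : V → F} (h : HolderClassOn (r + 1) a f S) :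
    HolderClassOn r a f S :=
  of_contDiffOn ha hS r (by exact_mod_cast h.1)

lemma of_le (ha : a ≤ 1) (hS : GoodSet S) {r s : ℕ} (hrs : r ≤ s) {f : V → F}
    (h : HolderClassOn s a f S) : HolderClassOn r a f S := by
  induction hrs with
  | refl => exact h
  | step _ ih => exact ih (h.of_succ ha hS)

lemma of_contDiffAt (ha : a ≤ 1) (hS : GoodSet S) (r : ℕ) {f : V → F}
    (h : ∀ x ∈ S, ContDiffAt ℝ (r + 1) f x) : HolderClassOn r a f S :=
  of_contDiffOn ha hS r fun x hx => (h x hx).contDiffWithinAt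

lemma const (ha : a ≤ 1) (hS : GoodSet S) (r : ℕ) (c : F) : HolderClassOn r a (fun _ => c) S :=
  of_contDiffOn ha hS r contDiffOn_const

lemma lipNear (hS : GoodSet S) {r : ℕ} (hr : 1 ≤ r) {f : V → F} (h : HolderClassOn r a f S)
    {x : V} (hx : x ∈ S) : LipNear f S x :=
  hS.lip f x hx ((h.1 x hx).of_le (by exact_mod_cast hr))

lemma add (hS : UniqueDiffOn ℝ S) : ∀ (r : ℕ) {F : Type} [NormedAddCommGroup F]
    [NormedSpace ℝ F] {f g : V → F}, HolderClassOn r a f S → HolderClassOn r a g S →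
      HolderClassOn r a (fun x => f x + g x) S := by
  intro r
  induction r with
  | zero =>
    intro F _ _ f g hf hg
    rw [holderClassOn_zero] at *
    exact ⟨hf.1.add hg.1, fun x hx => (hf.2 x hx).add (hg.2 x hx)⟩
  | succ r ih =>
    intro F _ _ f g hf hg
    rw [holderClassOn_succ hS] at *
    exact ⟨hf.1.add hg.1, (ih hf.2 hg.2).congr fun x hx =>
      fderivWithin_fun_add (hS x hx) (hf.1 x hx) (hg.1 x hx)⟩

/-- The Leibniz rule expresses the derivative by two bilinear maps on new spaces; therefore the
spaces and B are quantified inside the induction. -/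
lemma bilin (ha : a ≤ 1) (hS : GoodSet S) : ∀ (r : ℕ) {F G H : Type} [NormedAddCommGroup F]
    [NormedSpace ℝ F] [NormedAddCommGroup G] [NormedSpace ℝ G] [NormedAddCommGroup H]
    [NormedSpace ℝ H] (B : F →L[ℝ] G →L[ℝ] H) {f : V → F} {g : V → G}, HolderClassOn r a f S →
      HolderClassOn r a g S → HolderClassOn r a (fun x => B (f x) (g x)) S := by
  intro r
  induction r with
  | zero =>
    intro F G H _ _ _ _ _ _ B f g hf hg
    rw [holderClassOn_zero] at *
    refine ⟨?_, fun x hx => (hf.2 x hx).bilin B (hg.2 x hx) (hf.1 x hx) (hg.1 x hx)⟩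
    exact (B.continuous.comp_continuousOn hf.1).clm_apply hg.1
  | succ r ih =>
    intro F G H _ _ _ _ _ _ B f g hf hg
    have hf0 := hf.of_succ ha hS
    have hg0 := hg.of_succ ha hS
    rw [holderClassOn_succ hS.unique] at *
    refine ⟨fun x hx => (B.hasFDerivWithinAt_of_bilinear (hf.1 x hx).hasFDerivWithinAt
      (hg.1 x hx).hasFDerivWithinAt).differentiableWithinAt, ?_⟩
    refine (add hS.unique r (ih (B.precompR V) hf0 hg.2) (ih (B.precompL V) hf.2 hg0)).congr
      fun x hx => ?_
    exact (B.hasFDerivWithinAt_of_bilinear (hf.1 x hx).hasFDerivWithinAt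
      (hg.1 x hx).hasFDerivWithinAt).fderivWithin (hS.unique x hx)

lemma clm (ha : a ≤ 1) (hS : GoodSet S) {r : ℕ} (L : F →L[ℝ] G) {f : V → F}
    (hf : HolderClassOn r a f S) : HolderClassOn r a (fun x => L (f x)) S :=
  bilin ha hS r (ContinuousLinearMap.apply ℝ G |>.flip) (const ha hS r L) hf

lemma prodMk (ha : a ≤ 1) (hS : GoodSet S) {r : ℕ} {f : V → F} {g : V → G}
    (hf : HolderClassOn r a f S) (hg : HolderClassOn r a g S) :
    HolderClassOn r a (fun x => (f x, g x)) S :=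
  (add hS.unique r (hf.clm ha hS (ContinuousLinearMap.inl ℝ F G))
    (hg.clm ha hS (ContinuousLinearMap.inr ℝ F G))).congr fun x _ => by simp

end HolderClassOn

lemma HolderNear.comp {a : ℝ} (ha : 0 ≤ a) {S : Set V} {T : Set W} {f : W → F} {g : V → W} {x : V}
    (hf : HolderNear a f T (g x)) (hg : LipNear g S x) (hgc : ContinuousWithinAt g S x)
    (hm : MapsTo g S T) : HolderNear a (f ∘ g) S x := by
  obtain ⟨C, hC⟩ := hf
  obtain ⟨D, hD0, hD⟩ := hg
  refine ⟨|C| * D ^ a, ?_⟩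
  have ht : Tendsto g (𝓝[S] x) (𝓝[T] (g x)) := hgc.tendsto_nhdsWithin hm
  filter_upwards [(ht.prodMap ht).eventually hC, hD] with p h1 h2
  calc _ ≤ C * ‖g p.1 - g p.2‖ ^ a := h1
    _ ≤ |C| * (D * ‖p.1 - p.2‖) ^ a := by
      gcongr
      exact le_abs_self C
    _ = _ := by rw [Real.mul_rpow hD0 (norm_nonneg _)]; ring

/-- The Lipschitz hypothesis on g is kept apart from its class: the induction ends at r = 0, where g
would only be Hölder and the composition would lose part of the exponent. -/
lemma HolderClassOn.comp_of_lip {a : ℝ} (ha0 : 0 ≤ a) (ha : a ≤ 1) {S : Set V} {T : Set W}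
    (hS : GoodSet S) (hT : GoodSet T) : ∀ (r : ℕ) {F : Type} [NormedAddCommGroup F]
    [NormedSpace ℝ F] {f : W → F} {g : V → W}, HolderClassOn r a f T → HolderClassOn r a g S →
      (∀ x ∈ S, LipNear g S x) → MapsTo g S T → HolderClassOn r a (fun x => f (g x)) S := by
  intro r
  induction r with
  | zero =>
    intro F _ _ f g hf hg hl hm
    rw [holderClassOn_zero] at *
    exact ⟨hf.1.comp hg.1 hm, fun x hx => (hf.2 _ (hm hx)).comp ha0 (hl x hx) (hg.1 x hx) hm⟩
  | succ r ih =>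
    intro F _ _ f g hf hg hl hm
    have hg0 := hg.of_succ ha hS
    rw [holderClassOn_succ hS.unique] at *
    rw [holderClassOn_succ hT.unique] at hf
    refine ⟨hf.1.comp hg.1 hm, ?_⟩
    refine (HolderClassOn.bilin ha hS r (ContinuousLinearMap.compL ℝ V W F)
      (ih hf.2 hg0 hl hm) hg.2).congr fun x hx => ?_
    exact fderivWithin_comp x (hf.1 _ (hm hx)) (hg.1 x hx) hm (hS.unique x hx)

lemma HolderClassOn.comp {a : ℝ} (ha0 : 0 ≤ a) (ha : a ≤ 1) {S : Set V} {T : Set W}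
    (hS : GoodSet S) (hT : GoodSet T) {r : ℕ} (hr : 1 ≤ r) {f : W → F} {g : V → W}
    (hf : HolderClassOn r a f T) (hg : HolderClassOn r a g S) (hm : MapsTo g S T) :
    HolderClassOn r a (fun x => f (g x)) S :=
  hf.comp_of_lip ha0 ha hS hT r hg (fun _ hx => hg.lipNear hS hr hx) hm

/-- Composition with an outer function that is `C^∞` near the image. -/
lemma HolderClassOn.smooth_comp {a : ℝ} (ha0 : 0 ≤ a) (ha : a ≤ 1) {S : Set V}
    (hS : GoodSet S) {r : ℕ} (hr : 1 ≤ r) {T : Set W} (hT : IsOpen T) {f : W → F} {g : V → W}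
    (hf : ContDiffOn ℝ (⊤ : ℕ∞) f T) (hg : HolderClassOn r a g S) (hm : MapsTo g S T) :
    HolderClassOn r a (fun x => f (g x)) S :=
  (HolderClassOn.of_contDiffOn ha hT.goodSet r (hf.of_le (by exact_mod_cast le_top))).comp ha0 ha hS
    hT.goodSet hr hg hm

lemma HolderClassOn.fderiv_of_isOpen {a : ℝ} {O : Set V} (hO : IsOpen O) {r : ℕ} {f : V → F}
    (h : HolderClassOn (r + 1) a f O) : HolderClassOn r a (fderiv ℝ f) O :=
  ((holderClassOn_succ hO.uniqueDiffOn).1 h).2.congr fun _ hx => (fderivWithin_of_isOpen hO hx).symm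

end HolderCalculus

/-! ### Hermitian products and the connection form θ of the ball -/

section InnerCalculus

variable {n : ℕ} {V : Type} [NormedAddCommGroup V] [NormedSpace ℝ V]

/-- The derivative of the Hermitian product of two maps. -/
lemma hermitian_fderiv {f g : V → Cn n} {f' g' : V →L[ℝ] Cn n} {x : V}
    (hf : HasFDerivAt f f' x) (hg : HasFDerivAt g g' x) :
    DifferentiableAt ℝ (fun y => inner ℂ (f y) (g y)) x ∧
      ∀ h, fderiv ℝ (fun y => inner ℂ (f y) (g y)) x h
        = inner ℂ (f x) (g' h) + inner ℂ (f' h) (g x) := by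
  have := hf.inner ℂ hg
  exact ⟨this.differentiableAt, fun h => by rw [this.fderiv]; simp⟩

lemma normSq_eq_inner (y : Cn n) : ((‖y‖ : ℂ)) ^ 2 = inner ℂ y y := by
  rw [inner_self_eq_norm_sq_to_K]; rfl

lemma normSq_eq_re_inner (y : Cn n) : ‖y‖ ^ 2 = (inner ℂ y y : ℂ).re := by
  rw [← normSq_eq_inner]; norm_cast

lemma normSq_fderiv {f : V → Cn n} {f' : V →L[ℝ] Cn n} {x : V}
    (hf : HasFDerivAt f f' x) :
    DifferentiableAt ℝ (fun y => ‖f y‖ ^ 2) x ∧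
      ∀ h, fderiv ℝ (fun y => ‖f y‖ ^ 2) x h = 2 * (inner ℂ (f x) (f' h) : ℂ).re := by
  have h1 := hf.inner ℂ hf
  have h2 := Complex.reCLM.hasFDerivAt.comp x h1
  have e : (fun y => ‖f y‖ ^ 2) = (Complex.reCLM ∘ fun y => inner ℂ (f y) (f y)) := by
    funext y; simp [normSq_eq_re_inner]
  rw [e]
  refine ⟨h2.differentiableAt, fun h => ?_⟩
  rw [h2.fderiv]
  simp only [ContinuousLinearMap.comp_apply, fderivInnerCLM_apply, ContinuousLinearMap.prod_apply,
    Complex.reCLM_apply, Complex.add_re]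
  rw [← inner_conj_symm (f' h) (f x), Complex.conj_re]; ring

/-- The connection form `θ` of the ball: the component along `z` of `h` in `ℂ z ⊕ 𝓗_z`. -/
def ballTheta (y h : Cn n) : ℂ := inner ℂ y h / (‖y‖ : ℂ) ^ 2

lemma ballTheta_add (y h h' : Cn n) : ballTheta y (h + h') = ballTheta y h + ballTheta y h' := by
  simp [ballTheta, inner_add_right, add_div]

lemma ballTheta_sub (y h h' : Cn n) : ballTheta y (h - h') = ballTheta y h - ballTheta y h' := by
  simp [ballTheta, inner_sub_right, sub_div]

lemma ballTheta_smul (y h : Cn n) (c : ℂ) : ballTheta y (c • h) = c * ballTheta y h := by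
  simp [ballTheta, inner_smul_right, mul_div_assoc]

lemma normC_ne_zero {y : Cn n} (hy : y ≠ 0) : (‖y‖ : ℂ) ≠ 0 := by
  exact_mod_cast norm_ne_zero_iff.2 hy

lemma ballTheta_self {y : Cn n} (hy : y ≠ 0) : ballTheta y y = 1 := by
  rw [ballTheta, ← normSq_eq_inner, div_self (pow_ne_zero _ (normC_ne_zero hy))]

lemma inner_eq_ballTheta {y : Cn n} (hy : y ≠ 0) (h : Cn n) :
    inner ℂ y h = (‖y‖ : ℂ) ^ 2 * ballTheta y h := by
  rw [ballTheta, mul_div_cancel₀ _ (pow_ne_zero _ (normC_ne_zero hy))]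

lemma ballTheta_eq_zero {y : Cn n} (hy : y ≠ 0) {h : Cn n} :
    ballTheta y h = 0 ↔ inner ℂ y h = (0 : ℂ) := by
  rw [inner_eq_ballTheta hy]
  simp [normC_ne_zero hy]

/-- Homogeneity of degree −1 in the base point: this is the source of the simple pole of special
fields along the straight discs. -/
lemma ballTheta_smul_left (y h : Cn n) (c : ℂ) (hc : c ≠ 0) :
    ballTheta (c • y) h = ballTheta y h / c := by
  have hc' : (starRingEnd ℂ) c ≠ 0 := by simpa using hc
  have e : (‖c‖ : ℂ) ^ 2 = (starRingEnd ℂ) c * c := by rw [mul_comm, Complex.mul_conj']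
  rw [ballTheta, ballTheta, inner_smul_left, norm_smul, Complex.ofReal_mul, mul_pow, e,
    mul_assoc, mul_div_mul_left _ _ hc', div_div, mul_comm c]

lemma contDiffOn_ballTheta :
    ContDiffOn ℝ (⊤ : ℕ∞) (fun p : Cn n × Cn n => ballTheta p.1 p.2) {p | p.1 ≠ 0} := by
  have e : (fun p : Cn n × Cn n => ballTheta p.1 p.2)
      = fun p => inner ℂ p.1 p.2 * (inner ℂ p.1 p.1)⁻¹ := by
    funext p; rw [ballTheta, normSq_eq_inner, div_eq_mul_inv]
  rw [e]
  refine (contDiff_fst.inner ℂ contDiff_snd).contDiffOn.mul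
    ((contDiff_fst.inner ℂ contDiff_fst).contDiffOn.inv fun p hp => ?_)
  simpa using hp

lemma isOpen_fst_ne_zero : IsOpen {p : Cn n × Cn n | p.1 ≠ 0} :=
  isOpen_ne_fun continuous_fst continuous_const

end InnerCalculus

/-- The pull-back of `θ` by `Ψ`. -/
def theta {n : ℕ} (Ψ : Cn n → Cn n) (z h : Cn n) : ℂ := ballTheta (Ψ z) (fderiv ℝ Ψ z h)

/-! ### Circular representations: homogeneity, type of the pull-back of θ, inverse map -/

namespace IsCircularRep

variable {n k : ℕ} {a : ℝ} {J : EndField n} {Ψ : Cn n ≃ Cn n} (hΨ : IsCircularRep k a J Ψ)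
include hΨ

lemma map_zero : Ψ 0 = 0 := by simpa using hΨ.map_smul 0 0

lemma map_ne_zero {z : Cn n} (hz : z ≠ 0) : Ψ z ≠ 0 := fun h => hz (Ψ.injective (h.trans hΨ.map_zero.symm))

lemma symm_ne_zero {y : Cn n} (hy : y ≠ 0) : Ψ.symm y ≠ 0 := fun h =>
  hy (by rw [← Ψ.apply_symm_apply y, h, hΨ.map_zero])

lemma symm_smul (c : ℂ) (y : Cn n) : Ψ.symm (c • y) = c • Ψ.symm y := by
  rw [Equiv.symm_apply_eq, hΨ.map_smul, Equiv.apply_symm_apply]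

lemma contDiffAt {z : Cn n} (hz : z ≠ 0) : ContDiffAt ℝ (k + 1) Ψ z := by
  have := hΨ.regular.1.contDiffAt (isOpen_compl_singleton.mem_nhds hz)
  exact_mod_cast this

lemma differentiableAt {z : Cn n} (hz : z ≠ 0) : DifferentiableAt ℝ Ψ z :=
  (hΨ.contDiffAt hz).differentiableAt (by simp)

lemma hasFDerivAt {z : Cn n} (hz : z ≠ 0) : HasFDerivAt Ψ (fderiv ℝ Ψ z) z :=
  (hΨ.differentiableAt hz).hasFDerivAt

lemma fderiv_smul_self {z : Cn n} (hz : z ≠ 0) (c : ℂ) : fderiv ℝ Ψ z (c • z) = c • Ψ z := by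
  have h0 : HasDerivAt (fun s : ℝ => z + s • (c • z)) (c • z) 0 := by
    simpa using ((hasDerivAt_id (0 : ℝ)).smul_const (c • z)).const_add z
  have h1 : HasDerivAt (fun s : ℝ => Ψ (z + s • (c • z))) (fderiv ℝ Ψ z (c • z)) 0 := by
    have hd : HasFDerivAt Ψ (fderiv ℝ Ψ z) (z + (0 : ℝ) • (c • z)) := by
      simpa using hΨ.hasFDerivAt hz
    exact hd.comp_hasDerivAt (0 : ℝ) h0
  have e : (fun s : ℝ => Ψ (z + s • (c • z))) = fun s : ℝ => Ψ z + s • (c • Ψ z) := by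
    funext s
    have e1 : z + s • (c • z) = (1 + (s : ℂ) * c) • z := by
      rw [add_smul, one_smul, mul_smul, Complex.coe_smul]
    rw [e1, hΨ.map_smul, add_smul, one_smul, mul_smul, Complex.coe_smul]
  rw [e] at h1
  exact h1.unique (by simpa using ((hasDerivAt_id (0 : ℝ)).smul_const (c • Ψ z)).const_add (Ψ z))

lemma fderiv_self {z : Cn n} (hz : z ≠ 0) : fderiv ℝ Ψ z z = Ψ z := by
  simpa using hΨ.fderiv_smul_self hz 1

lemma fderiv_smul {z : Cn n} (hz : z ≠ 0) {c : ℂ} (hc : c ≠ 0) (h : Cn n) :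
    fderiv ℝ Ψ (c • z) (c • h) = c • fderiv ℝ Ψ z h := by
  have hm : HasFDerivAt (fun y : Cn n => c • y)
      ((c • ContinuousLinearMap.id ℂ (Cn n)).restrictScalars ℝ) z :=
    ((c • ContinuousLinearMap.id ℂ (Cn n)).restrictScalars ℝ).hasFDerivAt
  have h1 := (hΨ.hasFDerivAt (smul_ne_zero hc hz)).comp z hm
  have h2 := (((c • ContinuousLinearMap.id ℂ (Cn n)).restrictScalars ℝ).hasFDerivAt
    (x := Ψ z)).comp z (hΨ.hasFDerivAt hz)
  have e : (Ψ ∘ fun y : Cn n => c • y)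
      = (((c • ContinuousLinearMap.id ℂ (Cn n)).restrictScalars ℝ) ∘ Ψ) := by
    funext y; simp [hΨ.map_smul]
  rw [e] at h1
  simpa using congrArg (fun L => L h) (h1.unique h2)

/-- The differential of a map of degree 1 has degree 0 under real dilations. Bounds for it on the
unit sphere are therefore bounds everywhere off the origin. -/
lemma fderiv_real_smul {z : Cn n} (hz : z ≠ 0) {r : ℝ} (hr : r ≠ 0) :
    fderiv ℝ Ψ (r • z) = fderiv ℝ Ψ z := by
  ext1 h
  have hr' : (r : ℂ) ≠ 0 := by exact_mod_cast hr
  have h1 := hΨ.fderiv_smul hz hr' ((r : ℂ)⁻¹ • h)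
  rw [smul_inv_smul₀ hr', Complex.coe_smul] at h1
  rw [h1, ← Complex.ofReal_inv, Complex.coe_smul, Complex.coe_smul, ContinuousLinearMap.map_smul,
    smul_inv_smul₀ hr]

lemma theta_self {z : Cn n} (hz : z ≠ 0) (c : ℂ) : theta Ψ z (c • z) = c := by
  rw [theta, hΨ.fderiv_smul_self hz, ballTheta_smul, ballTheta_self (hΨ.map_ne_zero hz), mul_one]

lemma fderiv_normSq {z : Cn n} (hz : z ≠ 0) (h : Cn n) :
    fderiv ℝ (fun y => ‖Ψ y‖ ^ 2) z h = 2 * ‖Ψ z‖ ^ 2 * (theta Ψ z h).re := by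
  rw [(normSq_fderiv (hΨ.hasFDerivAt hz)).2, inner_eq_ballTheta (hΨ.map_ne_zero hz)]
  rw [← Complex.ofReal_pow, Complex.re_ofReal_mul, theta]; ring

lemma theta_add (z h h' : Cn n) : theta Ψ z (h + h') = theta Ψ z h + theta Ψ z h' := by
  rw [theta, map_add, ballTheta_add]; rfl

/-- `θ` is of type `(1,0)`, because `Ψ` maps the complex tangent spaces of `μ` into `𝓗`. -/
lemma theta_smul {z : Cn n} (hz : z ≠ 0) (c : ℂ) (h : Cn n) :
    theta Ψ z (c • h) = c * theta Ψ z h := by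
  set m : Cn n → ℝ := fun h => (theta Ψ z h).re with hm
  have key : ∀ h, theta Ψ z h = (m h : ℂ) - Complex.I * m (Complex.I • h) := by
    intro h
    -- With this d both m and m(i ·) vanish at h − d z, which is then complex tangent to the level
    -- of μ. So θ vanishes there and θ(h) = d. A form θ = m − i m(i ·) is complex linear.
    set d : ℂ := (m h : ℂ) - Complex.I * m (Complex.I • h) with hd
    have hre : ∀ c : ℂ, m (h - c • z) = m h - c.re ∧ m (Complex.I • (h - c • z))
        = m (Complex.I • h) + c.im := by
      intro c
      constructor
      · have := hΨ.theta_add z (h - c • z) (c • z)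
        rw [sub_add_cancel, hΨ.theta_self hz] at this
        simp [hm, this]
      · have := hΨ.theta_add z (Complex.I • (h - c • z)) ((Complex.I * c) • z)
        rw [mul_smul, ← smul_add, sub_add_cancel, ← mul_smul, hΨ.theta_self hz] at this
        simp [hm, this]
    have hH := hΨ.map_H z hz (h - d • z)
    rw [hΨ.fderiv_normSq hz, hΨ.fderiv_normSq hz] at hH
    change 2 * ‖Ψ z‖ ^ 2 * m _ = 0 → 2 * ‖Ψ z‖ ^ 2 * m _ = 0 → _ at hH
    rw [(hre d).1, (hre d).2] at hH
    have h0 := hH (by simp [hd]) (by simp [hd])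
    rw [← ballTheta_eq_zero (hΨ.map_ne_zero hz), map_sub, ballTheta_sub] at h0
    have h1 := hΨ.theta_self hz d
    rw [theta] at h1
    rw [h1] at h0
    exact sub_eq_zero.1 h0
  have hmr : ∀ (r : ℝ) h, m (r • h) = r * m h := by
    intro r h
    simp only [hm, theta]
    rw [ContinuousLinearMap.map_smul, ← Complex.coe_smul, ballTheta_smul, Complex.re_ofReal_mul]
  have hma : ∀ h h', m (h + h') = m h + m h' := by
    intro h h'; simp [hm, hΨ.theta_add]
  have hc : c • h = c.re • h + c.im • (Complex.I • h) := by
    conv_lhs => rw [← Complex.re_add_im c, add_smul, mul_smul, Complex.coe_smul, Complex.coe_smul]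
  have hI : Complex.I • (c • h) = c.re • (Complex.I • h) + (-c.im) • h := by
    rw [hc, smul_add, smul_comm Complex.I c.re, smul_comm Complex.I c.im, ← mul_smul Complex.I,
      Complex.I_mul_I, neg_one_smul, smul_neg, neg_smul]
  rw [key (c • h), key h, hI, hc, hma, hma, hmr, hmr, hmr, hmr]
  apply Complex.ext <;> simp <;> ring

/-- `θ` at a point, as a linear form. -/
def thetaLin {z : Cn n} (hz : z ≠ 0) : Cn n →ₗ[ℂ] ℂ where
  toFun := theta Ψ z
  map_add' := hΨ.theta_add z
  map_smul' := hΨ.theta_smul hz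

lemma theta_sum {z : Cn n} (hz : z ≠ 0) {ι : Type*} (s : Finset ι) (f : ι → Cn n) :
    theta Ψ z (∑ i ∈ s, f i) = ∑ i ∈ s, theta Ψ z (f i) := map_sum (hΨ.thetaLin hz) f s

lemma theta_sub (z h h' : Cn n) : theta Ψ z (h - h') = theta Ψ z h - theta Ψ z h' := by
  rw [theta, map_sub, ballTheta_sub]; rfl

lemma theta_smul_left {z : Cn n} (hz : z ≠ 0) {c : ℂ} (hc : c ≠ 0) (h : Cn n) :
    theta Ψ (c • z) h = theta Ψ z h / c := by
  have h1 := hΨ.theta_smul (smul_ne_zero hc hz) c (c⁻¹ • h)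
  have h2 : theta Ψ (c • z) (c • (c⁻¹ • h)) = theta Ψ z (c⁻¹ • h) := by
    rw [theta, hΨ.fderiv_smul hz hc, hΨ.map_smul, ballTheta_smul_left _ _ _ hc, ballTheta_smul,
      mul_div_cancel_left₀ _ hc]; rfl
  rw [smul_inv_smul₀ hc] at h2
  rw [h2, hΨ.theta_smul hz, div_eq_inv_mul]

lemma inner_fderiv_eq_zero {z : Cn n} (hz : z ≠ 0) {h : Cn n} :
    inner ℂ (Ψ z) (fderiv ℝ Ψ z h) = (0 : ℂ) ↔ theta Ψ z h = 0 :=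
  (ballTheta_eq_zero (hΨ.map_ne_zero hz)).symm

/-! ### The inverse map -/

/-- The local inverse provided by the inverse function theorem coincides with the global inverse,
since Ψ is bijective. -/
lemma symm_contDiffAt {y : Cn n} (hy : y ≠ 0) : ContDiffAt ℝ (k + 1) Ψ.symm y := by
  have hz := hΨ.symm_ne_zero hy
  obtain ⟨e, he⟩ := hΨ.invertible _ hz
  have hd : HasFDerivAt Ψ (e : Cn n →L[ℝ] Cn n) (Ψ.symm y) := by rw [he]; exact hΨ.hasFDerivAt hz
  have hn : ((k : WithTop ℕ∞) + 1) ≠ 0 := by simp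
  have h1 := (hΨ.contDiffAt hz).to_localInverse hd hn
  rw [Ψ.apply_symm_apply] at h1
  refine h1.congr_of_eventuallyEq ?_
  have h2 := ((hΨ.contDiffAt hz).hasStrictFDerivAt' hd hn).eventually_right_inverse
  rw [Ψ.apply_symm_apply] at h2
  filter_upwards [h2] with x hx
  rw [Equiv.symm_apply_eq]
  exact hx.symm

lemma fderiv_symm {y : Cn n} (hy : y ≠ 0) :
    fderiv ℝ Ψ.symm y = (fderiv ℝ Ψ (Ψ.symm y)).inverse := by
  have hz := hΨ.symm_ne_zero hy
  obtain ⟨e, he⟩ := hΨ.invertible _ hz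
  have hd : HasFDerivAt Ψ (e : Cn n →L[ℝ] Cn n) (Ψ.symm y) := by rw [he]; exact hΨ.hasFDerivAt hz
  have h1 : HasFDerivAt Ψ.symm (e.symm : Cn n →L[ℝ] Cn n) y :=
    hd.of_local_left_inverse (hΨ.symm_contDiffAt hy).continuousAt
      (Eventually.of_forall Ψ.apply_symm_apply)
  rw [h1.fderiv, ← he, ContinuousLinearMap.inverse_equiv]

lemma fderiv_inverse_apply {z : Cn n} (hz : z ≠ 0) (h : Cn n) :
    (fderiv ℝ Ψ z).inverse (fderiv ℝ Ψ z h) = h := by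
  obtain ⟨e, he⟩ := hΨ.invertible _ hz
  rw [← he, ContinuousLinearMap.inverse_equiv]; simp

lemma fderiv_apply_inverse {z : Cn n} (hz : z ≠ 0) (h : Cn n) :
    fderiv ℝ Ψ z ((fderiv ℝ Ψ z).inverse h) = h := by
  obtain ⟨e, he⟩ := hΨ.invertible _ hz
  rw [← he, ContinuousLinearMap.inverse_equiv]; simp

lemma symm_continuousOn : ContinuousOn Ψ.symm {0}ᶜ := fun _ hy =>
  (hΨ.symm_contDiffAt hy).continuousAt.continuousWithinAt

/-! ### Bounds -/

lemma exists_symm_bound : ∃ C : ℝ, 0 < C ∧ ∀ y, ‖Ψ.symm y‖ ≤ C * ‖y‖ := by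
  have hc : ContinuousOn Ψ.symm (Metric.sphere 0 1) :=
    hΨ.symm_continuousOn.mono fun y hy h => by simp [mem_singleton_iff.1 h] at hy
  obtain ⟨C, hC⟩ := (isCompact_sphere (0 : Cn n) 1).exists_bound_of_continuousOn hc
  refine ⟨max C 1, by positivity, fun y => ?_⟩
  rcases eq_or_ne y 0 with rfl | hy
  · have : Ψ.symm 0 = 0 := by rw [Equiv.symm_apply_eq, hΨ.map_zero]
    simp [this]
  · have h1 : ((‖y‖ : ℂ)⁻¹) • y ∈ Metric.sphere (0 : Cn n) 1 := by
      simp [norm_smul, hy]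
    have h2 := hC _ h1
    rw [hΨ.symm_smul, norm_smul, norm_inv, Complex.norm_real, norm_norm,
      inv_mul_le_iff₀ (norm_pos_iff.2 hy)] at h2
    calc _ ≤ ‖y‖ * C := h2
      _ ≤ max C 1 * ‖y‖ := by rw [mul_comm]; gcongr; exact le_max_left _ _

lemma exists_fderiv_bound : ∃ C : ℝ, ∀ z, z ≠ 0 → ‖fderiv ℝ Ψ z‖ ≤ C := by
  have hc : ContinuousOn (fderiv ℝ Ψ) (Metric.sphere 0 1) := fun z hz =>
    ((hΨ.contDiffAt (fun h => by simp [h] at hz)).fderiv_right (m := 0)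
      (by simp)).continuousAt.continuousWithinAt
  obtain ⟨C, hC⟩ := (isCompact_sphere (0 : Cn n) 1).exists_bound_of_continuousOn hc
  refine ⟨C, fun z hz => ?_⟩
  have h1 : (‖z‖⁻¹) • z ∈ Metric.sphere (0 : Cn n) 1 := by simp [norm_smul, hz]
  have := hC _ h1
  rwa [hΨ.fderiv_real_smul hz (inv_ne_zero (norm_ne_zero_iff.2 hz))] at this

/-! ### Regularity of `θ` -/

lemma holder_fderiv : HolderClassOn k a (fderiv ℝ Ψ) {0}ᶜ :=
  hΨ.regular.fderiv_of_isOpen isOpen_compl_singleton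

/-- The form contains the differential of Ψ, so that k of the k + 1 derivatives remain. -/
lemma holder_theta (ha0 : 0 ≤ a) (ha : a ≤ 1) (hk : 1 ≤ k) (v : Cn n) :
    HolderClassOn k a (fun z => theta Ψ z v) {0}ᶜ := by
  have hS : GoodSet ({0}ᶜ : Set (Cn n)) := isOpen_compl_singleton.goodSet
  refine HolderClassOn.smooth_comp ha0 ha hS hk isOpen_fst_ne_zero contDiffOn_ballTheta
    (g := fun z => (Ψ z, fderiv ℝ Ψ z v)) ?_ fun z hz => hΨ.map_ne_zero hz
  exact (hΨ.regular.of_succ ha hS).prodMk ha hS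
    (hΨ.holder_fderiv.clm ha hS (ContinuousLinearMap.apply ℝ (Cn n) v))

end IsCircularRep

/-! ### Affine and polar coordinates -/

section PolarCoordinates

variable {n : ℕ} {i : Fin n}

lemma affNorm_pos (w : Aff i) : 0 < affNorm i w := by
  unfold affNorm; positivity

lemma sqrt_affNorm_ne_zero (w : Aff i) : (Real.sqrt (affNorm i w) : ℂ) ≠ 0 := by
  exact_mod_cast (Real.sqrt_pos.2 (affNorm_pos w)).ne'

lemma affPt_self (w : Aff i) : affPt i w i = 1 := by simp [affPt]

lemma affPt_of_ne (w : Aff i) (α : {j : Fin n // j ≠ i}) : affPt i w α.1 = w α := by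
  simp [affPt, α.2]

lemma affPt_ne_zero (w : Aff i) : affPt i w ≠ 0 := fun h => by
  have := affPt_self w; rw [h] at this; simp at this

lemma affNorm_eq (w : Aff i) : affNorm i w = ‖affPt i w‖ ^ 2 := by
  rw [EuclideanSpace.norm_sq_eq, Fintype.sum_eq_add_sum_subtype_ne _ i, affPt_self, affNorm]
  simp [affPt_of_ne]

lemma sqrt_affNorm (w : Aff i) : Real.sqrt (affNorm i w) = ‖affPt i w‖ := by
  rw [affNorm_eq, Real.sqrt_sq (norm_nonneg _)]

/-- The `i`-th coordinate of the point with given polar coordinates. -/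
def polarFactor (i : Fin n) (p : Aff i × ℂ) : ℂ := p.2 / (Real.sqrt (affNorm i p.1) : ℂ)

lemma polarFactor_ne_zero {p : Aff i × ℂ} (hp : p.2 ≠ 0) : polarFactor i p ≠ 0 :=
  div_ne_zero hp (sqrt_affNorm_ne_zero _)

lemma polarPt_eq (p : Aff i × ℂ) : polarPt i p = polarFactor i p • affPt i p.1 := rfl

lemma polarPt_self (p : Aff i × ℂ) : polarPt i p i = polarFactor i p := by
  simp [polarPt_eq, affPt_self]

lemma polarPt_of_ne (p : Aff i × ℂ) (α : {j : Fin n // j ≠ i}) :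
    polarPt i p α.1 = polarFactor i p * p.1 α := by
  simp [polarPt_eq, affPt_of_ne]

lemma polarPt_ne_zero {p : Aff i × ℂ} (hp : p.2 ≠ 0) : polarPt i p ≠ 0 :=
  smul_ne_zero (polarFactor_ne_zero hp) (affPt_ne_zero _)

lemma norm_polarPt (p : Aff i × ℂ) : ‖polarPt i p‖ = ‖p.2‖ := by
  rw [polarPt_eq, norm_smul, polarFactor, norm_div, Complex.norm_real, Real.norm_eq_abs,
    abs_of_nonneg (Real.sqrt_nonneg _), sqrt_affNorm,
    div_mul_cancel₀ _ (norm_ne_zero_iff.2 (affPt_ne_zero _))]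

lemma polarPt_smul (p : Aff i × ℂ) (c : ℂ) : polarPt i (p.1, c * p.2) = c • polarPt i p := by
  simp only [polarPt, ← mul_smul, mul_div_assoc]

/-- The polar coordinates of a point. -/
def polarInv (i : Fin n) (z : Cn n) : Aff i × ℂ :=
  (fun α => z α.1 / z i, (‖z‖ : ℂ) * (z i / (‖z i‖ : ℂ)))

lemma eq_smul_affPt {z : Cn n} (hz : z i ≠ 0) : z = z i • affPt i (fun α => z α.1 / z i) := by
  ext j
  by_cases h : j = i
  · subst h; simp [affPt_self]
  · have := affPt_of_ne (fun α : {j : Fin n // j ≠ i} => z α.1 / z i) ⟨j, h⟩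
    simp only at this
    simp [this, mul_div_cancel₀ _ hz]

lemma polarInv_snd_ne_zero {z : Cn n} (hz : z i ≠ 0) : (polarInv i z).2 ≠ 0 := by
  have h0 : z ≠ 0 := fun h => hz (by simp [h])
  have h1 : (‖z i‖ : ℂ) ≠ 0 := by exact_mod_cast norm_ne_zero_iff.2 hz
  exact mul_ne_zero (normC_ne_zero h0) (div_ne_zero hz h1)

lemma polarPt_polarInv {z : Cn n} (hz : z i ≠ 0) : polarPt i (polarInv i z) = z := by
  have h1 : (‖z i‖ : ℂ) ≠ 0 := by exact_mod_cast norm_ne_zero_iff.2 hz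
  have e := congrArg norm (eq_smul_affPt hz)
  rw [norm_smul] at e
  have h2 : (‖affPt i (fun α => z α.1 / z i)‖ : ℂ) ≠ 0 := normC_ne_zero (affPt_ne_zero _)
  conv_rhs => rw [eq_smul_affPt hz]
  rw [polarPt_eq, polarFactor, sqrt_affNorm]
  congr 1
  simp only [polarInv]
  rw [e, Complex.ofReal_mul]
  field_simp

lemma polarInv_polarPt {p : Aff i × ℂ} (hp : p.2 ≠ 0) : polarInv i (polarPt i p) = p := by
  have hf := polarFactor_ne_zero hp
  have hn : (‖p.2‖ : ℂ) ≠ 0 := by exact_mod_cast norm_ne_zero_iff.2 hp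
  have hs := sqrt_affNorm_ne_zero p.1
  refine Prod.ext (funext fun α => ?_) ?_
  · simp only [polarInv]
    rw [polarPt_of_ne, polarPt_self, mul_div_cancel_left₀ _ hf]
  · simp only [polarInv]
    rw [norm_polarPt, polarPt_self, polarFactor, norm_div, Complex.norm_real, Real.norm_eq_abs,
      abs_of_nonneg (Real.sqrt_nonneg _), Complex.ofReal_div]
    field_simp

/-- The linear part of `affPt`. -/
def affLin (i : Fin n) : Aff i →L[ℝ] Cn n :=
  LinearMap.toContinuousLinearMap
    { toFun := fun w => WithLp.toLp 2 fun j => if h : j = i then 0 else w ⟨j, h⟩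
      map_add' := fun w w' => by ext j; by_cases h : j = i <;> simp [h]
      map_smul' := fun c w => by ext j; by_cases h : j = i <;> simp [h] }

lemma affLin_apply (w : Aff i) (j : Fin n) : affLin i w j = if h : j = i then 0 else w ⟨j, h⟩ := rfl

lemma affPt_eq (w : Aff i) : affPt i w = EuclideanSpace.single i 1 + affLin i w := by
  ext j
  by_cases h : j = i <;> simp [affPt, affLin_apply, h]

lemma affLin_single (α : {j : Fin n // j ≠ i}) (c : ℂ) :
    affLin i (Pi.single α c) = EuclideanSpace.single α.1 c := by
  ext j
  by_cases h : j = i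
  · have : i ≠ α.1 := fun h' => α.2 h'.symm
    subst h
    simp [affLin_apply, this]
  · by_cases h' : j = α.1
    · subst h'; simp [affLin_apply, h]
    · have : (⟨j, h⟩ : {j : Fin n // j ≠ i}) ≠ α := fun e => h' (by rw [← e])
      simp [affLin_apply, h, h', this]

lemma hasFDerivAt_affPt (w : Aff i) : HasFDerivAt (affPt i) (affLin i) w := by
  have : (affPt i) = fun w => EuclideanSpace.single i 1 + affLin i w := funext affPt_eq
  rw [this]
  exact (affLin i).hasFDerivAt.const_add _

lemma contDiff_affPt {m : WithTop ℕ∞} : ContDiff ℝ m (affPt i) := by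
  have : (affPt i) = fun w => EuclideanSpace.single i 1 + affLin i w := funext affPt_eq
  rw [this]
  exact contDiff_const.add (affLin i).contDiff

lemma contDiff_affNorm {m : WithTop ℕ∞} : ContDiff ℝ m (affNorm i) := by
  unfold affNorm
  refine contDiff_const.add (ContDiff.sum fun γ _ => ?_)
  exact (contDiff_norm_sq ℝ).comp (contDiff_apply ℝ ℂ γ)

lemma contDiff_sqrt_affNorm {m : WithTop ℕ∞} :
    ContDiff ℝ m (fun w : Aff i => (Real.sqrt (affNorm i w) : ℂ)) :=
  Complex.ofRealCLM.contDiff.comp (contDiff_affNorm.sqrt fun w => (affNorm_pos w).ne')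

lemma contDiff_polarFactor {m : WithTop ℕ∞} : ContDiff ℝ m (polarFactor i) := by
  unfold polarFactor
  simp only [div_eq_mul_inv]
  exact contDiff_snd.mul ((contDiff_sqrt_affNorm.comp contDiff_fst).inv
    fun p => sqrt_affNorm_ne_zero p.1)

lemma contDiff_polarPt {m : WithTop ℕ∞} : ContDiff ℝ m (polarPt i) :=
  contDiff_polarFactor.smul (contDiff_affPt.comp contDiff_fst)

lemma contDiff_coord {m : WithTop ℕ∞} (j : Fin n) : ContDiff ℝ m (fun z : Cn n => z j) :=
  ((EuclideanSpace.proj j : Cn n →L[ℂ] ℂ).restrictScalars ℝ).contDiff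

lemma contDiffAt_norm_Cn {m : WithTop ℕ∞} {z : Cn n} (h0 : z ≠ 0) :
    ContDiffAt ℝ m (fun z : Cn n => ‖z‖) z := by
  have e : (fun z : Cn n => ‖z‖) = fun z => Real.sqrt ((inner ℂ z z : ℂ).re) := by
    funext y; rw [← normSq_eq_re_inner, Real.sqrt_sq (norm_nonneg _)]
  rw [e]
  refine ContDiffAt.sqrt ?_ ?_
  · exact (Complex.reCLM.contDiff.comp (contDiff_id.inner ℂ contDiff_id)).contDiffAt
  · rw [← normSq_eq_re_inner]; exact pow_ne_zero _ (norm_ne_zero_iff.2 h0)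

lemma contDiffAt_polarInv {m : ℕ∞} {z : Cn n} (hz : z i ≠ 0) : ContDiffAt ℝ m (polarInv i) z := by
  have h0 : z ≠ 0 := fun h => hz (by simp [h])
  have hn := contDiffAt_norm_Cn (m := m) h0
  have hni : ContDiffAt ℝ m (fun z : Cn n => ‖z i‖) z :=
    (contDiffAt_norm ℝ hz).comp z (contDiff_coord i).contDiffAt
  have hi := (contDiff_coord (m := m) i).contDiffAt (x := z)
  refine ContDiffAt.prodMk (contDiffAt_pi.2 fun α => ?_) ?_
  · simp only [div_eq_mul_inv]
    exact (contDiff_coord _).contDiffAt.mul (hi.inv hz)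
  · simp only [div_eq_mul_inv]
    refine (Complex.ofRealCLM.contDiff.contDiffAt.comp z hn).mul (hi.mul
      ((Complex.ofRealCLM.contDiff.contDiffAt.comp z hni).inv ?_))
    simpa using hz

/-- Expansion of a vector by means of `affPt` and the coordinate vectors. -/
lemma eq_affPt_add_sum (w : Aff i) (h : Cn n) :
    h = h i • affPt i w + ∑ α : {j : Fin n // j ≠ i},
      (h α.1 - w α * h i) • EuclideanSpace.single α.1 (1 : ℂ) := by
  have e : ∑ α : {j : Fin n // j ≠ i}, (h α.1 - w α * h i) • EuclideanSpace.single α.1 (1 : ℂ)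
      = affLin i (fun α => h α.1 - w α * h i) := by
    rw [← Finset.univ_sum_single (fun α : {j : Fin n // j ≠ i} => h α.1 - w α * h i), map_sum]
    refine Finset.sum_congr rfl fun α _ => ?_
    rw [affLin_single]
    ext j
    by_cases hj : j = α.1 <;> simp [hj]
  rw [e, affPt_eq]
  ext j
  by_cases hj : j = i
  · subst hj; simp [affLin_apply]
  · simp [affLin_apply, hj]; ring

end PolarCoordinates

/-! ### The adapted polar frame and the potential f -/

namespace IsCircularRep

variable {n k : ℕ} {a : ℝ} {J : EndField n} {Ψ : Cn n ≃ Cn n} (hΨ : IsCircularRep k a J Ψ)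
  {i : Fin n}
include hΨ

lemma rho_eq (w : Aff i) : rho Ψ i w = ‖Ψ (affPt i w)‖ / ‖affPt i w‖ := by
  rw [rho, polarPt_eq, hΨ.map_smul, norm_smul, polarFactor, sqrt_affNorm]
  simp [div_eq_inv_mul]

lemma rho_pos (w : Aff i) : 0 < rho Ψ i w := by
  rw [hΨ.rho_eq]
  exact div_pos (norm_pos_iff.2 (hΨ.map_ne_zero (affPt_ne_zero w)))
    (norm_pos_iff.2 (affPt_ne_zero w))

lemma norm_map_polarPt (p : Aff i × ℂ) : ‖Ψ (polarPt i p)‖ = ‖p.2‖ * rho Ψ i p.1 := by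
  have : polarPt i p = p.2 • polarPt i (p.1, 1) := by rw [← polarPt_smul]; simp
  rw [this, hΨ.map_smul, norm_smul, rho]

lemma mem_polarDom {p : Aff i × ℂ} :
    p ∈ polarDom Ψ i ↔ p.2 ≠ 0 ∧ Ψ (polarPt i p) ∈ puncturedBall n := by
  unfold polarDom puncturedBall
  simp only [mem_ofPred_eq, hΨ.norm_map_polarPt]
  refine and_congr_right fun hp => ⟨fun h => ⟨hΨ.map_ne_zero (polarPt_ne_zero hp), h⟩, fun h => h.2⟩

/-- On the affine section ρ is μ divided by the Euclidean norm, and N is the square of that norm;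
the two logarithms add up to log μ². Hence derivatives of f are values of the pull-back of θ. -/
lemma pot_eq (w : Aff i) : pot Ψ i w = ((Real.log (‖Ψ (affPt i w)‖ ^ 2) : ℝ) : ℂ) := by
  have h1 : ‖Ψ (affPt i w)‖ ≠ 0 := norm_ne_zero_iff.2 (hΨ.map_ne_zero (affPt_ne_zero w))
  have h2 : ‖affPt i w‖ ≠ 0 := norm_ne_zero_iff.2 (affPt_ne_zero w)
  rw [pot, affNorm_eq, hΨ.rho_eq, ← Real.log_mul (by positivity) (by positivity), div_pow,
    div_mul_cancel₀ _ (by positivity)]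

lemma hasFDerivAt_pot (w : Aff i) : DifferentiableAt ℝ (pot Ψ i) w ∧ ∀ ξ,
    fderiv ℝ (pot Ψ i) w ξ = ((2 * (theta Ψ (affPt i w) (affLin i ξ)).re : ℝ) : ℂ) := by
  have hz := affPt_ne_zero w
  have hne : ‖Ψ (affPt i w)‖ ^ 2 ≠ 0 := pow_ne_zero _ (norm_ne_zero_iff.2 (hΨ.map_ne_zero hz))
  have h1 := (normSq_fderiv (hΨ.hasFDerivAt hz)).1.hasFDerivAt
  have h2 := (h1.comp w (hasFDerivAt_affPt w)).log hne
  have h3 := (Complex.ofRealCLM.hasFDerivAt (x := Real.log (‖Ψ (affPt i w)‖ ^ 2))).comp w h2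
  have e : pot Ψ i = Complex.ofRealCLM ∘ fun x => Real.log (((fun y => ‖Ψ y‖ ^ 2) ∘ affPt i) x) :=
    funext hΨ.pot_eq
  rw [e]
  refine ⟨h3.differentiableAt, fun ξ => ?_⟩
  rw [h3.fderiv]
  simp only [ContinuousLinearMap.comp_apply, _root_.smul_apply, Complex.ofRealCLM_apply,
    Function.comp, smul_eq_mul]
  rw [hΨ.fderiv_normSq hz]
  congr 1
  have h4 : ‖Ψ (affPt i w)‖ ≠ 0 := norm_ne_zero_iff.2 (hΨ.map_ne_zero hz)
  field_simp

/-- `∂_α f` is a component of the connection form. -/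
lemma dW_pot (w : Aff i) (α : {j : Fin n // j ≠ i}) :
    dW i α (pot Ψ i) w = theta Ψ (affPt i w) (EuclideanSpace.single α.1 1) := by
  have e : EuclideanSpace.single α.1 Complex.I
      = Complex.I • EuclideanSpace.single α.1 (1 : ℂ) := by
    ext j; by_cases h : j = α.1 <;> simp [h]
  rw [dW, (hΨ.hasFDerivAt_pot w).2, (hΨ.hasFDerivAt_pot w).2, affLin_single, affLin_single, e,
    hΨ.theta_smul (affPt_ne_zero w)]
  apply Complex.ext <;> simp

lemma dWbar_pot (w : Aff i) (α : {j : Fin n // j ≠ i}) :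
    dWbar i α (pot Ψ i) w = star (theta Ψ (affPt i w) (EuclideanSpace.single α.1 1)) := by
  have e : EuclideanSpace.single α.1 Complex.I
      = Complex.I • EuclideanSpace.single α.1 (1 : ℂ) := by
    ext j; by_cases h : j = α.1 <;> simp [h]
  rw [dWbar, (hΨ.hasFDerivAt_pot w).2, (hΨ.hasFDerivAt_pot w).2, affLin_single, affLin_single, e,
    hΨ.theta_smul (affPt_ne_zero w)]
  apply Complex.ext <;> simp <;> ring

/-- The expansion of `θ` in affine coordinates. -/
lemma theta_affPt (w : Aff i) (h : Cn n) :
    theta Ψ (affPt i w) h = h i + ∑ α : {j : Fin n // j ≠ i},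
      dW i α (pot Ψ i) w * (h α.1 - w α * h i) := by
  conv_lhs => rw [eq_affPt_add_sum w h]
  rw [hΨ.theta_add, hΨ.theta_self (affPt_ne_zero w), hΨ.theta_sum (affPt_ne_zero w)]
  congr 1
  refine Finset.sum_congr rfl fun α _ => ?_
  rw [hΨ.theta_smul (affPt_ne_zero w), hΨ.dW_pot, mul_comm]

lemma theta_polarPt {p : Aff i × ℂ} (hp : p.2 ≠ 0) (h : Cn n) :
    theta Ψ (polarPt i p) h = theta Ψ (affPt i p.1) h / polarFactor i p := by
  rw [polarPt_eq, hΨ.theta_smul_left (affPt_ne_zero _) (polarFactor_ne_zero hp)]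

omit hΨ in
lemma frameE_eq (p : Aff i × ℂ) (α : {j : Fin n // j ≠ i}) :
    frameE Ψ i p α = polarFactor i p •
      (EuclideanSpace.single α.1 (1 : ℂ) - dW i α (pot Ψ i) p.1 • affPt i p.1) := by
  rw [frameE, polarPt_eq, smul_sub, smul_comm]; rfl

/-- The multiple of Z subtracted in e_α is exactly the radial component of zⁱ ∂/∂z^α, so the frame
spans the kernel of θ. -/
lemma theta_frameE {p : Aff i × ℂ} (hp : p.2 ≠ 0) (α : {j : Fin n // j ≠ i}) :
    theta Ψ (polarPt i p) (frameE Ψ i p α) = 0 := by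
  rw [hΨ.theta_polarPt hp, frameE_eq, hΨ.theta_smul (affPt_ne_zero _), hΨ.theta_sub,
    hΨ.theta_self (affPt_ne_zero _), hΨ.dW_pot, sub_self, mul_zero, zero_div]

/-- Expansion of a vector in the adapted polar frame. -/
lemma eq_polar_frame {p : Aff i × ℂ} (hp : p.2 ≠ 0) (h : Cn n) :
    h = theta Ψ (polarPt i p) h • polarPt i p + ∑ α, compE i p α h • frameE Ψ i p α := by
  have hf := polarFactor_ne_zero hp
  have e : ∀ α : {j : Fin n // j ≠ i}, compE i p α h • frameE Ψ i p α
      = (h α.1 - p.1 α * h i) • EuclideanSpace.single α.1 (1 : ℂ)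
        - (dW i α (pot Ψ i) p.1 * (h α.1 - p.1 α * h i)) • affPt i p.1 := by
    intro α
    rw [frameE_eq, compE, ← mul_smul]
    change ((h α.1 - p.1 α * h i) / polarFactor i p * polarFactor i p) • _ = _
    rw [div_mul_cancel₀ _ hf, smul_sub, ← mul_smul, mul_comm (dW i α (pot Ψ i) p.1)]
  simp only [e]
  rw [Finset.sum_sub_distrib, ← Finset.sum_smul, hΨ.theta_polarPt hp, polarPt_eq, ← mul_smul,
    div_mul_cancel₀ _ hf, hΨ.theta_affPt, add_smul]
  conv_lhs => rw [eq_affPt_add_sum p.1 h]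
  abel

omit hΨ in
lemma compE_add {p : Aff i × ℂ} (α : {j : Fin n // j ≠ i}) (h h' : Cn n) :
    compE i p α (h + h') = compE i p α h + compE i p α h' := by
  simp only [compE, PiLp.add_apply]; ring

omit hΨ in
lemma compE_smul {p : Aff i × ℂ} (α : {j : Fin n // j ≠ i}) (c : ℂ) (h : Cn n) :
    compE i p α (c • h) = c * compE i p α h := by
  simp only [compE, PiLp.smul_apply, smul_eq_mul]; ring

omit hΨ in
lemma compE_sum {p : Aff i × ℂ} (α : {j : Fin n // j ≠ i}) {ι : Type*} (s : Finset ι)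
    (f : ι → Cn n) : compE i p α (∑ j ∈ s, f j) = ∑ j ∈ s, compE i p α (f j) := by
  classical
  induction s using Finset.induction_on with
  | empty => simp [compE]
  | insert j s hj ih => rw [Finset.sum_insert hj, Finset.sum_insert hj, compE_add, ih]

omit hΨ in
lemma compE_frameE {p : Aff i × ℂ} (hp : p.2 ≠ 0) (α β : {j : Fin n // j ≠ i}) :
    compE i p α (frameE Ψ i p β) = if α = β then 1 else 0 := by
  have hf := polarFactor_ne_zero hp
  rw [frameE_eq, compE]
  change _ / polarFactor i p = _
  have h1 : i ≠ β.1 := fun h => β.2 h.symm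
  simp only [PiLp.smul_apply, PiLp.sub_apply, smul_eq_mul, affPt_self, affPt_of_ne,
    PiLp.single_apply, h1, if_false]
  by_cases h : α = β
  · subst h; simp; field_simp; ring
  · have : α.1 ≠ β.1 := fun e => h (Subtype.ext e)
    rw [if_neg this, if_neg h, div_eq_zero_iff]; left; ring

/-- The functions Y^α/ζ, and likewise Y⁰/ζ below, are the components of the constant field v in the
frame e_α, Z. This explains their form: a special field is v plus a correction. -/
lemma YH_eq {p : Aff i × ℂ} (v : Cn n) (α : {j : Fin n // j ≠ i}) :
    YH i v p.1 α / p.2 = compE i p α v := by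
  rw [YH, compE, div_div_eq_mul_div, mul_comm (v i)]

lemma YZ_eq {p : Aff i × ℂ} (hp : p.2 ≠ 0) (v : Cn n) :
    YZ Ψ i v p.1 / p.2 = theta Ψ (polarPt i p) v := by
  have hs := sqrt_affNorm_ne_zero p.1
  rw [hΨ.theta_polarPt hp, hΨ.theta_affPt, polarFactor, YZ, div_div_eq_mul_div, add_mul,
    Finset.sum_mul]
  congr 2
  refine Finset.sum_congr rfl fun α _ => ?_
  rw [YH]; ring

end IsCircularRep

/-! ### Tensor fields on the ball and on its blow-up -/

section BlowUp

variable {n : ℕ} {i : Fin n}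

/-- The inverse of the affine chart `blowChart i` of the blow-up. -/
def blowInv (i : Fin n) (z : Cn n) : Cn n :=
  WithLp.toLp 2 fun j => if j = i then z i else z j / z i

lemma blowChart_self (u : Cn n) : blowChart i u i = u i := by simp [blowChart]

lemma blowChart_of_ne (u : Cn n) {j : Fin n} (h : j ≠ i) : blowChart i u j = u i * u j := by
  simp [blowChart, h]

lemma blowInv_self (z : Cn n) : blowInv i z i = z i := by simp [blowInv]

lemma blowInv_of_ne (z : Cn n) {j : Fin n} (h : j ≠ i) : blowInv i z j = z j / z i := by
  simp [blowInv, h]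

lemma blowChart_blowInv {z : Cn n} (hz : z i ≠ 0) : blowChart i (blowInv i z) = z := by
  ext j
  by_cases h : j = i
  · subst h; rw [blowChart_self, blowInv_self]
  · rw [blowChart_of_ne _ h, blowInv_self, blowInv_of_ne _ h, mul_div_cancel₀ _ hz]

lemma blowInv_blowChart {u : Cn n} (hu : u i ≠ 0) : blowInv i (blowChart i u) = u := by
  ext j
  by_cases h : j = i
  · subst h; rw [blowInv_self, blowChart_self]
  · rw [blowInv_of_ne _ h, blowChart_self, blowChart_of_ne _ h, mul_div_cancel_left₀ _ hu]

lemma contDiff_blowChart {m : WithTop ℕ∞} : ContDiff ℝ m (blowChart i) := by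
  unfold blowChart
  refine (PiLp.contDiff_toLp).comp (contDiff_pi.2 fun j => ?_)
  by_cases h : j = i
  · simp only [h, if_true]; exact contDiff_coord i
  · simp only [h, if_false]; exact (contDiff_coord i).mul (contDiff_coord j)

lemma contDiffAt_blowInv {m : WithTop ℕ∞} {z : Cn n} (hz : z i ≠ 0) :
    ContDiffAt ℝ m (blowInv i) z := by
  unfold blowInv
  refine (PiLp.contDiff_toLp).contDiffAt.comp z (contDiffAt_pi.2 fun j => ?_)
  by_cases h : j = i
  · simp only [h, if_true]; exact (contDiff_coord i).contDiffAt
  · simp only [h, if_false, div_eq_mul_inv]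
    exact (contDiff_coord j).contDiffAt.mul ((contDiff_coord i).contDiffAt.inv hz)

lemma fderiv_blowInv_blowChart {z : Cn n} (hz : z i ≠ 0) (h : Cn n) :
    fderiv ℝ (blowInv i) z (fderiv ℝ (blowChart i) (blowInv i z) h) = h ∧
    fderiv ℝ (blowChart i) (blowInv i z) (fderiv ℝ (blowInv i) z h) = h := by
  have h1 : HasFDerivAt (blowInv i) (fderiv ℝ (blowInv i) z) z :=
    ((contDiffAt_blowInv (m := 1) hz).differentiableAt one_ne_zero).hasFDerivAt
  have h2 : ∀ u, HasFDerivAt (blowChart i) (fderiv ℝ (blowChart i) u) u := fun u =>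
    ((contDiff_blowChart (m := 1)).differentiable one_ne_zero u).hasFDerivAt
  have hopen : ∀ᶠ y : Cn n in 𝓝 z, y i ≠ 0 :=
    (contDiff_coord (m := 0) i).continuous.continuousAt.eventually_ne hz
  constructor
  · have hz' : blowInv i z i ≠ 0 := by rwa [blowInv_self]
    have h1' : HasFDerivAt (blowInv i) (fderiv ℝ (blowInv i) z) (blowChart i (blowInv i z)) := by
      rwa [blowChart_blowInv hz]
    have h3 := h1'.comp (blowInv i z) (h2 _)
    have hopen' : ∀ᶠ y : Cn n in 𝓝 (blowInv i z), y i ≠ 0 :=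
      (contDiff_coord (m := 0) i).continuous.continuousAt.eventually_ne hz'
    have h4 : HasFDerivAt (blowInv i ∘ blowChart i) (ContinuousLinearMap.id ℝ _) (blowInv i z) :=
      (hasFDerivAt_id _).congr_of_eventuallyEq (hopen'.mono fun y hy => blowInv_blowChart hy)
    exact congrArg (fun L => L h) (h3.unique h4)
  · have h3 := (h2 (blowInv i z)).comp z h1
    have h4 : HasFDerivAt (blowChart i ∘ blowInv i) (ContinuousLinearMap.id ℝ _) z :=
      (hasFDerivAt_id _).congr_of_eventuallyEq (hopen.mono fun y hy => blowChart_blowInv hy)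
    exact congrArg (fun L => L h) (h3.unique h4)

/-- The derivative of the blow-down map, inverted. -/
lemma inverse_fderiv_blowChart {z : Cn n} (hz : z i ≠ 0) :
    (fderiv ℝ (blowChart i) (blowInv i z)).inverse = fderiv ℝ (blowInv i) z := by
  set e : Cn n ≃L[ℝ] Cn n := ContinuousLinearEquiv.equivOfInverse (fderiv ℝ (blowChart i) (blowInv i z))
    (fderiv ℝ (blowInv i) z) (fun h => (fderiv_blowInv_blowChart hz h).1)
    (fun h => (fderiv_blowInv_blowChart hz h).2)
  have : (fderiv ℝ (blowChart i) (blowInv i z)) = (e : Cn n →L[ℝ] Cn n) := rfl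
  rw [this, ContinuousLinearMap.inverse_equiv]
  rfl

/-- A tensor field on the ball is recovered from its pull-back to the blow-up. -/
lemma eq_pullEnd_blowChart (J : EndField n) {z : Cn n} (hz : z i ≠ 0) :
    J z = fderiv ℝ (blowChart i) (blowInv i z) ∘L
      (pullEnd (blowChart i) J (blowInv i z) ∘L fderiv ℝ (blowInv i) z) := by
  ext1 h
  simp only [pullEnd, ContinuousLinearMap.comp_apply, inverse_fderiv_blowChart hz,
    blowChart_blowInv hz, (fderiv_blowInv_blowChart hz _).2]

lemma exists_coord_ne_zero {z : Cn n} (hz : z ≠ 0) : ∃ i, z i ≠ 0 := by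
  by_contra! h
  exact hz (by ext j; simp [h j])

lemma blowInv_mem_blowDom {z : Cn n} (hz : z i ≠ 0) (h : ‖z‖ ≤ 1) : blowInv i z ∈ blowDom i := by
  rw [blowDom, mem_ofPred_eq, blowChart_blowInv hz]; exact h

lemma contDiffOn_fderiv_blowInv {m : WithTop ℕ∞} :
    ContDiffOn ℝ m (fderiv ℝ (blowInv i)) {z : Cn n | z i ≠ 0} := fun _ hz =>
  ((contDiffAt_blowInv (m := m + 1) hz).fderiv_right le_rfl).contDiffWithinAt

/-- Off the exceptional divisor the blow-down is a diffeomorphism in each chart, and the charts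
cover the punctured ball. -/
lemma ClassOnBlowUp.contDiffOn {r : ℕ} {a : ℝ} {J : EndField n} (hJ : ClassOnBlowUp r a J) :
    ContDiffOn ℝ r J (puncturedBall n) := by
  intro z hz
  obtain ⟨i, hi⟩ := exists_coord_ne_zero hz.1
  obtain ⟨G, hG, hGJ⟩ := hJ i
  have hO : {y : Cn n | y i ≠ 0} ∈ 𝓝 z :=
    (contDiff_coord (m := 0) i).continuous.continuousAt.eventually_ne hi
  rw [← contDiffWithinAt_inter hO]
  have hinv : ContDiffOn ℝ r (blowInv i) {y : Cn n | y i ≠ 0} := fun y hy =>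
    (contDiffAt_blowInv hy).contDiffWithinAt
  have h1 : ContDiffOn ℝ r (fun y => fderiv ℝ (blowChart i) (blowInv i y) ∘L
      (G (blowInv i y) ∘L fderiv ℝ (blowInv i) y)) (puncturedBall n ∩ {y | y i ≠ 0}) := by
    refine ContDiffOn.clm_comp ?_ (ContDiffOn.clm_comp ?_ ?_)
    · exact ((contDiff_blowChart (m := r + 1)).fderiv_right le_rfl).comp_contDiffOn
        (hinv.mono inter_subset_right)
    · exact hG.1.comp (hinv.mono inter_subset_right) fun y hy => blowInv_mem_blowDom hy.2 hy.1.2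
    · exact contDiffOn_fderiv_blowInv.mono inter_subset_right
  refine (h1.congr fun y hy => ?_) z ⟨hz, hi⟩
  rw [hGJ _ (blowInv_mem_blowDom hy.2 hy.1.2) (by rw [blowInv_self]; exact hy.2)]
  exact eq_pullEnd_blowChart J hy.2

lemma FamilyClassOnBlowUp.contDiffOn {r : ℕ} {a : ℝ} {J : ℝ → EndField n}
    (hJ : FamilyClassOnBlowUp r a J) :
    ContDiffOn ℝ r (fun q : ℝ × Cn n => J q.1 q.2) (Icc (0 : ℝ) 1 ×ˢ puncturedBall n) := by
  intro z hz
  obtain ⟨i, hi⟩ := exists_coord_ne_zero hz.2.1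
  obtain ⟨G, hG, hGJ⟩ := hJ i
  have hcont : Continuous fun q : ℝ × Cn n => q.2 i :=
    (contDiff_coord (m := 0) i).continuous.comp continuous_snd
  have hO : {y : ℝ × Cn n | y.2 i ≠ 0} ∈ 𝓝 z := hcont.continuousAt.eventually_ne hi
  rw [← contDiffWithinAt_inter hO]
  have hinv : ContDiffOn ℝ r (fun q : ℝ × Cn n => blowInv i q.2) {y : ℝ × Cn n | y.2 i ≠ 0} :=
    fun y hy => ((contDiffAt_blowInv hy).comp y contDiffAt_snd).contDiffWithinAt
  have h1 : ContDiffOn ℝ r (fun y : ℝ × Cn n => fderiv ℝ (blowChart i) (blowInv i y.2) ∘L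
      (G (y.1, blowInv i y.2) ∘L fderiv ℝ (blowInv i) y.2))
        (Icc (0 : ℝ) 1 ×ˢ puncturedBall n ∩ {y : ℝ × Cn n | y.2 i ≠ 0}) := by
    refine ContDiffOn.clm_comp ?_ (ContDiffOn.clm_comp ?_ ?_)
    · exact ((contDiff_blowChart (m := r + 1)).fderiv_right le_rfl).comp_contDiffOn
        (hinv.mono inter_subset_right)
    · exact hG.1.comp (contDiffOn_fst.prodMk (hinv.mono inter_subset_right))
        fun y hy => ⟨hy.1.1, blowInv_mem_blowDom hy.2 hy.1.2.2⟩
    · exact contDiffOn_fderiv_blowInv.comp contDiffOn_snd fun y hy => hy.2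
  refine (h1.congr fun y hy => ?_) z ⟨hz, hi⟩
  rw [hGJ _ hy.1.1 _ (blowInv_mem_blowDom hy.2 hy.1.2.2) (by rw [blowInv_self]; exact hy.2)]
  exact eq_pullEnd_blowChart (J y.1) hy.2

end BlowUp

/-! ### The punctured ball; rigidity of holomorphic functions with imaginary boundary values -/

section Ball

variable {n : ℕ}

lemma puncturedBall_eq : puncturedBall n = Metric.closedBall 0 1 ∩ {0}ᶜ := by
  ext z; simp [puncturedBall, and_comm]

lemma goodSet_puncturedBall : GoodSet (puncturedBall n) := by
  rw [puncturedBall_eq]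
  refine GoodSet.inter (Convex.goodSet (convex_closedBall _ _) ?_) isOpen_compl_singleton
  exact ⟨0, by
    rw [mem_interior_iff_mem_nhds]; exact Metric.closedBall_mem_nhds _ one_pos⟩

lemma isOpen_puncturedOpenBall : IsOpen (puncturedOpenBall n) := by
  have : puncturedOpenBall n = Metric.ball 0 1 ∩ {0}ᶜ := by
    ext z; simp [puncturedOpenBall, and_comm]
  rw [this]
  exact Metric.isOpen_ball.inter isOpen_compl_singleton

lemma puncturedOpenBall_subset : puncturedOpenBall n ⊆ puncturedBall n := fun _ h => ⟨h.1, h.2.le⟩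

lemma puncturedBall_mem_nhds {z : Cn n} (hz : z ∈ puncturedOpenBall n) : puncturedBall n ∈ 𝓝 z :=
  mem_of_superset (isOpen_puncturedOpenBall.mem_nhds hz) puncturedOpenBall_subset

/-- A function that is holomorphic in the punctured disc, has no pole at the origin and whose real
part vanishes on the boundary is an imaginary constant. -/
lemma exists_eq_imaginary_const {H : ℂ → ℂ}
    (hd : ∀ ζ : ℂ, ζ ≠ 0 → ‖ζ‖ < 1 → DifferentiableAt ℂ H ζ)
    (hc : ContinuousOn H {ζ | ζ ≠ 0 ∧ ‖ζ‖ ≤ 1})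
    (h0 : Tendsto (fun ζ => ζ * H ζ) (𝓝[≠] 0) (𝓝 0))
    (hb : ∀ ζ : ℂ, ‖ζ‖ = 1 → (H ζ).re = 0) :
    ∃ s : ℝ, ∀ ζ : ℂ, ζ ≠ 0 → ‖ζ‖ ≤ 1 → H ζ = Complex.I * s := by
  classical
  -- The hypothesis ζ H(ζ) → 0 is the little-o condition of Riemann's theorem on removable
  -- singularities.
  set F := Function.update H 0 (limUnder (𝓝[≠] 0) H) with hF
  have hFH : ∀ ζ : ℂ, ζ ≠ 0 → F ζ = H ζ := fun ζ hζ => Function.update_of_ne hζ _ _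
  have hFd : DifferentiableOn ℂ F (Metric.ball 0 1) := by
    refine Complex.differentiableOn_update_limUnder_of_isLittleO (Metric.ball_mem_nhds _ one_pos)
      (fun ζ hζ => (hd ζ hζ.2 (by simpa using hζ.1)).differentiableWithinAt) ?_
    rw [Asymptotics.isLittleO_iff_tendsto']
    · have h1 : Tendsto (fun ζ : ℂ => ζ * H ζ - ζ * H 0) (𝓝[≠] 0) (𝓝 (0 - 0 * H 0)) :=
        h0.sub ((tendsto_nhdsWithin_of_tendsto_nhds tendsto_id).mul_const _)
      rw [zero_mul, sub_zero] at h1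
      refine h1.congr fun ζ => ?_
      rw [sub_zero, div_inv_eq_mul]; ring
    · filter_upwards [self_mem_nhdsWithin] with ζ hζ h
      simp only [sub_zero, inv_eq_zero] at h
      exact absurd h hζ
  have hFc : ContinuousOn F (Metric.closedBall 0 1) := by
    intro ζ hζ
    rcases eq_or_ne ζ 0 with rfl | h
    · exact ((hFd.differentiableAt (Metric.ball_mem_nhds _ one_pos)).continuousAt).continuousWithinAt
    · have h1 : {ζ : ℂ | ζ ≠ 0 ∧ ‖ζ‖ ≤ 1} ∈ 𝓝[Metric.closedBall 0 1] ζ := by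
        filter_upwards [self_mem_nhdsWithin, mem_nhdsWithin_of_mem_nhds (isOpen_ne.mem_nhds h)]
          with x hx hx'
        exact ⟨hx', by simpa using hx⟩
      have h2 := ((hc ζ ⟨h, by simpa using hζ⟩).congr (g := F) (fun x hx => hFH x hx.1) (hFH ζ h))
      exact h2.mono_of_mem_nhdsWithin h1
  have hcl : DiffContOnCl ℂ F (Metric.ball 0 1) := ⟨hFd, by
    rwa [closure_ball _ one_ne_zero]⟩
  have hfr : ∀ ζ ∈ frontier (Metric.ball (0 : ℂ) 1), (F ζ).re = 0 := by
    intro ζ hζ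
    rw [frontier_ball _ one_ne_zero] at hζ
    have h1 : ‖ζ‖ = 1 := by simpa using hζ
    rw [hFH ζ (by rintro rfl; simp at h1), hb ζ h1]
  -- The maximum modulus principle for exp F and exp(−F), both of modulus 1 on the circle, gives
  -- both inequalities for Re F.
  have hre : ∀ ζ ∈ Metric.ball (0 : ℂ) 1, (F ζ).re = 0 := by
    intro ζ hζ
    have e1 := Complex.norm_le_of_forall_mem_frontier_norm_le (C := 1) Metric.isBounded_ball
      (Complex.differentiable_exp.comp_diffContOnCl hcl) (fun x hx => by
        simp [Complex.norm_exp, hfr x hx]) (subset_closure hζ)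
    have e2 := Complex.norm_le_of_forall_mem_frontier_norm_le (C := 1) Metric.isBounded_ball
      (Complex.differentiable_exp.comp_diffContOnCl hcl.neg) (fun x hx => by
        simp [Complex.norm_exp, hfr x hx]) (subset_closure hζ)
    simp only [Function.comp, Complex.norm_exp, Pi.neg_apply, Complex.neg_re, Real.exp_le_one_iff]
      at e1 e2
    linarith
  -- Re F is constant, so Re F'(ζ) and Re(i F'(ζ)), its derivatives along 1 and i, both vanish.
  have hder : (Metric.ball (0 : ℂ) 1).EqOn (deriv F) 0 := by
    intro ζ hζ
    have h1 := (hFd.differentiableAt (Metric.isOpen_ball.mem_nhds hζ)).hasDerivAt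
    have h2 := Complex.reCLM.hasFDerivAt.comp ζ (h1.hasFDerivAt.restrictScalars ℝ)
    have h3 : HasFDerivAt (Complex.reCLM ∘ F) (0 : ℂ →L[ℝ] ℝ) ζ :=
      (hasFDerivAt_const (0 : ℝ) ζ).congr_of_eventuallyEq (by
        filter_upwards [Metric.isOpen_ball.mem_nhds hζ] with x hx
        exact hre x hx)
    have h4 := h2.unique h3
    have h5 := congrArg (fun L => L 1) h4
    have h6 := congrArg (fun L => L Complex.I) h4
    apply Complex.ext
    · simpa using h5
    · simpa using h6
  obtain ⟨c, hcc⟩ := Metric.isOpen_ball.exists_is_const_of_deriv_eq_zero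
    (convex_ball (0 : ℂ) 1).isPreconnected hFd hder
  have hall : EqOn F (fun _ => c) (Metric.closedBall 0 1) :=
    EqOn.of_subset_closure (s := Metric.ball 0 1) hcc hFc continuousOn_const
      Metric.ball_subset_closedBall (by rw [closure_ball _ one_ne_zero])
  refine ⟨c.im, fun ζ hζ hζ1 => ?_⟩
  rw [← hFH ζ hζ, hall (by simpa using hζ1)]
  have h1 := hre 0 (Metric.mem_ball_self one_pos)
  rw [hcc 0 (Metric.mem_ball_self one_pos)] at h1
  change c = _
  apply Complex.ext <;> simp [h1]

end Ball

/-! ### The Lie derivative of J and the 𝓩-component of a field -/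

section LieDerivative

variable {n : ℕ} {J : EndField n} {X : VField n} {z : Cn n}

lemma fderiv_apply_const {V : Type} [NormedAddCommGroup V] [NormedSpace ℝ V]
    {J : V → (Cn n →L[ℝ] Cn n)} {z : V} (hJ : DifferentiableAt ℝ J z) (p : Cn n) (u : V) :
    fderiv ℝ (fun y => J y p) z u = fderiv ℝ J z u p := by
  have := hJ.hasFDerivAt.clm_apply (hasFDerivAt_const p z)
  rw [this.fderiv]; simp

lemma lieDer_eq (hJ : DifferentiableAt ℝ J z) (p : Cn n) :
    lieDer X J z p = fderiv ℝ J z (X z) p - fderiv ℝ X z (J z p) + J z (fderiv ℝ X z p) := by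
  simp [lieDer, VectorField.lieBracket, fderiv_apply_const hJ]

/-- Leibniz rule for the identity J_y(c y) = i c y, which holds in a neighbourhood of z. It removes
the derivatives of J from the computations on 𝓩. -/
lemma fderiv_J_smul_self (hS : StandardOnZ J) (hJ : DifferentiableAt ℝ J z)
    (hz : z ∈ puncturedOpenBall n) (c : ℂ) (u : Cn n) :
    fderiv ℝ J z u (c • z) = (Complex.I * c) • u - J z (c • u) := by
  have h1 := hJ.hasFDerivAt.clm_apply
    ((c • ContinuousLinearMap.id ℂ (Cn n)).restrictScalars ℝ).hasFDerivAt
  have h2 : HasFDerivAt (fun y => J y (((c • ContinuousLinearMap.id ℂ (Cn n)).restrictScalars ℝ) y))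
      (((Complex.I * c) • ContinuousLinearMap.id ℂ (Cn n)).restrictScalars ℝ) z := by
    refine (((Complex.I * c) • ContinuousLinearMap.id ℂ (Cn n)).restrictScalars
      ℝ).hasFDerivAt.congr_of_eventuallyEq ?_
    filter_upwards [isOpen_puncturedOpenBall.mem_nhds hz] with y hy
    simpa using hS y (puncturedOpenBall_subset hy) c
  have h3 := congrArg (fun L => L u) (h1.unique h2)
  simp only [_root_.add_apply, ContinuousLinearMap.comp_apply,
    ContinuousLinearMap.flip_apply, ContinuousLinearMap.coe_restrictScalars',
    _root_.smul_apply, ContinuousLinearMap.id_apply] at h3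
  rw [← h3]; abel

/-- `J` acts on the quotient by `𝓗`. -/
lemma ballTheta_J (hP : PreservesH J) (hz : z ∈ puncturedBall n) (w : Cn n) :
    ballTheta z (J z w) = ballTheta z (J z (ballTheta z w • z)) := by
  have h1 : inner ℂ z (w - ballTheta z w • z) = (0 : ℂ) := by
    rw [← ballTheta_eq_zero hz.1, ballTheta_sub, ballTheta_smul, ballTheta_self hz.1, mul_one,
      sub_self]
  have h2 := hP z hz _ h1
  rw [← ballTheta_eq_zero hz.1, map_sub, ballTheta_sub, sub_eq_zero] at h2
  exact h2

lemma ballTheta_J_of_standard (hS : StandardOnZ J) (hP : PreservesH J) (hz : z ∈ puncturedBall n)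
    (w : Cn n) : ballTheta z (J z w) = Complex.I * ballTheta z w := by
  rw [ballTheta_J hP hz, hS z hz, ballTheta_smul, ballTheta_self hz.1, mul_one]

/-- The derivative of `θ(X)`. -/
lemma fderiv_ballTheta (hz : z ≠ 0) (hX : DifferentiableAt ℝ X z) :
    DifferentiableAt ℝ (fun y => ballTheta y (X y)) z ∧
    ∀ u, fderiv ℝ (fun y => ballTheta y (X y)) z u =
      ballTheta z (fderiv ℝ X z u) + inner ℂ u (X z) / (‖z‖ : ℂ) ^ 2
        - 2 * ((ballTheta z u).re : ℂ) * ballTheta z (X z) := by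
  have hd : DifferentiableAt ℝ (fun y => ballTheta y (X y)) z := by
    have h1 := (contDiffOn_ballTheta (n := n)).contDiffAt (isOpen_fst_ne_zero.mem_nhds
      (show (z, X z).1 ≠ 0 from hz))
    exact (h1.differentiableAt (by simp)).comp (f := fun y => (y, X y)) z
      (differentiableAt_id.prodMk hX)
  refine ⟨hd, fun u => ?_⟩
  have hn : (‖z‖ : ℂ) ^ 2 ≠ 0 := pow_ne_zero _ (normC_ne_zero hz)
  obtain ⟨d1, f1⟩ := hermitian_fderiv (hasFDerivAt_id z) hX.hasFDerivAt
  obtain ⟨d2, f2⟩ := hermitian_fderiv (hasFDerivAt_id z) (hasFDerivAt_id z)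
  -- The identity ‖y‖² θ(X) = ⟨y, X⟩ is differentiated instead of the quotient that defines θ.
  have e : (fun y => inner ℂ (id y) (id y) * ballTheta y (X y))
      =ᶠ[𝓝 z] fun y => inner ℂ (id y) (X y) := by
    filter_upwards [isOpen_ne.mem_nhds hz] with y hy
    rw [id, inner_eq_ballTheta hy (X y), normSq_eq_inner]
  have h1 := congrArg (fun L => L u) ((d2.hasFDerivAt.mul hd.hasFDerivAt).unique
    (d1.hasFDerivAt.congr_of_eventuallyEq e))
  simp only [_root_.add_apply, _root_.smul_apply, smul_eq_mul] at h1
  rw [f1, f2] at h1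
  simp only [id, ContinuousLinearMap.id_apply] at h1
  have h2 : inner ℂ z u + inner ℂ u z = (‖z‖ : ℂ) ^ 2 * (2 * ((ballTheta z u).re : ℂ)) := by
    rw [← inner_conj_symm u z, inner_eq_ballTheta hz, map_mul, map_pow, Complex.conj_ofReal,
      ← mul_add, Complex.add_conj]
    push_cast; ring
  rw [h2, ← normSq_eq_inner, inner_eq_ballTheta hz] at h1
  have hn1 := normC_ne_zero hz
  field_simp
  linear_combination h1

/-- `((𝓛_X J)|_𝓩)^𝓩 = 0` is the Cauchy-Riemann equation for `θ(X)` along the straight discs. -/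
lemma ballTheta_lieDer (hS : StandardOnZ J) (hP : PreservesH J) (hJ : DifferentiableAt ℝ J z)
    (hX : DifferentiableAt ℝ X z) (hz : z ∈ puncturedOpenBall n) (c : ℂ) :
    ballTheta z (lieDer X J z (c • z)) =
      Complex.I * fderiv ℝ (fun y => ballTheta y (X y)) z (c • z)
        - fderiv ℝ (fun y => ballTheta y (X y)) z ((Complex.I * c) • z) := by
  have hz' := puncturedOpenBall_subset hz
  have hn : (‖z‖ : ℂ) ^ 2 ≠ 0 := pow_ne_zero _ (normC_ne_zero hz.1)
  rw [lieDer_eq hJ, fderiv_J_smul_self hS hJ hz, hS z hz', ballTheta_add, ballTheta_sub,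
    ballTheta_sub, ballTheta_J_of_standard hS hP hz', ballTheta_J_of_standard hS hP hz',
    (fderiv_ballTheta hz.1 hX).2, (fderiv_ballTheta hz.1 hX).2]
  simp only [ballTheta_smul, ballTheta_self hz.1, mul_one, inner_smul_left]
  have h5 : ∀ d : ℂ, d * inner ℂ z (X z) / (‖z‖ : ℂ) ^ 2 = d * ballTheta z (X z) := fun d => by
    rw [ballTheta, mul_div_assoc]
  simp only [h5]
  have h1 : ((Complex.I * c).re : ℂ) = -(c.im : ℂ) := by simp
  have h2 : (starRingEnd ℂ) (Complex.I * c) = -Complex.I * (starRingEnd ℂ) c := by simp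
  have h3 : (starRingEnd ℂ) c = c.re - c.im * Complex.I := by
    apply Complex.ext <;> simp
  rw [h1, h2, h3]
  ring_nf
  simp only [Complex.I_sq]
  ring

end LieDerivative

/-! ### Further operations on Hölder maps; limits along dense subsets -/

section General

variable {n : ℕ}

lemma HolderClassOn.inverse {V : Type} [NormedAddCommGroup V] [NormedSpace ℝ V] {r : ℕ} {a : ℝ}
    (ha0 : 0 ≤ a) (ha : a ≤ 1) (hr : 1 ≤ r) {S : Set V} (hS : GoodSet S)
    {L : V → (Cn n →L[ℝ] Cn n)} (hL : HolderClassOn r a L S)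
    (hi : ∀ x ∈ S, (L x).IsInvertible) : HolderClassOn r a (fun x => (L x).inverse) S := by
  refine hL.smooth_comp ha0 ha hS hr (ContinuousLinearEquiv.isOpen (𝕜 := ℝ) (E := Cn n) (F := Cn n))
    (f := ContinuousLinearMap.inverse) ?_ ?_
  · rintro _ ⟨e, rfl⟩
    exact (contDiffAt_map_inverse e).contDiffWithinAt
  · intro x hx
    obtain ⟨e, he⟩ := hi x hx
    exact ⟨e, he⟩

namespace HolderClassOn

variable {V : Type} [NormedAddCommGroup V] [NormedSpace ℝ V] {r : ℕ} {a : ℝ} {S : Set V}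

lemma smul (ha : a ≤ 1) (hS : GoodSet S) {f : V → ℂ} {g : V → Cn n} (hf : HolderClassOn r a f S)
    (hg : HolderClassOn r a g S) : HolderClassOn r a (fun x => f x • g x) S :=
  bilin ha hS r (ContinuousLinearMap.lsmul ℝ ℂ : ℂ →L[ℝ] Cn n →L[ℝ] Cn n) hf hg

lemma mul (ha : a ≤ 1) (hS : GoodSet S) {f g : V → ℂ} (hf : HolderClassOn r a f S)
    (hg : HolderClassOn r a g S) : HolderClassOn r a (fun x => f x * g x) S :=
  bilin ha hS r (ContinuousLinearMap.mul ℝ ℂ) hf hg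

lemma clm_apply (ha : a ≤ 1) (hS : GoodSet S) {f : V → (Cn n →L[ℝ] Cn n)} {g : V → Cn n}
    (hf : HolderClassOn r a f S) (hg : HolderClassOn r a g S) :
    HolderClassOn r a (fun x => f x (g x)) S :=
  bilin ha hS r (ContinuousLinearMap.id ℝ (Cn n →L[ℝ] Cn n)) hf hg

lemma sum (ha : a ≤ 1) (hS : GoodSet S) {F ι : Type} [NormedAddCommGroup F] [NormedSpace ℝ F]
    {f : ι → V → F} (s : Finset ι) (hf : ∀ j, HolderClassOn r a (f j) S) :
    HolderClassOn r a (fun x => ∑ j ∈ s, f j x) S := by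
  classical
  induction s using Finset.induction_on with
  | empty => simpa using const ha hS r (0 : F)
  | insert j s hj ih =>
    simp only [Finset.sum_insert hj]
    exact add hS.unique r (hf j) ih

end HolderClassOn

/-- A limit along a dense subset of the domain of continuity is a limit. -/
lemma tendsto_of_dense {f : Cn n → Cn n} {S U : Set (Cn n)} {v : Cn n} (hf : ContinuousOn f S)
    (hUS : U ⊆ S) (hSU : S ⊆ closure U) (h : Tendsto f (𝓝[U] 0) (𝓝 v)) :
    Tendsto f (𝓝[S] 0) (𝓝 v) := by
  rw [Metric.tendsto_nhdsWithin_nhds] at h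
  rw [Metric.tendsto_nhdsWithin_nhds]
  intro ε hε
  obtain ⟨δ, hδ, h⟩ := h (ε / 2) (half_pos hε)
  refine ⟨δ, hδ, fun {y} hy hyδ => ?_⟩
  have : (𝓝[U] y).NeBot := mem_closure_iff_nhdsWithin_neBot.1 (hSU hy)
  have h1 : Tendsto f (𝓝[U] y) (𝓝 (f y)) := (hf y hy).mono hUS
  have h2 : ∀ᶠ x in 𝓝[U] y, f x ∈ Metric.closedBall v (ε / 2) := by
    filter_upwards [self_mem_nhdsWithin, mem_nhdsWithin_of_mem_nhds
      (Metric.isOpen_ball.mem_nhds (Metric.mem_ball.2 hyδ))] with x hx hx'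
    exact Metric.mem_closedBall.2 (h hx hx').le
  have h3 := Metric.isClosed_closedBall.mem_of_tendsto h1 h2
  exact (Metric.mem_closedBall.1 h3).trans_lt (half_lt_self hε)

end General

/-! ### The 𝓩-component of a quasi-regular field on the straight discs -/

namespace IsCircularRep

variable {n k : ℕ} {a : ℝ} {J : EndField n} {Ψ : Cn n ≃ Cn n} (hΨ : IsCircularRep k a J Ψ)
  {i : Fin n}
include hΨ

lemma contDiff_rho {m : WithTop ℕ∞} (hm : m ≤ k + 1) : ContDiff ℝ m (rho Ψ i) := by
  have e : rho Ψ i = fun w => ‖Ψ (affPt i w)‖ * ‖affPt i w‖⁻¹ := by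
    funext w; rw [hΨ.rho_eq, div_eq_mul_inv]
  rw [e, contDiff_iff_contDiffAt]
  intro w
  refine ContDiffAt.mul ?_ (ContDiffAt.inv ?_ (norm_ne_zero_iff.2 (affPt_ne_zero w)))
  · exact (contDiffAt_norm_Cn (hΨ.map_ne_zero (affPt_ne_zero w))).comp w
      (((hΨ.contDiffAt (affPt_ne_zero w)).of_le hm).comp w contDiff_affPt.contDiffAt)
  · exact (contDiffAt_norm_Cn (affPt_ne_zero w)).comp w contDiff_affPt.contDiffAt

/-- The diffeomorphism (w, ζ) ↦ (w, ρ ζ) straightens the domain to a convex cylinder without the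
slice ζ = 0. -/
lemma goodSet_polarDom : GoodSet (polarDom Ψ i) := by
  let e : (Aff i × ℂ) ≃ (Aff i × ℂ) :=
    { toFun := fun p => (p.1, p.2 * (rho Ψ i p.1 : ℂ))
      invFun := fun p => (p.1, p.2 / (rho Ψ i p.1 : ℂ))
      left_inv := fun p => by
        have : (rho Ψ i p.1 : ℂ) ≠ 0 := by exact_mod_cast (hΨ.rho_pos p.1).ne'
        simp [this]
      right_inv := fun p => by
        have : (rho Ψ i p.1 : ℂ) ≠ 0 := by exact_mod_cast (hΨ.rho_pos p.1).ne'
        simp [this] }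
  have hr : ContDiff ℝ 1 (fun p : Aff i × ℂ => (rho Ψ i p.1 : ℂ)) :=
    Complex.ofRealCLM.contDiff.comp ((hΨ.contDiff_rho (by simp)).comp contDiff_fst)
  have hS : GoodSet (((univ : Set (Aff i)) ×ˢ Metric.closedBall (0 : ℂ) 1) ∩ {p | p.2 ≠ 0}) := by
    refine GoodSet.inter (Convex.goodSet (convex_univ.prod (convex_closedBall _ _)) ?_)
      (isOpen_ne_fun continuous_snd continuous_const)
    rw [interior_prod_eq, interior_univ, interior_closedBall _ one_ne_zero]
    exact ⟨(0, 0), mem_univ _, Metric.mem_ball_self one_pos⟩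
  have := hS.preimage e (contDiff_fst.prodMk (contDiff_snd.mul hr))
    (contDiff_fst.prodMk (by
      simp only [div_eq_mul_inv]
      exact contDiff_snd.mul (hr.inv fun p => by exact_mod_cast (hΨ.rho_pos p.1).ne')))
  convert this using 1
  ext p
  have : (rho Ψ i p.1 : ℂ) ≠ 0 := by exact_mod_cast (hΨ.rho_pos p.1).ne'
  simp [polarDom, e, and_comm, abs_of_pos (hΨ.rho_pos p.1), (hΨ.rho_pos p.1).ne']

/-- This is the form of X⁰ free of charts. It shows that the 𝓩-components given by the various
charts agree. -/
lemma specialX0_eq {p : Aff i × ℂ} (hp : p.2 ≠ 0) (v : Cn n) (σ : Cn n → ℝ) :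
    specialX0 Ψ i v σ p = theta Ψ (polarPt i p) v + Complex.I * σ (affPt i p.1)
      - (‖Ψ (polarPt i p)‖ : ℂ) ^ 2 * star (theta Ψ (polarPt i p) v) := by
  have hs : (starRingEnd ℂ) p.2 ≠ 0 := by simpa using hp
  rw [specialX0, ← hΨ.YZ_eq hp, hΨ.norm_map_polarPt, Complex.ofReal_mul, mul_pow]
  have : (‖p.2‖ : ℂ) ^ 2 = p.2 * (starRingEnd ℂ) p.2 := by rw [Complex.mul_conj']
  rw [this]
  simp only [Complex.star_def, map_div₀]
  field_simp

/-- The vector field `X - dΨ(v)` tends to zero at the origin. -/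
lemma tendsto_sub_of_quasiRegular {v : Cn n} {X : VField n}
    (hX : IsQuasiRegular k a Ψ v X) :
    Tendsto (fun y => (fderiv ℝ Ψ (Ψ.symm y)).inverse (X y)) (𝓝[puncturedBall n] 0) (𝓝 v) := by
  obtain ⟨U, ⟨O, -, rfl⟩, hU, hlim⟩ := hX.limit
  refine tendsto_of_dense ?_ inter_subset_right hU hlim
  have h1 : ContinuousOn (fun y => fderiv ℝ Ψ.symm y (X y)) (puncturedBall n) := by
    refine ContinuousOn.clm_apply ?_ hX.regular.continuousOn
    intro y hy
    exact ((hΨ.symm_contDiffAt hy.1).fderiv_right (m := 0)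
      (by simp)).continuousAt.continuousWithinAt
  exact h1.congr fun y hy => by simp only [hΨ.fderiv_symm hy.1]

lemma tendsto_sub {v : Cn n} {X : VField n} {S : Set (Cn n)} (hS : ∀ y ∈ S, y ≠ 0)
    (h : Tendsto (fun y => (fderiv ℝ Ψ (Ψ.symm y)).inverse (X y)) (𝓝[S] 0) (𝓝 v)) :
    Tendsto (fun y => X y - fderiv ℝ Ψ (Ψ.symm y) v) (𝓝[S] 0) (𝓝 0) := by
  obtain ⟨C, hC⟩ := hΨ.exists_fderiv_bound
  have h1 : Tendsto (fun y => C * ‖(fderiv ℝ Ψ (Ψ.symm y)).inverse (X y) - v‖) (𝓝[S] 0) (𝓝 0) := by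
    have h2 := ((h.sub_const v).norm).const_mul C
    simpa using h2
  refine squeeze_zero_norm' ?_ h1
  filter_upwards [self_mem_nhdsWithin] with y hy
  have hz := hΨ.symm_ne_zero (hS y hy)
  have e : X y - fderiv ℝ Ψ (Ψ.symm y) v
      = fderiv ℝ Ψ (Ψ.symm y) ((fderiv ℝ Ψ (Ψ.symm y)).inverse (X y) - v) := by
    rw [map_sub, hΨ.fderiv_apply_inverse hz]
  rw [e]
  exact ((fderiv ℝ Ψ (Ψ.symm y)).le_opNorm _).trans
    (mul_le_mul_of_nonneg_right (hC _ hz) (norm_nonneg _))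

/-- The remainder of the `𝓩`-component of a vector field. -/
def remainder (_ : IsCircularRep k a J Ψ) (X : VField n) (v z : Cn n) : ℂ :=
  ballTheta (Ψ z) (X (Ψ z)) - theta Ψ z v + (‖Ψ z‖ : ℂ) ^ 2 * star (theta Ψ z v)

/-- The remainder is constant and imaginary on the straight discs. -/
lemma exists_remainder_eq (hk : 1 ≤ k) (hS : StandardOnZ J) (hP : PreservesH J)
    (hJ : ∀ y ∈ puncturedOpenBall n, DifferentiableAt ℝ J y) {v : Cn n} {X : VField n}
    (hX : IsQuasiRegular k a Ψ v X) (hL : LieDerZZVanishes J X) {z : Cn n} (hz : z ≠ 0) :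
    ∃ s : ℝ, ∀ c : ℂ, c ≠ 0 → ‖Ψ (c • z)‖ ≤ 1 → hΨ.remainder X v (c • z) = Complex.I * s := by
  have hy := hΨ.map_ne_zero hz
  have hn : (‖Ψ z‖ : ℂ) ≠ 0 := normC_ne_zero hy
  have hn0 : 0 < ‖Ψ z‖ := norm_pos_iff.2 hy
  -- The point is moved to the boundary of the indicatrix, so that the disc c ↦ c y1 is the unit
  -- disc and μ = |c| along it.
  set z1 : Cn n := (‖Ψ z‖ : ℂ)⁻¹ • z with hz1
  have hz1' : z1 ≠ 0 := smul_ne_zero (inv_ne_zero hn) hz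
  have hN : ‖Ψ z1‖ = 1 := by
    rw [hz1, hΨ.map_smul, norm_smul, norm_inv, Complex.norm_real, norm_norm, inv_mul_cancel₀ hn0.ne']
  set y1 := Ψ z1 with hy1
  have hy10 : y1 ≠ 0 := hΨ.map_ne_zero hz1'
  have hNc : ∀ c : ℂ, ‖Ψ (c • z1)‖ = ‖c‖ := fun c => by rw [hΨ.map_smul, norm_smul, hN, mul_one]
  have hmem : ∀ c : ℂ, c ≠ 0 → ‖c‖ ≤ 1 → c • y1 ∈ puncturedBall n := fun c hc hc1 =>
    ⟨smul_ne_zero hc hy10, by rw [norm_smul, hN, mul_one]; exact hc1⟩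
  have hmem' : ∀ c : ℂ, c ≠ 0 → ‖c‖ < 1 → c • y1 ∈ puncturedOpenBall n := fun c hc hc1 =>
    ⟨smul_ne_zero hc hy10, by rw [norm_smul, hN, mul_one]; exact hc1⟩
  set t := theta Ψ z1 v with ht
  have hform : ∀ c : ℂ, c ≠ 0 → hΨ.remainder X v (c • z1)
      = ballTheta (c • y1) (X (c • y1)) - t / c + star t * c := by
    intro c hc
    have hc' : (starRingEnd ℂ) c ≠ 0 := by simpa using hc
    rw [remainder, hNc, hΨ.theta_smul_left hz1' hc, hΨ.map_smul, ← Complex.mul_conj']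
    simp only [Complex.star_def, map_div₀]
    rw [← ht, ← hy1]
    field_simp
  have hcont : Continuous fun c : ℂ => c • y1 := continuous_id.smul continuous_const
  have key := exists_eq_imaginary_const
    (H := fun c => ballTheta (c • y1) (X (c • y1)) - t / c + star t * c) ?_ ?_ ?_ ?_
  · obtain ⟨s, hs⟩ := key
    refine ⟨s, fun c hc hc1 => ?_⟩
    have e : c • z = (c * ‖Ψ z‖) • z1 := by
      rw [hz1, ← mul_smul, mul_assoc, mul_inv_cancel₀ hn, mul_one]
    rw [e, hNc] at hc1
    rw [e, hform _ (mul_ne_zero hc hn)]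
    exact hs _ (mul_ne_zero hc hn) hc1
  -- Holomorphy: θ(X) composed with the disc is real differentiable, and the vanishing of the 𝓩-part
  -- of 𝓛_X J, applied at c⁻¹ times the base point, is its Cauchy-Riemann equation.
  · intro c hc hc1
    have hcd : DifferentiableAt ℂ (fun c : ℂ => t / c) c :=
      (differentiableAt_const _).div differentiableAt_id hc
    have hsd : DifferentiableAt ℂ (fun c : ℂ => star t * c) c :=
      (differentiableAt_const _).mul differentiableAt_id
    refine (DifferentiableAt.sub ?_ hcd).add hsd
    have hXd : DifferentiableAt ℝ X (c • y1) :=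
      ((hX.regular.contDiffOn.contDiffAt (puncturedBall_mem_nhds (hmem' c hc hc1))).differentiableAt
        (by simp; omega))
    obtain ⟨hd, -⟩ := fderiv_ballTheta (smul_ne_zero hc hy10) hXd
    have hm : HasFDerivAt (fun c : ℂ => c • y1)
        ((ContinuousLinearMap.id ℝ ℂ).smulRight y1) c := by
      exact (ContinuousLinearMap.id ℝ ℂ).hasFDerivAt.smul_const y1
    have hcomp := hd.hasFDerivAt.comp c hm
    refine differentiableAt_complex_iff_differentiableAt_real.2 ⟨hcomp.differentiableAt, ?_⟩
    have hcomp' : fderiv ℝ (fun c : ℂ => ballTheta (c • y1) (X (c • y1))) c = _ := hcomp.fderiv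
    rw [hcomp']
    simp only [ContinuousLinearMap.comp_apply, ContinuousLinearMap.smulRight_apply,
      ContinuousLinearMap.id_apply, one_smul, smul_eq_mul]
    have h1 := ballTheta_lieDer hS hP (hJ _ (hmem' c hc hc1)) hXd (hmem' c hc hc1) (c⁻¹)
    rw [(ballTheta_eq_zero (smul_ne_zero hc hy10)).2 (hL _ (hmem' c hc hc1) _), mul_smul,
      inv_smul_smul₀ hc] at h1
    exact (sub_eq_zero.1 h1.symm).symm
  · have h1 : ContinuousOn (fun c : ℂ => ballTheta (c • y1) (X (c • y1))) {c | c ≠ 0 ∧ ‖c‖ ≤ 1} := by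
      refine (contDiffOn_ballTheta (n := n)).continuousOn.comp (f := fun c : ℂ => (c • y1, X (c • y1)))
        (hcont.continuousOn.prodMk (hX.regular.continuousOn.comp hcont.continuousOn
          fun c hc => hmem c hc.1 hc.2)) fun c hc => smul_ne_zero hc.1 hy10
    refine (h1.sub (continuousOn_const.div continuousOn_id fun c hc => hc.1)).add
      (continuousOn_const.mul continuousOn_id)
  -- No pole is left: X − dΨ(v) tends to 0, while θ at c y1 has norm at most 1/|c|, so c times the
  -- difference tends to 0.
  · have hlim := (hΨ.tendsto_sub (fun y hy => hy.1) (hΨ.tendsto_sub_of_quasiRegular hX))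
    have ht0 : Tendsto (fun c : ℂ => c • y1) (𝓝[≠] 0) (𝓝[puncturedBall n] 0) := by
      refine tendsto_nhdsWithin_iff.2 ⟨?_, ?_⟩
      · have := hcont.tendsto 0
        rw [zero_smul] at this
        exact this.mono_left nhdsWithin_le_nhds
      · have : ∀ᶠ c : ℂ in 𝓝[≠] 0, ‖c‖ < 1 :=
          mem_nhdsWithin_of_mem_nhds (by
            filter_upwards [Metric.ball_mem_nhds (0 : ℂ) one_pos] with c hc using by simpa using hc)
        filter_upwards [self_mem_nhdsWithin, this] with c hc hc1
        exact hmem c hc hc1.le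
    have h1 := ht0.eventually (eventually_mem_nhdsWithin)
    have h2 := ((hlim.comp ht0).norm)
    rw [norm_zero] at h2
    have h3 : Tendsto (fun c : ℂ => c * ballTheta (c • y1) (X (c • y1) - fderiv ℝ Ψ (Ψ.symm (c • y1)) v))
        (𝓝[≠] 0) (𝓝 0) := by
      refine squeeze_zero_norm' ?_ h2
      filter_upwards [self_mem_nhdsWithin] with c hc
      have hc0 : ‖c‖ ≠ 0 := norm_ne_zero_iff.2 hc
      rw [norm_mul, ballTheta, norm_div, norm_pow, Complex.norm_real, norm_norm, norm_smul, hN,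
        mul_one]
      have h4 := norm_inner_le_norm (𝕜 := ℂ) (c • y1) (X (c • y1) - fderiv ℝ Ψ (Ψ.symm (c • y1)) v)
      rw [norm_smul, hN, mul_one] at h4
      calc _ ≤ ‖c‖ * (‖c‖ * ‖X (c • y1) - fderiv ℝ Ψ (Ψ.symm (c • y1)) v‖ / ‖c‖ ^ 2) := by gcongr
        _ = _ := by simp only [Function.comp]; field_simp
    have h4 : Tendsto (fun c : ℂ => c * (star t * c)) (𝓝[≠] 0) (𝓝 0) := by
      have : Continuous fun c : ℂ => c * (star t * c) := by fun_prop
      simpa using (this.tendsto 0).mono_left nhdsWithin_le_nhds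
    have h5 := h3.add h4
    rw [add_zero] at h5
    refine h5.congr' ?_
    filter_upwards [self_mem_nhdsWithin] with c hc
    have e : ballTheta (c • y1) (fderiv ℝ Ψ (Ψ.symm (c • y1)) v) = t / c := by
      have e1 : Ψ.symm (c • y1) = c • z1 := by rw [hΨ.symm_smul, hy1, Ψ.symm_apply_apply]
      have e2 : ballTheta (c • y1) (fderiv ℝ Ψ (c • z1) v) = theta Ψ (c • z1) v := by
        rw [theta, hΨ.map_smul]
      rw [e1, e2, hΨ.theta_smul_left hz1' hc]
    rw [ballTheta_sub, e]; ring
  -- On |c| = 1 one has conj c = c⁻¹, so t/c and t̄ c are conjugate and their difference is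
  -- imaginary; θ(X) is imaginary by tangency.
  · intro c hc
    have hc0 : c ≠ 0 := by rintro rfl; simp at hc
    have h1 := hX.tangent (c • y1) (by rw [norm_smul, hN, mul_one, hc])
    have h2 : ballTheta (c • y1) (X (c • y1)) = inner ℂ (c • y1) (X (c • y1)) := by
      rw [ballTheta, norm_smul, hN, mul_one, hc]; simp
    have h3 : (starRingEnd ℂ) c = c⁻¹ := by
      rw [Complex.inv_def, Complex.normSq_eq_norm_sq, hc]; simp
    have h4 : star t * c = (starRingEnd ℂ) (t / c) := by
      rw [map_div₀, h3, div_inv_eq_mul]; rfl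
    simp only [h2, h4, Complex.add_re, Complex.sub_re, Complex.conj_re, h1]
    ring

end IsCircularRep

/-! ### Quasi-regular fields are special -/

namespace IsCircularRep

variable {n k : ℕ} {a : ℝ} {J : EndField n} {Ψ : Cn n ≃ Cn n} (hΨ : IsCircularRep k a J Ψ)
  {i : Fin n}
include hΨ

/-- A vector field expanded in the adapted polar frame. -/
lemma eq_fderiv_polar_frame {p : Aff i × ℂ} (hp : p.2 ≠ 0) (X : VField n) :
    X (Ψ (polarPt i p)) = fderiv ℝ Ψ (polarPt i p)
      (ballTheta (Ψ (polarPt i p)) (X (Ψ (polarPt i p))) • polarPt i p +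
        ∑ α, compE i p α ((fderiv ℝ Ψ (polarPt i p)).inverse (X (Ψ (polarPt i p)))) •
          frameE Ψ i p α) := by
  have hz := polarPt_ne_zero hp
  have h1 := hΨ.eq_polar_frame hp ((fderiv ℝ Ψ (polarPt i p)).inverse (X (Ψ (polarPt i p))))
  rw [theta, hΨ.fderiv_apply_inverse hz] at h1
  rw [← h1, hΨ.fderiv_apply_inverse hz]

lemma holder_compE_sub (ha : a ≤ 1) {S : Set (Aff i × ℂ)}
    (hS : GoodSet S) (hS0 : ∀ p ∈ S, p.2 ≠ 0) (α : {j : Fin n // j ≠ i}) (v : Cn n)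
    {V : Aff i × ℂ → Cn n} (hV : HolderClassOn k a V S) :
    HolderClassOn k a (fun p => compE i p α (V p) - YH i v p.1 α / p.2) S := by
  have hW : HolderClassOn k a (fun p => V p - v) S := by
    have := hV.add hS.unique k (HolderClassOn.const ha hS k (-v))
    simpa only [← sub_eq_add_neg] using this
  have hco : ∀ j : Fin n, HolderClassOn k a (fun p => (V p - v) j) S := fun j =>
    HolderClassOn.clm ha hS ((EuclideanSpace.proj j : Cn n →L[ℂ] ℂ).restrictScalars ℝ) hW
  have h1 : HolderClassOn k a (fun p : Aff i × ℂ => -p.1 α) S :=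
    HolderClassOn.of_contDiffOn ha hS k (((contDiff_apply ℝ ℂ α).comp contDiff_fst).neg.contDiffOn)
  have h2 : HolderClassOn k a (fun p : Aff i × ℂ => (p.2 / (Real.sqrt (affNorm i p.1) : ℂ))⁻¹) S :=
    HolderClassOn.of_contDiffOn ha hS k ((contDiff_polarFactor (i := i)).contDiffOn.inv
      fun p hp => polarFactor_ne_zero (hS0 p hp))
  refine HolderClassOn.congr (((hco α.1).add hS.unique k (h1.mul ha hS (hco i))).mul ha hS h2)
    fun p hp => ?_
  rw [hΨ.YH_eq, compE, compE, PiLp.sub_apply, PiLp.sub_apply]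
  ring

/-- Quasi-regular vector fields are special. -/
theorem exists_isSpecial (ha0 : 0 ≤ a) (ha : a ≤ 1) (hk : 1 ≤ k) (hS : StandardOnZ J)
    (hP : PreservesH J) (hJ : ∀ y ∈ puncturedOpenBall n, DifferentiableAt ℝ J y) {v : Cn n}
    {X : VField n} (hX : IsQuasiRegular k a Ψ v X) (hL : LieDerZZVanishes J X) :
    ∃ (σ : Cn n → ℝ) (Y : (i : Fin n) → Aff i × ℂ → {j : Fin n // j ≠ i} → ℂ),
      IsSpecial k a Ψ v σ Y X := by
  have hrem := fun z hz => hΨ.exists_remainder_eq hk hS hP hJ hX hL (z := z) hz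
  choose! s hs using hrem
  -- Each line is sampled at the point where μ = 1/2, inside the ball and away from the origin.
  -- There the constant of the disc inherits the regularity of X.
  have hhalf : ∀ z : Cn n, z ≠ 0 → ‖Ψ ((((2 * ‖Ψ z‖)⁻¹ : ℝ) : ℂ) • z)‖ = 1 / 2 := by
    intro z hz
    have := norm_pos_iff.2 (hΨ.map_ne_zero hz)
    rw [hΨ.map_smul, norm_smul, Complex.norm_real, Real.norm_eq_abs, abs_of_pos (by positivity)]
    field_simp
  have hhalf0 : ∀ z : Cn n, z ≠ 0 → (((2 * ‖Ψ z‖)⁻¹ : ℝ) : ℂ) ≠ 0 := by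
    intro z hz
    have := norm_pos_iff.2 (hΨ.map_ne_zero hz)
    exact_mod_cast (by positivity : (2 * ‖Ψ z‖)⁻¹ ≠ 0)
  have hss : ∀ (c : ℂ) (z : Cn n), c ≠ 0 → s (c • z) = s z := by
    intro c z hc
    rcases eq_or_ne z 0 with rfl | hz
    · simp
    · have hcz := smul_ne_zero hc hz
      -- The constants attached to z and c z are compared at a common point of their disc.
      have h1 := hs _ hcz _ (hhalf0 _ hcz) (by rw [hhalf _ hcz]; norm_num)
      have h2 := hs z hz _ (mul_ne_zero (hhalf0 _ hcz) hc) (by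
        rw [mul_smul, hhalf _ hcz]; norm_num)
      rw [← mul_smul] at h1
      have := h1.symm.trans h2
      simpa using this
  -- Ỹ is defined as the component along e_α minus its pole, so the expansion along 𝓗 holds by
  -- construction and only regularity and the limit ζ Ỹ → 0 need proof.
  refine ⟨s, fun i p α => compE i p α ((fderiv ℝ Ψ (polarPt i p)).inverse (X (Ψ (polarPt i p))))
    - YH i v p.1 α / p.2, hss, ?_, ?_, ?_, ?_⟩
  · have hG : GoodSet ({0}ᶜ : Set (Cn n)) := isOpen_compl_singleton.goodSet
    let T : Set ((Cn n × Cn n) × ℂ) := {q | q.1.1 ≠ 0}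
    have hT : IsOpen T := isOpen_ne_fun (continuous_fst.comp continuous_fst) continuous_const
    -- The formula for σ as a smooth function of Ψ(z), of X at the sampled point and of θ(v): at μ =
    -- 1/2 the factor of degree −1 in θ becomes 2‖Ψ z‖, and μ² becomes 1/4.
    let f : (Cn n × Cn n) × ℂ → ℝ := fun q => (ballTheta ((((2 * ‖q.1.1‖)⁻¹ : ℝ) : ℂ) • q.1.1) q.1.2
      - (2 * ‖q.1.1‖ : ℝ) * q.2 + (1 / 2 : ℝ) * (‖q.1.1‖ : ℂ) * star q.2).im
    have hnorm : ContDiffOn ℝ (⊤ : ℕ∞) (fun q : (Cn n × Cn n) × ℂ => ‖q.1.1‖) T := fun q hq =>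
      ((contDiffAt_norm_Cn hq).comp q (contDiff_fst.fst.contDiffAt)).contDiffWithinAt
    have hnormC : ContDiffOn ℝ (⊤ : ℕ∞) (fun q : (Cn n × Cn n) × ℂ => (‖q.1.1‖ : ℂ)) T :=
      Complex.ofRealCLM.contDiff.comp_contDiffOn hnorm
    have hf : ContDiffOn ℝ (⊤ : ℕ∞) f T := by
      refine Complex.imCLM.contDiff.comp_contDiffOn (((contDiffOn_ballTheta (n := n)).comp
        (f := fun q : (Cn n × Cn n) × ℂ => ((((2 * ‖q.1.1‖)⁻¹ : ℝ) : ℂ) • q.1.1, q.1.2)) ?_ ?_).sub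
        ?_ |>.add ?_)
      · refine ((Complex.ofRealCLM.contDiff.comp_contDiffOn ((contDiffOn_const.mul hnorm).inv
          fun q hq => ?_)).smul contDiff_fst.fst.contDiffOn).prodMk contDiff_fst.snd.contDiffOn
        exact mul_ne_zero two_ne_zero (norm_ne_zero_iff.2 hq)
      · intro q hq
        have : 0 < ‖q.1.1‖ := norm_pos_iff.2 hq
        refine smul_ne_zero ?_ hq
        exact_mod_cast (by positivity : (2 * ‖q.1.1‖)⁻¹ ≠ 0)
      · exact (Complex.ofRealCLM.contDiff.comp_contDiffOn (contDiffOn_const.mul hnorm)).mul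
          contDiff_snd.contDiffOn
      · exact (contDiffOn_const.mul hnormC).mul
          (Complex.conjCLE.contDiff.comp_contDiffOn contDiff_snd.contDiffOn)
    have hXc : HolderClassOn k a (fun z => X (Ψ ((((2 * ‖Ψ z‖)⁻¹ : ℝ) : ℂ) • z))) {0}ᶜ := by
      refine hX.regular.comp ha0 ha hG goodSet_puncturedBall hk ?_ fun z hz => ?_
      · refine (hΨ.regular.of_succ ha hG).comp ha0 ha hG hG hk ?_ fun z hz =>
          smul_ne_zero (hhalf0 z hz) hz
        refine HolderClassOn.smul ha hG ?_ (HolderClassOn.of_contDiffOn ha hG k contDiffOn_id)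
        refine HolderClassOn.of_contDiffAt ha hG k fun z hz => ?_
        refine Complex.ofRealCLM.contDiff.contDiffAt.comp z ((contDiffAt_const.mul
          ((contDiffAt_norm_Cn (hΨ.map_ne_zero hz)).comp z (hΨ.contDiffAt hz))).inv ?_)
        exact mul_ne_zero two_ne_zero (norm_ne_zero_iff.2 (hΨ.map_ne_zero hz))
      · exact ⟨hΨ.map_ne_zero (smul_ne_zero (hhalf0 z hz) hz), by rw [hhalf z hz]; norm_num⟩
    refine HolderClassOn.congr (HolderClassOn.smooth_comp ha0 ha hG hk hT hf
      (((hΨ.regular.of_succ ha hG).prodMk ha hG hXc).prodMk ha hG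
        (hΨ.holder_theta ha0 ha hk v)) fun z hz => hΨ.map_ne_zero hz) fun z hz => ?_
    have hz : z ≠ 0 := hz
    have h1 := hs z hz _ (hhalf0 z hz) (by rw [hhalf z hz]; norm_num)
    rw [remainder, hhalf z hz, hΨ.theta_smul_left hz (hhalf0 z hz)] at h1
    have h2 := congrArg Complex.im h1
    have hn : (‖Ψ z‖ : ℂ) ≠ 0 := normC_ne_zero (hΨ.map_ne_zero hz)
    have e1 : theta Ψ z v / (((2 * ‖Ψ z‖)⁻¹ : ℝ) : ℂ) = ((2 * ‖Ψ z‖ : ℝ) : ℂ) * theta Ψ z v := by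
      push_cast; field_simp
    have e2 : (((1 / 2 : ℝ)) : ℂ) ^ 2 * star (((2 * ‖Ψ z‖ : ℝ) : ℂ) * theta Ψ z v)
        = (1 / 2 : ℝ) * (‖Ψ z‖ : ℂ) * star (theta Ψ z v) := by
      rw [star_mul', Complex.star_def, Complex.conj_ofReal]; push_cast; ring
    rw [e1, e2, hΨ.map_smul] at h2
    simp only [f]
    rw [hΨ.map_smul, h2]
    simp
  · intro i α
    have hG := hΨ.goodSet_polarDom (i := i)
    have hG0 : GoodSet ({0}ᶜ : Set (Cn n)) := isOpen_compl_singleton.goodSet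
    have hpol : HolderClassOn k a (polarPt i) (polarDom Ψ i) :=
      HolderClassOn.of_contDiffOn ha hG k contDiff_polarPt.contDiffOn
    have hm : MapsTo (polarPt i) (polarDom Ψ i) {0}ᶜ := fun p hp => polarPt_ne_zero hp.1
    have hD : HolderClassOn k a (fun p => (fderiv ℝ Ψ (polarPt i p)).inverse) (polarDom Ψ i) :=
      (hΨ.holder_fderiv.comp ha0 ha hG hG0 hk hpol hm).inverse ha0 ha hk hG
        fun p hp => hΨ.invertible _ (hm hp)
    have hXp : HolderClassOn k a (fun p => X (Ψ (polarPt i p))) (polarDom Ψ i) :=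
      hX.regular.comp ha0 ha hG goodSet_puncturedBall hk
        ((hΨ.regular.of_succ ha hG0).comp ha0 ha hG hG0 hk hpol hm)
        fun p hp => (hΨ.mem_polarDom.1 hp).2
    have hV := hD.clm_apply ha hG hXp
    exact hΨ.holder_compE_sub ha hG (fun p hp => hp.1) α v hV
  · intro i α w
    have hlim := hΨ.tendsto_sub_of_quasiRegular hX
    have hcont : ContinuousAt (fun p : Aff i × ℂ => ‖p.2‖ * rho Ψ i p.1) (w, 0) :=
      (continuous_snd.norm.mul ((hΨ.contDiff_rho (m := 0) (by simp)).continuous.comp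
        continuous_fst)).continuousAt
    have ht : Tendsto (fun p => Ψ (polarPt i p)) (𝓝[polarDom Ψ i] (w, 0)) (𝓝[puncturedBall n] 0) := by
      refine tendsto_nhdsWithin_iff.2 ⟨?_, ?_⟩
      · rw [tendsto_zero_iff_norm_tendsto_zero]
        simp only [hΨ.norm_map_polarPt]
        have := hcont.tendsto
        simp only [norm_zero, zero_mul] at this
        exact this.mono_left nhdsWithin_le_nhds
      · filter_upwards [self_mem_nhdsWithin] with p hp
        exact (hΨ.mem_polarDom.1 hp).2
    have h1 := (hlim.comp ht).sub_const v
    rw [sub_self] at h1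
    have hg : Continuous fun q : (Aff i × ℂ) × Cn n =>
        (q.2 α.1 - q.1.1 α * q.2 i) * (Real.sqrt (affNorm i q.1.1) : ℂ) := by
      have c1 := (contDiff_coord (n := n) (m := 0) α.1).continuous
      have c2 := (contDiff_coord (n := n) (m := 0) i).continuous
      have c3 := (contDiff_sqrt_affNorm (i := i) (m := 0)).continuous
      exact ((c1.comp continuous_snd).sub (((continuous_apply α).comp continuous_fst.fst).mul
        (c2.comp continuous_snd))).mul (c3.comp continuous_fst.fst)
    have hid : Tendsto (fun p : Aff i × ℂ => p) (𝓝[polarDom Ψ i] (w, 0)) (𝓝 (w, 0)) :=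
      tendsto_id.mono_left nhdsWithin_le_nhds
    have h2 := (hg.tendsto ((w, 0), 0)).comp (hid.prodMk_nhds h1)
    simp only [PiLp.zero_apply, mul_zero, sub_zero, zero_mul] at h2
    refine h2.congr' ?_
    filter_upwards [self_mem_nhdsWithin] with p hp
    have hp0 : p.2 ≠ 0 := hp.1
    have hs := sqrt_affNorm_ne_zero p.1
    simp only [Function.comp, hΨ.YH_eq, Ψ.symm_apply_apply, PiLp.sub_apply]
    rw [compE, compE]
    field_simp
    ring
  · intro i p hp
    rw [hΨ.specialX0_eq hp.1]
    have hz := polarPt_ne_zero (i := i) hp.1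
    have hb := (hΨ.mem_polarDom.1 hp).2
    have h1 := hs _ hz 1 one_ne_zero (by rw [one_smul]; exact hb.2)
    have h2 : s (affPt i p.1) = s (polarPt i p) := by
      rw [polarPt_eq, hss _ _ (polarFactor_ne_zero hp.1)]
    rw [one_smul, remainder] at h1
    have h3 : theta Ψ (polarPt i p) v + Complex.I * (s (affPt i p.1) : ℂ)
        - (‖Ψ (polarPt i p)‖ : ℂ) ^ 2 * star (theta Ψ (polarPt i p) v)
        = ballTheta (Ψ (polarPt i p)) (X (Ψ (polarPt i p))) := by
      rw [h2]; linear_combination -h1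
    simp only [add_sub_cancel]
    rw [h3]
    exact hΨ.eq_fderiv_polar_frame hp.1 X

end IsCircularRep

/-! ### Special fields are quasi-regular -/

namespace IsCircularRep

variable {n k : ℕ} {a : ℝ} {J : EndField n} {Ψ : Cn n ≃ Cn n} (hΨ : IsCircularRep k a J Ψ)
  {i : Fin n}
include hΨ

lemma holder_dW_pot (ha0 : 0 ≤ a) (ha : a ≤ 1) (hk : 1 ≤ k) (α : {j : Fin n // j ≠ i}) :
    HolderClassOn k a (dW i α (pot Ψ i)) univ := by
  have hG : GoodSet (univ : Set (Aff i)) := isOpen_univ.goodSet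
  refine HolderClassOn.congr ((hΨ.holder_theta ha0 ha hk (EuclideanSpace.single α.1 1)).comp ha0 ha
    hG isOpen_compl_singleton.goodSet hk
    (HolderClassOn.of_contDiffOn ha hG k contDiff_affPt.contDiffOn)
    fun w _ => affPt_ne_zero w) fun w _ => hΨ.dW_pot w α

lemma continuous_dW_pot (ha0 : 0 ≤ a) (ha : a ≤ 1) (hk : 1 ≤ k) (α : {j : Fin n // j ≠ i}) :
    Continuous (dW i α (pot Ψ i)) :=
  continuousOn_univ.1 (hΨ.holder_dW_pot ha0 ha hk α).continuousOn

lemma map_polarPt_polarInv_mem {y : Cn n} (hy : y ∈ puncturedBall n) (hi : Ψ.symm y i ≠ 0) :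
    polarInv i (Ψ.symm y) ∈ polarDom Ψ i :=
  hΨ.mem_polarDom.2 ⟨polarInv_snd_ne_zero hi, by
    rw [polarPt_polarInv hi, Ψ.apply_symm_apply]; exact hy⟩

/-- The expansion of a special field, as a perturbation of the constant field `v`. -/
lemma expansion_eq {p : Aff i × ℂ} (hp : p.2 ≠ 0) (v : Cn n) (σ : Cn n → ℝ)
    (Y : {j : Fin n // j ≠ i} → ℂ) :
    specialX0 Ψ i v σ p • polarPt i p + ∑ α, (YH i v p.1 α / p.2 + Y α) • frameE Ψ i p α =
      v + (Complex.I * σ (affPt i p.1) - (rho Ψ i p.1 : ℂ) ^ 2 * star (YZ Ψ i v p.1) * p.2) •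
        polarPt i p + ∑ α, Y α • frameE Ψ i p α := by
  have h := hΨ.eq_polar_frame hp v
  simp only [← hΨ.YH_eq, ← hΨ.YZ_eq hp] at h
  simp only [specialX0, add_smul, sub_smul, Finset.sum_add_distrib]
  rw [eq_sub_of_add_eq' h.symm]
  abel

lemma fderiv_inverse_special {v : Cn n} {σ : Cn n → ℝ}
    {Y : (i : Fin n) → Aff i × ℂ → {j : Fin n // j ≠ i} → ℂ} {X : VField n}
    (hX : IsSpecial k a Ψ v σ Y X) {y : Cn n} (hy : y ∈ puncturedBall n) (hi : Ψ.symm y i ≠ 0) :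
    (fderiv ℝ Ψ (Ψ.symm y)).inverse (X y) =
      v + (Complex.I * σ (affPt i (polarInv i (Ψ.symm y)).1) -
        (rho Ψ i (polarInv i (Ψ.symm y)).1 : ℂ) ^ 2 *
          star (YZ Ψ i v (polarInv i (Ψ.symm y)).1) * (polarInv i (Ψ.symm y)).2) • Ψ.symm y +
        ∑ α, Y i (polarInv i (Ψ.symm y)) α • frameE Ψ i (polarInv i (Ψ.symm y)) α := by
  have hp := hΨ.map_polarPt_polarInv_mem hy hi
  have h1 := hX.expansion i _ hp
  rw [hΨ.expansion_eq hp.1, polarPt_polarInv hi, Ψ.apply_symm_apply] at h1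
  rw [h1, hΨ.fderiv_inverse_apply (hΨ.symm_ne_zero hy.1)]

lemma ballTheta_special_polarPt {v : Cn n} {σ : Cn n → ℝ}
    {Y : (i : Fin n) → Aff i × ℂ → {j : Fin n // j ≠ i} → ℂ} {X : VField n}
    (hX : IsSpecial k a Ψ v σ Y X) {p : Aff i × ℂ} (hp : p ∈ polarDom Ψ i) :
    ballTheta (Ψ (polarPt i p)) (X (Ψ (polarPt i p))) = specialX0 Ψ i v σ p := by
  have hz := polarPt_ne_zero (i := i) hp.1
  rw [hX.expansion i p hp]
  change theta Ψ _ _ = _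
  rw [hΨ.theta_add, hΨ.theta_sum hz, hΨ.theta_self hz]
  simp only [hΨ.theta_smul hz, hΨ.theta_frameE hp.1, mul_zero, Finset.sum_const_zero, add_zero]

/-- The `𝓩`-component of a special field. -/
lemma ballTheta_special {v : Cn n} {σ : Cn n → ℝ}
    {Y : (i : Fin n) → Aff i × ℂ → {j : Fin n // j ≠ i} → ℂ} {X : VField n}
    (hX : IsSpecial k a Ψ v σ Y X) {y : Cn n} (hy : y ∈ puncturedBall n) :
    ballTheta y (X y) = theta Ψ (Ψ.symm y) v + Complex.I * σ (Ψ.symm y)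
      - (‖y‖ : ℂ) ^ 2 * star (theta Ψ (Ψ.symm y) v) := by
  obtain ⟨i, hi⟩ := exists_coord_ne_zero (hΨ.symm_ne_zero hy.1)
  have hp := hΨ.map_polarPt_polarInv_mem hy hi
  have h1 := hΨ.ballTheta_special_polarPt hX hp
  rw [hΨ.specialX0_eq hp.1, ← hX.sigma_smul _ (affPt i _) (polarFactor_ne_zero hp.1),
    ← polarPt_eq, polarPt_polarInv hi, Ψ.apply_symm_apply] at h1
  exact h1

lemma special_tangent {v : Cn n} {σ : Cn n → ℝ}
    {Y : (i : Fin n) → Aff i × ℂ → {j : Fin n // j ≠ i} → ℂ} {X : VField n}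
    (hX : IsSpecial k a Ψ v σ Y X) {y : Cn n} (hy : ‖y‖ = 1) : (inner ℂ y (X y)).re = 0 := by
  have hy0 : y ≠ 0 := by rintro rfl; simp at hy
  rw [inner_eq_ballTheta hy0, hΨ.ballTheta_special hX ⟨hy0, hy.le⟩, hy]
  simp

/-- The limits ζ Ỹ → 0 are given at each (w, 0) separately, and w may leave every compact set of a
chart. An ultrafilter that tends to 0 selects the chart of the largest coordinate; there w stays in
the unit polydisc, hence converges, and the limit at a single (w, 0) suffices. -/
lemma special_tendsto (ha0 : 0 ≤ a) (ha : a ≤ 1) (hk : 1 ≤ k) {v : Cn n} {σ : Cn n → ℝ}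
    {Y : (i : Fin n) → Aff i × ℂ → {j : Fin n // j ≠ i} → ℂ} {X : VField n}
    (hX : IsSpecial k a Ψ v σ Y X) :
    Tendsto (fun y => (fderiv ℝ Ψ (Ψ.symm y)).inverse (X y)) (𝓝[puncturedBall n] 0) (𝓝 v) := by
  rw [tendsto_iff_ultrafilter]
  intro g hg
  have hgS : ∀ᶠ y in (g : Filter (Cn n)), y ∈ puncturedBall n := hg self_mem_nhdsWithin
  have hsymm : Tendsto Ψ.symm (g : Filter (Cn n)) (𝓝 0) := by
    obtain ⟨C, -, hC⟩ := hΨ.exists_symm_bound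
    have h1 : Tendsto (fun y : Cn n => C * ‖y‖) (𝓝 0) (𝓝 0) := by
      simpa using (continuous_norm.tendsto (0 : Cn n)).const_mul C
    exact squeeze_zero_norm hC (h1.mono_left (hg.trans nhdsWithin_le_nhds))
  have hmax : ∃ i : Fin n, ∀ᶠ y in (g : Filter (Cn n)), ∀ j, ‖Ψ.symm y j‖ ≤ ‖Ψ.symm y i‖ := by
    have : (⋃ i ∈ (univ : Set (Fin n)), {y | ∀ j, ‖Ψ.symm y j‖ ≤ ‖Ψ.symm y i‖}) ∈ g := by
      refine Filter.mem_of_superset hgS fun y hy => ?_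
      obtain ⟨i, -⟩ := exists_coord_ne_zero hy.1
      obtain ⟨m, -, hm⟩ := Finset.exists_max_image Finset.univ (fun j => ‖Ψ.symm y j‖)
        ⟨i, Finset.mem_univ i⟩
      exact mem_biUnion (mem_univ m) fun j => hm j (Finset.mem_univ j)
    obtain ⟨i, -, hi⟩ := (Ultrafilter.finite_biUnion_mem_iff finite_univ).1 this
    exact ⟨i, hi⟩
  obtain ⟨i, hi⟩ := hmax
  have hi0 : ∀ᶠ y in (g : Filter (Cn n)), Ψ.symm y i ≠ 0 := by
    filter_upwards [hgS, hi] with y hy hi h0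
    obtain ⟨j, hj⟩ := exists_coord_ne_zero (hΨ.symm_ne_zero hy.1)
    have := hi j
    rw [h0, norm_zero] at this
    exact hj (norm_le_zero_iff.1 this)
  let P : Cn n → Aff i × ℂ := fun y => polarInv i (Ψ.symm y)
  have hw : ∀ᶠ y in (g : Filter (Cn n)), (P y).1 ∈ Metric.closedBall (0 : Aff i) 1 := by
    filter_upwards [hi] with y hi
    rw [mem_closedBall_zero_iff, pi_norm_le_iff_of_nonneg zero_le_one]
    intro α
    simp only [P, polarInv, norm_div]
    exact div_le_one_of_le₀ (hi α.1) (norm_nonneg _)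
  obtain ⟨w0, -, hw0⟩ := (isCompact_closedBall (0 : Aff i) 1).ultrafilter_le_nhds
    (g.map fun y => (P y).1) (by
      rw [le_principal_iff]; exact hw)
  have hw0 : Tendsto (fun y => (P y).1) (g : Filter (Cn n)) (𝓝 w0) := hw0
  have hζ : Tendsto (fun y => (P y).2) (g : Filter (Cn n)) (𝓝 0) := by
    rw [tendsto_zero_iff_norm_tendsto_zero]
    have h1 := hsymm.norm
    rw [norm_zero] at h1
    refine h1.congr' ?_
    filter_upwards [hi0] with y hy
    rw [← norm_polarPt (i := i) (P y), polarPt_polarInv hy]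
  have hP : Tendsto P (g : Filter (Cn n)) (𝓝[polarDom Ψ i] (w0, 0)) := by
    refine tendsto_nhdsWithin_iff.2 ⟨hw0.prodMk_nhds hζ, ?_⟩
    filter_upwards [hgS, hi0] with y hy hy0 using hΨ.map_polarPt_polarInv_mem hy hy0
  have hf := fun α => hΨ.continuous_dW_pot (i := i) ha0 ha hk α
  have hA := (contDiff_affPt (i := i) (m := 0)).continuous
  have hs := (contDiff_sqrt_affNorm (i := i) (m := 0)).continuous
  have hYH : ∀ α, Continuous fun w => YH i v w α := fun α =>
    (continuous_const.sub (continuous_const.mul (continuous_apply α))).mul hs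
  have hYZ : Continuous fun w => YZ Ψ i v w :=
    (continuous_const.mul hs).add (continuous_finsetSum _ fun α _ => (hYH α).mul (hf α))
  have hσ : Continuous fun w => (σ (affPt i w) : ℂ) := Complex.continuous_ofReal.comp
    (continuous_iff_continuousAt.2 fun w => ((hX.sigma_regular.continuousOn.continuousAt
      (isOpen_compl_singleton.mem_nhds (affPt_ne_zero w))).comp hA.continuousAt))
  have hρ : Continuous fun w => (rho Ψ i w : ℂ) :=
    Complex.continuous_ofReal.comp (hΨ.contDiff_rho (m := 0) (by simp)).continuous
  have h1 : Continuous fun p : Aff i × ℂ => (Complex.I * σ (affPt i p.1) -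
      (rho Ψ i p.1 : ℂ) ^ 2 * star (YZ Ψ i v p.1) * p.2) :=
    (continuous_const.mul (hσ.comp continuous_fst)).sub
      ((((hρ.comp continuous_fst).pow 2).mul (hYZ.comp continuous_fst).star).mul continuous_snd)
  have h2 : ∀ α, Continuous fun p : Aff i × ℂ => ((Real.sqrt (affNorm i p.1) : ℂ)⁻¹) •
      (EuclideanSpace.single α.1 (1 : ℂ) - dW i α (pot Ψ i) p.1 • affPt i p.1) := fun α =>
    ((hs.comp continuous_fst).inv₀ fun p => sqrt_affNorm_ne_zero p.1).smul
      (continuous_const.sub (((hf α).comp continuous_fst).smul (hA.comp continuous_fst)))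
  have hPn := hP.mono_right nhdsWithin_le_nhds
  have h3 := (((h1.tendsto _).comp hPn).smul hsymm).const_add v
  have h4 := h3.add (tendsto_finsetSum Finset.univ fun α _ =>
    ((hX.Y_limit i α w0).comp hP).smul (((h2 α).tendsto _).comp hPn))
  simp only [smul_zero, zero_smul, Finset.sum_const_zero, add_zero] at h4
  refine h4.congr' ?_
  filter_upwards [hgS, hi0] with y hy hy0
  rw [hΨ.fderiv_inverse_special hX hy hy0]
  refine congrArg₂ _ rfl (Finset.sum_congr rfl fun α _ => ?_)
  simp only [Function.comp, frameE_eq, polarFactor, smul_smul, P]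
  congr 1
  ring

lemma special_regular (ha0 : 0 ≤ a) (ha : a ≤ 1) (hk : 1 ≤ k) {v : Cn n} {σ : Cn n → ℝ}
    {Y : (i : Fin n) → Aff i × ℂ → {j : Fin n // j ≠ i} → ℂ} {X : VField n}
    (hX : IsSpecial k a Ψ v σ Y X) : HolderClassOn k a X (puncturedBall n) := by
  refine holderClassOn_of_locally fun y hy => ?_
  obtain ⟨i, hi⟩ := exists_coord_ne_zero (hΨ.symm_ne_zero hy.1)
  have hG := hΨ.goodSet_polarDom (i := i)
  have hGU : GoodSet (univ : Set (Aff i)) := isOpen_univ.goodSet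
  have hG0 : GoodSet ({0}ᶜ : Set (Cn n)) := isOpen_compl_singleton.goodSet
  have hpol : HolderClassOn k a (polarPt i) (polarDom Ψ i) :=
    HolderClassOn.of_contDiffOn ha hG k contDiff_polarPt.contDiffOn
  have hm : MapsTo (polarPt i) (polarDom Ψ i) {0}ᶜ := fun p hp => polarPt_ne_zero hp.1
  have hfst : HolderClassOn k a (Prod.fst : Aff i × ℂ → Aff i) (polarDom Ψ i) :=
    HolderClassOn.of_contDiffOn ha hG k contDiff_fst.contDiffOn
  have hσ : HolderClassOn k a (fun p : Aff i × ℂ => σ (affPt i p.1)) (polarDom Ψ i) :=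
    hX.sigma_regular.comp ha0 ha hG hG0 hk
      (HolderClassOn.of_contDiffOn ha hG k (contDiff_affPt.comp contDiff_fst).contDiffOn)
      fun p _ => affPt_ne_zero p.1
  have hθ : HolderClassOn k a (fun p : Aff i × ℂ => theta Ψ (polarPt i p) v) (polarDom Ψ i) :=
    (hΨ.holder_theta ha0 ha hk v).comp ha0 ha hG hG0 hk hpol hm
  have hnorm : HolderClassOn k a (fun p : Aff i × ℂ => (‖Ψ (polarPt i p)‖ : ℂ) ^ 2)
      (polarDom Ψ i) := by
    refine HolderClassOn.smooth_comp ha0 ha hG hk (isOpen_compl_singleton (x := (0 : Cn n)))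
      (f := fun y : Cn n => (‖y‖ : ℂ) ^ 2) (g := fun p => Ψ (polarPt i p)) ?_
      ((hΨ.regular.of_succ ha hG0).comp ha0 ha hG hG0 hk hpol hm)
      fun p hp => hΨ.map_ne_zero (hm hp)
    exact (Complex.ofRealCLM.contDiff.comp_contDiffOn fun y hy =>
      (contDiffAt_norm_Cn hy).contDiffWithinAt).pow 2
  have hX0 : HolderClassOn k a (specialX0 Ψ i v σ) (polarDom Ψ i) := by
    have h1 := (HolderClassOn.clm ha hG (Complex.I • Complex.ofRealCLM) hσ)
    have h2 := HolderClassOn.clm ha hG (-(Complex.conjCLE : ℂ →L[ℝ] ℂ)) hθ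
    refine ((hθ.add hG.unique k h1).add hG.unique k (hnorm.mul ha hG h2)).congr fun p hp => ?_
    rw [hΨ.specialX0_eq hp.1]
    simp only [_root_.smul_apply, Complex.ofRealCLM_apply, smul_eq_mul, _root_.neg_apply,
      ContinuousLinearEquiv.coe_coe, Complex.conjCLE_apply, Complex.star_def]
    ring
  have hfr : ∀ α, HolderClassOn k a (fun p => frameE Ψ i p α) (polarDom Ψ i) := fun α => by
    have h1 := (hΨ.holder_dW_pot ha0 ha hk α).comp ha0 ha hG hGU hk hfst (mapsTo_univ _ _)
    have h2 : HolderClassOn k a (fun p => -(dW i α (pot Ψ i) p.1)) (polarDom Ψ i) :=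
      HolderClassOn.clm ha hG (-ContinuousLinearMap.id ℝ ℂ) h1
    have h3 : HolderClassOn k a (fun p : Aff i × ℂ => polarFactor i p •
        EuclideanSpace.single α.1 (1 : ℂ)) (polarDom Ψ i) :=
      HolderClassOn.of_contDiffOn ha hG k (contDiff_polarFactor.smul contDiff_const).contDiffOn
    refine (h3.add hG.unique k (h2.smul ha hG hpol)).congr fun p hp => ?_
    rw [frameE, neg_smul, ← sub_eq_add_neg]; rfl
  have hYH : ∀ α, HolderClassOn k a (fun p : Aff i × ℂ => YH i v p.1 α / p.2) (polarDom Ψ i) :=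
    fun α => by
      have := HolderClassOn.const ha hG k (0 : Cn n)
      refine HolderClassOn.congr (HolderClassOn.clm ha hG (-ContinuousLinearMap.id ℝ ℂ)
        (hΨ.holder_compE_sub ha hG (fun p hp => hp.1) α v this)) fun p hp => ?_
      have h0 := compE_smul (p := p) α 0 0
      simp only [zero_smul, zero_mul] at h0
      simp [h0]
  have hW : HolderClassOn k a (fun p => fderiv ℝ Ψ (polarPt i p) (specialX0 Ψ i v σ p • polarPt i p +
      ∑ α, (YH i v p.1 α / p.2 + Y i p α) • frameE Ψ i p α)) (polarDom Ψ i) := by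
    refine (hΨ.holder_fderiv.comp ha0 ha hG hG0 hk hpol hm).clm_apply ha hG
      ((hX0.smul ha hG hpol).add hG.unique k (HolderClassOn.sum ha hG _ fun α => ?_))
    exact ((hYH α).add hG.unique k (hX.Y_regular i α)).smul ha hG (hfr α)
  let O : Set (Cn n) := {y | y ≠ 0 ∧ Ψ.symm y i ≠ 0}
  have hO : IsOpen O := by
    rw [isOpen_iff_mem_nhds]
    intro y hy
    have h1 := (contDiff_coord (n := n) (m := 0) i).continuous.continuousAt.comp
      (hΨ.symm_contDiffAt hy.1).continuousAt
    filter_upwards [isOpen_compl_singleton.mem_nhds hy.1,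
      h1.eventually_ne (y := (0 : ℂ)) hy.2] with y h1 h2 using ⟨h1, h2⟩
  have hGO := goodSet_puncturedBall.inter hO
  refine ⟨O, hO, ⟨hy.1, hi⟩, ?_⟩
  have hinv : HolderClassOn k a (fun y => polarInv i (Ψ.symm y)) (puncturedBall n ∩ O) :=
    HolderClassOn.of_contDiffAt ha hGO k fun y hy =>
      (contDiffAt_polarInv (m := ((k + 1 : ℕ) : ℕ∞)) hy.2.2).comp y (hΨ.symm_contDiffAt hy.2.1)
  refine (hW.comp ha0 ha hGO hG hk hinv fun y hy =>
    hΨ.map_polarPt_polarInv_mem hy.1 hy.2.2).congr fun y hy => ?_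
  rw [← hX.expansion i _ (hΨ.map_polarPt_polarInv_mem hy.1 hy.2.2), polarPt_polarInv hy.2.2,
    Ψ.apply_symm_apply]

/-- Special vector fields are quasi-regular. -/
theorem special_isQuasiRegular (ha0 : 0 ≤ a) (ha : a ≤ 1) (hk : 1 ≤ k) {v : Cn n} {σ : Cn n → ℝ}
    {Y : (i : Fin n) → Aff i × ℂ → {j : Fin n // j ≠ i} → ℂ} {X : VField n}
    (hX : IsSpecial k a Ψ v σ Y X) : IsQuasiRegular k a Ψ v X where
  regular := hΨ.special_regular ha0 ha hk hX
  tangent _ := hΨ.special_tangent hX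
  limit := ⟨puncturedBall n, ⟨univ, isOpen_univ, (univ_inter _).symm⟩, subset_closure,
    hΨ.special_tendsto ha0 ha hk hX⟩

/-- The `𝓩`-component of a special field is holomorphic along the straight discs. -/
lemma fderiv_ballTheta_special {v : Cn n} {σ : Cn n → ℝ}
    {Y : (i : Fin n) → Aff i × ℂ → {j : Fin n // j ≠ i} → ℂ} {X : VField n}
    (hX : IsSpecial k a Ψ v σ Y X) (hXd : ∀ y ∈ puncturedOpenBall n, DifferentiableAt ℝ X y)
    {y : Cn n} (hy : y ∈ puncturedOpenBall n) (c : ℂ) :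
    fderiv ℝ (fun y => ballTheta y (X y)) y (c • y) =
      -c * (theta Ψ (Ψ.symm y) v + (‖y‖ : ℂ) ^ 2 * star (theta Ψ (Ψ.symm y) v)) := by
  have hz := hΨ.symm_ne_zero hy.1
  obtain ⟨hd, -⟩ := fderiv_ballTheta hy.1 (hXd y hy)
  have hm : HasFDerivAt (fun c : ℂ => c • y) ((ContinuousLinearMap.id ℝ ℂ).smulRight y) 1 :=
    (ContinuousLinearMap.id ℝ ℂ).hasFDerivAt.smul_const y
  have hd1 : HasFDerivAt (fun y => ballTheta y (X y)) (fderiv ℝ (fun y => ballTheta y (X y)) y)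
      ((1 : ℂ) • y) := by rw [one_smul]; exact hd.hasFDerivAt
  have hcomp := hd1.comp (1 : ℂ) hm
  set t := theta Ψ (Ψ.symm y) v with ht
  -- Along the disc through y the 𝓩-component is explicitly t/c + iσ − ‖y‖² t̄ c, holomorphic in c;
  -- its complex derivative at c = 1 gives the derivatives along all of 𝓩.
  have hF : HasDerivAt (fun c : ℂ => t / c + Complex.I * σ (Ψ.symm y) - (‖y‖ : ℂ) ^ 2 * star t * c)
      (-t - (‖y‖ : ℂ) ^ 2 * star t) 1 := by
    have h1 := ((hasDerivAt_inv (one_ne_zero (α := ℂ))).const_mul t).add_const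
      (Complex.I * σ (Ψ.symm y))
    have h2 := h1.sub ((hasDerivAt_id (1 : ℂ)).const_mul ((‖y‖ : ℂ) ^ 2 * star t))
    refine (h2.congr_deriv (by simp)).congr_of_eventuallyEq (Eventually.of_forall fun c => ?_)
    simp [div_eq_mul_inv]
  have hev : (fun c : ℂ => t / c + Complex.I * σ (Ψ.symm y) - (‖y‖ : ℂ) ^ 2 * star t * c) =ᶠ[𝓝 1]
      ((fun y => ballTheta y (X y)) ∘ fun c : ℂ => c • y) := by
    have h1 : ∀ᶠ c : ℂ in 𝓝 1, c • y ∈ puncturedOpenBall n := by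
      have : Tendsto (fun c : ℂ => c • y) (𝓝 1) (𝓝 y) := by
        simpa using hm.continuousAt.tendsto
      exact this (isOpen_puncturedOpenBall.mem_nhds hy)
    filter_upwards [h1] with c hc
    have hc0 : c ≠ 0 := by rintro rfl; exact hc.1 (zero_smul _ _)
    have hc' : (starRingEnd ℂ) c ≠ 0 := by simpa using hc0
    simp only [Function.comp]
    rw [hΨ.ballTheta_special hX (puncturedOpenBall_subset hc), hΨ.symm_smul,
      hΨ.theta_smul_left hz hc0, hX.sigma_smul _ _ hc0, norm_smul, Complex.ofReal_mul, mul_pow,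
      ← Complex.mul_conj', ← ht]
    simp only [Complex.star_def, map_div₀]
    field_simp
  have h5 := (hcomp.congr_of_eventuallyEq hev).unique (hF.hasFDerivAt.restrictScalars ℝ)
  have h6 := congrArg (fun L : ℂ →L[ℝ] ℂ => L c) h5
  simp only [ContinuousLinearMap.comp_apply, ContinuousLinearMap.smulRight_apply,
    ContinuousLinearMap.id_apply] at h6
  rw [h6]
  simp
  ring

lemma special_lieDerZZVanishes (ha0 : 0 ≤ a) (ha : a ≤ 1) (hk : 1 ≤ k) (hS : StandardOnZ J)
    (hP : PreservesH J) (hJ : ∀ y ∈ puncturedOpenBall n, DifferentiableAt ℝ J y)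
    {v : Cn n} {σ : Cn n → ℝ}
    {Y : (i : Fin n) → Aff i × ℂ → {j : Fin n // j ≠ i} → ℂ} {X : VField n}
    (hX : IsSpecial k a Ψ v σ Y X) : LieDerZZVanishes J X := by
  intro y hy c
  have hreg := hΨ.special_regular ha0 ha hk hX
  have hXd : ∀ y ∈ puncturedOpenBall n, DifferentiableAt ℝ X y := fun y hy =>
    (hreg.contDiffOn.contDiffAt (puncturedBall_mem_nhds hy)).differentiableAt (by simp; omega)
  rw [← ballTheta_eq_zero hy.1, ballTheta_lieDer hS hP (hJ y hy) (hXd y hy) hy,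
    hΨ.fderiv_ballTheta_special hX hXd hy, hΨ.fderiv_ballTheta_special hX hXd hy]
  ring

end IsCircularRep

/-! ### Integrability, the Levi form and the condition (O) -/

section Integrability

variable {n : ℕ} {J : EndField n} {X : VField n} {z : Cn n}

/-- Differentiation of ⟨y, J_y(h − θ_y(h) y)⟩ = 0, an identity near z expressing the invariance of
𝓗. The behaviour of J on 𝓩 is left open on purpose: in the third part it is not known yet. -/
lemma inner_fderiv_J (hP : PreservesH J) (hJ : DifferentiableAt ℝ J z)
    (hz : z ∈ puncturedOpenBall n) {h : Cn n} (hh : inner ℂ z h = (0 : ℂ)) (u : Cn n) :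
    inner ℂ z (fderiv ℝ J z u h) =
      inner ℂ z (J z (((inner ℂ u h : ℂ) / (‖z‖ : ℂ) ^ 2) • z)) - inner ℂ u (J z h) := by
  have hθ : ballTheta z h = 0 := (ballTheta_eq_zero hz.1).2 hh
  obtain ⟨hd1, hd2⟩ := fderiv_ballTheta (X := fun _ => h) hz.1 (differentiableAt_const _)
  have hproj : HasFDerivAt (fun y => h - ballTheta y h • y)
      (-(ballTheta z h • ContinuousLinearMap.id ℝ (Cn n) +
        (fderiv ℝ (fun y => ballTheta y h) z).smulRight z)) z := by
    exact (hd1.hasFDerivAt.smul (hasFDerivAt_id z)).const_sub h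
  have hJp := hJ.hasFDerivAt.clm_apply hproj
  obtain ⟨-, h2⟩ := hermitian_fderiv (hasFDerivAt_id z) hJp
  have h0 : (fun y => inner ℂ (id y) (J y (h - ballTheta y h • y)) : Cn n → ℂ) =ᶠ[𝓝 z]
      fun _ => 0 := by
    filter_upwards [isOpen_puncturedOpenBall.mem_nhds hz] with y hy
    refine hP y (puncturedOpenBall_subset hy) _ ?_
    rw [← ballTheta_eq_zero hy.1, ballTheta_sub, ballTheta_smul, ballTheta_self hy.1]
    ring
  have h3 := h2 u
  rw [h0.fderiv_eq] at h3
  have hd3 : fderiv ℝ (fun y => ballTheta y h) z u = inner ℂ u h / (‖z‖ : ℂ) ^ 2 := by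
    rw [hd2, hθ]; simp [ballTheta]
  simp only [fderiv_const_apply, _root_.zero_apply, id, hθ, zero_smul, sub_zero, zero_add,
    _root_.smul_apply, _root_.add_apply, ContinuousLinearMap.comp_apply, _root_.neg_apply, hd3,
    ContinuousLinearMap.smulRight_apply, map_neg, inner_add_right, inner_neg_right,
    ContinuousLinearMap.flip_apply, ContinuousLinearMap.id_apply] at h3
  linear_combination -h3

/-- Integrability makes `J` skew-symmetric with respect to the Levi form on `𝓗`. -/
lemma im_inner_J_of_nijenhuis (hP : PreservesH J)
    (hsq : ∀ z ∈ puncturedBall n, ∀ h, J z (J z h) = -h) (hJ : DifferentiableAt ℝ J z)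
    (hz : z ∈ puncturedOpenBall n) (hN : ∀ p q, nijenhuis J z p q = 0) {h k : Cn n}
    (hh : inner ℂ z h = (0 : ℂ)) (hk : inner ℂ z k = (0 : ℂ)) :
    (inner ℂ (J z h) k : ℂ).im + (inner ℂ h (J z k) : ℂ).im = 0 := by
  have hzb := puncturedOpenBall_subset hz
  have hn := normC_ne_zero hz.1
  -- The action of J on the quotient by 𝓗, identified with ℂ through ⟨z, ·⟩. It squares to −1 but is
  -- not assumed to be multiplication by i.
  let j : ℂ →ₗ[ℝ] ℂ :=
    { toFun := fun c => inner ℂ z (J z ((c / (‖z‖ : ℂ) ^ 2) • z))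
      map_add' := fun c d => by simp [add_div, add_smul, inner_add_right]
      map_smul' := fun r c => by
        have : (((r • c) / (‖z‖ : ℂ) ^ 2) • z) = r • ((c / (‖z‖ : ℂ) ^ 2) • z) := by
          rw [smul_div_assoc, smul_assoc]
        rw [this, map_smul, ← Complex.coe_smul, inner_smul_right]; simp }
  have hj : ∀ w, inner ℂ z (J z w) = j (inner ℂ z w) := by
    intro w
    have := ballTheta_J hP hzb w
    rw [ballTheta, ballTheta, div_left_inj' (pow_ne_zero 2 hn)] at this
    rw [this]; rfl
  have hjj : ∀ c, j (j c) = -c := by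
    intro c
    have e : inner ℂ z ((c / (‖z‖ : ℂ) ^ 2) • z) = c := by
      rw [inner_smul_right, ← normSq_eq_inner, div_mul_cancel₀ _ (pow_ne_zero 2 hn)]
    rw [← e, ← hj, ← hj, hsq z hzb, inner_neg_right, e]
  have hstar : ∀ u {h : Cn n}, inner ℂ z h = (0 : ℂ) → inner ℂ z (fderiv ℝ J z u h)
      = j (inner ℂ u h) - inner ℂ u (J z h) := fun u h hh => inner_fderiv_J hP hJ hz hh u
  have h1 := hN h k
  simp only [nijenhuis, VectorField.lieBracket, fderiv_apply_const hJ, fderiv_fun_const,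
    Pi.zero_apply, _root_.zero_apply, sub_zero, zero_sub] at h1
  have h2 := congrArg (inner ℂ z : Cn n → ℂ) h1
  simp only [inner_add_right, inner_sub_right, inner_neg_right, inner_zero_right, hj, hstar _ hh,
    hstar _ hk, map_sub, map_neg, hjj, map_add] at h2
  set A := (inner ℂ (J z h) k : ℂ).im + (inner ℂ h (J z k) : ℂ).im with hA
  set B := (inner ℂ (J z h) (J z k) : ℂ).im - (inner ℂ h k : ℂ).im with hB
  have hc : ∀ a b : Cn n, (inner ℂ a b : ℂ) - inner ℂ b a = 2 * (inner ℂ a b : ℂ).im * Complex.I := by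
    intro a b
    rw [← inner_conj_symm b a, Complex.sub_conj]; push_cast; ring
  have e1 : j (inner ℂ (J z k) h) - j (inner ℂ h (J z k)) - (j (inner ℂ (J z h) k) -
      j (inner ℂ k (J z h))) = -(2 * A) • j Complex.I := by
    rw [← map_sub, ← map_sub, ← map_sub, ← map_smul, ← neg_sub (inner ℂ h (J z k)), hc, hc]
    congr 1
    simp [A]; ring
  have e2 : (inner ℂ (J z h) (J z k) : ℂ) - inner ℂ (J z k) (J z h) - (inner ℂ h k - inner ℂ k h)
      = 2 * B * Complex.I := by
    rw [hc, hc, hB]; push_cast; ring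
  have e3 : (A : ℂ) * j Complex.I = B * Complex.I := by
    have : -(2 * A) • j Complex.I = -2 * ((A : ℂ) * j Complex.I) := by
      rw [Complex.real_smul]; push_cast; ring
    rw [this] at e1
    linear_combination (-1 / 2 : ℂ) * h2 + (1 / 2 : ℂ) * e1 + (1 / 2 : ℂ) * e2
  -- The component of the Nijenhuis tensor transversal to 𝓗 says A j(i) = B i with A and B real. If
  -- A ≠ 0, then i is an eigenvector of j with a real eigenvalue, which j² = −1 forbids.
  by_contra hA0
  have hA0' : (A : ℂ) ≠ 0 := by exact_mod_cast hA0
  have e4 : j Complex.I = (B / A) • Complex.I := by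
    rw [Complex.real_smul]; push_cast; field_simp; linear_combination e3
  have e5 := hjj Complex.I
  rw [e4, map_smul, e4, smul_smul] at e5
  have e6 := congrArg Complex.im e5
  simp at e6
  nlinarith [mul_self_nonneg (B / A)]

/-- Integrability is available in the open ball only; boundary points are reached along the radius,
by continuity of J. -/
lemma im_inner_J {r : ℕ} {a : ℝ} (hr : 1 ≤ r) (hJ : IsComplexStructure r a J) (hP : PreservesH J)
    (hz : z ∈ puncturedBall n) {h k : Cn n} (hh : inner ℂ z h = (0 : ℂ))
    (hk : inner ℂ z k = (0 : ℂ)) :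
    (inner ℂ (J z h) k : ℂ).im + (inner ℂ h (J z k) : ℂ).im = 0 := by
  have hc := hJ.regular.contDiffOn.continuousOn
  have hd : ∀ y ∈ puncturedOpenBall n, DifferentiableAt ℝ J y := fun y hy =>
    (hJ.regular.contDiffOn.contDiffAt (puncturedBall_mem_nhds hy)).differentiableAt
      (by simp; omega)
  have hlim : Tendsto (fun s : ℝ => s • z) (𝓝[<] 1) (𝓝[puncturedBall n] z) := by
    refine tendsto_nhdsWithin_iff.2 ⟨?_, ?_⟩
    · have : Continuous fun s : ℝ => s • z := by fun_prop
      simpa using (this.tendsto 1).mono_left nhdsWithin_le_nhds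
    · filter_upwards [Ioo_mem_nhdsLT (zero_lt_one (α := ℝ))] with s hs
      refine ⟨smul_ne_zero hs.1.ne' hz.1, ?_⟩
      rw [norm_smul, Real.norm_eq_abs, abs_of_pos hs.1]
      exact mul_le_one₀ hs.2.le (norm_nonneg _) hz.2
  have hJl := (hc z hz).tendsto.comp hlim
  have h0 : ∀ h : Cn n, Tendsto (fun s : ℝ => J (s • z) h) (𝓝[<] 1) (𝓝 (J z h)) := fun h =>
    ((ContinuousLinearMap.apply ℝ (Cn n) h).continuous.tendsto _).comp hJl
  have h3 := ((Complex.continuous_im.tendsto _).comp ((h0 h).inner (𝕜 := ℂ) (tendsto_const_nhds (x := k)))).add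
    ((Complex.continuous_im.tendsto _).comp ((tendsto_const_nhds (x := h)).inner (𝕜 := ℂ) (h0 k)))
  refine tendsto_nhds_unique_of_eventuallyEq h3 tendsto_const_nhds ?_
  filter_upwards [Ioo_mem_nhdsLT (zero_lt_one (α := ℝ))] with s hs
  have hs' : s • z ∈ puncturedOpenBall n := by
    refine ⟨smul_ne_zero hs.1.ne' hz.1, ?_⟩
    rw [norm_smul, Real.norm_eq_abs, abs_of_pos hs.1]
    exact mul_lt_one_of_nonneg_of_lt_one_left hs.1.le hs.2 hz.2
  have hs0 : ∀ h : Cn n, inner ℂ z h = (0 : ℂ) → inner ℂ (s • z) h = (0 : ℂ) := fun h hh => by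
    rw [← Complex.coe_smul, inner_smul_left, hh, mul_zero]
  exact im_inner_J_of_nijenhuis hP hJ.sq (hd _ hs') hs' (hJ.integrable _ hs') (hs0 h hh) (hs0 k hk)

/-- The condition on `X` which expresses that `𝓛_X J` preserves `𝓗`. -/
lemma im_inner_of_lieDer (hS : StandardOnZ J) (hP : PreservesH J) (hJ : DifferentiableAt ℝ J z)
    (hX : DifferentiableAt ℝ X z) (hz : z ∈ puncturedOpenBall n) {h : Cn n}
    (hh : inner ℂ z h = (0 : ℂ)) (hL : inner ℂ z (lieDer X J z h) = (0 : ℂ)) :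
    -2 * (inner ℂ (X z) h : ℂ).im = ‖z‖ ^ 2 *
      ((fderiv ℝ (fun y => ballTheta y (X y)) z (J z h)).re +
        (fderiv ℝ (fun y => ballTheta y (X y)) z h).im) := by
  have hzb := puncturedOpenBall_subset hz
  have hn := normC_ne_zero hz.1
  have hstd : ∀ c : ℂ, inner ℂ z (J z ((c / (‖z‖ : ℂ) ^ 2) • z)) = Complex.I * c := by
    intro c
    rw [hS z hzb, inner_smul_right, ← normSq_eq_inner]
    field_simp
  have hJh := hP z hzb h hh
  have hJw : ∀ w, inner ℂ z (J z w) = Complex.I * inner ℂ z w := by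
    intro w
    have := ballTheta_J_of_standard hS hP hzb w
    rw [ballTheta, ballTheta] at this
    field_simp at this
    exact this
  obtain ⟨-, hθ⟩ := fderiv_ballTheta hz.1 hX
  have hDX : ∀ u, inner ℂ z u = (0 : ℂ) → inner ℂ z (fderiv ℝ X z u) =
      (‖z‖ : ℂ) ^ 2 * fderiv ℝ (fun y => ballTheta y (X y)) z u - inner ℂ u (X z) := by
    intro u hu
    rw [hθ, (ballTheta_eq_zero hz.1).2 hu, inner_eq_ballTheta hz.1 (fderiv ℝ X z u)]
    field_simp
    simp
  rw [lieDer_eq hJ, inner_add_right, inner_sub_right, inner_fderiv_J hP hJ hz hh, hstd,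
    hDX _ hJh, hJw, hDX _ hh] at hL
  -- In the real part the two terms ⟨X, J h⟩ cancel. The imaginary part would only repeat the
  -- equation with J h in place of h.
  have h1 := congrArg Complex.re hL
  have hs1 : (inner ℂ h (X z) : ℂ).im = -(inner ℂ (X z) h : ℂ).im := by
    rw [← inner_conj_symm, Complex.conj_im]
  have hs2 : (inner ℂ (J z h) (X z) : ℂ).re = (inner ℂ (X z) (J z h) : ℂ).re := by
    rw [← inner_conj_symm, Complex.conj_re]
  rw [← Complex.ofReal_pow] at h1
  simp [-Complex.ofReal_pow, hs1, hs2] at h1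
  linarith

/-- If `𝓛_X J` vanishes on `𝓩`, then `[Z̄, X^𝓗]` is of type `(0,1)`. -/
lemma zbarCondition_of_lieDer (hS : StandardOnZ J) (hP : PreservesH J)
    (hJ : ∀ z ∈ puncturedOpenBall n, DifferentiableAt ℝ J z)
    (hX : ∀ z ∈ puncturedOpenBall n, DifferentiableAt ℝ X z)
    (hL : ∀ z ∈ puncturedOpenBall n, lieDer X J z z = 0) : ZbarCondition J X := by
  intro z hz
  have hzb := puncturedOpenBall_subset hz
  obtain ⟨hd, -⟩ := fderiv_ballTheta hz.1 (hX z hz)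
  have hW : HasFDerivAt (hPart X) (fderiv ℝ X z -
      (ballTheta z (X z) • ContinuousLinearMap.id ℝ (Cn n) +
        (fderiv ℝ (fun y => ballTheta y (X y)) z).smulRight z)) z :=
    (hX z hz).hasFDerivAt.sub (hd.hasFDerivAt.smul (hasFDerivAt_id z))
  have hI : HasFDerivAt (fun y : Cn n => Complex.I • y)
      (Complex.I • ContinuousLinearMap.id ℝ (Cn n)) z := (hasFDerivAt_id z).const_smul Complex.I
  have h1 := ballTheta_lieDer hS hP (hJ z hz) (hX z hz) hz 1
  rw [one_smul, mul_one, hL z hz] at h1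
  have h2 := hL z hz
  have h3 := fderiv_J_smul_self hS (hJ z hz) hz 1 (X z)
  rw [one_smul, mul_one, one_smul] at h3
  rw [lieDer_eq (hJ z hz), h3] at h2
  have h4 : J z z = Complex.I • z := by simpa using hS z hzb 1
  simp only [VectorField.lieBracket, hW.fderiv, hI.fderiv, fderiv_fun_id, hPart]
  simp only [_root_.sub_apply, _root_.add_apply, _root_.smul_apply, ContinuousLinearMap.id_apply,
    ContinuousLinearMap.smulRight_apply]
  have h5 : fderiv ℝ (fun y => ballTheta y (X y)) z (Complex.I • z) =
      Complex.I * fderiv ℝ (fun y => ballTheta y (X y)) z z := by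
    rw [show ballTheta z (0 : Cn n) = 0 by simp [ballTheta]] at h1
    linear_combination h1
  rw [h5, ← ballTheta]
  simp only [map_sub, map_add, hS z hzb]
  rw [h4] at h2
  rw [← sub_eq_zero]
  refine Eq.trans ?_ h2
  module

end Integrability

/-! ### Wirtinger derivatives -/

section Wirtinger

variable {n : ℕ} {i : Fin n}

lemma fderiv_eq_dW {u : Aff i → ℂ} (w ξ : Aff i) :
    fderiv ℝ u w ξ = ∑ α, (ξ α * dW i α u w + star (ξ α) * dWbar i α u w) := by
  have h1 : ξ = ∑ α, ((ξ α).re • (Pi.single α 1 : Aff i) +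
      (ξ α).im • (Pi.single α Complex.I : Aff i)) := by
    funext β
    rw [Finset.sum_apply, Finset.sum_eq_single β]
    · simp [Complex.re_add_im]
    · intro α _ hα
      simp [hα.symm]
    · simp
  conv_lhs => rw [h1]
  rw [map_sum]
  refine Finset.sum_congr rfl fun α _ => ?_
  rw [map_add, map_smul, map_smul, dW, dWbar]
  have h2 : ξ α = (ξ α).re + (ξ α).im * Complex.I := (Complex.re_add_im _).symm
  have h3 : star (ξ α) = (ξ α).re - (ξ α).im * Complex.I := by
    apply Complex.ext <;> simp
  rw [h3]
  nth_rewrite 3 [h2]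
  simp only [Complex.real_smul]
  linear_combination (ξ α).im * fderiv ℝ u w (Pi.single α Complex.I) * Complex.I_sq

lemma star_dW {u : Aff i → ℂ} {w : Aff i} (hu : DifferentiableAt ℝ u w)
    (α : {j : Fin n // j ≠ i}) : star (dW i α u w) = dWbar i α (fun w => star (u w)) w := by
  have h : fderiv ℝ (fun w => star (u w)) w = (Complex.conjCLE : ℂ →L[ℝ] ℂ) ∘L fderiv ℝ u w :=
    ((Complex.conjCLE : ℂ →L[ℝ] ℂ).hasFDerivAt.comp w hu.hasFDerivAt).fderiv
  rw [dW, dWbar, h]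
  simp

/-- Symmetry of the second derivatives, in complex coordinates. -/
lemma dW_dW_comm {u : Aff i → ℂ} (hu : ContDiff ℝ 2 u) (w : Aff i) (α β : {j : Fin n // j ≠ i}) :
    dW i α (dW i β u) w = dW i β (dW i α u) w ∧
      dW i α (dWbar i β u) w = dWbar i β (dW i α u) w := by
  have hd : DifferentiableAt ℝ (fderiv ℝ u) w :=
    ((hu.fderiv_right (m := 1) (by norm_num)).differentiable (by norm_num)) w
  have hsymm : ∀ ξ η, fderiv ℝ (fderiv ℝ u) w ξ η = fderiv ℝ (fderiv ℝ u) w η ξ :=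
    (hu.contDiffAt.isSymmSndFDerivAt (by simp)).eq
  have happ : ∀ η, HasFDerivAt (fun w => fderiv ℝ u w η) ((fderiv ℝ (fderiv ℝ u) w).flip η) w :=
    fun η => by simpa using hd.hasFDerivAt.clm_apply (hasFDerivAt_const η w)
  have h1 : ∀ β ξ, fderiv ℝ (dW i β u) w ξ = (fderiv ℝ (fderiv ℝ u) w ξ (Pi.single β 1)
      - Complex.I * fderiv ℝ (fderiv ℝ u) w ξ (Pi.single β Complex.I)) / 2 := by
    intro β ξ
    have := ((happ (Pi.single β 1)).sub ((happ (Pi.single β Complex.I)).const_mul Complex.I)).mul_const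
      (2⁻¹ : ℂ)
    have h2 : fderiv ℝ (dW i β u) w = _ := this.fderiv
    rw [h2]
    simp
    ring
  have h2 : ∀ β ξ, fderiv ℝ (dWbar i β u) w ξ = (fderiv ℝ (fderiv ℝ u) w ξ (Pi.single β 1)
      + Complex.I * fderiv ℝ (fderiv ℝ u) w ξ (Pi.single β Complex.I)) / 2 := by
    intro β ξ
    have := ((happ (Pi.single β 1)).add ((happ (Pi.single β Complex.I)).const_mul Complex.I)).mul_const
      (2⁻¹ : ℂ)
    have h2 : fderiv ℝ (dWbar i β u) w = _ := this.fderiv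
    rw [h2]
    simp
    ring
  constructor
  · rw [dW, dW, h1, h1, h1, h1, hsymm (Pi.single β 1) (Pi.single α 1),
      hsymm (Pi.single β 1) (Pi.single α Complex.I), hsymm (Pi.single β Complex.I) (Pi.single α 1),
      hsymm (Pi.single β Complex.I) (Pi.single α Complex.I)]
    ring
  · rw [dW, dWbar, h1, h1, h2, h2, hsymm (Pi.single β 1) (Pi.single α 1),
      hsymm (Pi.single β 1) (Pi.single α Complex.I), hsymm (Pi.single β Complex.I) (Pi.single α 1),
      hsymm (Pi.single β Complex.I) (Pi.single α Complex.I)]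
    ring

end Wirtinger

/-! ### The Levi form in the adapted polar frame -/

namespace IsCircularRep

variable {n k : ℕ} {a : ℝ} {J : EndField n} {Ψ : Cn n ≃ Cn n} (hΨ : IsCircularRep k a J Ψ)
  {i : Fin n}
include hΨ

lemma contDiff_pot {m : WithTop ℕ∞} (hm : m ≤ k + 1) : ContDiff ℝ m (pot Ψ i) := by
  have e : pot Ψ i = fun w => ((Real.log (‖Ψ (affPt i w)‖ ^ 2) : ℝ) : ℂ) := funext hΨ.pot_eq
  rw [e]
  refine Complex.ofRealCLM.contDiff.comp (ContDiff.log (ContDiff.pow ?_ 2) fun w => ?_)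
  · rw [contDiff_iff_contDiffAt]
    intro w
    exact (contDiffAt_norm_Cn (hΨ.map_ne_zero (affPt_ne_zero w))).comp w
      (((hΨ.contDiffAt (affPt_ne_zero w)).of_le hm).comp w contDiff_affPt.contDiffAt)
  · exact pow_ne_zero _ (norm_ne_zero_iff.2 (hΨ.map_ne_zero (affPt_ne_zero w)))

lemma differentiableAt_dW_pot (hk : 1 ≤ k) (w : Aff i) (α : {j : Fin n // j ≠ i}) :
    DifferentiableAt ℝ (dW i α (pot Ψ i)) w := by
  have h1 : ContDiff ℝ 1 (fderiv ℝ (pot Ψ i)) :=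
    (hΨ.contDiff_pot (m := 2) (by norm_cast; omega)).fderiv_right (by norm_num)
  have h2 := (h1.differentiable (by norm_num)) w
  have h3 : ∀ η, DifferentiableAt ℝ (fun w => fderiv ℝ (pot Ψ i) w η) w := fun η =>
    h2.clm_apply (differentiableAt_const η)
  exact ((h3 _).sub ((h3 _).const_mul Complex.I)).mul_const (2⁻¹ : ℂ)

lemma dW_pot_comm (hk : 1 ≤ k) (w : Aff i) (α β : {j : Fin n // j ≠ i}) :
    dW i α (dW i β (pot Ψ i)) w = dW i β (dW i α (pot Ψ i)) w :=
  (dW_dW_comm (hΨ.contDiff_pot (by norm_cast; omega)) w α β).1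

lemma gMat_eq (hk : 1 ≤ k) (w : Aff i) (α β : {j : Fin n // j ≠ i}) :
    gMat Ψ i w α β = dWbar i β (dW i α (pot Ψ i)) w :=
  (dW_dW_comm (hΨ.contDiff_pot (by norm_cast; omega)) w α β).2

lemma star_gMat (hk : 1 ≤ k) (w : Aff i) (α β : {j : Fin n // j ≠ i}) :
    star (gMat Ψ i w α β) = gMat Ψ i w β α := by
  rw [hΨ.gMat_eq hk w β α, gMat, Matrix.of_apply]
  have e : dWbar i β (pot Ψ i) = fun w => star (dW i β (pot Ψ i) w) := by
    funext w; rw [hΨ.dWbar_pot, hΨ.dW_pot]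
  rw [e]
  have := hΨ.differentiableAt_dW_pot hk w β
  rw [star_dW (u := fun w => star (dW i β (pot Ψ i) w))]
  · simp
  · exact (Complex.conjCLE : ℂ →L[ℝ] ℂ).differentiableAt.comp w this

omit hΨ in
lemma hasDerivAt_affine_coord {z : Cn n} (hz : z i ≠ 0) (h : Cn n) :
    HasDerivAt (fun t : ℝ => (polarInv i (z + t • h)).1)
      (fun α => compE i (polarInv i z) α h) 0 := by
  rw [hasDerivAt_pi]
  intro α
  have h0 : ∀ j, HasDerivAt (fun t : ℝ => (z + t • h) j) (h j) 0 := by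
    intro j
    have := ((hasDerivAt_id (0 : ℝ)).ofReal_comp.mul_const (h j)).const_add (z j)
    simpa using this
  have h1 := (h0 α.1).div (h0 i) (by simpa using hz)
  have h2 : polarFactor i (polarInv i z) = z i := by
    rw [← polarPt_self, polarPt_polarInv hz]
  refine h1.congr_deriv ?_
  rw [compE, ← polarFactor, h2]
  simp only [polarInv, zero_smul, add_zero]
  field_simp

/-- After multiplication by zⁱ the form depends on w alone, so its derivatives involve only those of
∂_α f. -/
lemma theta_mul_coord {z : Cn n} (hz : z i ≠ 0) (v : Cn n) :
    theta Ψ z v * z i = v i + ∑ α : {j : Fin n // j ≠ i},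
      dW i α (pot Ψ i) (polarInv i z).1 * (v α.1 - (polarInv i z).1 α * v i) := by
  have h2 : polarFactor i (polarInv i z) = z i := by
    rw [← polarPt_self, polarPt_polarInv hz]
  have h1 := hΨ.theta_polarPt (polarInv_snd_ne_zero hz) v
  rw [polarPt_polarInv hz, h2] at h1
  rw [h1, div_mul_cancel₀ _ hz, hΨ.theta_affPt]

lemma theta_eq_comp {z : Cn n} (hz : z i ≠ 0) (v : Cn n) :
    theta Ψ z v = v i / z i + ∑ α : {j : Fin n // j ≠ i},
      dW i α (pot Ψ i) (polarInv i z).1 * compE i (polarInv i z) α v := by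
  have h2 : polarFactor i (polarInv i z) = z i := by
    rw [← polarPt_self, polarPt_polarInv hz]
  rw [eq_div_of_mul_eq hz (hΨ.theta_mul_coord hz v), add_div, Finset.sum_div]
  refine congrArg₂ _ rfl (Finset.sum_congr rfl fun α _ => ?_)
  rw [compE, ← polarFactor, h2, mul_div_assoc]

lemma differentiableAt_theta (hk : 1 ≤ k) {z : Cn n} (hz : z ≠ 0) (v : Cn n) :
    DifferentiableAt ℝ (fun z => theta Ψ z v) z := by
  have h1 : DifferentiableAt ℝ (fderiv ℝ Ψ) z :=
    ((hΨ.contDiffAt hz).fderiv_right (m := 1) (by norm_cast; omega)).differentiableAt (by norm_num)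
  have h2 := (contDiffOn_ballTheta (n := n)).contDiffAt (isOpen_fst_ne_zero.mem_nhds
      (show (Ψ z, fderiv ℝ Ψ z v).1 ≠ 0 from hΨ.map_ne_zero hz))
  exact (h2.differentiableAt (by simp)).comp (f := fun y => (Ψ y, fderiv ℝ Ψ y v)) z
    ((hΨ.differentiableAt hz).prodMk (h1.clm_apply (differentiableAt_const v)))

/-- The derivatives, along `𝓗`, of the pull-back of `θ`. -/
lemma fderiv_theta (hk : 1 ≤ k) {p : Aff i × ℂ} (hp : p.2 ≠ 0) {h : Cn n}
    (hh : theta Ψ (polarPt i p) h = 0) (v : Cn n) :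
    fderiv ℝ (fun z => theta Ψ z v) (polarPt i p) h =
      ∑ β, (compE i p β h * ∑ α, compE i p α v *
          (dW i α (dW i β (pot Ψ i)) p.1 + dW i α (pot Ψ i) p.1 * dW i β (pot Ψ i) p.1) +
        star (compE i p β h) * ∑ α, compE i p α v * gMat Ψ i p.1 α β) := by
  set z := polarPt i p with hz
  have hz0 : z ≠ 0 := polarPt_ne_zero hp
  have hi : z i ≠ 0 := by rw [hz, polarPt_self]; exact polarFactor_ne_zero hp
  have hpz : polarInv i z = p := polarInv_polarPt hp
  have hfac : z i = polarFactor i p := polarPt_self p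
  have hline : HasDerivAt (fun t : ℝ => z + t • h) h 0 := by
    simpa using ((hasDerivAt_id (0 : ℝ)).smul_const h).const_add z
  have hlc : ∀ j, HasDerivAt (fun t : ℝ => (z + t • h) j) (h j) 0 := by
    intro j
    have := ((hasDerivAt_id (0 : ℝ)).ofReal_comp.mul_const (h j)).const_add (z j)
    simpa using this
  have hθ : HasDerivAt (fun t : ℝ => theta Ψ (z + t • h) v)
      (fderiv ℝ (fun z => theta Ψ z v) z h) 0 := by
    have := (hΨ.differentiableAt_theta hk hz0 v).hasFDerivAt
    exact HasFDerivAt.comp_hasDerivAt (f := fun t : ℝ => z + t • h)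
      (l := fun z => theta Ψ z v) (0 : ℝ) (by simpa using this) hline
  have h1 := hθ.mul (hlc i)
  have hw := hasDerivAt_affine_coord hi h
  rw [hpz] at hw
  have hwα : ∀ α : {j : Fin n // j ≠ i}, HasDerivAt (fun t : ℝ => (polarInv i (z + t • h)).1 α)
      (compE i p α h) 0 := fun α => (hasDerivAt_pi.1 hw) α
  have hf : ∀ α, HasDerivAt (fun t : ℝ => dW i α (pot Ψ i) (polarInv i (z + t • h)).1)
      (fderiv ℝ (dW i α (pot Ψ i)) p.1 fun β => compE i p β h) 0 := fun α => by
    have := (hΨ.differentiableAt_dW_pot hk p.1 α).hasFDerivAt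
    exact HasFDerivAt.comp_hasDerivAt (f := fun t : ℝ => (polarInv i (z + t • h)).1)
      (l := dW i α (pot Ψ i)) (0 : ℝ) (by simpa [hpz] using this) hw
  have h2 := (HasDerivAt.fun_sum fun α (_ : α ∈ Finset.univ) => (hf α).mul
    (((hwα α).mul_const (v i)).const_sub (v α.1))).const_add (v i)
  have hev : (fun t : ℝ => theta Ψ (z + t • h) v * (z + t • h) i) =ᶠ[𝓝 0]
      fun t : ℝ => v i + ∑ α : {j : Fin n // j ≠ i},
        dW i α (pot Ψ i) (polarInv i (z + t • h)).1 *
          (v α.1 - (polarInv i (z + t • h)).1 α * v i) := by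
    filter_upwards [(hlc i).continuousAt.eventually_ne (y := (0 : ℂ)) (by simpa using hi)] with t ht
    exact hΨ.theta_mul_coord ht v
  have h3 := h1.unique (h2.congr_of_eventuallyEq hev)
  simp only [zero_smul, add_zero, hpz] at h3
  have hv := hΨ.theta_eq_comp hi v
  have hh' := hΨ.theta_eq_comp hi h
  rw [hpz] at hv hh'
  rw [hh, eq_comm] at hh'
  have hcv : ∀ α : {j : Fin n // j ≠ i}, v α.1 - p.1 α * v i = compE i p α v * z i := fun α => by
    rw [compE, ← polarFactor, ← hfac, div_mul_cancel₀ _ hi]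
  simp only [hcv] at h3
  set f : {j : Fin n // j ≠ i} → ℂ := fun α => dW i α (pot Ψ i) p.1 with hfdef
  set x : {j : Fin n // j ≠ i} → ℂ := fun α => compE i p α h with hx
  set y : {j : Fin n // j ≠ i} → ℂ := fun α => compE i p α v with hy
  have hvi : v i = (theta Ψ z v - ∑ α, f α * y α) * z i := by
    rw [hv]; field_simp; ring
  -- The hypothesis θ(h) = 0 determines the i-th coordinate of h; this substitution produces the
  -- products ∂_α f ∂_β f.
  have hhi : h i = -(∑ α, f α * x α) * z i := by
    have : h i / z i = -∑ α, f α * x α := eq_neg_of_add_eq_zero_left hh'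
    rw [← this, div_mul_cancel₀ _ hi]
  have e1 : (∑ α, ((fderiv ℝ (dW i α (pot Ψ i)) p.1 x) * (y α * z i) + f α * -(x α * v i))) =
      (∑ α, fderiv ℝ (dW i α (pot Ψ i)) p.1 x * y α) * z i - (∑ α, f α * x α) * v i := by
    rw [Finset.sum_mul, Finset.sum_mul, ← Finset.sum_sub_distrib]
    exact Finset.sum_congr rfl fun α _ => by ring
  have e2 : fderiv ℝ (fun z => theta Ψ z v) z h =
      (∑ α, fderiv ℝ (dW i α (pot Ψ i)) p.1 x * y α) + (∑ α, f α * x α) * ∑ α, f α * y α := by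
    refine mul_right_cancel₀ hi ?_
    have h4 : fderiv ℝ (fun z => theta Ψ z v) z h * z i + theta Ψ z v * h i =
      ∑ α, ((fderiv ℝ (dW i α (pot Ψ i)) p.1 x) * (y α * z i) + f α * -(x α * v i)) := h3
    rw [e1] at h4
    rw [hhi, hvi] at h4
    linear_combination h4
  rw [e2]
  have e3 : ∀ α, fderiv ℝ (dW i α (pot Ψ i)) p.1 x =
      ∑ β, (x β * dW i α (dW i β (pot Ψ i)) p.1 + star (x β) * gMat Ψ i p.1 α β) := fun α => by
    rw [fderiv_eq_dW]
    exact Finset.sum_congr rfl fun β _ => by rw [hΨ.dW_pot_comm hk p.1 β α, hΨ.gMat_eq hk]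
  simp only [e3]
  rw [Finset.sum_mul_sum]
  simp only [Finset.sum_mul, Finset.mul_sum]
  rw [Finset.sum_comm, ← Finset.sum_add_distrib]
  refine Finset.sum_congr rfl fun β _ => ?_
  rw [← Finset.sum_add_distrib, ← Finset.sum_add_distrib]
  refine Finset.sum_congr rfl fun α _ => ?_
  simp only [f, x, y]
  ring

lemma compE_symm_eq {v : Cn n} {p : Aff i × ℂ} (β : {j : Fin n // j ≠ i}) :
    ∑ α, compE i p α v * (dW i α (dW i β (pot Ψ i)) p.1 +
      dW i α (pot Ψ i) p.1 * dW i β (pot Ψ i) p.1) = Hlow Ψ i v p.1 β / p.2 := by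
  rw [Hlow, Finset.sum_div]
  exact Finset.sum_congr rfl fun α _ => by rw [← hΨ.YH_eq]; ring

lemma compE_gMat_eq {v : Cn n} {p : Aff i × ℂ} (β : {j : Fin n // j ≠ i}) :
    ∑ α, compE i p α v * gMat Ψ i p.1 α β = Hbar Ψ i v p.1 β / p.2 := by
  rw [Hbar, Finset.sum_div]
  exact Finset.sum_congr rfl fun α _ => by rw [← hΨ.YH_eq]; ring

/-- The Levi form, in the coordinates `Ψ⁻¹`, is the differential of the pull-back of `θ`. -/
lemma fderiv_theta_sub (hk : 1 ≤ k) {z : Cn n} (hz : z ≠ 0) {u h : Cn n} (hu : theta Ψ z u = 0)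
    (hh : theta Ψ z h = 0) :
    (‖Ψ z‖ : ℂ) ^ 2 * (fderiv ℝ (fun z => theta Ψ z h) z u - fderiv ℝ (fun z => theta Ψ z u) z h) =
      2 * (inner ℂ (fderiv ℝ Ψ z u) (fderiv ℝ Ψ z h) : ℂ).im * Complex.I := by
  have hd : DifferentiableAt ℝ (fderiv ℝ Ψ) z :=
    ((hΨ.contDiffAt hz).fderiv_right (m := 1) (by norm_cast; omega)).differentiableAt (by norm_num)
  have hsymm := (((hΨ.contDiffAt hz).of_le (m := 2) (by norm_cast; omega)).isSymmSndFDerivAt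
    (by simp)).eq u h
  -- The second derivative of Ψ enters symmetrically in u and h, and drops out of the
  -- antisymmetrized expression.
  have key : ∀ u h, theta Ψ z h = 0 → (‖Ψ z‖ : ℂ) ^ 2 * fderiv ℝ (fun z => theta Ψ z h) z u =
      inner ℂ (Ψ z) (fderiv ℝ (fderiv ℝ Ψ) z u h) +
        inner ℂ (fderiv ℝ Ψ z u) (fderiv ℝ Ψ z h) := by
    intro u h hh
    have h1 : HasFDerivAt (fun z => fderiv ℝ Ψ z h) ((fderiv ℝ (fderiv ℝ Ψ) z).flip h) z := by
      simpa using hd.hasFDerivAt.clm_apply (hasFDerivAt_const h z)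
    obtain ⟨-, h2⟩ := hermitian_fderiv (hΨ.hasFDerivAt hz) h1
    obtain ⟨h3, -⟩ := hermitian_fderiv (hΨ.hasFDerivAt hz) (hΨ.hasFDerivAt hz)
    have hev : (fun y => inner ℂ (Ψ y) (Ψ y) * theta Ψ y h) =ᶠ[𝓝 z]
        fun y => inner ℂ (Ψ y) (fderiv ℝ Ψ y h) := by
      filter_upwards [isOpen_ne.mem_nhds hz] with y hy
      rw [theta, inner_eq_ballTheta (hΨ.map_ne_zero hy) (fderiv ℝ Ψ y h), normSq_eq_inner]
    have h4 := congrArg (fun L => L u) ((h3.hasFDerivAt.mul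
      (hΨ.differentiableAt_theta hk hz h).hasFDerivAt).congr_of_eventuallyEq hev.symm).fderiv
    rw [h2] at h4
    simp only [_root_.add_apply, _root_.smul_apply, smul_eq_mul, hh, zero_mul, add_zero,
      ContinuousLinearMap.flip_apply] at h4
    rw [normSq_eq_inner, ← h4]
  rw [mul_sub, key u h hh, key h u hu, hsymm, ← inner_conj_symm (fderiv ℝ Ψ z h)]
  have := Complex.sub_conj (inner ℂ (fderiv ℝ Ψ z u) (fderiv ℝ Ψ z h))
  push_cast at this
  linear_combination this

/-- The Levi form in the adapted polar frame. -/
lemma im_inner_fderiv_eq (hk : 1 ≤ k) {p : Aff i × ℂ} (hp : p.2 ≠ 0) {u h : Cn n}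
    (hu : theta Ψ (polarPt i p) u = 0) (hh : theta Ψ (polarPt i p) h = 0) :
    (inner ℂ (fderiv ℝ Ψ (polarPt i p) u) (fderiv ℝ Ψ (polarPt i p) h) : ℂ).im =
      -(‖Ψ (polarPt i p)‖ ^ 2 *
        (∑ β, star (compE i p β h) * ∑ α, compE i p α u * gMat Ψ i p.1 α β).im) := by
  have h1 := hΨ.fderiv_theta_sub hk (polarPt_ne_zero hp) hu hh
  rw [hΨ.fderiv_theta hk hp hu, hΨ.fderiv_theta hk hp hh] at h1
  set x : {j : Fin n // j ≠ i} → ℂ := fun α => compE i p α u with hx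
  set y : {j : Fin n // j ≠ i} → ℂ := fun α => compE i p α h with hy
  set S : {j : Fin n // j ≠ i} → {j : Fin n // j ≠ i} → ℂ := fun α β =>
    dW i α (dW i β (pot Ψ i)) p.1 + dW i α (pot Ψ i) p.1 * dW i β (pot Ψ i) p.1 with hS
  set Q := ∑ β, star (y β) * ∑ α, x α * gMat Ψ i p.1 α β with hQ
  have e1 : ∑ β, x β * ∑ α, y α * S α β = ∑ β, y β * ∑ α, x α * S α β := by
    simp only [Finset.mul_sum]
    rw [Finset.sum_comm]
    refine Finset.sum_congr rfl fun β _ => Finset.sum_congr rfl fun α _ => ?_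
    have : S β α = S α β := by simp only [S]; rw [hΨ.dW_pot_comm hk]; ring
    rw [this]; ring
  have e2 : ∑ β, star (x β) * ∑ α, y α * gMat Ψ i p.1 α β = star Q := by
    rw [hQ, star_sum]
    simp only [Finset.mul_sum, star_sum, star_mul', star_star, hΨ.star_gMat hk]
    rw [Finset.sum_comm]
    exact Finset.sum_congr rfl fun β _ => Finset.sum_congr rfl fun α _ => by ring
  have h2 : (‖Ψ (polarPt i p)‖ : ℂ) ^ 2 * ((∑ β, (x β * ∑ α, y α * S α β +
      star (x β) * ∑ α, y α * gMat Ψ i p.1 α β)) - ∑ β, (y β * ∑ α, x α * S α β +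
      star (y β) * ∑ α, x α * gMat Ψ i p.1 α β)) = _ := h1
  rw [Finset.sum_add_distrib, Finset.sum_add_distrib, e1, e2, ← hQ] at h2
  have h3 : star Q - Q = -(2 * Q.im * Complex.I) := by
    rw [← neg_sub, Complex.star_def, Complex.sub_conj]; push_cast; ring
  have h4 : ((inner ℂ (fderiv ℝ Ψ (polarPt i p) u) (fderiv ℝ Ψ (polarPt i p) h) : ℂ).im : ℂ) =
      ((-(‖Ψ (polarPt i p)‖ ^ 2 * Q.im) : ℝ) : ℂ) := by
    refine mul_right_cancel₀ Complex.I_ne_zero ?_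
    push_cast
    linear_combination (-1 / 2 : ℂ) * h2 + (1 / 2 : ℂ) * (‖Ψ (polarPt i p)‖ : ℂ) ^ 2 * h3
  exact_mod_cast h4

lemma compE_frame_sum {p : Aff i × ℂ} (hp : p.2 ≠ 0) (x : {j : Fin n // j ≠ i} → ℂ)
    (α : {j : Fin n // j ≠ i}) : compE i p α (∑ β, x β • frameE Ψ i p β) = x α := by
  rw [compE_sum]
  simp [compE_smul, compE_frameE hp]

lemma theta_frame_sum {p : Aff i × ℂ} (hp : p.2 ≠ 0) (x : {j : Fin n // j ≠ i} → ℂ) :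
    theta Ψ (polarPt i p) (∑ β, x β • frameE Ψ i p β) = 0 := by
  rw [hΨ.theta_sum (polarPt_ne_zero hp)]
  simp [hΨ.theta_smul (polarPt_ne_zero hp), hΨ.theta_frameE hp]

/-- The Levi form is non-degenerate. -/
lemma isUnit_gMat (hk : 1 ≤ k) {p : Aff i × ℂ} (hp : p.2 ≠ 0) : IsUnit (gMat Ψ i p.1) := by
  have hz := polarPt_ne_zero (i := i) hp
  rw [← Matrix.vecMul_injective_iff_isUnit]
  refine (injective_iff_map_eq_zero (Matrix.vecMulLinear (gMat Ψ i p.1))).2 fun x hx => ?_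
  have hx' : ∀ β, ∑ α, x α * gMat Ψ i p.1 α β = 0 := fun β => congrFun hx β
  set u := ∑ β, x β • frameE Ψ i p β with hu
  have hθu := hΨ.theta_frame_sum hp x
  rw [← hu] at hθu
  -- The test vector is the preimage of i dΨ(u). Paired with u by the Levi form it gives ‖dΨ(u)‖²,
  -- so the kernel of g is trivial.
  have h1 : theta Ψ (polarPt i p) ((fderiv ℝ Ψ (polarPt i p)).inverse
      (Complex.I • fderiv ℝ Ψ (polarPt i p) u)) = 0 := by
    rw [theta, hΨ.fderiv_apply_inverse hz, ballTheta_smul, ← theta, hθu, mul_zero]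
  have h2 := hΨ.im_inner_fderiv_eq hk hp hθu h1
  simp only [hu, hΨ.compE_frame_sum hp, hx', mul_zero, Finset.sum_const_zero, Complex.zero_im,
    neg_zero] at h2
  rw [← hu, hΨ.fderiv_apply_inverse hz, inner_smul_right, ← normSq_eq_inner, ← Complex.ofReal_pow]
    at h2
  have h3 : fderiv ℝ Ψ (polarPt i p) u = 0 := by simpa [-Complex.ofReal_pow] using h2
  have h4 : u = 0 := by
    rw [← hΨ.fderiv_inverse_apply hz u, h3, _root_.map_zero]
  funext α
  rw [← hΨ.compE_frame_sum hp x α, ← hu, h4]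
  simp [compE]

end IsCircularRep

/-! ### Linear algebra of endomorphisms that are skew for a Hermitian form -/

section HermitianAlgebra

variable {ι : Type} [Fintype ι] [DecidableEq ι]

/-- A real-linear endomorphism which is skew-symmetric for a hermitian form. -/
lemma hermitian_skew {G P Q : Matrix ι ι ℂ} (hG : ∀ a b, star (G a b) = G b a)
    (h : ∀ u v : ι → ℂ, (∑ β, star (v β) *
        ∑ α, (Complex.I * u α + ∑ d, (P α d * u d + Q α d * star (u d))) * G α β +
      ∑ β, star (Complex.I * v β + ∑ d, (P β d * v d + Q β d * star (v d))) *
        ∑ α, u α * G α β).im = 0) :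
    (∀ a b, ∑ c, P c a * G c b + ∑ c, star (P c b) * G a c = 0) ∧
      ∀ a b, ∑ c, Q c a * G c b = ∑ c, G c a * Q c b := by
  -- Test vectors with a single entry each. The values 1 and i for x and y then separate the
  -- ℂ-linear part from the antilinear part, and real from imaginary parts.
  have key : ∀ a b (x y : ℂ), (star y * x * (∑ c, P c a * G c b + ∑ c, star (P c b) * G a c) +
      star y * star x * (∑ c, Q c a * G c b) + star (star y * star x * ∑ c, G c a * Q c b)).im
        = 0 := by
    intro a b x y
    rw [← h (Pi.single a x) (Pi.single b y)]
    congr 1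
    have e1 : ∀ α, ∑ d, (P α d * Pi.single (M := fun _ => ℂ) a x d +
        Q α d * star (Pi.single (M := fun _ => ℂ) a x d)) = P α a * x + Q α a * star x := by
      intro α
      rw [Finset.sum_eq_single a (fun d _ hd => by simp [hd]) (by simp)]
      simp
    have e2 : ∀ β, ∑ d, (P β d * Pi.single (M := fun _ => ℂ) b y d +
        Q β d * star (Pi.single (M := fun _ => ℂ) b y d)) = P β b * y + Q β b * star y := by
      intro α
      rw [Finset.sum_eq_single b (fun d _ hd => by simp [hd]) (by simp)]
      simp
    have e3 : ∀ β, ∑ α, Pi.single (M := fun _ => ℂ) a x α * G α β = x * G a β := by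
      intro β
      rw [Finset.sum_eq_single a (fun d _ hd => by simp [hd]) (by simp)]
      simp
    have e4 : ∀ F : ι → ℂ, ∑ β, star (Pi.single (M := fun _ => ℂ) b y β) * F β = star y * F b := by
      intro β
      rw [Finset.sum_eq_single b (fun d _ hd => by simp [hd]) (by simp)]
      simp
    have e5 : ∑ α, (Complex.I * Pi.single (M := fun _ => ℂ) a x α + (P α a * x + Q α a * star x)) *
        G α b = Complex.I * ∑ α, Pi.single (M := fun _ => ℂ) a x α * G α b +
          (x * ∑ c, P c a * G c b + star x * ∑ c, Q c a * G c b) := by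
      simp only [Finset.mul_sum, ← Finset.sum_add_distrib]
      exact Finset.sum_congr rfl fun α _ => by ring
    have e6 : ∑ β, star (Complex.I * Pi.single (M := fun _ => ℂ) b y β + (P β b * y + Q β b * star y)) *
        (x * G a β) = -Complex.I * ∑ β, star (Pi.single (M := fun _ => ℂ) b y β) * (x * G a β) +
          (star y * x * ∑ c, star (P c b) * G a c + y * x * ∑ c, G a c * star (Q c b)) := by
      simp only [Finset.mul_sum, ← Finset.sum_add_distrib]
      refine Finset.sum_congr rfl fun α _ => ?_
      simp only [star_add, star_mul', star_star]
      rw [show star Complex.I = -Complex.I by simp]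
      ring
    have e7 : star (∑ c, G c a * Q c b) = ∑ c, G a c * star (Q c b) := by
      simp only [star_sum, star_mul', hG]
    simp only [e1, e2, e3]
    rw [e4, e5, e6, e4, e3, star_mul', e7]
    simp only [star_mul', star_star]
    ring
  have h0 : ∀ a b, ∑ c, P c a * G c b + ∑ c, star (P c b) * G a c = 0 ∧
      ∑ c, Q c a * G c b = ∑ c, G c a * Q c b := by
    intro a b
    have k1 := key a b 1 1
    have k2 := key a b Complex.I Complex.I
    have k3 := key a b Complex.I 1
    have k4 := key a b 1 Complex.I
    generalize ∑ c, P c a * G c b + ∑ c, star (P c b) * G a c = A at k1 k2 k3 k4 ⊢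
    generalize ∑ c, Q c a * G c b = T at k1 k2 k3 k4 ⊢
    generalize ∑ c, G c a * Q c b = S at k1 k2 k3 k4 ⊢
    simp at k1 k2 k3 k4
    constructor <;> apply Complex.ext <;> (try simp only [Complex.zero_re, Complex.zero_im]) <;>
      linarith
  exact ⟨fun a b => (h0 a b).1, fun a b => (h0 a b).2⟩

lemma eq_zero_of_im_sum {W : ι → ℂ} (h : ∀ x : ι → ℂ, (∑ b, star (x b) * W b).im = 0) : W = 0 := by
  funext b
  have e : ∀ c : ℂ, (star c * W b).im = 0 := fun c => by
    have := h (Pi.single b c)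
    rw [Finset.sum_eq_single b (fun d _ hd => by simp [hd]) (by simp)] at this
    simpa using this
  have h1 := e 1
  have h2 := e Complex.I
  simp at h1 h2
  exact Complex.ext h2 h1

open Matrix in
/-- Solution of a linear system whose matrix is hermitian. -/
lemma hermitian_solve_iff {G P Q : Matrix ι ι ℂ} (hU : IsUnit G)
    (hP : ∀ a b, ∑ c, P c a * G c b + ∑ c, star (P c b) * G a c = 0)
    (hQ : ∀ a b, ∑ c, Q c a * G c b = ∑ c, G c a * Q c b) (Y s K L : ι → ℂ) :
    (∀ b, ∑ a, Y a * G a b = s b + Complex.I / 2 * ∑ c, (star (P c b) * L c + Q c b * K c)) ↔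
      ∀ α, Y α = ∑ β, G⁻¹ β α * s β + Complex.I / 2 * ∑ δ, ∑ γ, Q α δ * G⁻¹ δ γ * K γ -
        Complex.I / 2 * ∑ δ, ∑ γ, P α δ * G⁻¹ γ δ * L γ := by
  have hdet : IsUnit G.det := (Matrix.isUnit_iff_isUnit_det G).1 hU
  have hGN : G * G⁻¹ = 1 := Matrix.mul_nonsing_inv G hdet
  have hNG : G⁻¹ * G = 1 := Matrix.nonsing_inv_mul G hdet
  have hPm : Pᵀ * G + G * P.map star = 0 := by
    ext a b
    rw [Matrix.add_apply, Matrix.mul_apply, Matrix.mul_apply, Matrix.zero_apply, ← hP a b]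
    simp [mul_comm]
  have hQm : Qᵀ * G = Gᵀ * Q := by
    ext a b
    rw [Matrix.mul_apply, Matrix.mul_apply]
    simpa using hQ a b
  -- The symmetries of P and Q, conjugated by G⁻¹, move P and Q from one side of the inverse matrix
  -- to the other. This brings the solution to the index pattern of (∗).
  have hP' : G⁻¹ * Pᵀ + P.map star * G⁻¹ = 0 := by
    calc _ = G⁻¹ * (Pᵀ * G + G * P.map star) * G⁻¹ := by
          rw [Matrix.mul_add, Matrix.add_mul, ← Matrix.mul_assoc, ← Matrix.mul_assoc, hNG,
            Matrix.mul_assoc, hGN, Matrix.mul_one, Matrix.one_mul]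
      _ = 0 := by rw [hPm, Matrix.mul_zero, Matrix.zero_mul]
  have hNGt : (G⁻¹)ᵀ * Gᵀ = 1 := by rw [← Matrix.transpose_mul, hGN, Matrix.transpose_one]
  have hQ' : (G⁻¹)ᵀ * Qᵀ = Q * G⁻¹ := by
    calc (G⁻¹)ᵀ * Qᵀ = (G⁻¹)ᵀ * (Qᵀ * G) * G⁻¹ := by
          rw [Matrix.mul_assoc, Matrix.mul_assoc, hGN, Matrix.mul_one]
      _ = _ := by rw [hQm, ← Matrix.mul_assoc, hNGt, Matrix.one_mul]
  have h1 : (∀ b, ∑ a, Y a * G a b = s b + Complex.I / 2 * ∑ c, (star (P c b) * L c + Q c b * K c)) ↔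
      Y ᵥ* G = s + (Complex.I / 2) • (L ᵥ* P.map star + K ᵥ* Q) := by
    rw [funext_iff]
    refine forall_congr' fun b => ?_
    simp only [Matrix.vecMul, dotProduct, Pi.add_apply, Pi.smul_apply, smul_eq_mul, Matrix.map_apply,
      Finset.sum_add_distrib, mul_comm]
  have h2 : (∀ α, Y α = ∑ β, G⁻¹ β α * s β + Complex.I / 2 * ∑ δ, ∑ γ, Q α δ * G⁻¹ δ γ * K γ -
        Complex.I / 2 * ∑ δ, ∑ γ, P α δ * G⁻¹ γ δ * L γ) ↔
      Y = (s + (Complex.I / 2) • (L ᵥ* P.map star + K ᵥ* Q)) ᵥ* G⁻¹ := by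
    rw [funext_iff]
    refine forall_congr' fun α => ?_
    have e1 : ∑ δ, ∑ γ, Q α δ * G⁻¹ δ γ * K γ = (K ᵥ* Q ᵥ* G⁻¹) α := by
      have : (K ᵥ* Q ᵥ* G⁻¹) = (Q * G⁻¹) *ᵥ K := by
        rw [Matrix.vecMul_vecMul, ← Matrix.mulVec_transpose, Matrix.transpose_mul, hQ']
      rw [this, Matrix.mulVec, dotProduct, Finset.sum_comm]
      refine Finset.sum_congr rfl fun γ _ => ?_
      rw [Matrix.mul_apply, Finset.sum_mul]
    have e2 : ∑ δ, ∑ γ, P α δ * G⁻¹ γ δ * L γ = -(L ᵥ* P.map star ᵥ* G⁻¹) α := by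
      have : (L ᵥ* P.map star ᵥ* G⁻¹) = -((P * (G⁻¹)ᵀ) *ᵥ L) := by
        rw [Matrix.vecMul_vecMul, eq_neg_of_add_eq_zero_right hP', Matrix.vecMul_neg,
          ← Matrix.mulVec_transpose, Matrix.transpose_mul, Matrix.transpose_transpose]
      rw [this, Pi.neg_apply, neg_neg, Matrix.mulVec, dotProduct, Finset.sum_comm]
      refine Finset.sum_congr rfl fun γ _ => ?_
      rw [Matrix.mul_apply, Finset.sum_mul]
      rfl
    rw [e1, e2, Matrix.add_vecMul, Matrix.smul_vecMul, Matrix.add_vecMul]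
    have e3 : ∑ β, G⁻¹ β α * s β = (s ᵥ* G⁻¹) α := by
      simp only [Matrix.vecMul, dotProduct, mul_comm]
    rw [e3]
    simp only [Pi.add_apply, Pi.smul_apply, smul_eq_mul]
    rw [show ∀ x y z : ℂ, x + Complex.I / 2 * y - Complex.I / 2 * -z =
      x + Complex.I / 2 * (z + y) from fun x y z => by ring]
  rw [h1, h2]
  constructor
  · intro h
    rw [← h, Matrix.vecMul_vecMul, hGN, Matrix.vecMul_one]
  · intro h
    rw [h, Matrix.vecMul_vecMul, hNG, Matrix.vecMul_one]

end HermitianAlgebra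

/-- The condition on the `𝓗`-component of `X` which expresses that `𝓛_X J` preserves `𝓗`, when
the `𝓩`-component is that of a special field. -/
def LeviCondition {n : ℕ} (J : EndField n) (Ψ : Cn n ≃ Cn n) (v : Cn n) (σ : Cn n → ℝ)
    (X : VField n) (y : Cn n) : Prop :=
  ∀ h, inner ℂ y h = (0 : ℂ) → -2 * (inner ℂ (X y) h : ℂ).im = ‖y‖ ^ 2 *
    ((1 - ‖y‖ ^ 2) * (fderiv ℝ (fun y => theta Ψ (Ψ.symm y) v) y (J y h)).re +
      (1 + ‖y‖ ^ 2) * (fderiv ℝ (fun y => theta Ψ (Ψ.symm y) v) y h).im +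
      fderiv ℝ (fun y => σ (Ψ.symm y)) y h)

/-! ### The tensor J − J_st in the polar frame -/

namespace IsCircularRep

variable {n k : ℕ} {a : ℝ} {J : EndField n} {Ψ : Cn n ≃ Cn n} (hΨ : IsCircularRep k a J Ψ)
  {i : Fin n}
include hΨ

lemma pullEnd_apply {z : Cn n} (hz : z ≠ 0) (h : Cn n) :
    fderiv ℝ Ψ z (pullEnd Ψ J z h) = J (Ψ z) (fderiv ℝ Ψ z h) :=
  hΨ.fderiv_apply_inverse hz _

lemma theta_pullEnd (hP : PreservesH J) {z : Cn n} (hz : z ≠ 0) (h1 : ‖Ψ z‖ ≤ 1) {h : Cn n}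
    (hh : theta Ψ z h = 0) : theta Ψ z (pullEnd Ψ J z h) = 0 := by
  rw [← hΨ.inner_fderiv_eq_zero hz] at hh ⊢
  rw [hΨ.pullEnd_apply hz]
  exact hP _ ⟨hΨ.map_ne_zero hz, h1⟩ _ hh

lemma eq_frame_sum {p : Aff i × ℂ} (hp : p.2 ≠ 0) {h : Cn n} (hh : theta Ψ (polarPt i p) h = 0) :
    h = ∑ α, compE i p α h • frameE Ψ i p α := by
  have := hΨ.eq_polar_frame hp h
  rwa [hh, zero_smul, zero_add] at this

omit hΨ in
-- Splitting of a real linear map into its ℂ-linear and antilinear parts; for J − J_st these yield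
-- the components with index δ and δ̄.
lemma real_linear_smul (L : Cn n →L[ℝ] Cn n) (c : ℂ) (e : Cn n) :
    L (c • e) = c • ((1 / 2 : ℂ) • (L e - Complex.I • L (Complex.I • e))) +
      star c • ((1 / 2 : ℂ) • (L e + Complex.I • L (Complex.I • e))) := by
  have h1 : c • e = c.re • e + c.im • (Complex.I • e) := by
    rw [← Complex.coe_smul, ← Complex.coe_smul, smul_smul, ← add_smul, Complex.re_add_im]
  have h2 : star c = c.re - c.im * Complex.I := by
    apply Complex.ext <;> simp
  have h3 : c = c.re + c.im * Complex.I := (Complex.re_add_im c).symm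
  rw [h1, map_add, _root_.map_smul, _root_.map_smul, h2, ← Complex.coe_smul, ← Complex.coe_smul]
  nth_rewrite 3 [h3]
  simp only [smul_sub, smul_add, smul_smul]
  have : (c.im : ℂ) * Complex.I * (1 / 2 * Complex.I) = -(c.im / 2) := by
    linear_combination (c.im / 2 : ℂ) * Complex.I_sq
  simp only [add_mul, sub_mul, add_smul, sub_smul, this]
  module

lemma compE_pullEnd {p : Aff i × ℂ} (hp : p.2 ≠ 0) {h : Cn n}
    (hh : theta Ψ (polarPt i p) h = 0) (α : {j : Fin n // j ≠ i}) :
    compE i p α (pullEnd Ψ J (polarPt i p) h) = Complex.I * compE i p α h +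
      ∑ δ, (deltaHol Ψ i J p α δ * compE i p δ h + deltaAnti Ψ i J p α δ * star (compE i p δ h)) := by
  let L : Cn n →L[ℝ] Cn n := pullEnd Ψ J (polarPt i p) - stdJ n
  have hL : ∀ h, L h = deltaJ Ψ i J p h := fun h => rfl
  have h1 : pullEnd Ψ J (polarPt i p) h = Complex.I • h + L h := by
    rw [hL, deltaJ]; abel
  rw [h1, compE_add, compE_smul]
  congr 1
  conv_lhs => rw [hΨ.eq_frame_sum hp hh]
  rw [map_sum, compE_sum]
  refine Finset.sum_congr rfl fun δ _ => ?_
  rw [real_linear_smul, compE_add, compE_smul α (compE i p δ h), compE_smul α (star _), hL, hL]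
  simp only [deltaHol, deltaAnti]
  ring

/-- The Levi form, as a sum. -/
lemma im_inner_fderiv_eq_zero (hk : 1 ≤ k) (hP : PreservesH J)
    (hskew : ∀ y ∈ puncturedBall n, ∀ h k, inner ℂ y h = (0 : ℂ) → inner ℂ y k = (0 : ℂ) →
      (inner ℂ (J y h) k : ℂ).im + (inner ℂ h (J y k) : ℂ).im = 0)
    {p : Aff i × ℂ} (hp : p ∈ polarDom Ψ i) :
    (∀ a b, ∑ c, deltaHol Ψ i J p c a * gMat Ψ i p.1 c b +
        ∑ c, star (deltaHol Ψ i J p c b) * gMat Ψ i p.1 a c = 0) ∧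
      ∀ a b, ∑ c, deltaAnti Ψ i J p c a * gMat Ψ i p.1 c b =
        ∑ c, gMat Ψ i p.1 c a * deltaAnti Ψ i J p c b := by
  refine hermitian_skew (P := Matrix.of (deltaHol Ψ i J p)) (Q := Matrix.of (deltaAnti Ψ i J p))
    (hΨ.star_gMat hk p.1) fun u v => ?_
  have hz := polarPt_ne_zero (i := i) hp.1
  have hy := (hΨ.mem_polarDom.1 hp).2
  have hu := hΨ.theta_frame_sum hp.1 u
  have hv := hΨ.theta_frame_sum hp.1 v
  have hJu := hΨ.theta_pullEnd hP hz hy.2 hu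
  have hJv := hΨ.theta_pullEnd hP hz hy.2 hv
  have h1 := hΨ.im_inner_fderiv_eq hk hp.1 hJu hv
  have h2 := hΨ.im_inner_fderiv_eq hk hp.1 hu hJv
  have h3 := hskew _ hy _ _ ((hΨ.inner_fderiv_eq_zero hz).2 hu) ((hΨ.inner_fderiv_eq_zero hz).2 hv)
  rw [hΨ.pullEnd_apply hz] at h1 h2
  rw [h1, h2] at h3
  simp only [hΨ.compE_pullEnd hp.1 hu, hΨ.compE_pullEnd hp.1 hv, hΨ.compE_frame_sum hp.1] at h3
  have hμ : ‖Ψ (polarPt i p)‖ ^ 2 ≠ 0 := pow_ne_zero _ (norm_ne_zero_iff.2 (hΨ.map_ne_zero hz))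
  rw [← neg_add, neg_eq_zero, ← mul_add, ← Complex.add_im] at h3
  exact (mul_eq_zero.1 h3).resolve_left hμ

lemma normSq_map_polarPt (p : Aff i × ℂ) :
    (‖Ψ (polarPt i p)‖ : ℂ) ^ 2 = (rho Ψ i p.1 : ℂ) ^ 2 * (p.2 * star p.2) := by
  rw [hΨ.norm_map_polarPt, Complex.ofReal_mul, mul_pow, ← Complex.mul_conj', Complex.star_def]
  ring

/-- The bracket whose conjugate appears is the vector m that represents h ↦ Re dθ(v)(h) by the
pairing Re Σ conj(h^β) m_β. The functions K_γ̄ and K_γ are 1 − μ² times m and its conjugate. -/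
lemma Klow_eq {p : Aff i × ℂ} (hp : p.2 ≠ 0) (v : Cn n) (γ : {j : Fin n // j ≠ i}) :
    Klow Ψ i v p γ = (1 - (‖Ψ (polarPt i p)‖ : ℂ) ^ 2) *
      star (Hbar Ψ i v p.1 γ / p.2 + star (Hlow Ψ i v p.1 γ / p.2)) := by
  have hs : star p.2 ≠ 0 := by simpa using hp
  have e : ∀ x : ℂ, star (x / p.2) = star x / star p.2 := fun x => map_div₀ (starRingEnd ℂ) x p.2
  rw [hΨ.normSq_map_polarPt, Klow, star_add, star_star, e]
  field_simp
  ring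

lemma Kbar_eq {p : Aff i × ℂ} (hp : p.2 ≠ 0) (v : Cn n) (γ : {j : Fin n // j ≠ i}) :
    Kbar Ψ i v p γ = (1 - (‖Ψ (polarPt i p)‖ : ℂ) ^ 2) *
      (Hbar Ψ i v p.1 γ / p.2 + star (Hlow Ψ i v p.1 γ / p.2)) := by
  have hs : star p.2 ≠ 0 := by simpa using hp
  have e : ∀ x : ℂ, star (x / p.2) = star x / star p.2 := fun x => map_div₀ (starRingEnd ℂ) x p.2
  rw [hΨ.normSq_map_polarPt, Kbar, e]
  field_simp
  ring

lemma fderiv_comp_symm {F : Type} [NormedAddCommGroup F] [NormedSpace ℝ F] {f : Cn n → F} {z : Cn n}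
    (hz : z ≠ 0) (hf : DifferentiableAt ℝ f z) (h : Cn n) :
    fderiv ℝ (fun y => f (Ψ.symm y)) (Ψ z) (fderiv ℝ Ψ z h) = fderiv ℝ f z h := by
  have hy := hΨ.map_ne_zero hz
  have h1 : HasFDerivAt Ψ.symm (fderiv ℝ Ψ z).inverse (Ψ z) := by
    have := ((hΨ.symm_contDiffAt hy).differentiableAt (by simp)).hasFDerivAt
    rwa [hΨ.fderiv_symm hy, Ψ.symm_apply_apply] at this
  have h2 : HasFDerivAt (fun y => f (Ψ.symm y)) (fderiv ℝ f z ∘L (fderiv ℝ Ψ z).inverse) (Ψ z) := by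
    refine HasFDerivAt.comp (Ψ z) ?_ h1
    rw [Ψ.symm_apply_apply]; exact hf.hasFDerivAt
  rw [h2.fderiv, ContinuousLinearMap.comp_apply, hΨ.fderiv_inverse_apply hz]

omit hΨ in
/-- The derivative of a homogeneous function in affine coordinates. -/
lemma fderiv_homogeneous {σ : Cn n → ℝ} (hσ : ∀ (c : ℂ) (z : Cn n), c ≠ 0 → σ (c • z) = σ z)
    {p : Aff i × ℂ} (hp : p.2 ≠ 0) (hd : DifferentiableAt ℝ σ (polarPt i p))
    (hd' : DifferentiableAt ℝ σ (affPt i p.1)) (h : Cn n) :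
    fderiv ℝ σ (polarPt i p) h = 2 * (∑ β, star (compE i p β h) *
      dWbar i β (fun w => (σ (affPt i w) : ℂ)) p.1).re := by
  set z := polarPt i p with hz
  have hi : z i ≠ 0 := by rw [hz, polarPt_self]; exact polarFactor_ne_zero hp
  have hpz : polarInv i z = p := polarInv_polarPt hp
  have hline : HasDerivAt (fun t : ℝ => z + t • h) h 0 := by
    simpa using ((hasDerivAt_id (0 : ℝ)).smul_const h).const_add z
  have hlc : HasDerivAt (fun t : ℝ => (z + t • h) i) (h i) 0 := by
    have := ((hasDerivAt_id (0 : ℝ)).ofReal_comp.mul_const (h i)).const_add (z i)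
    simpa using this
  have h1 : HasDerivAt (fun t : ℝ => σ (z + t • h)) (fderiv ℝ σ z h) 0 :=
    HasFDerivAt.comp_hasDerivAt (f := fun t : ℝ => z + t • h) (l := σ) (0 : ℝ)
      (by simpa using hd.hasFDerivAt) hline
  have hw := hasDerivAt_affine_coord hi h
  have hu : DifferentiableAt ℝ (fun w => (σ (affPt i w) : ℂ)) p.1 :=
    Complex.ofRealCLM.differentiableAt.comp p.1
      (hd'.comp p.1 (hasFDerivAt_affPt p.1).differentiableAt)
  have h2 : HasDerivAt (fun t : ℝ => (σ (affPt i (polarInv i (z + t • h)).1) : ℂ))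
      (fderiv ℝ (fun w => (σ (affPt i w) : ℂ)) p.1 fun β => compE i p β h) 0 := by
    rw [hpz] at hw
    exact HasFDerivAt.comp_hasDerivAt (f := fun t : ℝ => (polarInv i (z + t • h)).1)
      (l := fun w => (σ (affPt i w) : ℂ)) (0 : ℝ) (by simpa [hpz] using hu.hasFDerivAt) hw
  have hev : (fun t : ℝ => ((σ (z + t • h) : ℝ) : ℂ)) =ᶠ[𝓝 0]
      fun t : ℝ => (σ (affPt i (polarInv i (z + t • h)).1) : ℂ) := by
    filter_upwards [hlc.continuousAt.eventually_ne (y := (0 : ℂ)) (by simpa using hi)] with t ht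
    conv_lhs => rw [← polarPt_polarInv ht, polarPt_eq,
      hσ _ _ (polarFactor_ne_zero (polarInv_snd_ne_zero ht))]
  have h3 := h1.ofReal_comp.unique (h2.congr_of_eventuallyEq hev)
  rw [fderiv_eq_dW] at h3
  have h4 : ∀ β, dW i β (fun w => (σ (affPt i w) : ℂ)) p.1 =
      star (dWbar i β (fun w => (σ (affPt i w) : ℂ)) p.1) := fun β => by
    have e := star_dW hu β
    have : (fun w => star ((σ (affPt i w) : ℂ))) = fun w => (σ (affPt i w) : ℂ) := by
      funext w; simp
    rw [this] at e
    rw [← e, star_star]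
  have h5 := congrArg Complex.re h3
  rw [Complex.ofReal_re, Finset.sum_add_distrib, Complex.add_re] at h5
  have h6 : (∑ β, compE i p β h * dW i β (fun w => (σ (affPt i w) : ℂ)) p.1).re =
      (∑ β, star (compE i p β h) * dWbar i β (fun w => (σ (affPt i w) : ℂ)) p.1).re := by
    rw [Complex.re_sum, Complex.re_sum]
    refine Finset.sum_congr rfl fun β _ => ?_
    rw [h4, ← Complex.conj_re, ← Complex.star_def, star_mul', star_star]
  rw [h5, h6]; ring

end IsCircularRep

/-! ### Real and imaginary parts of real linear forms -/

section HermitianAlgebra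

variable {ι : Type} [Fintype ι]

lemma re_sum_conj (x κ η : ι → ℂ) :
    (∑ b, (x b * κ b + star (x b) * η b)).re = (∑ b, star (x b) * (η b + star (κ b))).re := by
  rw [Complex.re_sum, Complex.re_sum]
  refine Finset.sum_congr rfl fun b _ => ?_
  simp; ring

lemma im_sum_conj (x κ η : ι → ℂ) :
    (∑ b, (x b * κ b + star (x b) * η b)).im = (∑ b, star (x b) * (η b - star (κ b))).im := by
  rw [Complex.im_sum, Complex.im_sum]
  refine Finset.sum_congr rfl fun b _ => ?_
  simp; ring

/-- The adjoint of x ↦ i x + P x + Q x̄ for the real pairing Re Σ x̄_b m_b. It transfers J from the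
test vector h to the vector representing dθ(v). -/
lemma re_sum_conj_map (P Q : ι → ι → ℂ) (x m : ι → ℂ) :
    (∑ b, star (Complex.I * x b + ∑ d, (P b d * x d + Q b d * star (x d))) * m b).re =
      (∑ b, star (x b) * (-Complex.I * m b + ∑ c, (star (P c b) * m c + Q c b * star (m c)))).re := by
  have e1 : ∑ b, star (Complex.I * x b + ∑ d, (P b d * x d + Q b d * star (x d))) * m b =
      ∑ b, star (x b) * (-Complex.I * m b) + ∑ b, ∑ d, star (x d) * (star (P b d) * m b) +
        star (∑ b, ∑ d, star (x d) * (Q b d * star (m b))) := by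
    simp only [star_add, star_sum, star_mul', star_star, ← Finset.sum_add_distrib]
    refine Finset.sum_congr rfl fun b _ => ?_
    rw [add_mul, Finset.sum_mul, add_assoc, ← Finset.sum_add_distrib]
    refine congrArg₂ _ ?_ (Finset.sum_congr rfl fun d _ => by ring)
    simp; ring
  have e2 : ∑ b, star (x b) * (-Complex.I * m b + ∑ c, (star (P c b) * m c + Q c b * star (m c))) =
      ∑ b, star (x b) * (-Complex.I * m b) + ∑ b, ∑ d, star (x d) * (star (P b d) * m b) +
        ∑ b, ∑ d, star (x d) * (Q b d * star (m b)) := by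
    rw [Finset.sum_comm (f := fun b d => star (x d) * (star (P b d) * m b)),
      Finset.sum_comm (f := fun b d => star (x d) * (Q b d * star (m b)))]
    simp only [← Finset.sum_add_distrib]
    refine Finset.sum_congr rfl fun b _ => ?_
    rw [mul_add, add_assoc, ← Finset.sum_add_distrib, Finset.mul_sum]
    exact congrArg₂ _ rfl (Finset.sum_congr rfl fun d _ => by ring)
  rw [e1, e2, Complex.add_re, Complex.add_re, Complex.add_re, Complex.add_re, Complex.star_def,
    Complex.conj_re]

end HermitianAlgebra

/-! ### The Levi condition is equivalent to (∗) -/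

namespace IsCircularRep

variable {n k : ℕ} {a : ℝ} {J : EndField n} {Ψ : Cn n ≃ Cn n} (hΨ : IsCircularRep k a J Ψ)
  {i : Fin n}
include hΨ

lemma fderiv_theta_eq (hk : 1 ≤ k) {p : Aff i × ℂ} (hp : p.2 ≠ 0) {h : Cn n}
    (hh : theta Ψ (polarPt i p) h = 0) (v : Cn n) :
    fderiv ℝ (fun z => theta Ψ z v) (polarPt i p) h =
      ∑ β, (compE i p β h * (Hlow Ψ i v p.1 β / p.2) +
        star (compE i p β h) * (Hbar Ψ i v p.1 β / p.2)) := by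
  rw [hΨ.fderiv_theta hk hp hh]
  simp only [hΨ.compE_symm_eq, hΨ.compE_gMat_eq]

/-- The condition that `𝓛_X J` preserves `𝓗` determines the functions `Ỹ^α` of a special field. -/
theorem leviCondition_iff (hk : 1 ≤ k) (hP : PreservesH J)
    (hskew : ∀ y ∈ puncturedBall n, ∀ h k, inner ℂ y h = (0 : ℂ) → inner ℂ y k = (0 : ℂ) →
      (inner ℂ (J y h) k : ℂ).im + (inner ℂ h (J y k) : ℂ).im = 0)
    {v : Cn n} {σ : Cn n → ℝ} {Y : (i : Fin n) → Aff i × ℂ → {j : Fin n // j ≠ i} → ℂ}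
    {X : VField n} (hX : IsSpecial k a Ψ v σ Y X) {p : Aff i × ℂ} (hp : p ∈ polarDom Ψ i) :
    LeviCondition J Ψ v σ X (Ψ (polarPt i p)) ↔ ∀ α, Y i p α = explicitY Ψ i J v σ p α := by
  have hz := polarPt_ne_zero (i := i) hp.1
  have hy := (hΨ.mem_polarDom.1 hp).2
  obtain ⟨hPm, hQm⟩ := hΨ.im_inner_fderiv_eq_zero hk hP hskew hp
  have hσd : ∀ z : Cn n, z ≠ 0 → DifferentiableAt ℝ σ z := fun z hz =>
    (hX.sigma_regular.contDiffOn.contDiffAt (isOpen_compl_singleton.mem_nhds hz)).differentiableAt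
      (by simp; omega)
  set μ := ‖Ψ (polarPt i p)‖ with hμ
  have hμ0 : μ ^ 2 ≠ 0 := pow_ne_zero _ (norm_ne_zero_iff.2 (hΨ.map_ne_zero hz))
  set κ : {j : Fin n // j ≠ i} → ℂ := fun β => Hlow Ψ i v p.1 β / p.2 with hκ
  set η : {j : Fin n // j ≠ i} → ℂ := fun β => Hbar Ψ i v p.1 β / p.2 with hη
  set s : {j : Fin n // j ≠ i} → ℂ := fun β => dWbar i β (fun w => (σ (affPt i w) : ℂ)) p.1 with hs
  set XE : {j : Fin n // j ≠ i} → ℂ := fun α => YH i v p.1 α / p.2 + Y i p α with hXE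
  set G := gMat Ψ i p.1 with hG
  set P := deltaHol Ψ i J p with hPd
  set Q := deltaAnti Ψ i J p with hQd
  set m : {j : Fin n // j ≠ i} → ℂ := fun β => η β + star (κ β) with hm
  set T : {j : Fin n // j ≠ i} → ℂ := fun b => ∑ c, (star (P c b) * m c + Q c b * star (m c)) with hT
  -- W represents the difference of the two sides of the Levi condition: up to the factor μ², that
  -- difference at h = Σ x^β e_β is Im Σ x̄_b W_b. As x is arbitrary, the condition is W = 0.
  set W : {j : Fin n // j ≠ i} → ℂ := fun b => 2 * ∑ a, XE a * G a b -
    ((1 - (μ : ℂ) ^ 2) * (m b + Complex.I * T b) + (1 + (μ : ℂ) ^ 2) * (η b - star (κ b)) +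
      2 * Complex.I * s b) with hW
  have key : ∀ x : {j : Fin n // j ≠ i} → ℂ, μ ^ 2 * (∑ b, star (x b) * W b).im =
      -2 * (inner ℂ (X (Ψ (polarPt i p))) (fderiv ℝ Ψ (polarPt i p)
        (∑ β, x β • frameE Ψ i p β)) : ℂ).im - μ ^ 2 *
    ((1 - μ ^ 2) * (fderiv ℝ (fun y => theta Ψ (Ψ.symm y) v) (Ψ (polarPt i p))
        (J (Ψ (polarPt i p)) (fderiv ℝ Ψ (polarPt i p) (∑ β, x β • frameE Ψ i p β)))).re +
      (1 + μ ^ 2) * (fderiv ℝ (fun y => theta Ψ (Ψ.symm y) v) (Ψ (polarPt i p))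
        (fderiv ℝ Ψ (polarPt i p) (∑ β, x β • frameE Ψ i p β))).im +
      fderiv ℝ (fun y => σ (Ψ.symm y)) (Ψ (polarPt i p))
        (fderiv ℝ Ψ (polarPt i p) (∑ β, x β • frameE Ψ i p β))) := by
    intro x
    set h := ∑ β, x β • frameE Ψ i p β with hh
    have hθ := hΨ.theta_frame_sum hp.1 x
    rw [← hh] at hθ
    have hcomp : ∀ β, compE i p β h = x β := fun β => hΨ.compE_frame_sum hp.1 x β
    have hJθ := hΨ.theta_pullEnd hP hz hy.2 hθ
    have hd := hΨ.differentiableAt_theta hk hz v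
    rw [← hΨ.pullEnd_apply hz, hΨ.fderiv_comp_symm hz hd, hΨ.fderiv_comp_symm hz hd,
      hΨ.fderiv_comp_symm hz (hσd _ hz), hΨ.fderiv_theta_eq hk hp.1 hJθ,
      hΨ.fderiv_theta_eq hk hp.1 hθ,
      fderiv_homogeneous hX.sigma_smul hp.1 (hσd _ hz) (hσd _ (affPt_ne_zero _))]
    simp only [hΨ.compE_pullEnd hp.1 hθ, hcomp]
    have hin : (inner ℂ (X (Ψ (polarPt i p))) (fderiv ℝ Ψ (polarPt i p) h) : ℂ).im =
        -(μ ^ 2 * (∑ β, star (x β) * ∑ α, XE α * G α β).im) := by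
      have h1 := hX.expansion i p hp
      rw [h1, map_add, hΨ.fderiv_smul_self hz, inner_add_left, inner_smul_left,
        (hΨ.inner_fderiv_eq_zero hz).2 hθ, mul_zero, zero_add]
      have h2 := hΨ.im_inner_fderiv_eq hk hp.1 (hΨ.theta_frame_sum hp.1 XE) hθ
      simp only [hcomp, hΨ.compE_frame_sum hp.1] at h2
      exact h2
    rw [hin, re_sum_conj, im_sum_conj, re_sum_conj_map]
    have e1 : ∑ b, star (x b) * W b = 2 * ∑ b, star (x b) * ∑ a, XE a * G a b -
        ((1 - (μ : ℂ) ^ 2) * (Complex.I * ∑ b, star (x b) * (-Complex.I * m b + T b)) +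
          (1 + (μ : ℂ) ^ 2) * ∑ b, star (x b) * (η b - star (κ b)) +
          2 * (Complex.I * ∑ b, star (x b) * s b)) := by
      rw [Finset.mul_sum, Finset.mul_sum, Finset.mul_sum, Finset.mul_sum, Finset.mul_sum,
        Finset.mul_sum, ← Finset.sum_add_distrib, ← Finset.sum_add_distrib,
        ← Finset.sum_sub_distrib]
      refine Finset.sum_congr rfl fun b _ => ?_
      simp only [W]
      linear_combination -(1 - (μ : ℂ) ^ 2) * star (x b) * m b * Complex.I_sq
    rw [e1]
    have e2 : ∀ A B C D : ℂ, (2 * A - ((1 - (μ : ℂ) ^ 2) * (Complex.I * B) + (1 + (μ : ℂ) ^ 2) * C +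
        2 * (Complex.I * D))).im = 2 * A.im - ((1 - μ ^ 2) * B.re + (1 + μ ^ 2) * C.im +
          2 * D.re) := by
      intro A B C D
      have e3 : (1 - (μ : ℂ) ^ 2) = ((1 - μ ^ 2 : ℝ) : ℂ) := by push_cast; ring
      have e4 : (1 + (μ : ℂ) ^ 2) = ((1 + μ ^ 2 : ℝ) : ℂ) := by push_cast; ring
      rw [e3, e4, Complex.sub_im, Complex.add_im, Complex.add_im, Complex.im_ofReal_mul,
        Complex.im_ofReal_mul]
      simp
    rw [e2]
    ring
  have hWiff : LeviCondition J Ψ v σ X (Ψ (polarPt i p)) ↔ W = 0 := by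
    constructor
    · intro hC
      refine eq_zero_of_im_sum fun x => ?_
      have h1 := hC _ ((hΨ.inner_fderiv_eq_zero hz).2 (hΨ.theta_frame_sum hp.1 x))
      have h2 := key x
      rw [h1, sub_self] at h2
      exact (mul_eq_zero.1 h2).resolve_left hμ0
    · intro h0 h hh
      have h1 : theta Ψ (polarPt i p) ((fderiv ℝ Ψ (polarPt i p)).inverse h) = 0 := by
        rw [← hΨ.inner_fderiv_eq_zero hz, hΨ.fderiv_apply_inverse hz, hh]
      have h2 := key fun β => compE i p β ((fderiv ℝ Ψ (polarPt i p)).inverse h)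
      rw [← hΨ.eq_frame_sum hp.1 h1, hΨ.fderiv_apply_inverse hz, h0] at h2
      simp only [Pi.zero_apply, mul_zero, Finset.sum_const_zero, Complex.zero_im] at h2
      linarith
  rw [hWiff]
  -- W = 0 is a linear system for Ỹ with matrix g: the pole part of the field contributes η, and the
  -- remaining terms are those of (∗) before g is inverted.
  have hsolve := hermitian_solve_iff (hΨ.isUnit_gMat hk hp.1) (P := Matrix.of P) (Q := Matrix.of Q)
    hPm hQm (Y i p) (fun b => Complex.I * s b - (rho Ψ i p.1 : ℂ) ^ 2 * p.2 *
      star (Hlow Ψ i v p.1 b)) (Klow Ψ i v p) (Kbar Ψ i v p)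
  have h1 : (∀ α, Y i p α = explicitY Ψ i J v σ p α) ↔ ∀ α, Y i p α =
      ∑ β, (gMat Ψ i p.1)⁻¹ β α * (Complex.I * s β - (rho Ψ i p.1 : ℂ) ^ 2 * p.2 *
        star (Hlow Ψ i v p.1 β)) + Complex.I / 2 * ∑ δ, ∑ γ, Matrix.of Q α δ *
        (gMat Ψ i p.1)⁻¹ δ γ * Klow Ψ i v p γ - Complex.I / 2 * ∑ δ, ∑ γ, Matrix.of P α δ *
        (gMat Ψ i p.1)⁻¹ γ δ * Kbar Ψ i v p γ := by
    refine forall_congr' fun α => ?_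
    have : explicitY Ψ i J v σ p α = ∑ β, (gMat Ψ i p.1)⁻¹ β α * (Complex.I * s β -
        (rho Ψ i p.1 : ℂ) ^ 2 * p.2 * star (Hlow Ψ i v p.1 β)) + Complex.I / 2 * ∑ δ, ∑ γ,
        Matrix.of Q α δ * (gMat Ψ i p.1)⁻¹ δ γ * Klow Ψ i v p γ - Complex.I / 2 * ∑ δ, ∑ γ,
        Matrix.of P α δ * (gMat Ψ i p.1)⁻¹ γ δ * Kbar Ψ i v p γ := by
      rw [explicitY]
      simp only [gInv, Matrix.of_apply]
      congr 2
      rw [Finset.mul_sum, Finset.mul_sum, ← Finset.sum_sub_distrib]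
      exact Finset.sum_congr rfl fun β _ => by simp only [s]; ring
    rw [this]
  rw [h1, ← hsolve, funext_iff]
  refine forall_congr' fun b => ?_
  have e1 : ∑ a, XE a * G a b = η b + ∑ a, Y i p a * G a b := by
    have : η b = ∑ a, YH i v p.1 a / p.2 * G a b := by
      simp only [η]
      rw [← hΨ.compE_gMat_eq]
      exact Finset.sum_congr rfl fun α _ => by rw [hΨ.YH_eq]
    rw [this, ← Finset.sum_add_distrib]
    exact Finset.sum_congr rfl fun α _ => by simp only [XE]; ring
  have e2 : (rho Ψ i p.1 : ℂ) ^ 2 * p.2 * star (Hlow Ψ i v p.1 b) = (μ : ℂ) ^ 2 * star (κ b) := by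
    have hs' : star p.2 ≠ 0 := by simpa using hp.1
    have e : star (κ b) = star (Hlow Ψ i v p.1 b) / star p.2 :=
      map_div₀ (starRingEnd ℂ) _ p.2
    rw [e, hΨ.normSq_map_polarPt]
    field_simp
  have e3 : ∑ c, (star (Matrix.of P c b) * Kbar Ψ i v p c + Matrix.of Q c b * Klow Ψ i v p c) =
      (1 - (μ : ℂ) ^ 2) * T b := by
    simp only [T]
    rw [Finset.mul_sum]
    refine Finset.sum_congr rfl fun c _ => ?_
    rw [hΨ.Klow_eq hp.1, hΨ.Kbar_eq hp.1, Matrix.of_apply, Matrix.of_apply]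
    ring
  rw [e2, e3]
  simp only [W, Pi.zero_apply, e1, m]
  constructor <;> intro h
  · linear_combination (1 / 2 : ℂ) * h
  · linear_combination 2 * h

end IsCircularRep

/-! ### From the Lie derivative to the Levi condition -/

namespace IsCircularRep

variable {n k : ℕ} {a : ℝ} {J : EndField n} {Ψ : Cn n ≃ Cn n} (hΨ : IsCircularRep k a J Ψ)
  {i : Fin n}
include hΨ

lemma contDiffAt_theta_symm (ha0 : 0 ≤ a) (ha : a ≤ 1) (hk : 1 ≤ k) (v : Cn n) {y : Cn n}
    (hy : y ≠ 0) : ContDiffAt ℝ k (fun y => theta Ψ (Ψ.symm y) v) y :=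
  ((hΨ.holder_theta ha0 ha hk v).contDiffOn.contDiffAt
    (isOpen_compl_singleton.mem_nhds (hΨ.symm_ne_zero hy))).comp y
      ((hΨ.symm_contDiffAt hy).of_le (by norm_cast; omega))

lemma contDiffAt_comp_symm {σ : Cn n → ℝ} (hσ : HolderClassOn k a σ {0}ᶜ) {y : Cn n}
    (hy : y ≠ 0) : ContDiffAt ℝ k (fun y => σ (Ψ.symm y)) y :=
  (hσ.contDiffOn.contDiffAt (isOpen_compl_singleton.mem_nhds (hΨ.symm_ne_zero hy))).comp y
      ((hΨ.symm_contDiffAt hy).of_le (by norm_cast; omega))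

/-- The derivatives along `𝓗` of the `𝓩`-component of a special field. -/
lemma fderiv_ballTheta_special_of_inner_eq_zero (ha0 : 0 ≤ a) (ha : a ≤ 1) (hk : 1 ≤ k) {v : Cn n}
    {σ : Cn n → ℝ}
    {Y : (i : Fin n) → Aff i × ℂ → {j : Fin n // j ≠ i} → ℂ} {X : VField n}
    (hX : IsSpecial k a Ψ v σ Y X) {y : Cn n} (hy : y ∈ puncturedOpenBall n) {u : Cn n}
    (hu : inner ℂ y u = (0 : ℂ)) :
    fderiv ℝ (fun y => ballTheta y (X y)) y u = fderiv ℝ (fun y => theta Ψ (Ψ.symm y) v) y u +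
      Complex.I * fderiv ℝ (fun y => σ (Ψ.symm y)) y u -
        (‖y‖ : ℂ) ^ 2 * star (fderiv ℝ (fun y => theta Ψ (Ψ.symm y) v) y u) := by
  have hφ := ((hΨ.contDiffAt_theta_symm ha0 ha hk v hy.1).differentiableAt
    (by simp; omega)).hasFDerivAt
  have hσ := ((hΨ.contDiffAt_comp_symm hX.sigma_regular hy.1).differentiableAt
    (by simp; omega)).hasFDerivAt
  have hn := (Complex.ofRealCLM.hasFDerivAt.comp y (normSq_fderiv (hasFDerivAt_id y)).1.hasFDerivAt)
  have h1 := (hφ.add ((Complex.ofRealCLM.hasFDerivAt.comp y hσ).const_mul Complex.I)).sub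
    (hn.mul ((Complex.conjCLE : ℂ →L[ℝ] ℂ).hasFDerivAt.comp y hφ))
  have h2 := h1.congr_of_eventuallyEq (f₁ := fun y => ballTheta y (X y)) (by
    filter_upwards [isOpen_puncturedOpenBall.mem_nhds hy] with y hy
    rw [hΨ.ballTheta_special hX (puncturedOpenBall_subset hy)]; simp [Function.comp])
  rw [h2.fderiv]
  have h3 : fderiv ℝ (fun y : Cn n => ‖id y‖ ^ 2) y u = 0 := by
    rw [(normSq_fderiv (hasFDerivAt_id y)).2]
    simp [hu]
  simp only [_root_.sub_apply, _root_.add_apply, _root_.smul_apply,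
    ContinuousLinearMap.comp_apply, h3]
  simp

/-- If `𝓛_X J` preserves `𝓗`, then the special field `X` satisfies the Levi condition. -/
lemma leviCondition_of_lieDer (ha0 : 0 ≤ a) (ha : a ≤ 1) (hk : 1 ≤ k) (hS : StandardOnZ J)
    (hP : PreservesH J) (hJ : ContDiffOn ℝ 1 J (puncturedBall n)) {v : Cn n} {σ : Cn n → ℝ}
    {Y : (i : Fin n) → Aff i × ℂ → {j : Fin n // j ≠ i} → ℂ} {X : VField n}
    (hX : IsSpecial k a Ψ v σ Y X)
    (hL : ∀ y ∈ puncturedOpenBall n, ∀ h, inner ℂ y h = (0 : ℂ) →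
      inner ℂ y (lieDer X J y h) = (0 : ℂ)) {y : Cn n} (hy : y ∈ puncturedBall n) :
    LeviCondition J Ψ v σ X y := by
  have hreg := hΨ.special_regular ha0 ha hk hX
  have hXd : ∀ y ∈ puncturedOpenBall n, DifferentiableAt ℝ X y := fun y hy =>
    (hreg.contDiffOn.contDiffAt (puncturedBall_mem_nhds hy)).differentiableAt (by simp; omega)
  have hJd : ∀ y ∈ puncturedOpenBall n, DifferentiableAt ℝ J y := fun y hy =>
    (hJ.contDiffAt (puncturedBall_mem_nhds hy)).differentiableAt (by simp)
  have hopen : ∀ y ∈ puncturedOpenBall n, LeviCondition J Ψ v σ X y := by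
    intro y hy h hh
    have hJh := hP y (puncturedOpenBall_subset hy) h hh
    rw [im_inner_of_lieDer hS hP (hJd y hy) (hXd y hy) hy hh (hL y hy h hh),
      hΨ.fderiv_ballTheta_special_of_inner_eq_zero ha0 ha hk hX hy hh,
      hΨ.fderiv_ballTheta_special_of_inner_eq_zero ha0 ha hk hX hy hJh, ← Complex.ofReal_pow]
    simp [-Complex.ofReal_pow]
    ring_nf
    simp
  intro h hh
  -- (E) controls the Lie derivative in the open ball only, whereas (∗) is claimed up to the
  -- boundary; radial limits fill the gap.
  have hlim : Tendsto (fun s : ℝ => s • y) (𝓝[<] 1) (𝓝[puncturedBall n] y) := by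
    refine tendsto_nhdsWithin_iff.2 ⟨?_, ?_⟩
    · have : Continuous fun s : ℝ => s • y := by fun_prop
      simpa using (this.tendsto 1).mono_left nhdsWithin_le_nhds
    · filter_upwards [Ioo_mem_nhdsLT (zero_lt_one (α := ℝ))] with s hs
      refine ⟨smul_ne_zero hs.1.ne' hy.1, ?_⟩
      rw [norm_smul, Real.norm_eq_abs, abs_of_pos hs.1]
      exact mul_le_one₀ hs.2.le (norm_nonneg _) hy.2
  have hlim' := hlim.mono_right nhdsWithin_le_nhds
  have hφ : ContinuousAt (fderiv ℝ (fun y => theta Ψ (Ψ.symm y) v)) y :=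
    (((hΨ.contDiffAt_theta_symm ha0 ha hk v hy.1).of_le (m := 1) (by exact_mod_cast hk)).fderiv_right
      (m := 0) (by simp)).continuousAt
  have hσ : ContinuousAt (fderiv ℝ (fun y => σ (Ψ.symm y))) y :=
    (((hΨ.contDiffAt_comp_symm hX.sigma_regular hy.1).of_le (m := 1) (by exact_mod_cast hk)).fderiv_right
      (m := 0) (by simp)).continuousAt
  have hJh : ContinuousWithinAt (fun y => J y h) (puncturedBall n) y :=
    (hJ.continuousOn y hy).clm_apply continuousWithinAt_const
  have hcont : ContinuousWithinAt (fun y => -2 * (inner ℂ (X y) h : ℂ).im - ‖y‖ ^ 2 *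
    ((1 - ‖y‖ ^ 2) * (fderiv ℝ (fun y => theta Ψ (Ψ.symm y) v) y (J y h)).re +
      (1 + ‖y‖ ^ 2) * (fderiv ℝ (fun y => theta Ψ (Ψ.symm y) v) y h).im +
      fderiv ℝ (fun y => σ (Ψ.symm y)) y h)) (puncturedBall n) y := by
    have c1 := Complex.continuous_im.continuousAt.comp_continuousWithinAt
      ((hreg.continuousOn y hy).inner (𝕜 := ℂ) (continuousWithinAt_const (b := h)))
    have c2 := Complex.continuous_re.continuousAt.comp_continuousWithinAt
      (hφ.continuousWithinAt.clm_apply hJh)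
    have c3 := Complex.continuous_im.continuousAt.comp_continuousWithinAt
      (hφ.continuousWithinAt.clm_apply (continuousWithinAt_const (s := puncturedBall n) (b := h)))
    have c4 := hσ.continuousWithinAt.clm_apply
      (continuousWithinAt_const (s := puncturedBall n) (b := h))
    have c5 : ContinuousWithinAt (fun y : Cn n => ‖y‖ ^ 2) (puncturedBall n) y :=
      (continuous_norm.pow 2).continuousWithinAt
    exact (continuousWithinAt_const.mul c1).sub (c5.mul ((((continuousWithinAt_const.sub c5).mul
      c2).add ((continuousWithinAt_const.add c5).mul c3)).add c4))
  rw [← sub_eq_zero]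
  refine tendsto_nhds_unique_of_eventuallyEq (hcont.tendsto.comp hlim) tendsto_const_nhds ?_
  filter_upwards [Ioo_mem_nhdsLT (zero_lt_one (α := ℝ))] with s hs
  have hs' : s • y ∈ puncturedOpenBall n := by
    refine ⟨smul_ne_zero hs.1.ne' hy.1, ?_⟩
    rw [norm_smul, Real.norm_eq_abs, abs_of_pos hs.1]
    exact mul_lt_one_of_nonneg_of_lt_one_left hs.1.le hs.2 hy.2
  have hs0 : inner ℂ (s • y) h = (0 : ℂ) := by
    rw [← Complex.coe_smul, inner_smul_left, hh, mul_zero]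
  simp only [Function.comp]
  exact sub_eq_zero.2 (hopen _ hs' h hs0)

end IsCircularRep

/-! ### The first two statements of the theorem -/

namespace IsNormalForm

variable {n k : ℕ} {a : ℝ} {J : EndField n}

lemma contDiffOn (hJ : IsNormalForm k a J) (hk : 2 ≤ k) : ContDiffOn ℝ 1 J (puncturedBall n) :=
  hJ.complexStructure.regular.contDiffOn.of_le (by norm_cast; omega)

lemma differentiableAt (hJ : IsNormalForm k a J) (hk : 2 ≤ k) :
    ∀ y ∈ puncturedOpenBall n, DifferentiableAt ℝ J y := fun _ hy =>
  ((hJ.contDiffOn hk).contDiffAt (puncturedBall_mem_nhds hy)).differentiableAt (by simp)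

/-- Quasi-regular fields with vanishing `𝓩`-part of `𝓛_X J` on `𝓩` are the special fields. -/
theorem quasiRegular_iff_special (hJ : IsNormalForm k a J) (hk : 2 ≤ k) (ha0 : 0 ≤ a) (ha : a ≤ 1)
    {Ψ : Cn n ≃ Cn n} (hΨ : IsCircularRep k a J Ψ) {v : Cn n} {X : VField n} :
    (IsQuasiRegular k a Ψ v X ∧ LieDerZZVanishes J X) ↔
      ∃ (σ : Cn n → ℝ) (Y : (i : Fin n) → Aff i × ℂ → {j : Fin n // j ≠ i} → ℂ),
        IsSpecial k a Ψ v σ Y X := by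
  have hk1 : 1 ≤ k := by omega
  constructor
  · rintro ⟨hX, hL⟩
    exact hΨ.exists_isSpecial ha0 ha hk1 hJ.standardOnZ hJ.preservesH (hJ.differentiableAt hk) hX hL
  · rintro ⟨σ, Y, hX⟩
    exact ⟨hΨ.special_isQuasiRegular ha0 ha hk1 hX, hΨ.special_lieDerZZVanishes ha0 ha hk1
      hJ.standardOnZ hJ.preservesH (hJ.differentiableAt hk) hX⟩

end IsNormalForm

/-- The fields of a fundamental pair are special fields, with explicit functions `Ỹ^α`. -/
theorem IsFundamentalPair.special {n k : ℕ} {a b : ℝ} {J : EndField n} {Jt : ℝ → EndField n}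
    {X : ℝ → VField n} {v : ℝ → Cn n} {Ψ : ℝ → Cn n ≃ Cn n} (hk : 2 ≤ k) (ha0 : 0 ≤ a) (ha : a ≤ 1)
    (hF : IsFundamentalPair k a b J Jt X v Ψ) {t : ℝ} (ht : t ∈ Icc (0 : ℝ) 1) :
    (∃ (σ : Cn n → ℝ) (Y : (i : Fin n) → Aff i × ℂ → {j : Fin n // j ≠ i} → ℂ),
      IsSpecial k a (Ψ t) (v t) σ Y (X t) ∧
        ∀ i, ∀ p ∈ polarDom (Ψ t) i, ∀ α,
          Y i p α = explicitY (Ψ t) i (Jt t) (v t) σ p α) ∧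
      ZbarCondition (Jt t) (X t) := by
  have hk1 : 1 ≤ k := by omega
  have hN := (hF.J_normalForm t ht).1
  have hΨ := hF.circular t ht
  have hQ := hF.X_quasiRegular t ht
  have hE := hF.evolution.2 t ht
  have huniq : UniqueDiffWithinAt ℝ (Icc (0 : ℝ) 1) t := uniqueDiffOn_Icc_zero_one t ht
  have hLZ : ∀ z ∈ puncturedOpenBall n, ∀ c : ℂ, lieDer (X t) (Jt t) z (c • z) = 0 := by
    intro z hz c
    have h1 := hE z hz (c • z)
    -- On 𝓩 the structures do not depend on the parameter, so (E) forces 𝓛_X J to vanish there. The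
    -- same argument with ⟨z, ·⟩ shows that 𝓛_X J preserves 𝓗.
    have h2 : HasDerivWithinAt (fun s => Jt s z (c • z)) 0 (Icc 0 1) t :=
      (hasDerivWithinAt_const t _ ((Complex.I * c) • z)).congr
        (fun s hs => (hF.J_normalForm s hs).1.standardOnZ z (puncturedOpenBall_subset hz) c)
        ((hF.J_normalForm t ht).1.standardOnZ z (puncturedOpenBall_subset hz) c)
    exact neg_eq_zero.1 (huniq.eq_deriv _ h1 h2)
  have hLH : ∀ y ∈ puncturedOpenBall n, ∀ h, inner ℂ y h = (0 : ℂ) →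
      inner ℂ y (lieDer (X t) (Jt t) y h) = (0 : ℂ) := by
    intro z hz h hh
    have h1 := ((innerSL ℂ z).restrictScalars ℝ).hasFDerivAt.comp_hasDerivWithinAt t (hE z hz h)
    have h2 : HasDerivWithinAt (((innerSL ℂ z).restrictScalars ℝ) ∘ fun s => Jt s z h) 0
        (Icc 0 1) t :=
      (hasDerivWithinAt_const t _ (0 : ℂ)).congr
        (fun s hs => (hF.J_normalForm s hs).1.preservesH z (puncturedOpenBall_subset hz) h hh)
        ((hF.J_normalForm t ht).1.preservesH z (puncturedOpenBall_subset hz) h hh)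
    have h3 := huniq.eq_deriv _ h1 h2
    simpa using h3
  have hXd : ∀ y ∈ puncturedOpenBall n, DifferentiableAt ℝ (X t) y := fun y hy =>
    (hQ.regular.contDiffOn.contDiffAt (puncturedBall_mem_nhds hy)).differentiableAt
      (by simp; omega)
  obtain ⟨σ, Y, hS⟩ := (hN.quasiRegular_iff_special hk ha0 ha hΨ).1
    ⟨hQ, fun z hz c => by rw [hLZ z hz c, inner_zero_right]⟩
  refine ⟨⟨σ, Y, hS, fun i p hp => ?_⟩, zbarCondition_of_lieDer hN.standardOnZ hN.preservesH
    (hN.differentiableAt hk) hXd fun z hz => by simpa using hLZ z hz 1⟩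
  refine (hΨ.leviCondition_iff hk1 hN.preservesH (fun y hy h l hh hl => im_inner_J (by omega)
    hN.complexStructure hN.preservesH hy hh hl) hS hp).1 ?_
  exact hΨ.leviCondition_of_lieDer ha0 ha hk1 hN.standardOnZ hN.preservesH (hN.contDiffOn hk) hS hLH
    ((IsCircularRep.mem_polarDom hΨ).1 hp).2

/-- Families of functions of class `C^m`, whose derivatives up to order `m` are jointly continuous in
the parameter and the point. -/
def ParamContDiff {P V : Type} [TopologicalSpace P] [NormedAddCommGroup V] [NormedSpace ℝ V] :
    ℕ → ∀ {F : Type} [NormedAddCommGroup F] [NormedSpace ℝ F], (P → V → F) → Set P → Set V → Prop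
  | 0, _, _, _, f, Q, O => ContinuousOn (fun x : P × V => f x.1 x.2) (Q ×ˢ O)
  | m + 1, F, _, _, f, Q, O => ContinuousOn (fun x : P × V => f x.1 x.2) (Q ×ˢ O) ∧
      ∃ f' : P → V → (V →L[ℝ] F), (∀ q ∈ Q, ∀ y ∈ O, HasFDerivAt (f q) (f' q y) y) ∧
        ParamContDiff m f' Q O

/-! ### Families with derivatives jointly continuous in parameter and point -/

namespace ParamContDiff

variable {P V W F G H : Type} [TopologicalSpace P] [NormedAddCommGroup V] [NormedSpace ℝ V]
  [NormedAddCommGroup W] [NormedSpace ℝ W]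
  [NormedAddCommGroup F] [NormedSpace ℝ F] [NormedAddCommGroup G] [NormedSpace ℝ G]
  [NormedAddCommGroup H] [NormedSpace ℝ H] {Q : Set P} {O : Set V}

lemma continuousOn {m : ℕ} {f : P → V → F} (h : ParamContDiff m f Q O) :
    ContinuousOn (fun x : P × V => f x.1 x.2) (Q ×ˢ O) := by
  cases m with
  | zero => exact h
  | succ m => exact h.1

lemma congr (hO : IsOpen O) : ∀ {m : ℕ} {f g : P → V → F}, ParamContDiff m f Q O →
    (∀ q ∈ Q, ∀ y ∈ O, g q y = f q y) → ParamContDiff m g Q O := by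
  intro m
  cases m with
  | zero => exact fun {f g} h he => ContinuousOn.congr h fun x hx => he x.1 hx.1 x.2 hx.2
  | succ m =>
    rintro f g ⟨h, f', hf', hm⟩ he
    refine ⟨ContinuousOn.congr h fun x hx => he x.1 hx.1 x.2 hx.2, f', fun q hq y hy => ?_, hm⟩
    refine (hf' q hq y hy).congr_of_eventuallyEq ?_
    filter_upwards [hO.mem_nhds hy] with y' hy' using he q hq y' hy'

lemma pred : ∀ {m : ℕ} {F : Type} [NormedAddCommGroup F] [NormedSpace ℝ F] {f : P → V → F},
    ParamContDiff (m + 1) f Q O → ParamContDiff m f Q O := by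
  intro m
  induction m with
  | zero => exact fun h => h.1
  | succ m ih =>
    rintro F _ _ f ⟨h, f', hf', hm⟩
    exact ⟨h, f', hf', ih hm⟩

lemma fderiv (hO : IsOpen O) {m : ℕ} {f : P → V → F} (h : ParamContDiff (m + 1) f Q O) :
    ParamContDiff m (fun q => fderiv ℝ (f q)) Q O := by
  obtain ⟨-, f', hf', hm⟩ := h
  exact hm.congr hO fun q hq y hy => (hf' q hq y hy).fderiv

lemma differentiableAt {m : ℕ} {f : P → V → F} (h : ParamContDiff (m + 1) f Q O) {q : P}
    (hq : q ∈ Q) {y : V} (hy : y ∈ O) : DifferentiableAt ℝ (f q) y := by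
  obtain ⟨-, f', hf', -⟩ := h
  exact (hf' q hq y hy).differentiableAt

lemma of_fderiv {m : ℕ} {f : P → V → F}
    (hc : ContinuousOn (fun x : P × V => f x.1 x.2) (Q ×ˢ O))
    (hd : ∀ q ∈ Q, ∀ y ∈ O, DifferentiableAt ℝ (f q) y)
    (h : ParamContDiff m (fun q => _root_.fderiv ℝ (f q)) Q O) : ParamContDiff (m + 1) f Q O :=
  ⟨hc, _, fun q hq y hy => (hd q hq y hy).hasFDerivAt, h⟩

/-- Functions of the parameter. -/
lemma param : ∀ {m : ℕ} {F : Type} [NormedAddCommGroup F] [NormedSpace ℝ F] {f : P → F},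
    ContinuousOn f Q → ParamContDiff m (fun q (_ : V) => f q) Q O := by
  intro m
  induction m with
  | zero => exact fun {F} _ _ {f} h => h.comp continuousOn_fst fun x hx => hx.1
  | succ m ih =>
    intro F _ _ f h
    exact ⟨h.comp continuousOn_fst fun x hx => hx.1, fun _ _ => 0,
      fun q _ y _ => hasFDerivAt_const _ y, ih continuousOn_const⟩

lemma of_contDiffOn (hO : IsOpen O) : ∀ {m : ℕ} {F : Type} [NormedAddCommGroup F] [NormedSpace ℝ F]
    {f : V → F}, ContDiffOn ℝ m f O → ParamContDiff m (fun _ : P => f) Q O := by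
  intro m
  induction m with
  | zero =>
    exact fun h => h.continuousOn.comp continuousOn_snd fun x hx => hx.2
  | succ m ih =>
    intro F _ _ f h
    refine ⟨h.continuousOn.comp continuousOn_snd fun x hx => hx.2, fun _ => _root_.fderiv ℝ f,
      fun q _ y hy => ((h.contDiffAt (hO.mem_nhds hy)).differentiableAt (by simp)).hasFDerivAt,
      ih (h.fderiv_of_isOpen hO (by simp))⟩

lemma add : ∀ {m : ℕ} {F : Type} [NormedAddCommGroup F] [NormedSpace ℝ F] {f g : P → V → F},
    ParamContDiff m f Q O → ParamContDiff m g Q O →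
      ParamContDiff m (fun q y => f q y + g q y) Q O := by
  intro m
  induction m with
  | zero => exact fun hf hg => ContinuousOn.add hf hg
  | succ m ih =>
    rintro F _ _ f g ⟨hf, f', hf', hfm⟩ ⟨hg, g', hg', hgm⟩
    exact ⟨hf.add hg, _, fun q hq y hy => (hf' q hq y hy).add (hg' q hq y hy), ih hfm hgm⟩

lemma bilin : ∀ {m : ℕ} {F G H : Type} [NormedAddCommGroup F] [NormedSpace ℝ F]
    [NormedAddCommGroup G] [NormedSpace ℝ G] [NormedAddCommGroup H] [NormedSpace ℝ H]
    (B : F →L[ℝ] G →L[ℝ] H) {f : P → V → F} {g : P → V → G}, ParamContDiff m f Q O →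
      ParamContDiff m g Q O → ParamContDiff m (fun q y => B (f q y) (g q y)) Q O := by
  intro m
  induction m with
  | zero =>
    intro F G H _ _ _ _ _ _ B f g hf hg
    exact B.isBoundedBilinearMap.continuous.comp_continuousOn (ContinuousOn.prodMk hf hg)
  | succ m ih =>
    intro F G H _ _ _ _ _ _ B f g hf0 hg0
    have hf1 := hf0.pred
    have hg1 := hg0.pred
    obtain ⟨hf, f', hf', hfm⟩ := hf0
    obtain ⟨hg, g', hg', hgm⟩ := hg0
    refine ⟨B.isBoundedBilinearMap.continuous.comp_continuousOn (hf.prodMk hg), _,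
      fun q hq y hy => B.hasFDerivAt_of_bilinear (hf' q hq y hy) (hg' q hq y hy), ?_⟩
    exact add (ih (B.precompR V) hf1 hgm) (ih (B.precompL V) hfm hg1)

lemma clm {m : ℕ} (L : F →L[ℝ] G) {f : P → V → F} (hf : ParamContDiff m f Q O) :
    ParamContDiff m (fun q y => L (f q y)) Q O :=
  bilin (ContinuousLinearMap.apply ℝ G |>.flip) (param (f := fun _ : P => L) continuousOn_const) hf

lemma prodMk {m : ℕ} {f : P → V → F} {g : P → V → G} (hf : ParamContDiff m f Q O)
    (hg : ParamContDiff m g Q O) : ParamContDiff m (fun q y => (f q y, g q y)) Q O := by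
  have := add (hf.clm (ContinuousLinearMap.inl ℝ F G)) (hg.clm (ContinuousLinearMap.inr ℝ F G))
  simpa using this

lemma comp : ∀ {m : ℕ} {F : Type} [NormedAddCommGroup F] [NormedSpace ℝ F] {T : Set W}
    {f : P → W → F} {g : P → V → W}, ParamContDiff m f Q T → ParamContDiff m g Q O →
      (∀ q ∈ Q, MapsTo (g q) O T) → ParamContDiff m (fun q y => f q (g q y)) Q O := by
  intro m
  have hcont : ∀ {F : Type} [NormedAddCommGroup F] [NormedSpace ℝ F] {T : Set W}
    {f : P → W → F} {g : P → V → W}, ContinuousOn (fun x : P × W => f x.1 x.2) (Q ×ˢ T) →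
      ContinuousOn (fun x : P × V => g x.1 x.2) (Q ×ˢ O) → (∀ q ∈ Q, MapsTo (g q) O T) →
      ContinuousOn (fun x : P × V => f x.1 (g x.1 x.2)) (Q ×ˢ O) := fun {F} _ _ {T f g} hf hg hm =>
    hf.comp (f := fun x : P × V => (x.1, g x.1 x.2)) (continuousOn_fst.prodMk hg)
      fun x hx => ⟨hx.1, hm x.1 hx.1 hx.2⟩
  induction m with
  | zero => exact fun hf hg hm => hcont hf hg hm
  | succ m ih =>
    intro F _ _ T f g hf0 hg0 hm
    have hg1 := hg0.pred
    obtain ⟨hf, f', hf', hfm⟩ := hf0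
    obtain ⟨hg, g', hg', hgm⟩ := hg0
    refine ⟨hcont hf hg hm, fun q y => f' q (g q y) ∘L g' q y, fun q hq y hy =>
      (hf' q hq _ (hm q hq hy)).comp y (hg' q hq y hy), ?_⟩
    exact bilin (ContinuousLinearMap.compL ℝ V W F) (ih hfm hg1 hm) hgm

/-- Composition with a smooth function. -/
lemma smooth_comp {m : ℕ} {T : Set W} (hT : IsOpen T) {f : W → F} {g : P → V → W}
    (hf : ContDiffOn ℝ m f T) (hg : ParamContDiff m g Q O) (hm : ∀ q ∈ Q, MapsTo (g q) O T) :
    ParamContDiff m (fun q y => f (g q y)) Q O :=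
  comp (of_contDiffOn hT hf) hg hm

/-- Jointly `C¹` functions. -/
lemma of_contDiffOn_prod {K : Set ℝ} {S : Set V} {f : ℝ → V → F} (hK : UniqueDiffOn ℝ K)
    (hS : UniqueDiffOn ℝ S) (h : ContDiffOn ℝ 1 (fun x : ℝ × V => f x.1 x.2) (K ×ˢ S))
    {O : Set V} (hO : IsOpen O) (hOS : O ⊆ S) : ParamContDiff 1 f K O := by
  refine ⟨h.continuousOn.mono (prod_mono_right hOS), fun t y =>
    fderivWithin ℝ (fun x : ℝ × V => f x.1 x.2) (K ×ˢ S) (t, y) ∘L ContinuousLinearMap.inr ℝ ℝ V,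
    fun t ht y hy => ?_, ?_⟩
  · have h1 := (h.differentiableOn (by simp) (t, y) ⟨ht, hOS hy⟩).hasFDerivWithinAt
    have h2 : HasFDerivAt (fun y : V => (t, y)) (ContinuousLinearMap.inr ℝ ℝ V) y :=
      hasFDerivAt_prodMk_right t y
    have h3 := HasFDerivWithinAt.comp (f := fun y : V => (t, y)) y h1
      (h2.hasFDerivWithinAt (s := O)) fun y' hy' => ⟨ht, hOS hy'⟩
    exact h3.hasFDerivAt (hO.mem_nhds hy)
  · have h1 := h.continuousOn_fderivWithin (hK.prod hS) le_rfl
    exact (((ContinuousLinearMap.compL ℝ V (ℝ × V) F).flip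
      (ContinuousLinearMap.inr ℝ ℝ V)).continuous.comp_continuousOn h1).mono (prod_mono_right hOS)

end ParamContDiff

/-! ### The chart domains of the blow-up as cylinders -/

section BlowDom

variable {n : ℕ} {i : Fin n}

/-- Multiplication of the `i`-th coordinate by a function of the other coordinates. -/
def scaleCoord (i : Fin n) (f : ℝ → ℝ) (u : Cn n) : Cn n :=
  WithLp.toLp 2 fun j => if j = i then (f (1 + ∑ l ∈ Finset.univ.erase i, ‖u l‖ ^ 2) : ℂ) * u i else u j

lemma contDiff_scaleCoord {m : ℕ} {f : ℝ → ℝ} (hf : ContDiffOn ℝ m f (Ioi 0)) :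
    ContDiff ℝ m (scaleCoord i f) := by
  unfold scaleCoord
  refine (PiLp.contDiff_toLp).comp (contDiff_pi.2 fun j => ?_)
  by_cases h : j = i
  · simp only [h, if_true]
    refine ContDiff.mul ?_ (contDiff_coord i)
    refine Complex.ofRealCLM.contDiff.comp ?_
    have h1 : ContDiff ℝ m fun u : Cn n => 1 + ∑ l ∈ Finset.univ.erase i, ‖u l‖ ^ 2 :=
      contDiff_const.add (ContDiff.sum fun l _ => (contDiff_coord l).norm_sq ℝ)
    exact hf.comp_contDiff h1 fun u => by
      have : 0 < 1 + ∑ l ∈ Finset.univ.erase i, ‖u l‖ ^ 2 := by positivity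
      exact this
  · simp only [h, if_false]; exact contDiff_coord j

lemma sum_erase_scaleCoord (f : ℝ → ℝ) (u : Cn n) :
    ∑ l ∈ Finset.univ.erase i, ‖scaleCoord i f u l‖ ^ 2 = ∑ l ∈ Finset.univ.erase i, ‖u l‖ ^ 2 :=
  Finset.sum_congr rfl fun l hl => by simp [scaleCoord, Finset.ne_of_mem_erase hl]

lemma scaleCoord_comp {f g : ℝ → ℝ} (h : ∀ x, 0 < x → f x * g x = 1) (u : Cn n) :
    scaleCoord i f (scaleCoord i g u) = u := by
  have hp : 0 < 1 + ∑ l ∈ Finset.univ.erase i, ‖u l‖ ^ 2 := by positivity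
  ext j
  by_cases hj : j = i
  · subst hj
    rw [scaleCoord, sum_erase_scaleCoord]
    have := h _ hp
    simp only [scaleCoord, if_true]
    rw [← mul_assoc, ← Complex.ofReal_mul, this]
    simp
  · simp [scaleCoord, hj]

/-- The part of the blow-up in an affine chart is diffeomorphic to a cylinder. -/
lemma exists_blowDom_diffeo (i : Fin n) : ∃ e : Cn n ≃ Cn n, (∀ m : ℕ, ContDiff ℝ m e) ∧
    (∀ m : ℕ, ContDiff ℝ m e.symm) ∧ blowDom i = e ⁻¹' {u | ‖u i‖ ≤ 1} := by
  have hm : ∀ x : ℝ, 0 < x → √x * (√x)⁻¹ = 1 := fun x hx =>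
    mul_inv_cancel₀ (Real.sqrt_pos.2 hx).ne'
  have hs : ∀ m : ℕ, ContDiffOn ℝ m Real.sqrt (Ioi 0) := fun m x hx =>
    (Real.contDiffAt_sqrt (ne_of_gt hx)).contDiffWithinAt
  refine ⟨⟨scaleCoord i Real.sqrt, scaleCoord i fun x => (√x)⁻¹,
    scaleCoord_comp fun x hx => by rw [mul_comm, hm x hx], scaleCoord_comp hm⟩,
    fun m => contDiff_scaleCoord (hs m), fun m => contDiff_scaleCoord
      ((hs m).inv fun x hx => (Real.sqrt_pos.2 hx).ne'), ?_⟩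
  ext u
  have hp : 0 < 1 + ∑ l ∈ Finset.univ.erase i, ‖u l‖ ^ 2 := by positivity
  have h1 : ‖blowChart i u‖ ^ 2 = ‖scaleCoord i Real.sqrt u i‖ ^ 2 := by
    rw [EuclideanSpace.norm_sq_eq, ← Finset.add_sum_erase _ _ (Finset.mem_univ i),
      Finset.sum_congr rfl (g := fun l => ‖u i‖ ^ 2 * ‖u l‖ ^ 2) fun l hl => by
        simp [blowChart, Finset.ne_of_mem_erase hl, mul_pow], ← Finset.mul_sum]
    simp only [blowChart, scaleCoord, if_true, norm_mul, mul_pow, Complex.norm_real,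
      Real.norm_eq_abs, sq_abs, Real.sq_sqrt hp.le]
    ring
  rw [blowDom, mem_preimage, mem_ofPred_eq, mem_ofPred_eq, ← sq_le_one_iff₀ (norm_nonneg _), h1,
    sq_le_one_iff₀ (norm_nonneg _)]
  rfl

lemma goodSet_blowDom : GoodSet (blowDom i) := by
  obtain ⟨e, h1, h2, h3⟩ := exists_blowDom_diffeo i
  rw [h3]
  refine GoodSet.preimage (Convex.goodSet ?_ ?_) e (h1 1) (h2 1)
  · have : {u : Cn n | ‖u i‖ ≤ 1} = (EuclideanSpace.proj i : Cn n →L[ℂ] ℂ).restrictScalars ℝ ⁻¹'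
      Metric.closedBall 0 1 := by ext u; simp
    rw [this]
    exact (convex_closedBall _ _).linear_preimage _
  · refine ⟨0, mem_interior_iff_mem_nhds.2 ?_⟩
    have : Continuous fun u : Cn n => ‖u i‖ := (contDiff_coord (m := 0) i).continuous.norm
    filter_upwards [this.continuousAt.eventually_lt continuousAt_const
      (show ‖(0 : Cn n) i‖ < 1 by simp)] with u hu using hu.le

end BlowDom

/-! ### Projections to 𝓩 and 𝓗, and dilations read in a chart -/

section Projections

variable {n : ℕ}

/-- The orthogonal projection to `𝓩_y`. -/
def projZ (y : Cn n) : Cn n →L[ℝ] Cn n :=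
  (((((‖y‖ : ℂ) ^ 2)⁻¹) • (innerSL ℂ y : Cn n →L[ℂ] ℂ)).smulRight y).restrictScalars ℝ

lemma projZ_apply (y h : Cn n) : projZ y h = ballTheta y h • y := by
  simp [projZ, ballTheta, div_eq_mul_inv, mul_comm]

lemma inner_sub_projZ {y : Cn n} (hy : y ≠ 0) (h : Cn n) : inner ℂ y (h - projZ y h) = (0 : ℂ) := by
  rw [← ballTheta_eq_zero hy, ballTheta_sub, projZ_apply, ballTheta_smul, ballTheta_self hy]
  ring

lemma projZ_smul_self {y : Cn n} (hy : y ≠ 0) (c : ℂ) : projZ y (c • y) = c • y := by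
  rw [projZ_apply, ballTheta_smul, ballTheta_self hy, mul_one]

lemma projZ_eq_zero {y : Cn n} {h : Cn n} (hh : inner ℂ y h = (0 : ℂ)) : projZ y h = 0 := by
  rw [projZ_apply, ballTheta, hh, zero_div, zero_smul]

lemma contDiffOn_projZ {m : ℕ} : ContDiffOn ℝ m (projZ (n := n)) {0}ᶜ := by
  rw [contDiffOn_clm_apply]
  intro h
  simp only [projZ_apply]
  refine ContDiffOn.fun_smul ?_ contDiffOn_id
  exact ((contDiffOn_ballTheta (n := n)).of_le (m := m) (by exact_mod_cast le_top)).comp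
    (f := fun y : Cn n => (y, h)) (contDiffOn_id.prodMk contDiffOn_const) fun y hy => hy

/-- The orthogonal projection to `𝓗_y`. -/
def projH (y : Cn n) : Cn n →L[ℝ] Cn n := ContinuousLinearMap.id ℝ (Cn n) - projZ y

lemma projH_apply (y h : Cn n) : projH y h = h - projZ y h := rfl

lemma contDiffOn_projH {m : ℕ} : ContDiffOn ℝ m (projH (n := n)) {0}ᶜ :=
  contDiffOn_const.sub contDiffOn_projZ

/-- Multiplication of the `i`-th coordinate by `r`. -/
def scaleLin (i : Fin n) (r : ℝ) : Cn n →L[ℝ] Cn n :=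
  ContinuousLinearMap.id ℝ _ + (r - 1) •
    ((EuclideanSpace.proj i : Cn n →L[ℂ] ℂ).smulRight (EuclideanSpace.single i (1 : ℂ))).restrictScalars ℝ

lemma scaleLin_apply (i : Fin n) (r : ℝ) (k : Cn n) (j : Fin n) :
    scaleLin i r k j = if j = i then r * k j else k j := by
  by_cases h : j = i
  · subst h
    simp [scaleLin]; ring
  · simp [scaleLin, h]

lemma contDiff_scaleLin {m : ℕ} (i : Fin n) : ContDiff ℝ m (scaleLin i) :=
  contDiff_const.add ((contDiff_id.sub contDiff_const).smul contDiff_const)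

end Projections

/-! ### Extension of J across the exceptional divisor -/

section Extension

variable {n : ℕ} {i : Fin n}

/-- In a chart the dilation by r only multiplies the i-th coordinate, an operation which still makes
sense at r = 0. This is what gives access to the divisor from (r, y). -/
lemma scaleLin_blowInv {r : ℝ} (hr : r ≠ 0) {y : Cn n} :
    scaleLin i r (blowInv i y) = blowInv i (r • y) := by
  ext j
  rw [scaleLin_apply]
  by_cases h : j = i
  · subst h; simp [blowInv_self]
  · have : (r : ℂ) ≠ 0 := by exact_mod_cast hr
    simp [h, blowInv_of_ne, mul_div_mul_left _ _ this]

lemma blowChart_scaleLin (r : ℝ) (k : Cn n) : blowChart i (scaleLin i r k) = r • blowChart i k := by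
  ext j
  by_cases h : j = i
  · subst h; simp [blowChart_self, scaleLin_apply]
  · simp [h, blowChart_of_ne, scaleLin_apply, mul_assoc]

lemma fderiv_blowInv_smul {r : ℝ} (hr : r ≠ 0) {y : Cn n} (hy : y i ≠ 0) (h : Cn n) :
    r • fderiv ℝ (blowInv i) (r • y) h = scaleLin i r (fderiv ℝ (blowInv i) y h) := by
  have hry : (r • y) i ≠ 0 := by simp [hr, hy]
  have h1 : HasFDerivAt (fun y => blowInv i (r • y)) (fderiv ℝ (blowInv i) (r • y) ∘L
      (r • ContinuousLinearMap.id ℝ (Cn n))) y :=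
    HasFDerivAt.comp y ((contDiffAt_blowInv (m := 1) hry).differentiableAt one_ne_zero).hasFDerivAt
      ((hasFDerivAt_id y).const_smul r)
  have h2 : HasFDerivAt (fun y => scaleLin i r (blowInv i y)) (scaleLin i r ∘L
      fderiv ℝ (blowInv i) y) y := (scaleLin i r).hasFDerivAt.comp y
    ((contDiffAt_blowInv (m := 1) hy).differentiableAt one_ne_zero).hasFDerivAt
  have h3 : (fun y => scaleLin i r (blowInv i y)) = fun y => blowInv i (r • y) :=
    funext fun y => scaleLin_blowInv hr
  rw [h3] at h2
  have := congrArg (fun L => L h) (h1.unique h2)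
  simpa using this

lemma fderiv_blowChart_scaleLin (r : ℝ) (k h : Cn n) :
    fderiv ℝ (blowChart i) (scaleLin i r k) (scaleLin i r h) = r • fderiv ℝ (blowChart i) k h := by
  have hd : ∀ k, HasFDerivAt (blowChart i) (fderiv ℝ (blowChart i) k) k := fun k =>
    ((contDiff_blowChart (m := 1)).differentiable one_ne_zero k).hasFDerivAt
  have h1 := (hd (scaleLin i r k)).comp k (scaleLin i r).hasFDerivAt
  have h2 := (hd k).const_smul r
  have h3 : blowChart i ∘ scaleLin i r = fun k => r • blowChart i k :=
    funext fun k => blowChart_scaleLin r k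
  rw [h3] at h1
  exact congrArg (fun L => L h) (h1.unique h2)

lemma scaleLin_scaleLin_inv {r : ℝ} (hr : r ≠ 0) (h : Cn n) :
    scaleLin i r (scaleLin i r⁻¹ h) = h := by
  have : (r : ℂ) ≠ 0 := by exact_mod_cast hr
  ext j
  by_cases hj : j = i
  · subst hj; simp [scaleLin_apply, this]
  · simp [scaleLin_apply, hj]

/-- The expression of a tensor field near the exceptional divisor. -/
def blowExt (i : Fin n) (G : ℝ × Cn n → Cn n →L[ℝ] Cn n) (t : ℝ) (x : ℝ × Cn n) :
    Cn n →L[ℝ] Cn n :=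
  projH x.2 ∘L (fderiv ℝ (blowChart i) (blowInv i x.2) ∘L
    (G (t, scaleLin i x.1 (blowInv i x.2)) ∘L (scaleLin i x.1 ∘L (fderiv ℝ (blowInv i) x.2 ∘L
      projH x.2)))) +
  fderiv ℝ (blowChart i) (scaleLin i x.1 (blowInv i x.2)) ∘L
    (G (t, scaleLin i x.1 (blowInv i x.2)) ∘L (fderiv ℝ (blowInv i) x.2 ∘L projZ x.2))

/-- The i-th coordinate line of the chart lies over the complex line of y, so its direction is
carried into 𝓩. -/
lemma fderiv_blowChart_single {y : Cn n} (hy : y i ≠ 0) (c : ℂ) :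
    fderiv ℝ (blowChart i) (blowInv i y) (EuclideanSpace.single i c) = (c / y i) • y := by
  have hd : HasFDerivAt (blowChart i) (fderiv ℝ (blowChart i) (blowInv i y)) (blowInv i y) :=
    ((contDiff_blowChart (m := 1)).differentiable one_ne_zero _).hasFDerivAt
  have hl : HasDerivAt (fun s : ℝ => blowInv i y + s • EuclideanSpace.single i c)
      (EuclideanSpace.single i c) 0 := by
    simpa using ((hasDerivAt_id (0 : ℝ)).smul_const (EuclideanSpace.single i c)).const_add
      (blowInv i y)
  have h1 := HasFDerivAt.comp_hasDerivAt (f := fun s : ℝ => blowInv i y + s • EuclideanSpace.single i c)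
    (l := blowChart i) (l' := fderiv ℝ (blowChart i) (blowInv i y)) 0 (by simpa using hd) hl
  have h2 : HasDerivAt (fun s : ℝ => y + s • ((c / y i) • y)) ((c / y i) • y) 0 := by
    simpa using ((hasDerivAt_id (0 : ℝ)).smul_const ((c / y i) • y)).const_add y
  have h3 : (blowChart i ∘ fun s : ℝ => blowInv i y + s • EuclideanSpace.single i c) =
      fun s : ℝ => y + s • ((c / y i) • y) := by
    funext s
    ext j
    by_cases h : j = i
    · subst h
      simp [blowChart_self, blowInv_self, div_mul_cancel₀ _ hy]
    · simp only [Function.comp, blowChart_of_ne _ h, PiLp.add_apply, PiLp.smul_apply,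
        blowInv_self, blowInv_of_ne _ h, PiLp.single_apply, h, if_true, if_false,
        smul_zero, add_zero, Complex.real_smul, smul_eq_mul]
      field_simp
  rw [h3] at h1
  exact h1.unique h2

/-- The dilation alters only the i-th coordinate, whose image lies in 𝓩 and is killed by the
projection. A singular factor r⁻¹ is removed in this way. -/
lemma projH_fderiv_blowChart {y : Cn n} (hy : y i ≠ 0) (r : ℝ) (h : Cn n) :
    projH y (fderiv ℝ (blowChart i) (blowInv i y) (scaleLin i r h)) =
      projH y (fderiv ℝ (blowChart i) (blowInv i y) h) := by
  have hy0 : y ≠ 0 := fun h => hy (by simp [h])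
  have h1 : scaleLin i r h = h + EuclideanSpace.single i (((r : ℂ) - 1) * h i) := by
    ext j
    by_cases hj : j = i
    · subst hj; simp [scaleLin_apply]; ring
    · simp [scaleLin_apply, hj]
  rw [h1, map_add, map_add, fderiv_blowChart_single hy, projH_apply y (_ • y),
    projZ_smul_self hy0, sub_self, add_zero]

/-- On 𝓗, the chart expression is conjugated by the dilation. Its only negative power of r sits in a
direction tangent to 𝓩, and can be projected away because J preserves 𝓗. On 𝓩, the differential of
`blowInv` takes the same values at y and at r y, so no negative power of r appears. -/
lemma blowExt_eq {Jt : ℝ → EndField n} {G : ℝ × Cn n → (Cn n →L[ℝ] Cn n)} {t : ℝ}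
    (hG : ∀ u ∈ blowDom i, u i ≠ 0 → G (t, u) = pullEnd (blowChart i) (Jt t) u)
    (hP : PreservesH (Jt t)) {r : ℝ} (hr : r ≠ 0) {y : Cn n} (hy : y i ≠ 0) (hry : ‖r • y‖ ≤ 1) :
    blowExt i G t (r, y) = Jt t (r • y) := by
  have hryi : (r • y) i ≠ 0 := by simp [hr, hy]
  have hy0 : y ≠ 0 := fun h => hy (by simp [h])
  have hJ := eq_pullEnd_blowChart (i := i) (Jt t) hryi
  rw [← hG _ (blowInv_mem_blowDom hryi hry) (by rwa [blowInv_self]), ← scaleLin_blowInv hr] at hJ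
  have hJ' : ∀ h, Jt t (r • y) h = fderiv ℝ (blowChart i) (blowInv i y) (scaleLin i r⁻¹
      (G (t, scaleLin i r (blowInv i y)) (scaleLin i r (fderiv ℝ (blowInv i) y h)))) := by
    intro h
    rw [← fderiv_blowInv_smul hr hy, _root_.map_smul, _root_.map_smul, _root_.map_smul,
      ← fderiv_blowChart_scaleLin, scaleLin_scaleLin_inv hr, hJ]
    rfl
  have hmem : r • y ∈ puncturedBall n := ⟨smul_ne_zero hr hy0, hry⟩
  ext1 h
  have hH : Jt t (r • y) (h - projZ y h) = projH y
      (Jt t (r • y) (h - projZ y h)) := by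
    have h1 := hP _ hmem (h - projZ y h) (by
      rw [← Complex.coe_smul, inner_smul_left, inner_sub_projZ hy0, mul_zero])
    rw [← Complex.coe_smul, inner_smul_left, mul_eq_zero, or_iff_right (by simpa using hr), Complex.coe_smul] at h1
    rw [projH_apply, projZ_eq_zero h1, sub_zero]
  have hZ : Jt t (r • y) (projZ y h) = fderiv ℝ (blowChart i) (scaleLin i r (blowInv i y))
      (G (t, scaleLin i r (blowInv i y)) (fderiv ℝ (blowInv i) y (projZ y h))) := by
    have h1 : fderiv ℝ (blowInv i) y (projZ y h) =
        EuclideanSpace.single i (ballTheta y h * y i) := by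
      rw [← (fderiv_blowInv_blowChart hy (EuclideanSpace.single i (ballTheta y h * y i))).1,
        fderiv_blowChart_single hy, mul_div_cancel_right₀ _ hy, projZ_apply]
    have h2 : fderiv ℝ (blowInv i) (r • y) (projZ y h) =
        EuclideanSpace.single i (ballTheta y h * y i) := by
      rw [← (fderiv_blowInv_blowChart hryi (EuclideanSpace.single i (ballTheta y h * y i))).1,
        fderiv_blowChart_single hryi, projZ_apply, PiLp.smul_apply, ← Complex.coe_smul,
        ← Complex.coe_smul, smul_smul, smul_eq_mul]
      have : (r : ℂ) ≠ 0 := by exact_mod_cast hr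
      congr 2
      field_simp
    rw [h1, ← h2, hJ]
    rfl
  have hs : Jt t (r • y) h = Jt t (r • y) (h - projZ y h) + Jt t (r • y) (projZ y h) := by
    rw [← map_add, sub_add_cancel]
  rw [hs, hZ, hH, hJ', projH_fderiv_blowChart hy]
  rfl

/-- No division by r is left in the expression, which is therefore C¹ through r = 0 and for negative
r. The bounds on r and y keep the argument of G inside the chart domain. -/
lemma paramContDiff_blowExt {G : ℝ × Cn n → (Cn n →L[ℝ] Cn n)}
    (hG : ContDiffOn ℝ 1 G (Icc (0 : ℝ) 1 ×ˢ blowDom i)) :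
    ParamContDiff 1 (blowExt i G) (Icc 0 1) (Ioo (-1) 1 ×ˢ {y : Cn n | y i ≠ 0 ∧ ‖y‖ < 1}) := by
  have hcoord : Continuous fun y : Cn n => y i := (contDiff_coord (m := 0) i).continuous
  have hO : IsOpen {y : Cn n | y i ≠ 0 ∧ ‖y‖ < 1} :=
    (isOpen_ne_fun hcoord continuous_const).inter (isOpen_lt continuous_norm continuous_const)
  have hO' : IsOpen (Ioo (-1 : ℝ) 1 ×ˢ {y : Cn n | y i ≠ 0 ∧ ‖y‖ < 1}) := isOpen_Ioo.prod hO
  have hT : IsOpen {u : Cn n | ‖blowChart i u‖ < 1} :=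
    isOpen_lt (contDiff_blowChart (m := 0)).continuous.norm continuous_const
  have hG' : ParamContDiff 1 (fun t u => G (t, u)) (Icc 0 1) {u : Cn n | ‖blowChart i u‖ < 1} :=
    ParamContDiff.of_contDiffOn_prod uniqueDiffOn_Icc_zero_one goodSet_blowDom.1 hG hT
      fun u hu => (le_of_lt hu : ‖blowChart i u‖ ≤ 1)
  have s1 : ContDiffOn ℝ 1 (fun x : ℝ × Cn n => blowInv i x.2)
      (Ioo (-1 : ℝ) 1 ×ˢ {y : Cn n | y i ≠ 0 ∧ ‖y‖ < 1}) := fun x hx =>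
    ((contDiffAt_blowInv hx.2.1).comp x contDiffAt_snd).contDiffWithinAt
  have s2 : ContDiffOn ℝ 1 (fun x : ℝ × Cn n => scaleLin i x.1)
      (Ioo (-1 : ℝ) 1 ×ˢ {y : Cn n | y i ≠ 0 ∧ ‖y‖ < 1}) :=
    ((contDiff_scaleLin i).comp contDiff_fst).contDiffOn
  have s3 := s2.clm_apply s1
  have s4 : ContDiffOn ℝ 1 (fun x : ℝ × Cn n => projZ x.2)
      (Ioo (-1 : ℝ) 1 ×ˢ {y : Cn n | y i ≠ 0 ∧ ‖y‖ < 1}) :=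
    contDiffOn_projZ.comp contDiffOn_snd fun x hx h => hx.2.1 (by
      have : x.2 = 0 := h
      simp [this])
  have s5 : ContDiffOn ℝ 1 (fun x : ℝ × Cn n => fderiv ℝ (blowInv i) x.2)
      (Ioo (-1 : ℝ) 1 ×ˢ {y : Cn n | y i ≠ 0 ∧ ‖y‖ < 1}) :=
    contDiffOn_fderiv_blowInv.comp contDiffOn_snd fun x hx => hx.2.1
  have hB : ContDiff ℝ 1 (fderiv ℝ (blowChart (n := n) i)) :=
    (contDiff_blowChart (m := 2)).fderiv_right (by norm_num)
  have s6 : ContDiffOn ℝ 1 (fun x : ℝ × Cn n => projH x.2)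
      (Ioo (-1 : ℝ) 1 ×ˢ {y : Cn n | y i ≠ 0 ∧ ‖y‖ < 1}) := contDiffOn_const.sub s4
  have p := fun {F : Type} [NormedAddCommGroup F] [NormedSpace ℝ F] {f : ℝ × Cn n → F}
    (h : ContDiffOn ℝ 1 f (Ioo (-1 : ℝ) 1 ×ˢ {y : Cn n | y i ≠ 0 ∧ ‖y‖ < 1})) =>
    ParamContDiff.of_contDiffOn (P := ℝ) (Q := Icc 0 1) hO' (m := 1) (f := f) h
  have pG := hG'.comp (p s3) fun t _ x hx => by
    have hx1 : |x.1| < 1 := abs_lt.2 hx.1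
    show ‖blowChart i (scaleLin i x.1 (blowInv i x.2))‖ < 1
    rw [blowChart_scaleLin, blowChart_blowInv hx.2.1, norm_smul, Real.norm_eq_abs]
    exact mul_lt_one_of_nonneg_of_lt_one_left (abs_nonneg _) hx1 hx.2.2.le
  have cl := fun {f g : ℝ → ℝ × Cn n → (Cn n →L[ℝ] Cn n)}
    (hf : ParamContDiff 1 f (Icc 0 1) (Ioo (-1) 1 ×ˢ {y : Cn n | y i ≠ 0 ∧ ‖y‖ < 1}))
    (hg : ParamContDiff 1 g (Icc 0 1) (Ioo (-1) 1 ×ˢ {y : Cn n | y i ≠ 0 ∧ ‖y‖ < 1})) =>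
    ParamContDiff.bilin (ContinuousLinearMap.compL ℝ (Cn n) (Cn n) (Cn n)) hf hg
  exact (cl (p s6) (cl (p (hB.comp_contDiffOn s1)) (cl pG (cl (p s2) (cl (p s5) (p s6)))))).add
    (cl (p (hB.comp_contDiffOn s3)) (cl pG (cl (p s5) (p s4))))

end Extension

/-! ### Parametrized families: iterated derivatives, inverses -/

namespace ParamContDiff

variable {P V F : Type} [TopologicalSpace P] [NormedAddCommGroup V] [NormedSpace ℝ V]
  [NormedAddCommGroup F] [NormedSpace ℝ F] {Q : Set P} {O : Set V}

lemma of_iteratedFDeriv (hO : IsOpen O) : ∀ {m : ℕ} {F : Type} [NormedAddCommGroup F]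
    [NormedSpace ℝ F] {f : P → V → F}, (∀ q ∈ Q, ContDiffOn ℝ m (f q) O) →
    (∀ j ≤ m, ContinuousOn (fun x : P × V => iteratedFDeriv ℝ j (f x.1) x.2) (Q ×ˢ O)) →
    ParamContDiff m f Q O := by
  intro m
  have hz : ∀ {F : Type} [NormedAddCommGroup F] [NormedSpace ℝ F] {f : P → V → F},
      ContinuousOn (fun x : P × V => iteratedFDeriv ℝ 0 (f x.1) x.2) (Q ×ˢ O) →
      ContinuousOn (fun x : P × V => f x.1 x.2) (Q ×ˢ O) := by
    intro F _ _ f h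
    have := (continuousMultilinearCurryFin0 ℝ V F).continuous.comp_continuousOn h
    exact this
  induction m with
  | zero => exact fun _ h => hz (h 0 le_rfl)
  | succ m ih =>
    intro F _ _ f hd h
    refine of_fderiv (hz (h 0 (Nat.zero_le _))) (fun q hq y hy =>
      ((hd q hq).contDiffAt (hO.mem_nhds hy)).differentiableAt (by simp))
      (ih (fun q hq => (hd q hq).fderiv_of_isOpen hO (by simp)) fun j hj => ?_)
    have h1 := (continuousMultilinearCurryRightEquiv' ℝ j V F).symm.symm.continuous.comp_continuousOn
      (h (j + 1) (by omega))
    refine h1.congr fun x _ => ?_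
    simp [iteratedFDeriv_succ_eq_comp_right]

lemma inverse {m : ℕ} {f : P → V → (F →L[ℝ] F)} [CompleteSpace F] (h : ParamContDiff m f Q O)
    (hi : ∀ q ∈ Q, ∀ y ∈ O, (f q y).IsInvertible) :
    ParamContDiff m (fun q y => (f q y).inverse) Q O := by
  refine smooth_comp (T := range ((↑) : (F ≃L[ℝ] F) → F →L[ℝ] F)) (f := ContinuousLinearMap.inverse)
    ContinuousLinearEquiv.isOpen ?_ h fun q hq y hy => hi q hq y hy
  rintro _ ⟨e, rfl⟩
  exact (contDiffAt_map_inverse e).contDiffWithinAt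

end ParamContDiff

/-- Families of complex structures and special vector fields, with explicit functions `Ỹ^α`. -/
structure IsSpecialFamily {n : ℕ} (k : ℕ) (a b : ℝ) (Jt : ℝ → EndField n) (X : ℝ → VField n)
    (v : ℝ → Cn n) (Ψ : ℝ → Cn n ≃ Cn n) (σ : ℝ → Cn n → ℝ)
    (Y : ℝ → (i : Fin n) → Aff i × ℂ → {j : Fin n // j ≠ i} → ℂ) : Prop where
  two_le : 2 ≤ k
  a_nonneg : 0 ≤ a
  a_le : a ≤ 1
  guide : ContinuousOn v (Icc 0 1)
  guide_ne_zero : ∀ t ∈ Icc (0 : ℝ) 1, v t ≠ 0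
  J_regular : FamilyClassOnBlowUp 1 b Jt
  X_regular : ContDiffOn ℝ 1 (fun q : ℝ × Cn n => X q.1 q.2) (Icc (0 : ℝ) 1 ×ˢ puncturedBall n)
  Psi_regular : ∀ m : ℕ, m ≤ k + 1 →
    ContinuousOn (fun q : ℝ × Cn n => iteratedFDeriv ℝ m (Ψ q.1) q.2) (Icc (0 : ℝ) 1 ×ˢ {0}ᶜ)
  complexStructure : ∀ t ∈ Icc (0 : ℝ) 1, IsComplexStructure k a (Jt t)
  preservesH : ∀ t ∈ Icc (0 : ℝ) 1, PreservesH (Jt t)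
  circular : ∀ t ∈ Icc (0 : ℝ) 1, IsCircularRep k a (Jt t) (Ψ t)
  special : ∀ t ∈ Icc (0 : ℝ) 1, IsSpecial k a (Ψ t) (v t) (σ t) (Y t) (X t)
  explicit : ∀ t ∈ Icc (0 : ℝ) 1, ∀ i, ∀ p ∈ polarDom (Ψ t) i, ∀ α,
    Y t i p α = explicitY (Ψ t) i (Jt t) (v t) (σ t) p α
  zbar : ∀ t ∈ Icc (0 : ℝ) 1, ZbarCondition (Jt t) (X t)
  evolution : ∀ t ∈ Icc (0 : ℝ) 1, ∀ z ∈ puncturedOpenBall n, ∀ h : Cn n,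
    HasDerivWithinAt (fun s => Jt s z h) (-lieDer (X t) (Jt t) z h) (Icc 0 1) t

/-! ### Joint regularity of Ψ_t and of its inverse -/

namespace IsSpecialFamily

variable {n k : ℕ} {a b : ℝ} {Jt : ℝ → EndField n} {X : ℝ → VField n} {v : ℝ → Cn n}
  {Ψ : ℝ → Cn n ≃ Cn n} {σ : ℝ → Cn n → ℝ}
  {Y : ℝ → (i : Fin n) → Aff i × ℂ → {j : Fin n // j ≠ i} → ℂ}
  (hF : IsSpecialFamily k a b Jt X v Ψ σ Y)
include hF

/-- Since k ≥ 2 there are three derivatives of Ψ. They give two of θ(v), hence a differential of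
θ(v) of class C¹, as needed for the C¹ extension of X. -/
lemma param_Psi : ParamContDiff 3 (fun t z => Ψ t z) (Icc 0 1) {0}ᶜ := by
  have hk := hF.two_le
  exact ParamContDiff.of_iteratedFDeriv isOpen_compl_singleton
    (fun t ht => (hF.circular t ht).regular.1.of_le (by norm_cast; omega))
    fun j hj => hF.Psi_regular j (by omega)

lemma exists_norm_bounds : ∃ m M : ℝ, 0 < m ∧ 0 < M ∧ ∀ t ∈ Icc (0 : ℝ) 1, ∀ z : Cn n, z ≠ 0 →
    m * ‖z‖ ≤ ‖Ψ t z‖ ∧ ‖Ψ t z‖ ≤ M * ‖z‖ := by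
  have hc : ContinuousOn (fun q : ℝ × Cn n => ‖Ψ q.1 q.2‖) (Icc 0 1 ×ˢ Metric.sphere 0 1) :=
    (hF.param_Psi.continuousOn.mono (prod_mono_right fun z hz h => by
      have : z = 0 := h
      simp [this] at hz)).norm
  have hK : IsCompact (Icc (0 : ℝ) 1 ×ˢ Metric.sphere (0 : Cn n) 1) :=
    isCompact_Icc.prod (isCompact_sphere _ _)
  have hpos : ∀ q ∈ Icc (0 : ℝ) 1 ×ˢ Metric.sphere (0 : Cn n) 1, 0 < ‖Ψ q.1 q.2‖ := fun q hq =>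
    norm_pos_iff.2 ((hF.circular q.1 hq.1).map_ne_zero fun h => by
      have := hq.2; simp [h] at this)
  obtain ⟨m, hm, hm'⟩ := hK.exists_forall_le' hc (a := 0) hpos
  obtain ⟨M, hM⟩ := (hK.image_of_continuousOn hc).isBounded.subset_closedBall 0
  refine ⟨m, max M 1, hm, by positivity, fun t ht z hz => ?_⟩
  have hz' : 0 < ‖z‖ := norm_pos_iff.2 hz
  have hu : ‖z‖⁻¹ • z ∈ Metric.sphere (0 : Cn n) 1 := by simp [norm_smul, hz'.ne']
  have he : ‖Ψ t z‖ = ‖Ψ t (‖z‖⁻¹ • z)‖ * ‖z‖ := by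
    rw [← Complex.coe_smul, (hF.circular t ht).map_smul, norm_smul]
    simp [field]
  have h1 : m ≤ ‖Ψ t (‖z‖⁻¹ • z)‖ := hm' (t, ‖z‖⁻¹ • z) ⟨ht, hu⟩
  have h2 := hM (mem_image_of_mem _ (show (t, ‖z‖⁻¹ • z) ∈ _ from ⟨ht, hu⟩))
  rw [Metric.mem_closedBall, dist_zero_right, norm_norm] at h2
  rw [he]
  exact ⟨mul_le_mul_of_nonneg_right h1 hz'.le,
    mul_le_mul_of_nonneg_right (h2.trans (le_max_left _ _)) hz'.le⟩

/-- The norm bounds, uniform in t, keep the preimages of points near y in a compact annulus. By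
joint continuity every cluster point z satisfies Ψ_t z = y, so it is unique. -/
lemma continuousOn_symm : ContinuousOn (fun q : ℝ × Cn n => (Ψ q.1).symm q.2)
    (Icc (0 : ℝ) 1 ×ˢ {0}ᶜ) := by
  rintro ⟨t, y⟩ ⟨ht, hy⟩
  obtain ⟨m, M, hm, hM, hb⟩ := hF.exists_norm_bounds
  have hy' : 0 < ‖y‖ := norm_pos_iff.2 hy
  have hK : IsCompact (Metric.closedBall (0 : Cn n) (2 * ‖y‖ / m) \ Metric.ball 0 (‖y‖ / 2 / M)) :=
    (isCompact_closedBall _ _).diff Metric.isOpen_ball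
  refine hK.tendsto_nhds_of_unique_mapClusterPt ?_ ?_
  · have h1 : ∀ᶠ q : ℝ × Cn n in 𝓝[Icc (0 : ℝ) 1 ×ˢ {0}ᶜ] (t, y),
        ‖y‖ / 2 < ‖q.2‖ ∧ ‖q.2‖ < 2 * ‖y‖ := by
      have hc : ContinuousAt (fun q : ℝ × Cn n => ‖q.2‖) (t, y) := continuous_snd.norm.continuousAt
      exact nhdsWithin_le_nhds ((hc.eventually_const_lt (show ‖y‖ / 2 < ‖y‖ by linarith)).and
        (hc.eventually_lt_const (show ‖y‖ < 2 * ‖y‖ by linarith)))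
    filter_upwards [h1, self_mem_nhdsWithin] with q hq hq'
    obtain ⟨b1, b2⟩ := hb q.1 hq'.1 _ ((hF.circular q.1 hq'.1).symm_ne_zero hq'.2)
    rw [Equiv.apply_symm_apply] at b1 b2
    constructor
    · rw [Metric.mem_closedBall, dist_zero_right, le_div_iff₀ hm]
      linarith
    · rw [Metric.mem_ball, dist_zero_right, not_lt, div_le_iff₀ hM]
      linarith
  · intro z hz hcl
    have hz0 : z ≠ 0 := fun h => hz.2 (by rw [h]; exact Metric.mem_ball_self (by positivity))
    obtain ⟨U, hU, hUz⟩ := mapClusterPt_iff_ultrafilter.1 hcl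
    have h1 : Tendsto (fun q : ℝ × Cn n => (q.1, (Ψ q.1).symm q.2)) U
        (𝓝[Icc (0 : ℝ) 1 ×ˢ {0}ᶜ] (t, z)) := by
      refine tendsto_nhdsWithin_iff.2 ⟨Tendsto.prodMk_nhds ?_ hUz, ?_⟩
      · exact (continuous_fst.tendsto (t, y)).mono_left (hU.trans nhdsWithin_le_nhds)
      · have : ∀ᶠ q : ℝ × Cn n in U, q ∈ Icc (0 : ℝ) 1 ×ˢ {0}ᶜ := hU self_mem_nhdsWithin
        filter_upwards [this] with q hq
        exact ⟨hq.1, (hF.circular q.1 hq.1).symm_ne_zero hq.2⟩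
    have h2 := (hF.param_Psi.continuousOn (t, z) ⟨ht, hz0⟩).tendsto.comp h1
    have h3 : Tendsto (fun q : ℝ × Cn n => q.2) U (𝓝 y) :=
      (continuous_snd.tendsto (t, y)).mono_left (hU.trans nhdsWithin_le_nhds)
    have h4 : y = Ψ t z := tendsto_nhds_unique h3 (by simpa [Function.comp_def] using h2)
    show z = (Ψ t).symm y
    rw [h4, Equiv.symm_apply_apply]

lemma mapsTo_symm : ∀ t ∈ Icc (0 : ℝ) 1, MapsTo (fun y => (Ψ t).symm y) {0}ᶜ {0}ᶜ :=
  fun t ht _ hy => (hF.circular t ht).symm_ne_zero hy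

/-- Bootstrap: the derivative of the inverse map is the inverse of the derivative of Ψ evaluated at
the inverse map, which gains one order at each step. -/
lemma param_symm : ∀ {m : ℕ}, m ≤ 3 →
    ParamContDiff m (fun t y => (Ψ t).symm y) (Icc 0 1) {0}ᶜ := by
  intro m
  induction m with
  | zero => exact fun _ => hF.continuousOn_symm
  | succ m ih =>
    intro hm
    have hd : ∀ t ∈ Icc (0 : ℝ) 1, ∀ y ∈ ({0}ᶜ : Set (Cn n)),
        DifferentiableAt ℝ (fun y => (Ψ t).symm y) y := fun t ht y hy =>
      ((hF.circular t ht).symm_contDiffAt hy).differentiableAt (by norm_cast)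
    refine ParamContDiff.of_fderiv hF.continuousOn_symm hd ?_
    have h1 : ParamContDiff m (fun t => fderiv ℝ (Ψ t)) (Icc 0 1) {0}ᶜ := by
      have h2 := hF.param_Psi.fderiv isOpen_compl_singleton
      have hm' : m ≤ 2 := by omega
      interval_cases m
      · exact h2.pred.pred
      · exact h2.pred
      · exact h2
    refine ((h1.comp (ih (by omega)) hF.mapsTo_symm).inverse fun t ht y hy =>
      (hF.circular t ht).invertible _ ((hF.circular t ht).symm_ne_zero hy)).congr
        isOpen_compl_singleton fun t ht y hy => ?_
    exact (hF.circular t ht).fderiv_symm hy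

/-- The function `y ↦ θ(DΨ v)`. -/
lemma param_theta : ParamContDiff 2 (fun t y => theta (Ψ t) ((Ψ t).symm y) (v t)) (Icc 0 1)
    ({0}ᶜ : Set (Cn n)) := by
  have h1 := (hF.param_Psi.fderiv isOpen_compl_singleton).comp (hF.param_symm (by norm_num))
    hF.mapsTo_symm
  have h2 := ParamContDiff.bilin (ContinuousLinearMap.id ℝ (Cn n →L[ℝ] Cn n)) h1
    (ParamContDiff.param hF.guide)
  have h3 := ParamContDiff.smooth_comp isOpen_fst_ne_zero
    ((contDiffOn_ballTheta (n := n)).of_le (m := (2 : ℕ)) (WithTop.coe_le_coe.2 le_top))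
    ((ParamContDiff.of_contDiffOn isOpen_compl_singleton contDiffOn_id).prodMk h2)
    fun t ht y hy => hy
  refine h3.congr isOpen_compl_singleton fun t ht y hy => ?_
  rw [theta, Equiv.apply_symm_apply]
  rfl

end IsSpecialFamily

/-! ### Reconstruction of a special field from J, θ(v) and σ -/

section FieldFormula

variable {n : ℕ}

/-- The solution `w` of `-2 Im ⟨w, h⟩ = m(h)`. -/
def symVec : (Cn n →L[ℝ] ℝ) →L[ℝ] Cn n :=
  ∑ j, ((ContinuousLinearMap.apply ℝ ℝ (EuclideanSpace.single j (1 : ℂ))).smulRight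
      ((Complex.I / 2) • EuclideanSpace.single j (1 : ℂ)) +
    (ContinuousLinearMap.apply ℝ ℝ (EuclideanSpace.single j Complex.I)).smulRight
      ((-(1 / 2) : ℂ) • EuclideanSpace.single j (1 : ℂ)))

lemma eq_symVec {w : Cn n} {m : Cn n →L[ℝ] ℝ} (h : ∀ u, -2 * (inner ℂ w u : ℂ).im = m u) :
    w = symVec m := by
  have e : ∀ j, m (EuclideanSpace.single j (1 : ℂ)) = 2 * (w j).im ∧
      m (EuclideanSpace.single j Complex.I) = -2 * (w j).re := by
    intro j
    rw [← h, ← h]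
    simp [EuclideanSpace.inner_single_right]
  have hw : w = ∑ j, w j • EuclideanSpace.single j (1 : ℂ) := by
    ext l
    simp [Pi.single_apply]
  refine hw.trans ?_
  rw [symVec, _root_.sum_apply]
  refine Finset.sum_congr rfl fun j _ => ?_
  simp only [_root_.add_apply, ContinuousLinearMap.smulRight_apply,
    ContinuousLinearMap.apply_apply, (e j).1, (e j).2, ← Complex.coe_smul, smul_smul, ← add_smul]
  congr 1
  apply Complex.ext <;> simp <;> ring

/-- The part of a special field which does not depend on `σ`, along the dilations of `y`. -/
def radialField (j : Cn n →L[ℝ] Cn n) (φ : ℂ) (φ' : Cn n →L[ℝ] ℂ) (r : ℝ) (y : Cn n) : Cn n :=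
  (φ - ((r ^ 2 * ‖y‖ ^ 2 : ℝ) : ℂ) * star φ) • y +
    symVec ((‖y‖ ^ 2 • ((1 - r ^ 2 * ‖y‖ ^ 2) • (Complex.reCLM ∘L (φ' ∘L j)) +
      (1 + r ^ 2 * ‖y‖ ^ 2) • (Complex.imCLM ∘L φ'))) ∘L projH y)

lemma fderiv_smul_of_homogeneous {F : Type} [NormedAddCommGroup F] [NormedSpace ℝ F] {f : Cn n → F}
    {r c : ℝ} (hr : r ≠ 0) (h : ∀ y, f (r • y) = c • f y) {y : Cn n} (hd : DifferentiableAt ℝ f y) :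
    fderiv ℝ f (r • y) = (c / r) • fderiv ℝ f y := by
  have h1 : fderiv ℝ (fun y => f (r • y)) y = c • fderiv ℝ f y := by
    rw [show (fun y => f (r • y)) = fun y => c • f y from funext h, fderiv_fun_const_smul hd]
  rw [fderiv_comp_smul] at h1
  rw [div_eq_inv_mul, mul_smul, ← h1, inv_smul_smul₀ hr]

variable {k : ℕ} {a : ℝ} {J : EndField n} {Ψ : Cn n ≃ Cn n}

/-- A special field is determined by the Levi condition. -/
lemma IsCircularRep.special_smul (hΨ : IsCircularRep k a J Ψ) (ha0 : 0 ≤ a) (ha : a ≤ 1) (hk : 1 ≤ k)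
    {v : Cn n} {σ : Cn n → ℝ}
    {Y : (i : Fin n) → Aff i × ℂ → {j : Fin n // j ≠ i} → ℂ} {X : VField n}
    (hX : IsSpecial k a Ψ v σ Y X) {r : ℝ} (hr : r ≠ 0) {y : Cn n} (hy : r • y ∈ puncturedBall n)
    (hL : LeviCondition J Ψ v σ X (r • y)) :
    X (r • y) = radialField (J (r • y)) (theta Ψ (Ψ.symm y) v)
        (fderiv ℝ (fun y => theta Ψ (Ψ.symm y) v) y) r y +
      r • ((Complex.I * σ (Ψ.symm y)) • y +
        symVec ((‖y‖ ^ 2 • fderiv ℝ (fun y => σ (Ψ.symm y)) y) ∘L projH y)) := by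
  have hrc : (r : ℂ) ≠ 0 := by exact_mod_cast hr
  have hy0 : y ≠ 0 := fun h => hy.1 (by rw [h, smul_zero])
  have hφs : ∀ y, y ≠ 0 → theta Ψ (Ψ.symm (r • y)) v = r⁻¹ • theta Ψ (Ψ.symm y) v := by
    intro y hy
    rw [← Complex.coe_smul r y, hΨ.symm_smul, hΨ.theta_smul_left (hΨ.symm_ne_zero hy) hrc,
      Complex.real_smul, Complex.ofReal_inv, div_eq_inv_mul]
  have hσs : ∀ y, σ (Ψ.symm (r • y)) = σ (Ψ.symm y) := by
    intro y
    rw [← Complex.coe_smul r y, hΨ.symm_smul, hX.sigma_smul _ _ hrc]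
  have hφd := (hΨ.contDiffAt_theta_symm ha0 ha hk v hy0).differentiableAt (by simp; omega)
  have hσd := (hΨ.contDiffAt_comp_symm hX.sigma_regular hy0).differentiableAt (by simp; omega)
  -- The function θ(v) has degree −1 and σ degree 0 under dilations, so their differentials have
  -- degrees −2 and −1. The factor ‖r y‖² of the Levi condition compensates exactly.
  have hD : fderiv ℝ (fun y => theta Ψ (Ψ.symm y) v) (r • y) =
      (r⁻¹ / r) • fderiv ℝ (fun y => theta Ψ (Ψ.symm y) v) y := by
    refine fderiv_smul_of_homogeneous hr (fun y => ?_) hφd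
    by_cases h : y = 0
    · subst h
      have h0 : theta Ψ (Ψ.symm 0) v = 0 := by
        rw [theta, Equiv.apply_symm_apply]; simp [ballTheta]
      rw [smul_zero, h0, smul_zero]
    · exact hφs y h
  have hDσ : fderiv ℝ (fun y => σ (Ψ.symm y)) (r • y) =
      (1 / r) • fderiv ℝ (fun y => σ (Ψ.symm y)) y :=
    fderiv_smul_of_homogeneous hr (fun y => by rw [hσs, one_smul]) hσd
  have hn : ‖r • y‖ ^ 2 = r ^ 2 * ‖y‖ ^ 2 := by
    rw [norm_smul, mul_pow, Real.norm_eq_abs, sq_abs]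
  have hHP : ∀ h, inner ℂ (r • y) (projH y h) = (0 : ℂ) := by
    intro h
    rw [← Complex.coe_smul, inner_smul_left, projH_apply, inner_sub_projZ hy0, mul_zero]
  have hH : projH y (X (r • y)) = symVec ((‖y‖ ^ 2 • ((1 - r ^ 2 * ‖y‖ ^ 2) • (Complex.reCLM ∘L
      (fderiv ℝ (fun y => theta Ψ (Ψ.symm y) v) y ∘L J (r • y))) +
      (1 + r ^ 2 * ‖y‖ ^ 2) • (Complex.imCLM ∘L fderiv ℝ (fun y => theta Ψ (Ψ.symm y) v) y))) ∘L
        projH y + r • ((‖y‖ ^ 2 • fderiv ℝ (fun y => σ (Ψ.symm y)) y) ∘L projH y)) := by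
    refine eq_symVec fun u => ?_
    have h1 : inner ℂ (projH y (X (r • y))) u = (inner ℂ (X (r • y)) (projH y u) : ℂ) := by
      have e1 : inner ℂ (projZ y (X (r • y))) (projH y u) = (0 : ℂ) := by
        rw [projZ_apply, inner_smul_left, projH_apply, inner_sub_projZ hy0, mul_zero]
      have e2 : inner ℂ (projH y (X (r • y))) (projZ y u) = (0 : ℂ) := by
        rw [projZ_apply, inner_smul_right, ← inner_conj_symm, projH_apply, inner_sub_projZ hy0]
        simp
      have e3 : u = projH y u + projZ y u := by rw [projH_apply, sub_add_cancel]
      have e4 : X (r • y) = projH y (X (r • y)) + projZ y (X (r • y)) := by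
        rw [projH_apply, sub_add_cancel]
      rw [e4, inner_add_left, e1, add_zero, ← e4]
      nth_rewrite 1 [e3]
      rw [inner_add_right, e2, add_zero]
    rw [h1, hL _ (hHP u), hD, hDσ, hn]
    simp only [_root_.add_apply, _root_.smul_apply, ContinuousLinearMap.comp_apply, smul_eq_mul,
      Complex.reCLM_apply, Complex.imCLM_apply, Complex.smul_re, Complex.smul_im]
    field_simp
  have hZ : projZ y (X (r • y)) = (theta Ψ (Ψ.symm y) v - ((r ^ 2 * ‖y‖ ^ 2 : ℝ) : ℂ) *
      star (theta Ψ (Ψ.symm y) v) + r * (Complex.I * σ (Ψ.symm y))) • y := by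
    have h1 := hΨ.ballTheta_special hX hy
    rw [← Complex.coe_smul r y, ballTheta_smul_left _ _ _ hrc, Complex.coe_smul, hφs y hy0, hσs,
      ← Complex.ofReal_pow, hn, div_eq_iff hrc] at h1
    rw [projZ_apply, h1, star_smul, Complex.real_smul, Complex.real_smul]
    congr 1
    push_cast
    simp only [star_trivial]
    push_cast
    field_simp
    ring
  have hs : X (r • y) = projZ y (X (r • y)) + projH y (X (r • y)) := by
    rw [projH_apply, add_sub_cancel]
  refine hs.trans ?_
  rw [hZ, hH, radialField, map_add, add_smul, smul_add r, _root_.map_smul, mul_smul, Complex.coe_smul]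
  abel

end FieldFormula

/-! ### Extension of X across the exceptional divisor -/

namespace IsSpecialFamily

variable {n k : ℕ} {a b : ℝ} {Jt : ℝ → EndField n} {X : ℝ → VField n} {v : ℝ → Cn n}
  {Ψ : ℝ → Cn n ≃ Cn n} {σ : ℝ → Cn n → ℝ}
  {Y : ℝ → (i : Fin n) → Aff i × ℂ → {j : Fin n // j ≠ i} → ℂ}
  (hF : IsSpecialFamily k a b Jt X v Ψ σ Y)
include hF

lemma leviCondition {t : ℝ} (ht : t ∈ Icc (0 : ℝ) 1) {y : Cn n} (hy : y ∈ puncturedBall n) :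
    LeviCondition (Jt t) (Ψ t) (v t) (σ t) (X t) y := by
  have hΨ := hF.circular t ht
  have hk := hF.two_le
  obtain ⟨i, hi⟩ := exists_coord_ne_zero (hΨ.symm_ne_zero hy.1)
  have hp := hΨ.map_polarPt_polarInv_mem hy hi
  have h1 := (hΨ.leviCondition_iff (by omega) (hF.preservesH t ht) (fun y hy h l hh hl =>
    im_inner_J (by omega) (hF.complexStructure t ht) (hF.preservesH t ht) hy hh hl)
    (hF.special t ht) hp).2 (hF.explicit t ht i _ hp)
  rwa [polarPt_polarInv hi, Equiv.apply_symm_apply] at h1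

/-- The fields `J_t` and `X_t` extend regularly to the exceptional divisor and beyond it. -/
lemma exists_extension (i : Fin n) : ∃ (𝒥 : ℝ → ℝ × Cn n → (Cn n →L[ℝ] Cn n))
    (𝒳 : ℝ → ℝ × Cn n → Cn n),
    ParamContDiff 1 𝒥 (Icc 0 1) (Ioo (-1) 1 ×ˢ {y : Cn n | y i ≠ 0 ∧ ‖y‖ < 1}) ∧
    ParamContDiff 1 𝒳 (Icc 0 1) (Ioo (-1) 1 ×ˢ {y : Cn n | y i ≠ 0 ∧ ‖y‖ < 1}) ∧
    ∀ t ∈ Icc (0 : ℝ) 1, ∀ r ∈ Ioo (-1 : ℝ) 1, r ≠ 0 → ∀ y : Cn n, y i ≠ 0 → ‖y‖ < 1 →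
      𝒥 t (r, y) = Jt t (r • y) ∧ 𝒳 t (r, y) = X t (r • y) := by
  obtain ⟨G, hG, hGJ⟩ := hF.J_regular i
  set O : Set (Cn n) := {y : Cn n | y i ≠ 0 ∧ ‖y‖ < 1} with hOdef
  have hk := hF.two_le
  have hO : IsOpen O := (isOpen_ne_fun (contDiff_coord (m := 0) i).continuous
    continuous_const).inter (isOpen_lt continuous_norm continuous_const)
  have hOV : IsOpen (Ioo (-1 : ℝ) 1 ×ˢ O) := isOpen_Ioo.prod hO
  have hO0 : ∀ y ∈ O, y ≠ 0 := fun y hy h => hy.1 (by simp [h])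
  have hJ := paramContDiff_blowExt (i := i) hG.1
  have p := fun {F : Type} [NormedAddCommGroup F] [NormedSpace ℝ F] {f : ℝ × Cn n → F}
    (h : ContDiffOn ℝ 1 f (Ioo (-1 : ℝ) 1 ×ˢ O)) =>
    ParamContDiff.of_contDiffOn (P := ℝ) (Q := Icc 0 1) hOV (m := 1) (f := f) h
  have hsnd : ContDiffOn ℝ 1 (fun x : ℝ × Cn n => x.2) (Ioo (-1 : ℝ) 1 ×ˢ O) := contDiffOn_snd
  have hm : ∀ t ∈ Icc (0 : ℝ) 1, MapsTo (fun x : ℝ × Cn n => x.2) (Ioo (-1 : ℝ) 1 ×ˢ O) {0}ᶜ :=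
    fun t _ x hx => hO0 _ hx.2
  have hφ := (hF.param_theta.pred).comp (p hsnd) hm
  have hDφ := (hF.param_theta.fderiv isOpen_compl_singleton).comp (p hsnd) hm
  have hsq : ContDiffOn ℝ 1 (fun x : ℝ × Cn n => ‖x.2‖ ^ 2) (Ioo (-1 : ℝ) 1 ×ˢ O) :=
    hsnd.norm_sq ℝ
  have hrsq : ContDiffOn ℝ 1 (fun x : ℝ × Cn n => x.1 ^ 2 * ‖x.2‖ ^ 2) (Ioo (-1 : ℝ) 1 ×ˢ O) :=
    (contDiffOn_fst.pow 2).mul hsq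
  have hR : ParamContDiff 1 (fun t (x : ℝ × Cn n) => radialField (blowExt i G t x)
      (theta (Ψ t) ((Ψ t).symm x.2) (v t))
      (fderiv ℝ (fun y => theta (Ψ t) ((Ψ t).symm y) (v t)) x.2) x.1 x.2)
      (Icc 0 1) (Ioo (-1) 1 ×ˢ O) := by
    have c1 : ParamContDiff 1 (fun t (x : ℝ × Cn n) => ((theta (Ψ t) ((Ψ t).symm x.2) (v t)) -
        ((x.1 ^ 2 * ‖x.2‖ ^ 2 : ℝ) : ℂ) * star (theta (Ψ t) ((Ψ t).symm x.2) (v t))) • x.2)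
        (Icc 0 1) (Ioo (-1) 1 ×ˢ O) := by
      have s1 := ParamContDiff.bilin (ContinuousLinearMap.lsmul ℝ ℝ) (p hrsq.neg)
        (hφ.clm (Complex.conjCLE : ℂ →L[ℝ] ℂ))
      have s2 := ParamContDiff.bilin (ContinuousLinearMap.lsmul ℝ ℂ (E := Cn n)) (hφ.add s1) (p hsnd)
      refine s2.congr hOV fun t _ x _ => ?_
      simp [sub_eq_add_neg, add_smul]
    have c2 := ParamContDiff.bilin (ContinuousLinearMap.lsmul ℝ ℝ)
      (p (contDiffOn_const.sub hrsq : ContDiffOn ℝ 1 (fun x : ℝ × Cn n => 1 - x.1 ^ 2 * ‖x.2‖ ^ 2) _))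
      ((ParamContDiff.bilin (ContinuousLinearMap.compL ℝ (Cn n) (Cn n) ℂ) hDφ hJ).clm
        (ContinuousLinearMap.compL ℝ (Cn n) ℂ ℝ Complex.reCLM))
    have c3 := ParamContDiff.bilin (ContinuousLinearMap.lsmul ℝ ℝ)
      (p (contDiffOn_const.add hrsq : ContDiffOn ℝ 1 (fun x : ℝ × Cn n => 1 + x.1 ^ 2 * ‖x.2‖ ^ 2) _))
      (hDφ.clm (ContinuousLinearMap.compL ℝ (Cn n) ℂ ℝ Complex.imCLM))
    have c4 := ParamContDiff.bilin (ContinuousLinearMap.lsmul ℝ ℝ) (p hsq) (c2.add c3)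
    have c5 := ParamContDiff.bilin (ContinuousLinearMap.compL ℝ (Cn n) (Cn n) ℝ) c4
      (p (contDiffOn_projH.comp hsnd fun x hx => hO0 _ hx.2))
    exact c1.add (c5.clm symVec)
  have hX : ParamContDiff 1 X (Icc 0 1) (puncturedOpenBall n) :=
    ParamContDiff.of_contDiffOn_prod uniqueDiffOn_Icc_zero_one goodSet_puncturedBall.1 hF.X_regular
      isOpen_puncturedOpenBall puncturedOpenBall_subset
  have hhalf : ∀ y ∈ O, (1 / 2 : ℝ) • y ∈ puncturedOpenBall n := fun y hy =>
    ⟨smul_ne_zero (by norm_num) (hO0 y hy), by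
      rw [norm_smul]
      have := hy.2
      norm_num
      linarith [norm_nonneg y]⟩
  have hX2 := hX.comp (p (contDiffOn_const.fun_smul hsnd : ContDiffOn ℝ 1
    (fun x : ℝ × Cn n => (1 / 2 : ℝ) • x.2) _)) fun t _ x hx => hhalf _ hx.2
  have hR2 := hR.comp (p (contDiffOn_const.prodMk hsnd : ContDiffOn ℝ 1
    (fun x : ℝ × Cn n => ((1 / 2 : ℝ), x.2)) _)) fun t _ x hx => ⟨by norm_num, hx.2⟩
  -- No regularity of σ in t is given. However, its contribution to X(r y) is linear in r, so it is
  -- recovered from r = 1/2: X(r y) = R(r) + 2r (X(y/2) − R(1/2)), where R is the part without σ.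
  have hS := ParamContDiff.bilin (ContinuousLinearMap.lsmul ℝ ℝ)
    (p (contDiffOn_const.mul contDiffOn_fst : ContDiffOn ℝ 1 (fun x : ℝ × Cn n => 2 * x.1) _))
    (hX2.add (hR2.clm (-ContinuousLinearMap.id ℝ (Cn n))))
  refine ⟨_, _, hJ, hR.add hS, fun t ht r hr hr0 y hyi hy1 => ?_⟩
  have hy0 := hO0 y ⟨hyi, hy1⟩
  have hP := hF.preservesH t ht
  have hball : ∀ r ∈ Ioo (-1 : ℝ) 1, r ≠ 0 → r • y ∈ puncturedBall n := fun r hr hr0 =>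
    ⟨smul_ne_zero hr0 hy0, by
      rw [norm_smul, Real.norm_eq_abs]
      exact mul_le_one₀ (abs_lt.2 hr).le (norm_nonneg _) hy1.le⟩
  have hJe : ∀ r ∈ Ioo (-1 : ℝ) 1, r ≠ 0 → blowExt i G t (r, y) = Jt t (r • y) :=
    fun r hr hr0 => blowExt_eq (hGJ t ht) hP hr0 hyi (hball r hr hr0).2
  have hXe := fun r hr hr0 => (hF.circular t ht).special_smul hF.a_nonneg hF.a_le (by omega)
    (hF.special t ht) hr0 (hball r hr hr0) (hF.leviCondition ht (hball r hr hr0))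
  refine ⟨hJe r hr hr0, ?_⟩
  have e1 := hXe r hr hr0
  have e2 := hXe (1 / 2) (by norm_num) (by norm_num)
  simp only [_root_.neg_apply, ContinuousLinearMap.id_apply, ContinuousLinearMap.lsmul_apply,
    hJe r hr hr0, hJe (1 / 2) (by norm_num) (by norm_num)]
  rw [e1, e2, add_neg_cancel_comm, smul_smul]
  congr 2
  ring

end IsSpecialFamily

lemma ParamContDiff.eventually_norm_lt {V F : Type} [NormedAddCommGroup V] [NormedSpace ℝ V]
    [NormedAddCommGroup F] [NormedSpace ℝ F] {m : ℕ} {f : ℝ → ℝ × V → F} {W : Set V}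
    (hf : ParamContDiff m f (Icc 0 1) (Ioo (-1) 1 ×ˢ W)) (hW : IsOpen W) {T : ℝ}
    (hT : T ∈ Icc (0 : ℝ) 1) {z : V} (hz : z ∈ W) (h0 : f T (0, z) = 0) {ε : ℝ} (hε : 0 < ε) :
    ∀ᶠ x : (ℝ × ℝ) × V in 𝓝 ((T, 0), z), x.1.1 ∈ Icc (0 : ℝ) 1 →
      ‖f x.1.1 (x.1.2, x.2)‖ < ε := by
  have h1 := (hf.continuousOn (T, (0, z)) ⟨hT, by norm_num, hz⟩).norm
  have h2 : ∀ᶠ x : ℝ × (ℝ × V) in 𝓝[Icc 0 1 ×ˢ (Ioo (-1) 1 ×ˢ W)] (T, (0, z)), ‖f x.1 x.2‖ < ε :=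
    h1.eventually_lt_const (by simpa [h0] using hε)
  rw [eventually_nhdsWithin_iff] at h2
  have hc : Continuous fun x : (ℝ × ℝ) × V => (x.1.1, (x.1.2, x.2)) := by fun_prop
  have h3 := (hc.tendsto ((T, 0), z)).eventually h2
  have hc' : Continuous fun x : (ℝ × ℝ) × V => (x.1.2, x.2) := by fun_prop
  have h4 : ∀ᶠ x : (ℝ × ℝ) × V in 𝓝 ((T, 0), z), (x.1.2, x.2) ∈ Ioo (-1 : ℝ) 1 ×ˢ W :=
    (hc'.tendsto ((T, 0), z)).eventually ((isOpen_Ioo.prod hW).mem_nhds ⟨by norm_num, hz⟩)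
  filter_upwards [h3, h4] with x h3 h4 hx using h3 ⟨hx, h4⟩

/-! ### The limit of J at the origin in circular coordinates -/

namespace IsCircularRep

variable {n k : ℕ} {a : ℝ} {J : EndField n} {Ψ : Cn n ≃ Cn n} (hΨ : IsCircularRep k a J Ψ)
include hΨ

lemma map_real_smul (r : ℝ) (z : Cn n) : Ψ (r • z) = r • Ψ z := by
  rw [← Complex.coe_smul, hΨ.map_smul, Complex.coe_smul]

lemma eventually_smul_mem {z : Cn n} (hz : z ≠ 0) :
    ∀ᶠ r : ℝ in 𝓝[>] 0, r • Ψ z ∈ puncturedBall n := by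
  have hc : Continuous fun r : ℝ => ‖r • Ψ z‖ := by fun_prop
  have h1 : ∀ᶠ r : ℝ in 𝓝 0, ‖r • Ψ z‖ < 1 := hc.continuousAt.eventually_lt_const (by simp)
  filter_upwards [nhdsWithin_le_nhds h1, self_mem_nhdsWithin] with r hr hr0
  exact ⟨smul_ne_zero (ne_of_gt hr0) (hΨ.map_ne_zero hz), hr.le⟩

/-- In the coordinates of a circular representation, `J` is standard at the origin. -/
lemma tendsto_pullEnd (hS : StandardOnZ J) {z : Cn n} (hz : z ≠ 0) (h : Cn n) :
    Tendsto (fun r : ℝ => pullEnd Ψ J (r • z) h) (𝓝[>] 0) (𝓝 (Complex.I • h)) := by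
  -- The two components have different reasons: on the kernel of θ the limit is holomorphy on the
  -- exceptional divisor, and on the radial line it is standardness on 𝓩.
  have hs : h = (h - theta Ψ z h • z) + theta Ψ z h • z := by rw [sub_add_cancel]
  have h0 : theta Ψ z (h - theta Ψ z h • z) = 0 := by
    rw [hΨ.theta_sub, hΨ.theta_self hz, sub_self]
  have h1 := hΨ.exceptional z hz (h - theta Ψ z h • z)
    (by rw [hΨ.fderiv_normSq hz, h0]; simp)
    (by rw [hΨ.fderiv_normSq hz, hΨ.theta_smul hz, h0]; simp)
  have h2 : Tendsto (fun r : ℝ => pullEnd Ψ J (r • z) (theta Ψ z h • z)) (𝓝[>] 0)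
      (𝓝 (Complex.I • (theta Ψ z h • z))) := by
    refine tendsto_const_nhds.congr' ?_
    filter_upwards [hΨ.eventually_smul_mem hz, self_mem_nhdsWithin] with r hr hr0
    have hr0' : r ≠ 0 := ne_of_gt hr0
    have hrc : (r : ℂ) ≠ 0 := by exact_mod_cast hr0'
    have e : ∀ c : ℂ, fderiv ℝ Ψ (r • z) (c • z) = c • Ψ z := by
      intro c
      rw [hΨ.fderiv_real_smul hz hr0', hΨ.fderiv_smul_self hz]
    rw [pullEnd, ContinuousLinearMap.comp_apply, ContinuousLinearMap.comp_apply, e,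
      hΨ.map_real_smul]
    have e2 : J (r • Ψ z) (theta Ψ z h • Ψ z) = (Complex.I * theta Ψ z h) • Ψ z := by
      have aux : ∀ c : ℂ, (c / r) • (r • Ψ z) = c • Ψ z := fun c => by
        rw [← Complex.coe_smul, smul_smul, div_mul_cancel₀ _ hrc]
      have h3 := hS _ hr (theta Ψ z h / r)
      rwa [aux, ← mul_div_assoc, aux] at h3
    rw [e2, ← e, hΨ.fderiv_inverse_apply (smul_ne_zero hr0' hz), smul_smul]
  have h3 := h1.add h2
  rw [← smul_add, ← hs] at h3
  refine h3.congr fun r => ?_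
  rw [← map_add, ← hs]

end IsCircularRep

/-! ### Behaviour of the family near the origin -/

namespace IsSpecialFamily

variable {n k : ℕ} {a b : ℝ} {Jt : ℝ → EndField n} {X : ℝ → VField n} {v : ℝ → Cn n}
  {Ψ : ℝ → Cn n ≃ Cn n} {σ : ℝ → Cn n → ℝ}
  {Y : ℝ → (i : Fin n) → Aff i × ℂ → {j : Fin n // j ≠ i} → ℂ}
  (hF : IsSpecialFamily k a b Jt X v Ψ σ Y)
include hF

/-- At t = T and r = 0 the extended fields, read in the coordinates of Ψ_T, equal v_T and i whatever
the direction z. The estimates are joint continuity at that point. They hold near one direction;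
compactness of the set of directions makes them uniform afterwards. -/
lemma eventually_near {T : ℝ} (hT : T ∈ Icc (0 : ℝ) 1) (hS : StandardOnZ (Jt T)) {z : Cn n}
    (hz : z ≠ 0) (hz1 : ‖Ψ T z‖ < 1) {ε : ℝ} (hε : 0 < ε) :
    ∀ᶠ x : (ℝ × ℝ) × Cn n in 𝓝 ((T, 0), z), x.1.1 ∈ Icc (0 : ℝ) 1 → 0 < x.1.2 →
      ‖VectorField.pullback ℝ (Ψ T) (X x.1.1) (x.1.2 • x.2) - v T‖ < ε ∧
      x.1.2 * ‖fderiv ℝ (VectorField.pullback ℝ (Ψ T) (X x.1.1)) (x.1.2 • x.2)‖ < ε ∧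
      ‖pullEnd (Ψ T) (Jt x.1.1) (x.1.2 • x.2) - stdJ n‖ < ε ∧
      x.1.2 * ‖theta (Ψ x.1.1) ((Ψ x.1.1).symm (Ψ T (x.1.2 • x.2))) (v x.1.1)
        - theta (Ψ T) (x.1.2 • x.2) (v T)‖ < ε := by
  have hΨ := hF.circular T hT
  have hk := hF.two_le
  obtain ⟨i, hi⟩ := exists_coord_ne_zero (hΨ.map_ne_zero hz)
  obtain ⟨𝒥, 𝒳, hJ, hX, he⟩ := hF.exists_extension i
  set O : Set (Cn n) := {y : Cn n | y i ≠ 0 ∧ ‖y‖ < 1} with hOdef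
  have hO : IsOpen O := (isOpen_ne_fun (contDiff_coord (m := 0) i).continuous
    continuous_const).inter (isOpen_lt continuous_norm continuous_const)
  have hΨd : ContDiffOn ℝ 2 (Ψ T) {0}ᶜ := hΨ.regular.1.of_le (by norm_cast; omega)
  set W : Set (Cn n) := {0}ᶜ ∩ Ψ T ⁻¹' O with hWdef
  have hW : IsOpen W := hΨd.continuousOn.isOpen_inter_preimage isOpen_compl_singleton hO
  have hzW : z ∈ W := ⟨hz, hi, hz1⟩
  have hV : IsOpen (Ioo (-1 : ℝ) 1 ×ˢ W) := isOpen_Ioo.prod hW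
  have p := fun {F : Type} [NormedAddCommGroup F] [NormedSpace ℝ F] {m : ℕ} {f : ℝ × Cn n → F}
    (h : ContDiffOn ℝ m f (Ioo (-1 : ℝ) 1 ×ˢ W)) =>
    ParamContDiff.of_contDiffOn (P := ℝ) (Q := Icc 0 1) hV (m := m) (f := f) h
  have hsnd : MapsTo (fun x : ℝ × Cn n => x.2) (Ioo (-1 : ℝ) 1 ×ˢ W) {0}ᶜ := fun x hx => hx.2.1
  have hD : ContDiffOn ℝ 1 (fun x : ℝ × Cn n => fderiv ℝ (Ψ T) x.2) (Ioo (-1 : ℝ) 1 ×ˢ W) :=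
    (hΨd.fderiv_of_isOpen isOpen_compl_singleton (by norm_num)).comp contDiffOn_snd hsnd
  have pD := p (m := 1) hD
  have pDi := pD.inverse fun t _ x hx => hΨ.invertible _ hx.2.1
  have pm : ParamContDiff 1 (fun (_ : ℝ) (x : ℝ × Cn n) => (x.1, Ψ T x.2)) (Icc 0 1)
      (Ioo (-1) 1 ×ˢ W) := p (m := 1) (contDiffOn_fst.prodMk
    ((hΨd.of_le (by norm_num)).comp contDiffOn_snd hsnd))
  have hm : ∀ t ∈ Icc (0 : ℝ) 1, MapsTo (fun x : ℝ × Cn n => (x.1, Ψ T x.2)) (Ioo (-1 : ℝ) 1 ×ˢ W)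
      (Ioo (-1) 1 ×ˢ O) := fun t _ x hx => ⟨hx.1, hx.2.2⟩
  have pX := ParamContDiff.bilin (ContinuousLinearMap.id ℝ (Cn n →L[ℝ] Cn n)) pDi (hX.comp pm hm)
  have pJ := ParamContDiff.bilin (ContinuousLinearMap.compL ℝ (Cn n) (Cn n) (Cn n)) pDi
    (ParamContDiff.bilin (ContinuousLinearMap.compL ℝ (Cn n) (Cn n) (Cn n)) (hJ.comp pm hm) pD)
  set 𝒳' : ℝ → ℝ × Cn n → Cn n := fun t x => (fderiv ℝ (Ψ T) x.2).inverse (𝒳 t (x.1, Ψ T x.2))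
    with hX'
  set 𝒥' : ℝ → ℝ × Cn n → (Cn n →L[ℝ] Cn n) := fun t x => (fderiv ℝ (Ψ T) x.2).inverse ∘L
    (𝒥 t (x.1, Ψ T x.2) ∘L fderiv ℝ (Ψ T) x.2) with hJ'
  have pX' : ParamContDiff 1 𝒳' (Icc 0 1) (Ioo (-1) 1 ×ˢ W) := pX
  have pJ' : ParamContDiff 1 𝒥' (Icc 0 1) (Ioo (-1) 1 ×ˢ W) := pJ
  have eX : ∀ t ∈ Icc (0 : ℝ) 1, ∀ r ∈ Ioo (-1 : ℝ) 1, r ≠ 0 → ∀ z ∈ W,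
      𝒳' t (r, z) = VectorField.pullback ℝ (Ψ T) (X t) (r • z) := by
    intro t ht r hr hr0 z hz
    simp only [hX', VectorField.pullback]
    rw [(he t ht r hr hr0 _ hz.2.1 hz.2.2).2, hΨ.fderiv_real_smul hz.1 hr0, hΨ.map_real_smul]
  have eJ : ∀ t ∈ Icc (0 : ℝ) 1, ∀ r ∈ Ioo (-1 : ℝ) 1, r ≠ 0 → ∀ z ∈ W,
      𝒥' t (r, z) = pullEnd (Ψ T) (Jt t) (r • z) := by
    intro t ht r hr hr0 z hz
    simp only [hJ', pullEnd]
    rw [(he t ht r hr hr0 _ hz.2.1 hz.2.2).1, hΨ.fderiv_real_smul hz.1 hr0, hΨ.map_real_smul]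
  have hlim : ∀ z ∈ W, Tendsto (fun r : ℝ => (r, z)) (𝓝[>] 0) (𝓝 (0, z)) := fun z _ => by
    have : Continuous fun r : ℝ => (r, z) := by fun_prop
    exact (this.tendsto 0).mono_left nhdsWithin_le_nhds
  have hev : ∀ᶠ r : ℝ in 𝓝[>] 0, r ∈ Ioo (-1 : ℝ) 1 ∧ r ≠ 0 := by
    filter_upwards [Ioo_mem_nhdsGT (zero_lt_one (α := ℝ))] with r hr
    exact ⟨⟨by linarith [hr.1], hr.2⟩, hr.1.ne'⟩
  have hcont : ∀ {F : Type} [NormedAddCommGroup F] [NormedSpace ℝ F] {f : ℝ → ℝ × Cn n → F},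
      ParamContDiff 1 f (Icc 0 1) (Ioo (-1) 1 ×ˢ W) → ∀ z ∈ W,
        Tendsto (fun r : ℝ => f T (r, z)) (𝓝[>] 0) (𝓝 (f T (0, z))) := by
    intro F _ _ f hf z hz
    exact ((hf.differentiableAt hT (y := (0, z)) ⟨by norm_num, hz⟩).continuousAt.tendsto).comp
      (hlim z hz)
  -- The value on the divisor is the limit along the ray through z, which is v_T for a special
  -- field.
  have X0 : ∀ z ∈ W, 𝒳' T (0, z) = v T := by
    intro z hz
    refine tendsto_nhds_unique (hcont pX' z hz) ?_
    have h1 := hΨ.special_tendsto hF.a_nonneg hF.a_le (by omega) (hF.special T hT)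
    have h2 : Tendsto (fun r : ℝ => r • Ψ T z) (𝓝[>] 0) (𝓝[puncturedBall n] 0) := by
      refine tendsto_nhdsWithin_iff.2 ⟨?_, hΨ.eventually_smul_mem hz.1⟩
      have : Continuous fun r : ℝ => r • Ψ T z := by fun_prop
      simpa using (this.tendsto 0).mono_left nhdsWithin_le_nhds
    refine (h1.comp h2).congr' ?_
    filter_upwards [hev] with r hr
    rw [eX T hT r hr.1 hr.2 z hz, VectorField.pullback, Function.comp, ← hΨ.map_real_smul,
      Equiv.symm_apply_apply]
  have J0 : ∀ z ∈ W, 𝒥' T (0, z) = stdJ n := by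
    intro z hz
    ext1 h
    refine tendsto_nhds_unique ?_ (hΨ.tendsto_pullEnd hS hz.1 h)
    have h1 := ((ContinuousLinearMap.apply ℝ (Cn n) h).continuous.tendsto _).comp (hcont pJ' z hz)
    refine h1.congr' ?_
    filter_upwards [hev] with r hr
    rw [Function.comp, eJ T hT r hr.1 hr.2 z hz]
    rfl
  -- The extension is constant in z on r = 0, so its derivative in z vanishes there. By the chain
  -- rule that derivative is r dX(r z), which is thus small.
  have D0 : (fderiv ℝ (𝒳' T) (0, z)) ∘L ContinuousLinearMap.inr ℝ ℝ (Cn n) = 0 := by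
    have h1 := HasFDerivAt.comp (f := fun z : Cn n => ((0 : ℝ), z)) z
      (pX'.differentiableAt hT (y := (0, z)) ⟨by norm_num, hzW⟩).hasFDerivAt
      (hasFDerivAt_prodMk_right (𝕜 := ℝ) (0 : ℝ) z)
    have h2 : HasFDerivAt (𝒳' T ∘ fun z : Cn n => ((0 : ℝ), z)) (0 : Cn n →L[ℝ] Cn n) z := by
      refine (hasFDerivAt_const (v T) z).congr_of_eventuallyEq ?_
      filter_upwards [hW.mem_nhds hzW] with z hz using X0 z hz
    exact h1.unique h2
  have f1 := (pX'.add (ParamContDiff.param (f := fun _ : ℝ => -v T) continuousOn_const)).eventually_norm_lt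
    hW hT hzW (by rw [X0 z hzW, add_neg_cancel]) hε
  have f2 := ((pX'.fderiv hV).clm ((ContinuousLinearMap.compL ℝ (Cn n) (ℝ × Cn n) (Cn n)).flip
    (ContinuousLinearMap.inr ℝ ℝ (Cn n)))).eventually_norm_lt hW hT hzW D0 hε
  have f3 := (pJ'.add (ParamContDiff.param (f := fun _ : ℝ => -stdJ n)
    continuousOn_const)).eventually_norm_lt hW hT hzW (by rw [J0 z hzW, add_neg_cancel]) hε
  have f4 := (((hF.param_theta.pred.comp (p (m := 1) (((hΨd.of_le (m := 1) (by norm_num)).comp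
      contDiffOn_snd hsnd))) fun t _ x hx => hΨ.map_ne_zero hx.2.1)).add
    (p (m := 1) (f := fun x : ℝ × Cn n => -theta (Ψ T) x.2 (v T)) (ContDiffOn.neg
      (((hΨ.holder_theta hF.a_nonneg hF.a_le (by omega) (v T)).contDiffOn.of_le (m := 1)
      (by norm_cast; omega)).comp contDiffOn_snd hsnd)))).eventually_norm_lt hW hT hzW (by
        simp only [Function.comp, Equiv.symm_apply_apply, add_neg_cancel]) hε
  have hev' : ∀ᶠ x : (ℝ × ℝ) × Cn n in 𝓝 ((T, 0), z), (x.1.2, x.2) ∈ Ioo (-1 : ℝ) 1 ×ˢ W := by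
    have hc : Continuous fun x : (ℝ × ℝ) × Cn n => (x.1.2, x.2) := by fun_prop
    exact (hc.tendsto ((T, 0), z)).eventually (hV.mem_nhds ⟨by norm_num, hzW⟩)
  filter_upwards [f1, f2, f3, f4, hev'] with x g1 g2 g3 g4 hx ht hr
  obtain ⟨⟨t, r⟩, z⟩ := x
  simp only at *
  have hrc : (r : ℂ) ≠ 0 := by exact_mod_cast hr.ne'
  refine ⟨?_, ?_, ?_, ?_⟩
  · rw [← eX t ht r hx.1 hr.ne' z hx.2]
    simpa [sub_eq_add_neg] using g1 ht
  · have h1 := HasFDerivAt.comp (f := fun z : Cn n => (r, z)) z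
      (pX'.differentiableAt ht (y := (r, z)) hx).hasFDerivAt
      (hasFDerivAt_prodMk_right (𝕜 := ℝ) r z)
    have h2 := h1.congr_of_eventuallyEq
      (f₁ := fun z : Cn n => VectorField.pullback ℝ (Ψ T) (X t) (r • z)) (by
        filter_upwards [hW.mem_nhds hx.2] with z' hz' using (eX t ht r hx.1 hr.ne' z' hz').symm)
    have h3 := h2.fderiv
    rw [fderiv_comp_smul] at h3
    have h4 := g2 ht
    have h5 : r * ‖fderiv ℝ (VectorField.pullback ℝ (Ψ T) (X t)) (r • z)‖ =
        ‖r • fderiv ℝ (VectorField.pullback ℝ (Ψ T) (X t)) (r • z)‖ := by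
      rw [norm_smul, Real.norm_of_nonneg hr.le]
    rw [h5, h3]
    exact h4
  · rw [← eJ t ht r hx.1 hr.ne' z hx.2]
    simpa [sub_eq_add_neg] using g3 ht
  · have h4 := g4 ht
    -- Both values of θ have degree −1, so the factor r is absorbed and the difference is evaluated
    -- at z itself.
    rw [hΨ.map_real_smul, ← Complex.coe_smul r (Ψ T z), ← Complex.coe_smul r z, (hF.circular t ht).symm_smul,
      (hF.circular t ht).theta_smul_left ((hF.circular t ht).symm_ne_zero (hΨ.map_ne_zero hx.2.1)) hrc,
      hΨ.theta_smul_left hx.2.1 hrc, ← sub_div, norm_div, Complex.norm_real, Real.norm_of_nonneg hr.le,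
      mul_div_cancel₀ _ hr.ne']
    simpa [sub_eq_add_neg] using h4

/-- The behaviour of the family near the origin, in the coordinates of `Ψ_T`. -/
lemma exists_near {T : ℝ} (hT : T ∈ Icc (0 : ℝ) 1) (hS : StandardOnZ (Jt T)) {ε : ℝ} (hε : 0 < ε) :
    ∃ δ, 0 < δ ∧ ∀ t ∈ Icc (0 : ℝ) 1, |t - T| < δ → ∀ z, z ≠ 0 → ‖Ψ T z‖ < δ →
      ‖VectorField.pullback ℝ (Ψ T) (X t) z - v T‖ < ε ∧
      ‖Ψ T z‖ * ‖fderiv ℝ (VectorField.pullback ℝ (Ψ T) (X t)) z‖ < ε ∧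
      ‖pullEnd (Ψ T) (Jt t) z - stdJ n‖ < ε ∧
      ‖Ψ T z‖ * ‖theta (Ψ t) ((Ψ t).symm (Ψ T z)) (v t) - theta (Ψ T) z (v T)‖ < ε := by
  have hΨ := hF.circular T hT
  have hK : IsCompact ((Ψ T).symm '' Metric.sphere 0 (1 / 2)) :=
    (isCompact_sphere _ _).image_of_continuousOn (hΨ.symm_continuousOn.mono fun y hy h => by
      rw [mem_singleton_iff.1 h] at hy; norm_num at hy)
  have hK' : ∀ z ∈ (Ψ T).symm '' Metric.sphere 0 (1 / 2), z ≠ 0 ∧ ‖Ψ T z‖ = 1 / 2 := by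
    rintro _ ⟨y, hy, rfl⟩
    rw [mem_sphere_zero_iff_norm] at hy
    exact ⟨hΨ.symm_ne_zero fun h => by rw [h] at hy; norm_num at hy, by
      rw [Equiv.apply_symm_apply, hy]⟩
  have h1 := hK.eventually_forall_of_forall_eventually (x₀ := (T, (0 : ℝ)))
    (P := fun q z => q.1 ∈ Icc (0 : ℝ) 1 → 0 < q.2 →
      ‖VectorField.pullback ℝ (Ψ T) (X q.1) (q.2 • z) - v T‖ < ε ∧
      q.2 * ‖fderiv ℝ (VectorField.pullback ℝ (Ψ T) (X q.1)) (q.2 • z)‖ < ε ∧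
      ‖pullEnd (Ψ T) (Jt q.1) (q.2 • z) - stdJ n‖ < ε ∧
      q.2 * ‖theta (Ψ q.1) ((Ψ q.1).symm (Ψ T (q.2 • z))) (v q.1)
        - theta (Ψ T) (q.2 • z) (v T)‖ < ε) fun z hz => hF.eventually_near hT hS (hK' z hz).1
    ((hK' z hz).2.trans_lt (by norm_num)) hε
  obtain ⟨δ, hδ, h2⟩ := Metric.eventually_nhds_iff.1 h1
  refine ⟨δ / 2, by positivity, fun t ht htT z hz hzδ => ?_⟩
  set r : ℝ := 2 * ‖Ψ T z‖ with hr
  have hμ : 0 < ‖Ψ T z‖ := norm_pos_iff.2 (hΨ.map_ne_zero hz)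
  have hr0 : 0 < r := by positivity
  have hmem : r⁻¹ • z ∈ (Ψ T).symm '' Metric.sphere 0 (1 / 2) := by
    refine ⟨Ψ T (r⁻¹ • z), ?_, Equiv.symm_apply_apply _ _⟩
    rw [mem_sphere_zero_iff_norm, hΨ.map_real_smul, norm_smul, Real.norm_of_nonneg (by positivity), hr]
    field_simp
  have h3 := h2 (y := (t, r)) (by
    rw [Prod.dist_eq, max_lt_iff, Real.dist_eq, Real.dist_eq, sub_zero, abs_of_pos hr0]
    exact ⟨by linarith, by linarith⟩) _ hmem ht hr0
  rw [smul_inv_smul₀ hr0.ne'] at h3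
  refine ⟨h3.1, lt_of_le_of_lt ?_ h3.2.1, h3.2.2.1, lt_of_le_of_lt ?_ h3.2.2.2⟩ <;>
  · refine mul_le_mul_of_nonneg_right ?_ (norm_nonneg _)
    rw [hr]; linarith

/-- Mean value inequality for the extended tensor between (−r, y) and (r, y): the difference is at
most 2Cr, so its square, 4C²r², is below ε r for small r. Regularity through r = 0 is essential
here, since r and −r lie on opposite sides of the divisor. -/
lemma eventually_reflect {T : ℝ} (hT : T ∈ Icc (0 : ℝ) 1) {y : Cn n} (hy : y ≠ 0) (hy1 : ‖y‖ < 1)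
    {ε : ℝ} (hε : 0 < ε) :
    ∀ᶠ x : (ℝ × ℝ) × Cn n in 𝓝 ((T, 0), y), x.1.1 ∈ Icc (0 : ℝ) 1 → 0 < x.1.2 →
      ‖Jt x.1.1 (x.1.2 • x.2) x.2 - Jt x.1.1 (-x.1.2 • x.2) x.2‖ ^ 2 ≤ ε * x.1.2 := by
  obtain ⟨i, hi⟩ := exists_coord_ne_zero hy
  obtain ⟨𝒥, 𝒳, hJ, -, he⟩ := hF.exists_extension i
  set O : Set (Cn n) := {y : Cn n | y i ≠ 0 ∧ ‖y‖ < 1} with hOdef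
  have hO : IsOpen O := (isOpen_ne_fun (contDiff_coord (m := 0) i).continuous
    continuous_const).inter (isOpen_lt continuous_norm continuous_const)
  have hV : IsOpen (Ioo (-1 : ℝ) 1 ×ˢ O) := isOpen_Ioo.prod hO
  have pE : ParamContDiff 1 (fun t (x : ℝ × Cn n) => 𝒥 t x x.2) (Icc 0 1) (Ioo (-1) 1 ×ˢ O) :=
    ParamContDiff.bilin (ContinuousLinearMap.id ℝ (Cn n →L[ℝ] Cn n)) hJ
      (ParamContDiff.of_contDiffOn (P := ℝ) hV (m := 1) (f := fun x : ℝ × Cn n => x.2) contDiffOn_snd)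
  have hyO : y ∈ O := ⟨hi, hy1⟩
  set C : ℝ := ‖fderiv ℝ (fun x : ℝ × Cn n => 𝒥 T x x.2) (0, y)‖ + 1 with hC
  have h1 : ∀ᶠ x : ℝ × (ℝ × Cn n) in 𝓝[Icc 0 1 ×ˢ (Ioo (-1) 1 ×ˢ O)] (T, (0, y)),
      ‖fderiv ℝ (fun x' : ℝ × Cn n => 𝒥 x.1 x' x'.2) x.2‖ < C :=
    ((pE.fderiv hV).continuousOn (T, (0, y)) ⟨hT, by norm_num, hyO⟩).norm.eventually_lt_const
      (by rw [hC]; exact lt_add_one _)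
  obtain ⟨δ, hδ, h2⟩ := Metric.mem_nhdsWithin_iff.1 h1
  obtain ⟨δ', hδ', h3⟩ := Metric.isOpen_iff.1 hV (0, y) ⟨by norm_num, hyO⟩
  have h4 : ∀ᶠ x : (ℝ × ℝ) × Cn n in 𝓝 ((T, 0), y), dist x ((T, 0), y) < min δ δ' :=
    Metric.ball_mem_nhds _ (by positivity)
  have h5 : ∀ᶠ x : (ℝ × ℝ) × Cn n in 𝓝 ((T, 0), y), x.1.2 * (2 * C) ^ 2 < ε := by
    have : Continuous fun x : (ℝ × ℝ) × Cn n => x.1.2 * (2 * C) ^ 2 := by fun_prop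
    exact this.continuousAt.eventually_lt_const (by simpa using hε)
  filter_upwards [h4, h5] with x hx hx5 ht hr
  obtain ⟨⟨t, r⟩, z⟩ := x
  simp only at *
  rw [Prod.dist_eq, max_lt_iff, Prod.dist_eq, max_lt_iff] at hx
  obtain ⟨⟨hx1, hx2⟩, hx3⟩ := hx
  simp only [Real.dist_eq, sub_zero, abs_of_pos hr] at hx2
  have hball : ∀ s ∈ Icc (-r) r, (s, z) ∈ Metric.ball ((0 : ℝ), y) (min δ δ') := by
    intro s hs
    rw [Metric.mem_ball, Prod.dist_eq, max_lt_iff, Real.dist_eq, sub_zero]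
    exact ⟨lt_of_le_of_lt (abs_le.2 hs) hx2, hx3⟩
  have hmem : ∀ x ∈ Metric.ball ((0 : ℝ), y) (min δ δ'), x ∈ Ioo (-1 : ℝ) 1 ×ˢ O := fun x hx =>
    h3 (Metric.ball_subset_ball (min_le_right _ _) hx)
  have hmv := (convex_ball ((0 : ℝ), y) (min δ δ')).norm_image_sub_le_of_norm_hasFDerivWithin_le
    (f := fun x' : ℝ × Cn n => 𝒥 t x' x'.2) (C := C)
    (fun x hx => (pE.differentiableAt ht (hmem x hx)).hasFDerivAt.hasFDerivWithinAt)
    (fun x hx => le_of_lt (h2 (a := (t, x)) ⟨by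
      rw [Metric.mem_ball, Prod.dist_eq, max_lt_iff]
      exact ⟨hx1.trans_le (min_le_left _ _), lt_of_lt_of_le hx (min_le_left _ _)⟩,
      ht, hmem x hx⟩))
    (hball (-r) ⟨le_rfl, by linarith⟩) (hball r ⟨by linarith, le_rfl⟩)
  have hm1 := hmem _ (hball r ⟨by linarith, le_rfl⟩)
  have hm2 := hmem _ (hball (-r) ⟨le_rfl, by linarith⟩)
  have e1 := (he t ht r hm1.1 hr.ne' z hm1.2.1 hm1.2.2).1
  have e2 := (he t ht (-r) hm2.1 (neg_ne_zero.2 hr.ne') z hm1.2.1 hm1.2.2).1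
  simp only [e1, e2] at hmv
  have e3 : ‖((r, z) : ℝ × Cn n) - (-r, z)‖ = 2 * r := by
    rw [Prod.mk_sub_mk, sub_self, sub_neg_eq_add, Prod.norm_def, norm_zero, ← two_mul,
      Real.norm_of_nonneg (by positivity), max_eq_left (by positivity)]
  rw [e3] at hmv
  calc _ ≤ (C * (2 * r)) ^ 2 := pow_le_pow_left₀ (norm_nonneg _) hmv 2
    _ = r * (2 * C) ^ 2 * r := by ring
    _ ≤ ε * r := mul_le_mul_of_nonneg_right hx5.le hr.le

/-- Regularity across the exceptional divisor compares opposite points. -/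
lemma exists_reflect {T : ℝ} (hT : T ∈ Icc (0 : ℝ) 1) {ε : ℝ} (hε : 0 < ε) :
    ∃ δ, 0 < δ ∧ ∀ t ∈ Icc (0 : ℝ) 1, |t - T| < δ → ∀ y, y ≠ 0 → ‖y‖ < δ →
      ‖Jt t y y - Jt t (-y) y‖ ^ 2 ≤ ε * ‖y‖ ^ 3 := by
  have hK' : ∀ y ∈ Metric.sphere (0 : Cn n) (1 / 2), y ≠ 0 ∧ ‖y‖ = 1 / 2 := by
    intro y hy
    rw [mem_sphere_zero_iff_norm] at hy
    exact ⟨fun h => by rw [h] at hy; norm_num at hy, hy⟩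
  have h1 := (isCompact_sphere (0 : Cn n) (1 / 2)).eventually_forall_of_forall_eventually
    (x₀ := (T, (0 : ℝ))) (P := fun q y => q.1 ∈ Icc (0 : ℝ) 1 → 0 < q.2 →
      ‖Jt q.1 (q.2 • y) y - Jt q.1 (-q.2 • y) y‖ ^ 2 ≤ ε / 8 * q.2) fun y hy => hF.eventually_reflect hT (hK' y hy).1 ((hK' y hy).2.trans_lt (by norm_num))
      (show 0 < ε / 8 by positivity)
  obtain ⟨δ, hδ, h2⟩ := Metric.eventually_nhds_iff.1 h1
  refine ⟨δ / 2, by positivity, fun t ht htT y hy hyδ => ?_⟩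
  -- The vector fed to J is scaled as well, so the square gains r², and (ε/8) r³ = ε ‖y‖³.
  set r : ℝ := 2 * ‖y‖ with hr
  have hμ : 0 < ‖y‖ := norm_pos_iff.2 hy
  have hr0 : 0 < r := by positivity
  have hmem : r⁻¹ • y ∈ Metric.sphere (0 : Cn n) (1 / 2) := by
    rw [mem_sphere_zero_iff_norm, norm_smul, Real.norm_of_nonneg (by positivity), hr]
    field_simp
  have h3 := h2 (y := (t, r)) (by
    rw [Prod.dist_eq, max_lt_iff, Real.dist_eq, Real.dist_eq, sub_zero, abs_of_pos hr0]
    exact ⟨by linarith, by linarith⟩) _ hmem ht hr0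
  rw [neg_smul, smul_inv_smul₀ hr0.ne', _root_.map_smul, _root_.map_smul, ← smul_sub, norm_smul,
    Real.norm_of_nonneg (by positivity), mul_pow, inv_pow, inv_mul_le_iff₀ (by positivity)] at h3
  calc _ ≤ _ := h3
    _ = ε * ‖y‖ ^ 3 := by rw [hr]; ring

end IsSpecialFamily

/-! ### The defect of J on 𝓩 and its transport equation -/

section Transport

variable {n : ℕ}

/-- The defect of `J` on `𝓩`. -/
def defect (J : EndField n) : VField n := fun y => J y y - Complex.I • y

/-- From J_y y = i y and J² = −1 one gets J_y(i y) = −y, and real linearity covers the complex line.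
The boundary sphere is reached by radial limits. -/
lemma standardOnZ_of_defect {J : EndField n}
    (h : ∀ y ∈ puncturedOpenBall n, defect J y = 0) (hJ : ContinuousOn J (puncturedBall n))
    (hsq : ∀ z ∈ puncturedBall n, ∀ h, J z (J z h) = -h) : StandardOnZ J := by
  have h1 : ∀ y ∈ puncturedBall n, J y y = Complex.I • y := by
    intro y hy
    have hlim : Tendsto (fun s : ℝ => s • y) (𝓝[<] 1) (𝓝[puncturedBall n] y) := by
      refine tendsto_nhdsWithin_iff.2 ⟨?_, ?_⟩
      · have : Continuous fun s : ℝ => s • y := by fun_prop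
        simpa using (this.tendsto 1).mono_left nhdsWithin_le_nhds
      · filter_upwards [Ioo_mem_nhdsLT (zero_lt_one (α := ℝ))] with s hs
        refine ⟨smul_ne_zero hs.1.ne' hy.1, ?_⟩
        rw [norm_smul, Real.norm_eq_abs, abs_of_pos hs.1]
        exact mul_le_one₀ hs.2.le (norm_nonneg _) hy.2
    have hc : ContinuousWithinAt (defect J) (puncturedBall n) y :=
      ((hJ y hy).clm_apply continuousWithinAt_id).sub
        (continuous_const_smul Complex.I).continuousWithinAt
    have h2 : defect J y = 0 := by
      refine tendsto_nhds_unique_of_eventuallyEq (hc.tendsto.comp hlim) tendsto_const_nhds ?_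
      filter_upwards [Ioo_mem_nhdsLT (zero_lt_one (α := ℝ))] with s hs
      refine h _ ⟨smul_ne_zero hs.1.ne' hy.1, ?_⟩
      rw [norm_smul, Real.norm_eq_abs, abs_of_pos hs.1]
      exact mul_lt_one_of_nonneg_of_lt_one_left hs.1.le hs.2 hy.2
    exact sub_eq_zero.1 h2
  intro y hy c
  have h2 : J y (Complex.I • y) = -y := by rw [← h1 y hy, hsq y hy]
  have e2 : c • y = c.re • y + c.im • (Complex.I • y) := by
    rw [← Complex.coe_smul, ← Complex.coe_smul, smul_smul, ← add_smul, Complex.re_add_im]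
  rw [mul_smul, e2, map_add, _root_.map_smul, _root_.map_smul, h1 y hy, h2, smul_add,
    smul_comm _ c.re, smul_comm _ c.im, smul_smul Complex.I, Complex.I_mul_I, neg_one_smul]

lemma hasFDerivAt_defect {J : EndField n} {y : Cn n} (hJ : DifferentiableAt ℝ J y) :
    HasFDerivAt (defect J) (J y ∘L ContinuousLinearMap.id ℝ (Cn n) + (fderiv ℝ J y).flip y - stdJ n) y :=
  (hJ.hasFDerivAt.clm_apply (hasFDerivAt_id y)).sub (stdJ n).hasFDerivAt

/-- The evolution of the defect is a transport equation along `X`. -/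
lemma neg_lieDer_self {J : EndField n} {X : VField n} {y : Cn n} (hy : y ≠ 0)
    (hJ : DifferentiableAt ℝ J y) (hX : DifferentiableAt ℝ X y) (hsq : ∀ h, J y (J y h) = -h)
    (hZ : J y (VectorField.lieBracket ℝ (fun y => y) (hPart X) y)
      = VectorField.lieBracket ℝ (fun y => Complex.I • y) (hPart X) y) {c : ℂ}
    (hc : ∀ d : ℂ, fderiv ℝ (fun y => ballTheta y (X y)) y (d • y) = d * c) :
    -lieDer X J y y = -VectorField.lieBracket ℝ X (defect J) y - c.re • defect J y +
      c.im • J y (defect J y) := by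
  obtain ⟨hd, -⟩ := fderiv_ballTheta hy hX
  have hW : HasFDerivAt (hPart X) (fderiv ℝ X y -
      (ballTheta y (X y) • ContinuousLinearMap.id ℝ (Cn n) +
        (fderiv ℝ (fun y => ballTheta y (X y)) y).smulRight y)) y :=
    hX.hasFDerivAt.sub (hd.hasFDerivAt.smul (hasFDerivAt_id y))
  have hI : HasFDerivAt (fun y : Cn n => Complex.I • y)
      (Complex.I • ContinuousLinearMap.id ℝ (Cn n)) y := (hasFDerivAt_id y).const_smul Complex.I
  simp only [VectorField.lieBracket, hW.fderiv, hI.fderiv, fderiv_fun_id, hPart] at hZ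
  have hc1 := hc 1
  have hcI := hc Complex.I
  rw [one_smul, one_mul] at hc1
  simp only [_root_.sub_apply, _root_.add_apply, _root_.smul_apply, ContinuousLinearMap.id_apply,
    ContinuousLinearMap.smulRight_apply, hc1, hcI] at hZ
  rw [← ballTheta] at hZ
  rw [lieDer_eq hJ, VectorField.lieBracket, (hasFDerivAt_defect hJ).fderiv]
  simp only [_root_.sub_apply, _root_.add_apply, ContinuousLinearMap.comp_apply,
    ContinuousLinearMap.id_apply, ContinuousLinearMap.flip_apply]
  have hst : ∀ h, stdJ n h = Complex.I • h := fun h => rfl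
  have e1 : J y (c • y) = c.re • J y y + c.im • J y (Complex.I • y) := by
    rw [← _root_.map_smul, ← _root_.map_smul, ← map_add, ← Complex.coe_smul, ← Complex.coe_smul,
      smul_smul, ← add_smul, Complex.re_add_im]
  have e2 : c • y = c.re • y + c.im • (Complex.I • y) := by
    rw [← Complex.coe_smul, ← Complex.coe_smul, smul_smul, ← add_smul, Complex.re_add_im]
  have e3 : (Complex.I * c) • y = c.re • (Complex.I • y) - c.im • y := by
    rw [mul_smul, e2, smul_add, smul_comm _ c.re, smul_comm _ c.im, smul_smul Complex.I,
      Complex.I_mul_I, neg_one_smul, smul_neg, sub_eq_add_neg]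
  simp only [hst, defect, map_sub, map_add, hsq, e1, e3, smul_sub, smul_neg] at hZ ⊢
  rw [← sub_eq_zero] at hZ ⊢
  -- Up to sign, the discrepancy between the two sides is exactly the discrepancy in (O).
  refine Eq.trans ?_ (neg_eq_zero.2 hZ)
  rw [mul_smul] at *
  module

end Transport

/-! ### The differential inequality for the squared defect -/

namespace IsSpecialFamily

variable {n k : ℕ} {a b : ℝ} {Jt : ℝ → EndField n} {X : ℝ → VField n} {v : ℝ → Cn n}
  {Ψ : ℝ → Cn n ≃ Cn n} {σ : ℝ → Cn n → ℝ}
  {Y : ℝ → (i : Fin n) → Aff i × ℂ → {j : Fin n // j ≠ i} → ℂ}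
  (hF : IsSpecialFamily k a b Jt X v Ψ σ Y)
include hF

lemma contDiffOn_J {t : ℝ} (ht : t ∈ Icc (0 : ℝ) 1) : ContDiffOn ℝ 1 (Jt t) (puncturedBall n) :=
  (hF.complexStructure t ht).regular.contDiffOn.of_le (by have := hF.two_le; norm_cast; omega)

lemma differentiableAt_J {t : ℝ} (ht : t ∈ Icc (0 : ℝ) 1) {y : Cn n} (hy : y ∈ puncturedOpenBall n) :
    DifferentiableAt ℝ (Jt t) y :=
  ((hF.contDiffOn_J ht).contDiffAt (puncturedBall_mem_nhds hy)).differentiableAt (by simp)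

lemma differentiableAt_X {t : ℝ} (ht : t ∈ Icc (0 : ℝ) 1) {y : Cn n} (hy : y ∈ puncturedOpenBall n) :
    DifferentiableAt ℝ (X t) y := by
  have hk := hF.two_le
  exact (((hF.circular t ht).special_regular hF.a_nonneg hF.a_le (by omega)
    (hF.special t ht)).contDiffOn.contDiffAt (puncturedBall_mem_nhds hy)).differentiableAt
      (by simp; omega)

/-- The square of the defect, in the coordinates of `Ψ_T`, satisfies a transport inequality. -/
lemma transport {T t : ℝ} (hT : T ∈ Icc (0 : ℝ) 1) (ht : t ∈ Icc (0 : ℝ) 1) {z : Cn n}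
    (hz : Ψ T z ∈ puncturedOpenBall n) :
    ∃ d : ℝ, HasDerivWithinAt
        (fun s => ‖VectorField.pullback ℝ (Ψ T) (defect (Jt s)) z‖ ^ 2) d (Icc 0 1) t ∧
      DifferentiableAt ℝ (fun z => ‖VectorField.pullback ℝ (Ψ T) (defect (Jt t)) z‖ ^ 2) z ∧
      d + fderiv ℝ (fun z => ‖VectorField.pullback ℝ (Ψ T) (defect (Jt t)) z‖ ^ 2) z
          (VectorField.pullback ℝ (Ψ T) (X t) z) ≤
        (2 * ‖fderiv ℝ (VectorField.pullback ℝ (Ψ T) (X t)) z‖ +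
          2 * (theta (Ψ t) ((Ψ t).symm (Ψ T z)) (v t)).re * (1 + ‖Ψ T z‖ ^ 2) +
          2 * ‖theta (Ψ t) ((Ψ t).symm (Ψ T z)) (v t)‖ * ‖pullEnd (Ψ T) (Jt t) z - stdJ n‖) *
        ‖VectorField.pullback ℝ (Ψ T) (defect (Jt t)) z‖ ^ 2 := by
  have hΨ := hF.circular T hT
  have hk := hF.two_le
  have hz0 : z ≠ 0 := fun h => hz.1 (by rw [h, hΨ.map_zero])
  have hJd := hF.differentiableAt_J ht hz
  have hXd := hF.differentiableAt_X ht hz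
  have hEd := (hasFDerivAt_defect hJd).differentiableAt
  set φ : ℂ := theta (Ψ t) ((Ψ t).symm (Ψ T z)) (v t) with hφ
  set c : ℂ := -(φ + (‖Ψ T z‖ : ℂ) ^ 2 * star φ) with hc
  set L := (fderiv ℝ (Ψ T) z).inverse with hL
  set E := VectorField.pullback ℝ (Ψ T) (defect (Jt t)) with hE
  set X' := VectorField.pullback ℝ (Ψ T) (X t) with hX'
  have hinv : ContDiffAt ℝ 1 (fun z => (fderiv ℝ (Ψ T) z).inverse) z := by
    obtain ⟨e, he⟩ := hΨ.invertible z hz0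
    refine ContDiffAt.comp z (he ▸ contDiffAt_map_inverse e) ?_
    exact ((hΨ.contDiffAt hz0).fderiv_right (m := 1) (by norm_cast; omega))
  have hΨ1 := hΨ.differentiableAt hz0
  have hpd : ∀ {V : VField n}, DifferentiableAt ℝ V (Ψ T z) →
      DifferentiableAt ℝ (VectorField.pullback ℝ (Ψ T) V) z := fun hV =>
    (hinv.differentiableAt one_ne_zero).clm_apply (hV.comp z hΨ1)
  have hEd' : DifferentiableAt ℝ E z := hpd hEd
  have htime : HasDerivWithinAt (fun s => VectorField.pullback ℝ (Ψ T) (defect (Jt s)) z)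
      (-VectorField.lieBracket ℝ X' E z - c.re • E z + c.im • pullEnd (Ψ T) (Jt t) z (E z))
      (Icc 0 1) t := by
    have h1 := (hF.evolution t ht _ hz (Ψ T z)).sub_const (Complex.I • Ψ T z)
    have h2 := L.hasFDerivAt.comp_hasDerivWithinAt t h1
    refine h2.congr_deriv ?_
    rw [neg_lieDer_self hz.1 hJd hXd ((hF.complexStructure t ht).sq _ (puncturedOpenBall_subset hz))
      (hF.zbar t ht _ hz) (c := c) fun d => by
        rw [(hF.circular t ht).fderiv_ballTheta_special (hF.special t ht)
          (fun y hy => hF.differentiableAt_X ht hy) hz, hc]; ring]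
    -- The pull-back by Ψ_T does not depend on time, and the Lie bracket is natural, so the equation
    -- keeps its form in the coordinates of Ψ_T.
    have h3 := VectorField.pullback_lieBracket (𝕜 := ℝ) (n := 2) (by simp)
      ((hΨ.contDiffAt hz0).of_le (by norm_cast; omega)) hXd hEd
    have h4 : L (Jt t (Ψ T z) (defect (Jt t) (Ψ T z))) = pullEnd (Ψ T) (Jt t) z (E z) := by
      rw [pullEnd, ContinuousLinearMap.comp_apply, ContinuousLinearMap.comp_apply, hE,
        VectorField.pullback, hΨ.fderiv_apply_inverse hz0]
    rw [map_add, map_sub, map_neg, _root_.map_smul, _root_.map_smul, h4, ← h3]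
    rfl
  refine ⟨_, htime.norm_sq, hEd'.norm_sq ℝ, ?_⟩
  rw [hEd'.hasFDerivAt.norm_sq.fderiv]
  simp only [_root_.smul_apply, ContinuousLinearMap.comp_apply, innerSL_apply_apply, nsmul_eq_mul,
    Nat.cast_ofNat]
  change 2 * inner ℝ (E z) (-VectorField.lieBracket ℝ X' E z - c.re • E z +
    c.im • pullEnd (Ψ T) (Jt t) z (E z)) + 2 * inner ℝ (E z) (fderiv ℝ E z (X' z)) ≤ _
  -- Multiplication by i is skew for the real inner product, so only the small difference J − i
  -- contributes to the term with Im c. The derivatives of E cancel between the bracket and the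
  -- transport term, leaving ⟨E, dX(E)⟩.
  have hI : ∀ e : Cn n, inner ℝ e (stdJ n e) = 0 := by
    intro e
    have : ∀ j, stdJ n e j = Complex.I * e j := fun j => by simp [stdJ]
    simp only [PiLp.inner_apply, this]
    refine Finset.sum_eq_zero fun j _ => ?_
    simp [Complex.inner]; ring
  have hs : pullEnd (Ψ T) (Jt t) z (E z) = (pullEnd (Ψ T) (Jt t) z - stdJ n) (E z) + stdJ n (E z) := by
    rw [_root_.sub_apply, sub_add_cancel]
  rw [VectorField.lieBracket, hs]
  simp only [inner_add_right, inner_sub_right, inner_smul_right, hI, neg_sub]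
  have b1 : inner ℝ (E z) (fderiv ℝ X' z (E z)) ≤ ‖fderiv ℝ X' z‖ * ‖E z‖ ^ 2 := by
    refine (real_inner_le_norm _ _).trans ?_
    have := (fderiv ℝ X' z).le_opNorm (E z)
    nlinarith [norm_nonneg (E z)]
  have b2 : c.im * inner ℝ (E z) ((pullEnd (Ψ T) (Jt t) z - stdJ n) (E z)) ≤
      ‖φ‖ * ‖pullEnd (Ψ T) (Jt t) z - stdJ n‖ * ‖E z‖ ^ 2 := by
    have g1 : |c.im| ≤ ‖φ‖ := by
      have e : c.im = -(φ.im * (1 - ‖Ψ T z‖ ^ 2)) := by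
        rw [hc, ← Complex.ofReal_pow]; simp [-Complex.ofReal_pow]; ring
      rw [e, abs_neg, abs_mul]
      have h1 : |1 - ‖Ψ T z‖ ^ 2| ≤ 1 := by
        rw [abs_le]
        have := hz.2
        constructor <;> nlinarith [norm_nonneg (Ψ T z)]
      exact (mul_le_of_le_one_right (abs_nonneg _) h1).trans (Complex.abs_im_le_norm φ)
    have g2 : |inner ℝ (E z) ((pullEnd (Ψ T) (Jt t) z - stdJ n) (E z))| ≤
        ‖pullEnd (Ψ T) (Jt t) z - stdJ n‖ * ‖E z‖ ^ 2 := by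
      refine (abs_real_inner_le_norm _ _).trans ?_
      have := (pullEnd (Ψ T) (Jt t) z - stdJ n).le_opNorm (E z)
      nlinarith [norm_nonneg (E z)]
    refine (le_abs_self _).trans ?_
    rw [abs_mul, mul_assoc]
    exact mul_le_mul g1 g2 (abs_nonneg _) (norm_nonneg _)
  have b3 : c.re = -(φ.re * (1 + ‖Ψ T z‖ ^ 2)) := by
    rw [hc, ← Complex.ofReal_pow]; simp [-Complex.ofReal_pow]; ring
  have b4 : inner ℝ (E z) (E z) = ‖E z‖ ^ 2 := real_inner_self_eq_norm_sq _
  rw [b4, b3]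
  linarith

/-- The logarithmic derivative of `μ` along `X`. -/
lemma fderiv_normSq_pullback {T t : ℝ} (hT : T ∈ Icc (0 : ℝ) 1) (ht : t ∈ Icc (0 : ℝ) 1) {z : Cn n}
    (hz : Ψ T z ∈ puncturedBall n) :
    fderiv ℝ (fun z => ‖Ψ T z‖ ^ 2) z (VectorField.pullback ℝ (Ψ T) (X t) z) =
      2 * ‖Ψ T z‖ ^ 2 * ((theta (Ψ t) ((Ψ t).symm (Ψ T z)) (v t)).re * (1 - ‖Ψ T z‖ ^ 2)) := by
  have hΨ := hF.circular T hT
  have hz0 : z ≠ 0 := fun h => hz.1 (by rw [h, hΨ.map_zero])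
  rw [hΨ.fderiv_normSq hz0, theta, VectorField.pullback, hΨ.fderiv_apply_inverse hz0,
    (hF.circular t ht).ballTheta_special (hF.special t ht) hz, ← Complex.ofReal_pow]
  congr 1
  simp [-Complex.ofReal_pow]
  ring

end IsSpecialFamily

/-- A maximum principle for transport inequalities. -/
lemma le_of_transport {V : Type} [NormedAddCommGroup V] [NormedSpace ℝ V] {K : Set (ℝ × V)}
    (hK : IsCompact K) {Q : ℝ → V → ℝ} {ε : ℝ} (hQ : ContinuousOn (fun x : ℝ × V => Q x.1 x.2) K)
    (h : ∀ t z, (t, z) ∈ K → ε < Q t z → (∀ᶠ s in 𝓝[<] t, (s, z) ∈ K) ∧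
      (∀ᶠ z' in 𝓝 z, (t, z') ∈ K) ∧ ∃ (d : ℝ) (w : V), HasDerivWithinAt (fun s => Q s z) d (Iio t) t ∧
        d + fderiv ℝ (Q t) z w < 0) : ∀ t z, (t, z) ∈ K → Q t z ≤ ε := by
  intro t₀ z₀ h₀
  -- At a maximum above ε the derivative in z vanishes and the left derivative in t is nonnegative,
  -- contradicting the strict inequality. Using only times before t includes maxima at the final
  -- time.
  obtain ⟨⟨t, z⟩, hx, hmax⟩ := hK.exists_isMaxOn ⟨_, h₀⟩ hQ
  refine (hmax h₀).trans ?_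
  by_contra! hlt
  obtain ⟨h1, h2, d, w, hd, hneg⟩ := h t z hx hlt
  have e1 : fderiv ℝ (Q t) z = 0 := IsLocalMax.fderiv_eq_zero (by
    filter_upwards [h2] with z' hz' using hmax hz')
  have e2 : 0 ≤ d := by
    rw [hasDerivWithinAt_iff_tendsto_slope' self_notMem_Iio] at hd
    refine ge_of_tendsto hd ?_
    filter_upwards [h1, self_mem_nhdsWithin] with s hs hst
    have h3 : Q s z ≤ Q t z := hmax hs
    rw [slope_def_field]
    exact div_nonneg_of_nonpos (by linarith) (by have : s < t := hst; linarith)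
  rw [e1] at hneg
  simp at hneg
  linarith

/-! ### Topological properties of Ψ used on annuli -/

namespace IsCircularRep

variable {n k : ℕ} {a : ℝ} {J : EndField n} {Ψ : Cn n ≃ Cn n} (hΨ : IsCircularRep k a J Ψ)
include hΨ

lemma continuous : Continuous Ψ := by
  rw [continuous_iff_continuousAt]
  intro z
  by_cases hz : z = 0
  · obtain ⟨C, hC⟩ := hΨ.exists_fderiv_bound
    subst hz
    have h1 : ∀ z, ‖Ψ z‖ ≤ C * ‖z‖ := by
      intro z
      by_cases hz : z = 0
      · rw [hz, hΨ.map_zero]; simp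
      · rw [← hΨ.fderiv_self hz]
        exact (fderiv ℝ Ψ z).le_of_opNorm_le (hC z hz) z
    rw [ContinuousAt, hΨ.map_zero]
    refine squeeze_zero_norm h1 ?_
    have : Continuous fun z : Cn n => C * ‖z‖ := by fun_prop
    simpa using this.tendsto 0
  · exact (hΨ.differentiableAt hz).continuousAt

lemma continuous_symm : Continuous Ψ.symm := by
  rw [continuous_iff_continuousAt]
  intro y
  by_cases hy : y = 0
  · obtain ⟨C, -, hC⟩ := hΨ.exists_symm_bound
    subst hy
    have h0 : Ψ.symm 0 = 0 := by rw [Equiv.symm_apply_eq, hΨ.map_zero]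
    rw [ContinuousAt, h0]
    refine squeeze_zero_norm hC ?_
    have : Continuous fun z : Cn n => C * ‖z‖ := by fun_prop
    simpa using this.tendsto 0
  · exact (hΨ.symm_contDiffAt hy).continuousAt

lemma isCompact_annulus (m : ℝ) : IsCompact {z | m ≤ ‖Ψ z‖ ∧ ‖Ψ z‖ ≤ 1} := by
  have h1 : {z | m ≤ ‖Ψ z‖ ∧ ‖Ψ z‖ ≤ 1} = Ψ.symm '' (Metric.closedBall 0 1 \ Metric.ball 0 m) := by
    rw [Equiv.image_symm_eq_preimage]
    ext z
    simp [and_comm]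
  rw [h1]
  exact ((isCompact_closedBall _ _).diff Metric.isOpen_ball).image hΨ.continuous_symm

lemma contDiffAt_inverse_fderiv (hk : 1 ≤ k) {z : Cn n} (hz : z ≠ 0) :
    ContDiffAt ℝ 1 (fun z => (fderiv ℝ Ψ z).inverse) z := by
  obtain ⟨e, he⟩ := hΨ.invertible z hz
  refine ContDiffAt.comp z (he ▸ contDiffAt_map_inverse e) ?_
  exact ((hΨ.contDiffAt hz).fderiv_right (m := 1) (by norm_cast; omega))

lemma uniqueDiffOn_preimage : UniqueDiffOn ℝ {z | Ψ z ∈ puncturedBall n} := by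
  intro z hz
  have hy : Ψ z ≠ 0 := hz.1
  have h1 : {z | Ψ z ∈ puncturedBall n} = Ψ.symm '' puncturedBall n := by
    rw [Equiv.image_symm_eq_preimage]; rfl
  have h2 := ((hΨ.symm_contDiffAt hy).differentiableAt (by simp)).hasFDerivAt.hasFDerivWithinAt
    (s := puncturedBall n)
  have h3 := h2.uniqueDiffWithinAt (goodSet_puncturedBall.1 _ hz) (by
    rw [hΨ.fderiv_symm hy, Equiv.symm_apply_apply]
    have hz0 : z ≠ 0 := fun h => hy (by rw [h, hΨ.map_zero])
    exact Function.Surjective.denseRange fun h => ⟨_, hΨ.fderiv_inverse_apply hz0 h⟩)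
  rwa [← h1, Equiv.symm_apply_apply] at h3

end IsCircularRep

/-! ### Weighted maximum principle for the defect -/

namespace IsSpecialFamily

variable {n k : ℕ} {a b : ℝ} {Jt : ℝ → EndField n} {X : ℝ → VField n} {v : ℝ → Cn n}
  {Ψ : ℝ → Cn n ≃ Cn n} {σ : ℝ → Cn n → ℝ}
  {Y : ℝ → (i : Fin n) → Aff i × ℂ → {j : Fin n // j ≠ i} → ℂ}
  (hF : IsSpecialFamily k a b Jt X v Ψ σ Y)
include hF

/-- The rate of growth of the square of the defect, weighted by `1 - μ²`. -/
def growth (_ : IsSpecialFamily k a b Jt X v Ψ σ Y) (T t : ℝ) (z : Cn n) : ℝ :=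
  2 * ‖fderiv ℝ (VectorField.pullback ℝ (Ψ T) (X t)) z‖ +
    2 * (theta (Ψ t) ((Ψ t).symm (Ψ T z)) (v t)).re +
    2 * ‖theta (Ψ t) ((Ψ t).symm (Ψ T z)) (v t)‖ * ‖pullEnd (Ψ T) (Jt t) z - stdJ n‖

omit hF in
lemma map_subset {m : ℝ} (hm : 0 < m) {T : ℝ} :
    {z | m ≤ ‖Ψ T z‖ ∧ ‖Ψ T z‖ ≤ 1} ⊆ {z | Ψ T z ∈ puncturedBall n} := fun _ hz =>
  ⟨norm_pos_iff.1 (hm.trans_le hz.1), hz.2⟩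

lemma continuousOn_defect {T : ℝ} (hT : T ∈ Icc (0 : ℝ) 1) :
    ContinuousOn (fun x : ℝ × Cn n => VectorField.pullback ℝ (Ψ T) (defect (Jt x.1)) x.2)
      (Icc 0 1 ×ˢ {z | Ψ T z ∈ puncturedBall n}) := by
  have hΨ := hF.circular T hT
  have hk := hF.two_le
  have c1 : ContinuousOn (fun x : ℝ × Cn n => (fderiv ℝ (Ψ T) x.2).inverse)
      (Icc 0 1 ×ˢ {z | Ψ T z ∈ puncturedBall n}) := fun x hx =>
    ((hΨ.contDiffAt_inverse_fderiv (by omega) fun h => hx.2.1 (by rw [h, hΨ.map_zero])).continuousAt.comp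
      continuousAt_snd).continuousWithinAt
  have c2 : ContinuousOn (fun x : ℝ × Cn n => Jt x.1 (Ψ T x.2))
      (Icc 0 1 ×ˢ {z | Ψ T z ∈ puncturedBall n}) :=
    hF.J_regular.contDiffOn.continuousOn.comp (f := fun x : ℝ × Cn n => (x.1, Ψ T x.2))
      (continuous_fst.prodMk (hΨ.continuous.comp continuous_snd)).continuousOn fun x hx => hx
  have c3 : ContinuousOn (fun x : ℝ × Cn n => Ψ T x.2)
      (Icc 0 1 ×ˢ {z | Ψ T z ∈ puncturedBall n}) :=
    (hΨ.continuous.comp continuous_snd).continuousOn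
  exact c1.clm_apply ((c2.clm_apply c3).sub (c3.const_smul Complex.I))

/-- Bounds away from the origin. -/
lemma exists_far_bound {T : ℝ} (hT : T ∈ Icc (0 : ℝ) 1) {m : ℝ} (hm : 0 < m) :
    ∃ C, 0 < C ∧ ∀ t ∈ Icc (0 : ℝ) 1, ∀ z, m ≤ ‖Ψ T z‖ → ‖Ψ T z‖ < 1 →
      hF.growth T t z ≤ C ∧ ‖VectorField.pullback ℝ (Ψ T) (X t) z‖ ≤ C ∧
        ‖theta (Ψ t) ((Ψ t).symm (Ψ T z)) (v t)‖ ≤ C := by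
  have hΨ := hF.circular T hT
  have hk := hF.two_le
  set S : Set (Cn n) := {z | Ψ T z ∈ puncturedBall n} with hSdef
  have hS0 : ∀ z ∈ S, z ≠ 0 := fun z hz h => hz.1 (by rw [h, hΨ.map_zero])
  have hK : IsCompact (Icc (0 : ℝ) 1 ×ˢ {z | m ≤ ‖Ψ T z‖ ∧ ‖Ψ T z‖ ≤ 1}) :=
    isCompact_Icc.prod (hΨ.isCompact_annulus m)
  have hKS : Icc (0 : ℝ) 1 ×ˢ {z | m ≤ ‖Ψ T z‖ ∧ ‖Ψ T z‖ ≤ 1} ⊆ Icc (0 : ℝ) 1 ×ˢ S :=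
    prod_mono_right (map_subset hm)
  have dΨ : ContDiffOn ℝ 1 (fun x : ℝ × Cn n => Ψ T x.2) (Icc (0 : ℝ) 1 ×ˢ S) := fun x hx =>
    (((hΨ.contDiffAt (hS0 _ hx.2)).of_le (by norm_cast; omega)).comp x
      contDiffAt_snd).contDiffWithinAt
  have dL : ContDiffOn ℝ 1 (fun x : ℝ × Cn n => (fderiv ℝ (Ψ T) x.2).inverse) (Icc (0 : ℝ) 1 ×ˢ S) :=
    fun x hx => ((hΨ.contDiffAt_inverse_fderiv (by omega) (hS0 _ hx.2)).comp x
      contDiffAt_snd).contDiffWithinAt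
  have dX : ContDiffOn ℝ 1 (fun x : ℝ × Cn n => VectorField.pullback ℝ (Ψ T) (X x.1) x.2)
      (Icc (0 : ℝ) 1 ×ˢ S) :=
    dL.clm_apply (hF.X_regular.comp (f := fun x : ℝ × Cn n => (x.1, Ψ T x.2))
      (contDiffOn_fst.prodMk dΨ) fun x hx => hx)
  have cX' := dX.continuousOn_fderivWithin (uniqueDiffOn_Icc_zero_one.prod hΨ.uniqueDiffOn_preimage)
    le_rfl
  have cφ : ContinuousOn (fun x : ℝ × Cn n => theta (Ψ x.1) ((Ψ x.1).symm (Ψ T x.2)) (v x.1))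
      (Icc (0 : ℝ) 1 ×ˢ S) :=
    hF.param_theta.continuousOn.comp (f := fun x : ℝ × Cn n => (x.1, Ψ T x.2))
      (continuousOn_fst.prodMk dΨ.continuousOn) fun x hx => ⟨hx.1, hx.2.1⟩
  have cD : ContinuousOn (fun x : ℝ × Cn n => fderiv ℝ (Ψ T) x.2) (Icc (0 : ℝ) 1 ×ˢ S) := fun x hx =>
    ((((hΨ.contDiffAt (hS0 _ hx.2)).fderiv_right (m := 1) (by norm_cast; omega)).continuousAt).comp
      continuousAt_snd).continuousWithinAt
  have cJ : ContinuousOn (fun x : ℝ × Cn n => pullEnd (Ψ T) (Jt x.1) x.2 - stdJ n)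
      (Icc (0 : ℝ) 1 ×ˢ S) :=
    (dL.continuousOn.clm_comp ((hF.J_regular.contDiffOn.continuousOn.comp
      (f := fun x : ℝ × Cn n => (x.1, Ψ T x.2)) (continuousOn_fst.prodMk dΨ.continuousOn)
        fun x hx => hx).clm_comp cD)).sub continuousOn_const
  obtain ⟨C1, h1⟩ := hK.exists_bound_of_continuousOn (cX'.mono hKS)
  obtain ⟨C2, h2⟩ := hK.exists_bound_of_continuousOn (cφ.mono hKS)
  obtain ⟨C3, h3⟩ := hK.exists_bound_of_continuousOn (cJ.mono hKS)
  obtain ⟨C4, h4⟩ := hK.exists_bound_of_continuousOn (dX.continuousOn.mono hKS)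
  refine ⟨max 1 (max (2 * C1 + 2 * C2 + 2 * C2 * C3) (max C4 C2)), by positivity, fun t ht z hz hz1 => ?_⟩
  have hx : (t, z) ∈ Icc (0 : ℝ) 1 ×ˢ {z | m ≤ ‖Ψ T z‖ ∧ ‖Ψ T z‖ ≤ 1} := ⟨ht, hz, hz1.le⟩
  refine ⟨le_trans ?_ ((le_max_left _ _).trans (le_max_right _ _)),
    (h4 _ hx).trans ((le_max_left _ _).trans ((le_max_right _ _).trans (le_max_right _ _))),
    (h2 _ hx).trans ((le_max_right _ _).trans ((le_max_right _ _).trans (le_max_right _ _)))⟩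
  have hzS : Ψ T z ∈ puncturedOpenBall n := ⟨(map_subset hm ⟨hz, hz1.le⟩).1, hz1⟩
  have b1 : ‖fderiv ℝ (VectorField.pullback ℝ (Ψ T) (X t)) z‖ ≤ C1 := by
    have g1 := (dX.differentiableOn one_ne_zero (t, z) (hKS hx)).hasFDerivWithinAt
    have g2 := HasFDerivWithinAt.comp (f := fun z : Cn n => (t, z)) z g1
      ((hasFDerivAt_prodMk_right (𝕜 := ℝ) t z).hasFDerivWithinAt (s := S)) fun z' hz' => ⟨ht, hz'⟩
    have g3 : S ∈ 𝓝 z := mem_of_superset ((isOpen_puncturedOpenBall.preimage hΨ.continuous).mem_nhds hzS)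
      fun z' hz' => puncturedOpenBall_subset hz'
    have g4 : fderiv ℝ (VectorField.pullback ℝ (Ψ T) (X t)) z = _ := (g2.hasFDerivAt g3).fderiv
    rw [g4]
    calc _ ≤ _ := ContinuousLinearMap.opNorm_comp_le _ _
      _ ≤ C1 * 1 := mul_le_mul (h1 _ hx) (ContinuousLinearMap.norm_inr_le_one ℝ ℝ (Cn n))
          (norm_nonneg _) ((norm_nonneg _).trans (h1 _ hx))
      _ = C1 := mul_one _
  have b2 := h2 _ hx
  have b3 := h3 _ hx
  simp only at b2 b3
  have b4 := (Complex.re_le_norm (theta (Ψ t) ((Ψ t).symm (Ψ T z)) (v t))).trans b2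
  have b5 := mul_le_mul b2 b3 (norm_nonneg _) ((norm_nonneg _).trans b2)
  rw [growth]
  linarith

/-- A weighted estimate of the defect. -/
lemma weighted_defect_le {T S : ℝ} (hT : T ∈ Icc (0 : ℝ) 1) (hS : S ≤ 1)
    (h0 : ∀ y ∈ puncturedOpenBall n, defect (Jt T) y = 0) {m : ℝ} (hm : 0 < m) {C ε : ℝ} (hC : 0 ≤ C)
    (hε : 0 ≤ ε) {w : ℝ → Cn n → ℝ}
    (hw : ContinuousOn (fun x : ℝ × Cn n => w x.1 x.2) (Icc T S ×ˢ {z | m ≤ ‖Ψ T z‖ ∧ ‖Ψ T z‖ ≤ 1}))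
    (hb : ∀ t ∈ Icc T S, ∀ z, ‖Ψ T z‖ = m → ‖Ψ T z‖ < 1 →
      w t z * ‖VectorField.pullback ℝ (Ψ T) (defect (Jt t)) z‖ ^ 2 ≤ ε)
    (hd : ∀ t ∈ Ioc T S, ∀ z, m < ‖Ψ T z‖ → ‖Ψ T z‖ < 1 → 0 < w t z → defect (Jt t) (Ψ T z) ≠ 0 →
      ∃ d, HasDerivAt (fun s => w s z) d t ∧ DifferentiableAt ℝ (w t) z ∧
        d + fderiv ℝ (w t) z (VectorField.pullback ℝ (Ψ T) (X t) z) +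
          (hF.growth T t z - C) * w t z < 0) :
    ∀ t ∈ Icc T S, ∀ z, m ≤ ‖Ψ T z‖ → ‖Ψ T z‖ ≤ 1 →
      Real.exp (-C * t) * (1 - ‖Ψ T z‖ ^ 2) * w t z *
        ‖VectorField.pullback ℝ (Ψ T) (defect (Jt t)) z‖ ^ 2 ≤ ε := by
  have hΨ := hF.circular T hT
  have hTS : Icc T S ⊆ Icc (0 : ℝ) 1 := Icc_subset_Icc hT.1 hS
  set K : Set (ℝ × Cn n) := Icc T S ×ˢ {z | m ≤ ‖Ψ T z‖ ∧ ‖Ψ T z‖ ≤ 1} with hKdef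
  have hK : IsCompact K := isCompact_Icc.prod (hΨ.isCompact_annulus m)
  have hcont : ContinuousOn (fun x : ℝ × Cn n => Real.exp (-C * x.1) * (1 - ‖Ψ T x.2‖ ^ 2) * w x.1 x.2 *
      ‖VectorField.pullback ℝ (Ψ T) (defect (Jt x.1)) x.2‖ ^ 2) K := by
    have c1 : Continuous fun x : ℝ × Cn n => Real.exp (-C * x.1) * (1 - ‖Ψ T x.2‖ ^ 2) := by
      have := hΨ.continuous
      fun_prop
    exact (c1.continuousOn.mul hw).mul (((hF.continuousOn_defect hT).mono
      (prod_mono hTS (map_subset hm))).norm.pow 2)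
  have key := le_of_transport hK (Q := fun t z => Real.exp (-C * t) * (1 - ‖Ψ T z‖ ^ 2) * w t z *
      ‖VectorField.pullback ℝ (Ψ T) (defect (Jt t)) z‖ ^ 2) (ε := ε) hcont ?_
  · exact fun t ht z h1 h2 => key t z ⟨ht, h1, h2⟩
  intro t z hx hlt
  obtain ⟨ht, hz, hz1⟩ := hx
  have ht01 := hTS ht
  -- A value above ε ≥ 0 cannot occur on the unit sphere, because of the factor 1 − μ²; nor at t =
  -- T, where the defect is zero; nor on μ = m, by the boundary hypothesis and since the other
  -- factors are at most 1.
  have hlt1 : ‖Ψ T z‖ < 1 := by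
    refine lt_of_le_of_ne hz1 fun h => ?_
    rw [h] at hlt
    simp at hlt
    linarith
  have hopen : Ψ T z ∈ puncturedOpenBall n := ⟨(map_subset hm ⟨hz, hz1⟩).1, hlt1⟩
  have hz0 : z ≠ 0 := fun h => hopen.1 (by rw [h, hΨ.map_zero])
  have hp : 0 < 1 - ‖Ψ T z‖ ^ 2 := by nlinarith [norm_nonneg (Ψ T z)]
  have hexp := Real.exp_pos (-C * t)
  have hN : 0 < ‖VectorField.pullback ℝ (Ψ T) (defect (Jt t)) z‖ ^ 2 := by
    refine lt_of_le_of_ne (sq_nonneg _) fun h => ?_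
    rw [← h, mul_zero] at hlt
    linarith
  have hwpos : 0 < w t z := by
    by_contra! h
    have : Real.exp (-C * t) * (1 - ‖Ψ T z‖ ^ 2) * w t z *
      ‖VectorField.pullback ℝ (Ψ T) (defect (Jt t)) z‖ ^ 2 ≤ 0 :=
      mul_nonpos_of_nonpos_of_nonneg (mul_nonpos_of_nonneg_of_nonpos (by positivity) h) hN.le
    linarith
  have hdef : defect (Jt t) (Ψ T z) ≠ 0 := fun h => by
    rw [VectorField.pullback, h] at hN
    simp at hN
  have hTt : T < t := by
    refine lt_of_le_of_ne ht.1 fun h => hdef ?_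
    rw [← h]
    exact h0 _ hopen
  have hmlt : m < ‖Ψ T z‖ := by
    refine lt_of_le_of_ne hz fun h => ?_
    have h1 := hb t ht z h.symm hlt1
    have h2 : Real.exp (-C * t) * (1 - ‖Ψ T z‖ ^ 2) ≤ 1 := by
      refine mul_le_one₀ (Real.exp_le_one_iff.2 ?_) hp.le (by nlinarith [norm_nonneg (Ψ T z)])
      rw [neg_mul, neg_nonpos]
      exact mul_nonneg hC ht01.1
    have h3 := mul_le_mul_of_nonneg_right h2 (mul_pos hwpos hN).le
    rw [← mul_assoc, one_mul] at h3
    linarith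
  refine ⟨?_, ?_, ?_⟩
  · filter_upwards [Ioo_mem_nhdsLT hTt] with s hs
    exact ⟨⟨hs.1.le, hs.2.le.trans ht.2⟩, hz, hz1⟩
  · have hc : Continuous fun z => ‖Ψ T z‖ := hΨ.continuous.norm
    filter_upwards [hc.continuousAt.eventually_const_lt hmlt,
      hc.continuousAt.eventually_lt_const hlt1] with z' h1 h2
    exact ⟨ht, h1.le, h2.le⟩
  · obtain ⟨d, hd1, hd2, hd3⟩ := hd t ⟨hTt, ht.2⟩ z hmlt hlt1 hwpos hdef
    obtain ⟨e, he1, he2, he3⟩ := hF.transport hT ht01 hopen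
    set N : ℝ → Cn n → ℝ := fun t z => ‖VectorField.pullback ℝ (Ψ T) (defect (Jt t)) z‖ ^ 2 with hNdef
    have he1' : HasDerivWithinAt (fun s => N s z) e (Iio t) t := by
      refine (he1.mono_of_mem_nhdsWithin ?_)
      have : Icc T t ∈ 𝓝[<] t := mem_of_superset (Ioo_mem_nhdsLT hTt) Ioo_subset_Icc_self
      exact mem_of_superset this (Icc_subset_Icc hT.1 (ht.2.trans hS))
    have hE : HasDerivAt (fun s => Real.exp (-C * s)) (-C * Real.exp (-C * t)) t := by
      simpa [mul_comm] using ((hasDerivAt_id t).const_mul (-C)).exp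
    have hμ := hF.fderiv_normSq_pullback hT ht01 (puncturedOpenBall_subset hopen)
    have hμd : DifferentiableAt ℝ (fun z => ‖Ψ T z‖ ^ 2) z := (hΨ.differentiableAt hz0).norm_sq ℝ
    have ht' := ((hE.hasDerivWithinAt (s := Iio t)).mul_const (1 - ‖Ψ T z‖ ^ 2)).mul
      (hd1.hasDerivWithinAt (s := Iio t)) |>.mul he1'
    have hz' := (((hμd.hasFDerivAt.const_sub 1).const_mul (Real.exp (-C * t))).mul
      hd2.hasFDerivAt).mul (he2.hasFDerivAt)
    refine ⟨_, VectorField.pullback ℝ (Ψ T) (X t) z, ht', ?_⟩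
    have hz'' := hz'.fderiv
    rw [show fderiv ℝ (fun z => Real.exp (-C * t) * (1 - ‖Ψ T z‖ ^ 2) * w t z *
      ‖VectorField.pullback ℝ (Ψ T) (defect (Jt t)) z‖ ^ 2) z = _ from hz'']
    simp only [_root_.add_apply, _root_.smul_apply, _root_.neg_apply, smul_eq_mul, hμ, Pi.mul_apply]
    rw [growth] at hd3
    set φ := theta (Ψ t) ((Ψ t).symm (Ψ T z)) (v t)
    set D := fderiv ℝ (w t) z (VectorField.pullback ℝ (Ψ T) (X t) z)
    set A := ‖fderiv ℝ (VectorField.pullback ℝ (Ψ T) (X t)) z‖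
    set B := ‖pullEnd (Ψ T) (Jt t) z - stdJ n‖
    set N' := fderiv ℝ (fun z => ‖VectorField.pullback ℝ (Ψ T) (defect (Jt t)) z‖ ^ 2) z
      (VectorField.pullback ℝ (Ψ T) (X t) z)
    set ν := ‖VectorField.pullback ℝ (Ψ T) (defect (Jt t)) z‖ ^ 2
    set q := ‖Ψ T z‖ ^ 2
    set x := Real.exp (-C * t)
    have hν : N t z = ν := rfl
    rw [hν]
    -- Along X the logarithmic derivative of 1 − μ² is −2μ² Re φ. This cancels the term 2μ² Re φ of
    -- the transport inequality and leaves the rate called growth.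
    have f1 := mul_le_mul_of_nonneg_left he3 (show 0 ≤ x * (1 - q) * w t z by positivity)
    have f2 := mul_neg_of_pos_of_neg (show 0 < x * (1 - q) * ν by positivity) hd3
    calc _ = x * (1 - q) * w t z * (e + N') + x * (1 - q) * ν * (d + D - C * w t z - 2 * q * φ.re * w t z) := by ring
      _ ≤ _ := add_le_add f1 le_rfl
      _ = x * (1 - q) * ν * (d + D + (2 * A + 2 * φ.re + 2 * ‖φ‖ * B - C) * w t z) := by ring
      _ < 0 := f2

end IsSpecialFamily

/-! ### Bounds for the inverse differential -/

namespace IsCircularRep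

variable {n k : ℕ} {a : ℝ} {J : EndField n} {Ψ : Cn n ≃ Cn n} (hΨ : IsCircularRep k a J Ψ)
include hΨ

lemma exists_inverse_fderiv_bound : ∃ C : ℝ, 0 < C ∧ ∀ z, z ≠ 0 → ‖(fderiv ℝ Ψ z).inverse‖ ≤ C := by
  have hc : ContinuousOn (fun z => (fderiv ℝ Ψ z).inverse) (Metric.sphere 0 1) := fun z hz => by
    have hz0 : z ≠ 0 := fun h => by simp [h] at hz
    obtain ⟨e, he⟩ := hΨ.invertible z hz0
    have h1 : ContinuousAt ContinuousLinearMap.inverse (fderiv ℝ Ψ z) :=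
      he ▸ (contDiffAt_map_inverse (𝕜 := ℝ) (n := 0) e).continuousAt
    exact (h1.comp (((hΨ.contDiffAt hz0).fderiv_right (m := 0) (by simp)).continuousAt)).continuousWithinAt
  obtain ⟨C, hC⟩ := (isCompact_sphere (0 : Cn n) 1).exists_bound_of_continuousOn hc
  refine ⟨max 1 C, by positivity, fun z hz => ?_⟩
  have h1 : (‖z‖⁻¹) • z ∈ Metric.sphere (0 : Cn n) 1 := by simp [norm_smul, hz]
  have := hC _ h1
  rw [hΨ.fderiv_real_smul hz (inv_ne_zero (norm_ne_zero_iff.2 hz))] at this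
  exact this.trans (le_max_right _ _)

lemma pullback_eq_zero {X : VField n} {z : Cn n} (hz : z ≠ 0) :
    VectorField.pullback ℝ Ψ X z = 0 ↔ X (Ψ z) = 0 := by
  constructor
  · intro h
    have h1 := hΨ.fderiv_apply_inverse hz (X (Ψ z))
    rw [VectorField.pullback] at h
    rw [h, _root_.map_zero] at h1
    exact h1.symm
  · intro h
    rw [VectorField.pullback, h, _root_.map_zero]

end IsCircularRep

/-! ### Confinement of the defect to a cone about the direction of the pole -/

namespace IsSpecialFamily

variable {n k : ℕ} {a b : ℝ} {Jt : ℝ → EndField n} {X : ℝ → VField n} {v : ℝ → Cn n}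
  {Ψ : ℝ → Cn n ≃ Cn n} {σ : ℝ → Cn n → ℝ}
  {Y : ℝ → (i : Fin n) → Aff i × ℂ → {j : Fin n // j ≠ i} → ℂ}
  (hF : IsSpecialFamily k a b Jt X v Ψ σ Y)
include hF

/-- The defect vanishes outside any given cone about the direction of the pole. -/
lemma defect_support {T : ℝ} (hT : T ∈ Icc (0 : ℝ) 1) (hS : StandardOnZ (Jt T)) {q : ℝ} (hq0 : 0 < q)
    (hq : q < 1) : ∃ δ, 0 < δ ∧ ∀ t ∈ Icc T (T + δ), t ≤ 1 → ∀ z, Ψ T z ∈ puncturedOpenBall n →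
      defect (Jt t) (Ψ T z) ≠ 0 → q * (‖v T‖ * ‖z‖) ≤ inner ℝ (v T) z := by
  have hΨ := hF.circular T hT
  set V := ‖v T‖ with hV
  have hVpos : 0 < V := norm_pos_iff.2 (hF.guide_ne_zero T hT)
  -- The weight V‖z‖(1 − C1(t − T)) − l⟨v_T, z⟩ − κ requires l > 1 for its decay along X ≈ v_T, and
  -- l q = (1 + q)/2 < 1 so that the final cone still fits into the one given by q.
  set l := (1 + q) / (2 * q) with hl
  have hl1 : 1 < l := by rw [hl, lt_div_iff₀ (by linarith)]; linarith
  have hlq : l * q = (1 + q) / 2 := by rw [hl]; field_simp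
  -- The largest error ‖X − v_T‖ for which V‖X‖ − l⟨v_T, X⟩ ≤ 0 is guaranteed: V(V + e0) = l(V² − V
  -- e0).
  set e0 := (l - 1) * V / (1 + l) with he0
  have he0pos : 0 < e0 := div_pos (mul_pos (by linarith) hVpos) (by linarith)
  have he0' : e0 * (1 + l) = (l - 1) * V := by rw [he0]; field_simp
  obtain ⟨d0, hd0, hnear⟩ := hF.exists_near hT hS he0pos
  obtain ⟨B, hB, hfar⟩ := hF.exists_far_bound hT hd0
  obtain ⟨m0, M, hm0, hM, hmM⟩ := hF.exists_norm_bounds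
  -- Away from the origin X is merely bounded by B; there the decrease of the opening in time, at
  -- rate C1 V‖z‖ with ‖z‖ ≥ d0/M, outweighs the transport.
  set C1 := (1 + l) * B * M / d0 with hC1
  have hC1pos : 0 < C1 := by positivity
  refine ⟨min (d0 / 2) ((1 - q) / (2 * C1)), by
    have : 0 < 1 - q := by linarith
    positivity, fun t₁ ht₁ ht₁1 z₁ hz₁ hdef => ?_⟩
  have hs2 : t₁ - T ≤ d0 / 2 := by linarith [ht₁.2, min_le_left (d0 / 2) ((1 - q) / (2 * C1))]
  have hs3 : C1 * (t₁ - T) ≤ (1 - q) / 2 := by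
    have : t₁ - T ≤ (1 - q) / (2 * C1) := by
      linarith [ht₁.2, min_le_right (d0 / 2) ((1 - q) / (2 * C1))]
    calc _ ≤ C1 * ((1 - q) / (2 * C1)) := mul_le_mul_of_nonneg_left this hC1pos.le
      _ = _ := by field_simp
  have hz₁0 : z₁ ≠ 0 := fun h => hz₁.1 (by rw [h, hΨ.map_zero])
  set r₁ := ‖Ψ T z₁‖ with hr₁
  have hr₁pos : 0 < r₁ := norm_pos_iff.2 hz₁.1
  suffices h : ∀ κ : ℝ, 0 < κ → V * ‖z₁‖ * (1 - C1 * (t₁ - T)) - l * inner ℝ (v T) z₁ - κ ≤ 0 by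
    have h1 : V * ‖z₁‖ * (1 - C1 * (t₁ - T)) - l * inner ℝ (v T) z₁ ≤ 0 :=
      le_of_forall_pos_le_add fun κ hκ => by linarith [h κ hκ]
    have h2 : V * ‖z₁‖ * (l * q) ≤ V * ‖z₁‖ * (1 - C1 * (t₁ - T)) :=
      mul_le_mul_of_nonneg_left (by rw [hlq]; linarith) (by positivity)
    have h3 : l * (q * (V * ‖z₁‖)) ≤ l * inner ℝ (v T) z₁ := by linarith
    exact le_of_mul_le_mul_left h3 (by linarith)
  intro κ hκ
  obtain ⟨Cs, hCs, hsym⟩ := hΨ.exists_symm_bound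
  -- On μ = m one has V(1 + l)‖z‖ ≤ κ, so the weight is nonpositive on the inner boundary. The
  -- constant κ > 0 serves only this purpose and tends to 0 at the end.
  set m := min (κ / (V * (1 + l) * Cs)) r₁ with hm
  have hmpos : 0 < m := by
    have : 0 < 1 + l := by linarith
    positivity
  -- This C depends on κ through m. That is harmless: the bound to be obtained is 0, so the
  -- exponential factor plays no role, and the length of the time interval was fixed before.
  obtain ⟨C, hC, hCb⟩ := hF.exists_far_bound hT hmpos
  have hfact : ∀ t ∈ Icc T t₁, 0 ≤ 1 - C1 * (t - T) ∧ 1 - C1 * (t - T) ≤ 1 := fun t ht => by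
    have h1 : C1 * (t - T) ≤ C1 * (t₁ - T) := mul_le_mul_of_nonneg_left (by linarith [ht.2]) hC1pos.le
    have h2 : 0 ≤ C1 * (t - T) := mul_nonneg hC1pos.le (by linarith [ht.1])
    constructor <;> linarith
  have hCS : ∀ z, |inner ℝ (v T) z| ≤ V * ‖z‖ := fun z => abs_real_inner_le_norm _ _
  have key := hF.weighted_defect_le hT ht₁1 (fun y hy => by
      have := hS y (puncturedOpenBall_subset hy) 1
      rw [one_smul, mul_one] at this
      rw [defect, this, sub_self]) hmpos (C := C + 1) (by linarith) le_rfl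
    (w := fun t z => V * ‖z‖ * (1 - C1 * (t - T)) - l * inner ℝ (v T) z - κ) (by fun_prop) ?_ ?_
    t₁ ⟨ht₁.1, le_rfl⟩ z₁ (min_le_right _ _) hz₁.2.le
  · by_contra! hpos
    refine absurd key (not_le.2 ?_)
    have h1 : 0 < ‖VectorField.pullback ℝ (Ψ T) (defect (Jt t₁)) z₁‖ :=
      norm_pos_iff.2 fun h => hdef ((hΨ.pullback_eq_zero hz₁0).1 h)
    have h2 : 0 < 1 - ‖Ψ T z₁‖ ^ 2 := by nlinarith [norm_nonneg (Ψ T z₁), hz₁.2]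
    have h3 := Real.exp_pos (-(C + 1) * t₁)
    positivity
  · intro t ht z hz hz1
    refine mul_nonpos_of_nonpos_of_nonneg ?_ (sq_nonneg _)
    have h1 := hsym (Ψ T z)
    rw [Equiv.symm_apply_apply, hz] at h1
    have h2 : V * ‖z‖ * (1 - C1 * (t - T)) ≤ V * ‖z‖ :=
      mul_le_of_le_one_right (by positivity) (hfact t ht).2
    have h3 : -(l * inner ℝ (v T) z) ≤ l * (V * ‖z‖) := by
      rw [← mul_neg]
      exact mul_le_mul_of_nonneg_left ((neg_le_abs _).trans (hCS z)) (by linarith)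
    have h4 : V * (1 + l) * ‖z‖ ≤ V * (1 + l) * (Cs * (κ / (V * (1 + l) * Cs))) :=
      mul_le_mul_of_nonneg_left (h1.trans (mul_le_mul_of_nonneg_left (min_le_left _ _) hCs.le))
        (mul_nonneg hVpos.le (by linarith))
    have h5 : V * (1 + l) * (Cs * (κ / (V * (1 + l) * Cs))) = κ := by
      have : 1 + l ≠ 0 := by linarith
      field_simp
    linarith
  · intro t ht z hz hz1 hw _
    have htI : t ∈ Icc T t₁ := ⟨ht.1.le, ht.2⟩
    have ht01 : t ∈ Icc (0 : ℝ) 1 := ⟨hT.1.trans ht.1.le, ht.2.trans ht₁1⟩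
    have hz0 : z ≠ 0 := fun h => by
      rw [h, hΨ.map_zero, norm_zero] at hz
      linarith
    have hnd : DifferentiableAt ℝ (fun z : Cn n => ‖z‖) z := differentiableAt_id.norm ℝ hz0
    set L := fderiv ℝ (fun z : Cn n => ‖z‖) z with hL
    have hL1 : ∀ x, L x ≤ ‖x‖ := fun x => (Real.le_norm_self _).trans (by
      have h1 : ‖L‖ ≤ 1 := by
        have := norm_fderiv_le_of_lipschitz ℝ (x₀ := z) (lipschitzWith_one_norm (E := Cn n))
        simpa using this
      simpa using L.le_of_opNorm_le h1 x)
    have hfd : HasFDerivAt (fun z : Cn n => V * ‖z‖ * (1 - C1 * (t - T)) - l * inner ℝ (v T) z - κ)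
        ((1 - C1 * (t - T)) • (V • L) - l • innerSL ℝ (v T)) z := by
      refine ((((hnd.hasFDerivAt.const_mul V).mul_const _).sub
        ((innerSL ℝ (v T)).hasFDerivAt.const_mul l)).sub_const κ).congr_fderiv ?_
      rfl
    have hdt : HasDerivAt (fun t : ℝ => V * ‖z‖ * (1 - C1 * (t - T)) - l * inner ℝ (v T) z - κ)
        (V * ‖z‖ * (-(C1 * 1))) t :=
      ((((((hasDerivAt_id t).sub_const T).const_mul C1).const_sub 1).const_mul (V * ‖z‖)).sub_const
        _).sub_const κ
    refine ⟨_, hdt, hfd.differentiableAt, ?_⟩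
    rw [hfd.fderiv]
    simp only [_root_.sub_apply, _root_.smul_apply, smul_eq_mul, innerSL_apply_apply]
    set x := VectorField.pullback ℝ (Ψ T) (X t) z
    obtain ⟨hf0, hf1⟩ := hfact t htI
    have h1 : (1 - C1 * (t - T)) * (V * L x) ≤ V * ‖x‖ := by
      refine (mul_le_mul_of_nonneg_left (mul_le_mul_of_nonneg_left (hL1 x) hVpos.le) hf0).trans ?_
      exact mul_le_of_le_one_left (by positivity) hf1
    have h2 : (hF.growth T t z - (C + 1)) * (V * ‖z‖ * (1 - C1 * (t - T)) - l * inner ℝ (v T) z - κ) < 0 := by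
      refine mul_neg_of_neg_of_pos ?_ hw
      linarith [(hCb t ht01 z hz.le hz1).1]
    suffices h3 : V * ‖z‖ * (-(C1 * 1)) + (V * ‖x‖ - l * inner ℝ (v T) x) ≤ 0 by linarith
    by_cases hzd : ‖Ψ T z‖ < d0
    · have h4 := (hnear t ht01 (by
        rw [abs_of_nonneg (by linarith [ht.1])]
        linarith [ht.2]) z hz0 hzd).1
      have h5 : ‖x‖ ≤ V + e0 := by
        have := norm_add_le (x - v T) (v T)
        rw [sub_add_cancel] at this
        linarith
      have h6 : V * V - V * e0 ≤ inner ℝ (v T) x := by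
        have e1 : inner ℝ (v T) x = V * V + inner ℝ (v T) (x - v T) := by
          rw [inner_sub_right, real_inner_self_eq_norm_mul_norm]; ring
        have e2 := (abs_le.1 (hCS (x - v T))).1
        have e3 := mul_le_mul_of_nonneg_left h4.le hVpos.le
        linarith
      have h7 : 0 ≤ V * ‖z‖ * C1 := by positivity
      have h8 : V * ‖x‖ ≤ V * (V + e0) := mul_le_mul_of_nonneg_left h5 hVpos.le
      have h9 := mul_le_mul_of_nonneg_left h6 (show 0 ≤ l by linarith)
      have h10 : V * (e0 * (1 + l)) = V * ((l - 1) * V) := by rw [he0']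
      linarith
    · have h4 := (hfar t ht01 z (not_lt.1 hzd) hz1).2.1
      have h5 : d0 ≤ M * ‖z‖ := (not_lt.1 hzd).trans (hmM T hT z hz0).2
      have h6 : (1 + l) * B ≤ C1 * ‖z‖ := by
        rw [hC1, div_mul_eq_mul_div, le_div_iff₀ hd0]
        calc _ ≤ (1 + l) * B * (M * ‖z‖) := mul_le_mul_of_nonneg_left h5
              (mul_nonneg (by linarith) hB.le)
          _ = _ := by ring
      have h7 : -(l * inner ℝ (v T) x) ≤ l * (V * ‖x‖) := by
        rw [← mul_neg]
        exact mul_le_mul_of_nonneg_left ((neg_le_abs _).trans (hCS x)) (by linarith)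
      have h8 : V * (1 + l) * ‖x‖ ≤ V * (1 + l) * B :=
        mul_le_mul_of_nonneg_left h4 (mul_nonneg hVpos.le (by linarith))
      have h9 := mul_le_mul_of_nonneg_left h6 hVpos.le
      linarith

end IsSpecialFamily

/-! ### Positivity of Re θ(v) near the direction of v -/

namespace IsCircularRep

variable {n k : ℕ} {a : ℝ} {J : EndField n} {Ψ : Cn n ≃ Cn n} (hΨ : IsCircularRep k a J Ψ)
include hΨ

lemma exists_norm_mul_theta_bound (v : Cn n) :
    ∃ B : ℝ, 0 ≤ B ∧ ∀ z, z ≠ 0 → ‖Ψ z‖ * ‖theta Ψ z v‖ ≤ B := by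
  obtain ⟨C, hC⟩ := hΨ.exists_fderiv_bound
  refine ⟨|C| * ‖v‖, by positivity, fun z hz => ?_⟩
  have h0 : 0 < ‖Ψ z‖ := norm_pos_iff.2 (hΨ.map_ne_zero hz)
  have h1 : ‖theta Ψ z v‖ ≤ ‖fderiv ℝ Ψ z v‖ / ‖Ψ z‖ := by
    rw [theta, ballTheta, norm_div, norm_pow, Complex.norm_real, norm_norm,
      div_le_div_iff₀ (by positivity) h0]
    calc _ ≤ ‖Ψ z‖ * ‖fderiv ℝ Ψ z v‖ * ‖Ψ z‖ :=
          mul_le_mul_of_nonneg_right (norm_inner_le_norm _ _) h0.le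
      _ = _ := by ring
  calc _ ≤ ‖Ψ z‖ * (‖fderiv ℝ Ψ z v‖ / ‖Ψ z‖) := mul_le_mul_of_nonneg_left h1 h0.le
    _ = ‖fderiv ℝ Ψ z v‖ := by field_simp
    _ ≤ |C| * ‖v‖ := (fderiv ℝ Ψ z).le_of_opNorm_le ((hC z hz).trans (le_abs_self _)) v

/-- Near the direction of `v`, the component of `v` along the radial field is positive. -/
lemma exists_theta_pos (hk : 1 ≤ k) {v : Cn n} (hv : v ≠ 0) : ∃ q c : ℝ, 0 < q ∧ q < 1 ∧ 0 < c ∧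
    ∀ z, z ≠ 0 → q * (‖v‖ * ‖z‖) ≤ inner ℝ v z → c ≤ ‖Ψ z‖ * (theta Ψ z v).re := by
  have hV : 0 < ‖v‖ := norm_pos_iff.2 hv
  have hc : ContinuousAt (fun z => ‖Ψ z‖ * (theta Ψ z v).re) v :=
    hΨ.continuous.continuousAt.norm.mul
      (Complex.continuous_re.continuousAt.comp (hΨ.differentiableAt_theta hk hv v).continuousAt)
  have hval : ‖Ψ v‖ * (theta Ψ v v).re = ‖Ψ v‖ := by
    have := hΨ.theta_self hv 1
    rw [one_smul] at this
    rw [this, Complex.one_re, mul_one]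
  have hΨv : 0 < ‖Ψ v‖ := norm_pos_iff.2 (hΨ.map_ne_zero hv)
  obtain ⟨r, hr, hr'⟩ := Metric.eventually_nhds_iff.1 (hc.eventually (lt_mem_nhds
    (show ‖Ψ v‖ / 2 < ‖Ψ v‖ * (theta Ψ v v).re by rw [hval]; linarith)))
  -- If s z has length ‖v‖, the cone condition gives ‖s z − v‖² = 2‖v‖² − 2⟨v, s z⟩ ≤ r²/2, so s z
  -- is in the ball where positivity holds by continuity. The product μ Re θ(v) does not change
  -- under dilations.
  refine ⟨max (1 / 2) (1 - r ^ 2 / (4 * ‖v‖ ^ 2)), ‖Ψ v‖ / 2, lt_max_of_lt_left (by norm_num),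
    max_lt (by norm_num) (by
      have : 0 < r ^ 2 / (4 * ‖v‖ ^ 2) := by positivity
      linarith), by positivity, fun z hz hcone => ?_⟩
  have hz' : 0 < ‖z‖ := norm_pos_iff.2 hz
  set s := ‖v‖ / ‖z‖ with hs
  have hspos : 0 < s := by positivity
  have hsz : s * ‖z‖ = ‖v‖ := by rw [hs]; field_simp
  have h1 : dist (s • z) v < r := by
    rw [dist_eq_norm, ← abs_of_pos hr, ← abs_norm, ← sq_lt_sq, norm_sub_sq_real, norm_smul,
      Real.norm_eq_abs, abs_of_pos hspos, hsz, real_inner_smul_left, real_inner_comm]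
    have h2 : (1 - r ^ 2 / (4 * ‖v‖ ^ 2)) * (‖v‖ * ‖z‖) ≤ inner ℝ v z :=
      (mul_le_mul_of_nonneg_right (le_max_right _ _) (by positivity)).trans hcone
    have h3 := mul_le_mul_of_nonneg_left h2 hspos.le
    have h4 : s * ((1 - r ^ 2 / (4 * ‖v‖ ^ 2)) * (‖v‖ * ‖z‖)) = ‖v‖ ^ 2 - r ^ 2 / 4 := by
      calc _ = (1 - r ^ 2 / (4 * ‖v‖ ^ 2)) * ‖v‖ * (s * ‖z‖) := by ring
        _ = _ := by rw [hsz]; field_simp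
    have h5 : 0 < r ^ 2 := by positivity
    linarith
  have h2 := hr' h1
  have e1 : theta Ψ (s • z) v = theta Ψ z v / s := by
    rw [← Complex.coe_smul]
    exact hΨ.theta_smul_left hz (Complex.ofReal_ne_zero.2 hspos.ne') v
  have e2 : ‖Ψ (s • z)‖ * (theta Ψ (s • z) v).re = ‖Ψ z‖ * (theta Ψ z v).re := by
    rw [e1, hΨ.map_real_smul, norm_smul, Real.norm_eq_abs, abs_of_pos hspos, Complex.div_ofReal_re]
    field_simp
  rw [e2] at h2
  exact h2.le

end IsCircularRep

/-! ### Vanishing of the defect -/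

namespace IsSpecialFamily

variable {n k : ℕ} {a b : ℝ} {Jt : ℝ → EndField n} {X : ℝ → VField n} {v : ℝ → Cn n}
  {Ψ : ℝ → Cn n ≃ Cn n} {σ : ℝ → Cn n → ℝ}
  {Y : ℝ → (i : Fin n) → Aff i × ℂ → {j : Fin n // j ≠ i} → ℂ}
  (hF : IsSpecialFamily k a b Jt X v Ψ σ Y)
include hF

lemma exists_uniform_reflect {ε : ℝ} (hε : 0 < ε) :
    ∃ δ, 0 < δ ∧ ∀ t ∈ Icc (0 : ℝ) 1, ∀ y, y ≠ 0 → ‖y‖ < δ →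
      ‖Jt t y y - Jt t (-y) y‖ ^ 2 ≤ ε * ‖y‖ ^ 3 := by
  have h1 := (isCompact_Icc (a := (0 : ℝ)) (b := 1)).eventually_forall_of_forall_eventually
    (x₀ := (0 : Cn n)) (P := fun y t => t ∈ Icc (0 : ℝ) 1 → y ≠ 0 →
      ‖Jt t y y - Jt t (-y) y‖ ^ 2 ≤ ε * ‖y‖ ^ 3) fun T hT => by
    obtain ⟨δ, hδ, h⟩ := hF.exists_reflect hT hε
    filter_upwards [prod_mem_nhds (Metric.ball_mem_nhds (0 : Cn n) hδ) (Metric.ball_mem_nhds T hδ)]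
      with x hx ht hx0
    refine h x.2 ht ?_ x.1 hx0 (by simpa using hx.1)
    simpa [Real.dist_eq] using hx.2
  obtain ⟨δ, hδ, h2⟩ := Metric.eventually_nhds_iff.1 h1
  exact ⟨δ, hδ, fun t ht y hy hyδ => h2 (by simpa using hyδ) t ht ht hy⟩

/-- The maximum principle is applied with the weight μ⁻³. Near the origin the squared defect grows
along X at rate 2 Re φ up to small multiples of 1/μ, while the weight decays at rate about 3 Re φ;
in the cone containing the defect, Re φ is at least a positive multiple of 1/μ, so the net rate is
bounded above. The exponent has to exceed 2 for this sign, and 3 is also small enough for the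
reflection estimate to make the inner boundary term arbitrarily small. -/
lemma defect_eq_zero {T : ℝ} (hT : T ∈ Icc (0 : ℝ) 1) (hS : StandardOnZ (Jt T)) :
    ∃ δ, 0 < δ ∧ ∀ t ∈ Icc T (T + δ), t ≤ 1 → ∀ y ∈ puncturedOpenBall n, defect (Jt t) y = 0 := by
  have hΨ := hF.circular T hT
  have hk := hF.two_le
  obtain ⟨q, c, hq0, hq1, hc, hcone⟩ := hΨ.exists_theta_pos (by omega) (hF.guide_ne_zero T hT)
  obtain ⟨d1, hd1, hsupp⟩ := hF.defect_support hT hS hq0 hq1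
  obtain ⟨B, hB, hBb⟩ := hΨ.exists_norm_mul_theta_bound (v T)
  -- Near the origin μ times the net rate is at most 2ε − (c − ε) + 5(B + 1)ε = ε(8 + 5B) − c, which
  -- this choice makes negative.
  set ε := min 1 (c / (2 * (8 + 5 * B))) with hε
  have hεpos : 0 < ε := by positivity
  have hε1 : ε ≤ 1 := min_le_left _ _
  have hεc : ε * (8 + 5 * B) < c := by
    calc _ ≤ c / (2 * (8 + 5 * B)) * (8 + 5 * B) :=
          mul_le_mul_of_nonneg_right (min_le_right _ _) (by positivity)
      _ = c / 2 := by field_simp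
      _ < c := by linarith
  obtain ⟨d0, hd0, hnear⟩ := hF.exists_near hT hS hεpos
  -- In contrast with the cone estimate, C is fixed before the inner radius m, so the exponential
  -- factor survives the passage to the limit in m.
  obtain ⟨C, hC, hfar⟩ := hF.exists_far_bound hT (lt_min hd0 hεpos)
  obtain ⟨Ci, hCi, hinv⟩ := hΨ.exists_inverse_fderiv_bound
  refine ⟨min d1 (d0 / 2), by positivity, fun t₁ ht₁ ht₁1 y₁ hy₁ => ?_⟩
  have htd1 : t₁ ≤ T + d1 := ht₁.2.trans (by linarith [min_le_left d1 (d0 / 2)])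
  have htd0 : t₁ ≤ T + d0 / 2 := ht₁.2.trans (by linarith [min_le_right d1 (d0 / 2)])
  set z₁ := Ψ T |>.symm y₁ with hz₁
  have hΨz₁ : Ψ T z₁ = y₁ := Equiv.apply_symm_apply _ _
  have hz₁0 : z₁ ≠ 0 := hΨ.symm_ne_zero hy₁.1
  have hr₁ : 0 < ‖y₁‖ := norm_pos_iff.2 hy₁.1
  have h0 : ∀ y ∈ puncturedOpenBall n, defect (Jt T) y = 0 := fun y hy => by
    have := hS y (puncturedOpenBall_subset hy) 1
    rw [one_smul, mul_one] at this
    rw [defect, this, sub_self]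
  -- The number e bounds the inner boundary term; it tends to 0 as the inner radius shrinks, at a
  -- fixed point z₁.
  suffices h : ∀ e : ℝ, 0 < e → Real.exp (-(4 * C + 1) * t₁) * (1 - ‖Ψ T z₁‖ ^ 2) * (‖Ψ T z₁‖ ^ 3)⁻¹ *
      ‖VectorField.pullback ℝ (Ψ T) (defect (Jt t₁)) z₁‖ ^ 2 ≤ e by
    have h1 := le_of_forall_pos_le_add fun e he => (h e he).trans (zero_add e).ge
    by_contra hne
    have h2 : 0 < ‖VectorField.pullback ℝ (Ψ T) (defect (Jt t₁)) z₁‖ :=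
      norm_pos_iff.2 fun h => hne (by simpa [hΨz₁] using (hΨ.pullback_eq_zero hz₁0).1 h)
    have h3 : 0 < 1 - ‖Ψ T z₁‖ ^ 2 := by rw [hΨz₁]; nlinarith [hy₁.2]
    have h4 := Real.exp_pos (-(4 * C + 1) * t₁)
    have h5 : 0 < ‖Ψ T z₁‖ := by rw [hΨz₁]; exact hr₁
    refine absurd h1 (not_le.2 ?_)
    positivity
  intro e he
  obtain ⟨d2, hd2, href⟩ := hF.exists_uniform_reflect (show 0 < e / Ci ^ 2 by positivity)
  set m := min (d2 / 2) ‖y₁‖ with hm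
  have hmpos : 0 < m := by positivity
  have hmem : ∀ z, m ≤ ‖Ψ T z‖ → ‖Ψ T z‖ ≤ 1 → z ≠ 0 := fun z hz _ h => by
    rw [h, hΨ.map_zero, norm_zero] at hz
    linarith
  refine hF.weighted_defect_le hT ht₁1 h0 hmpos (C := 4 * C + 1) (by linarith) he.le
    (w := fun _ z => (‖Ψ T z‖ ^ 3)⁻¹) ?_ ?_ ?_ t₁ ⟨ht₁.1, le_rfl⟩ z₁
    (by rw [hΨz₁]; exact min_le_right _ _) (by rw [hΨz₁]; exact hy₁.2.le)
  · have hcn : Continuous fun x : ℝ × Cn n => ‖Ψ T x.2‖ ^ 3 :=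
      ((hΨ.continuous.comp continuous_snd).norm).pow 3
    refine hcn.continuousOn.inv₀ fun x hx => ?_
    exact (pow_pos (hmpos.trans_le hx.2.1) 3).ne'
  · intro t ht z hz hz1
    have ht01 : t ∈ Icc (0 : ℝ) 1 := ⟨hT.1.trans ht.1, ht.2.trans ht₁1⟩
    have hz0 : z ≠ 0 := hmem z hz.ge hz1.le
    have hy0 : Ψ T z ≠ 0 := hΨ.map_ne_zero hz0
    by_cases hdef : defect (Jt t) (Ψ T z) = 0
    · rw [(hΨ.pullback_eq_zero hz0).2 hdef]
      simpa using he.le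
    have hin := hsupp t ⟨ht.1, ht.2.trans htd1⟩ ht01.2 z ⟨hy0, hz1⟩ hdef
    have hneg : Ψ T (-z) = -Ψ T z := by simpa using hΨ.map_smul (-1) z
    -- The cone condition cannot hold at both z and −z. So J_t is standard at the opposite point,
    -- and the defect at y is the difference of J_t y y and J_t (−y) y, to which the reflection
    -- estimate applies.
    have hdef' : defect (Jt t) (-Ψ T z) = 0 := by
      by_contra hne
      rw [← hneg] at hne
      have h1 := hsupp t ⟨ht.1, ht.2.trans htd1⟩ ht01.2 (-z)
        ⟨by rw [hneg]; exact neg_ne_zero.2 hy0, by rw [hneg, norm_neg]; exact hz1⟩ hne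
      rw [norm_neg, inner_neg_right] at h1
      have h2 : 0 < q * (‖v T‖ * ‖z‖) := by
        have := norm_pos_iff.2 (hF.guide_ne_zero T hT)
        have := norm_pos_iff.2 hz0
        positivity
      linarith
    have h1 : defect (Jt t) (Ψ T z) = Jt t (Ψ T z) (Ψ T z) - Jt t (-Ψ T z) (Ψ T z) := by
      rw [defect, map_neg, smul_neg, sub_neg_eq_add, neg_add_eq_zero] at hdef'
      rw [defect, hdef']
    have h2 := href t ht01 (Ψ T z) hy0 (by rw [hz]; exact (min_le_left _ _).trans_lt (by linarith))
    rw [← h1] at h2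
    have h3 : ‖VectorField.pullback ℝ (Ψ T) (defect (Jt t)) z‖ ≤ Ci * ‖defect (Jt t) (Ψ T z)‖ :=
      ContinuousLinearMap.le_of_opNorm_le _ (hinv z hz0) _
    have hpos : 0 < ‖Ψ T z‖ := norm_pos_iff.2 hy0
    rw [inv_mul_le_iff₀ (by positivity)]
    calc _ ≤ (Ci * ‖defect (Jt t) (Ψ T z)‖) ^ 2 := pow_le_pow_left₀ (norm_nonneg _) h3 2
      _ = Ci ^ 2 * ‖defect (Jt t) (Ψ T z)‖ ^ 2 := by ring
      _ ≤ Ci ^ 2 * (e / Ci ^ 2 * ‖Ψ T z‖ ^ 3) := mul_le_mul_of_nonneg_left h2 (by positivity)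
      _ = ‖Ψ T z‖ ^ 3 * e := by field_simp
  · intro t ht z hz hz1 hw hdef
    have ht01 : t ∈ Icc (0 : ℝ) 1 := ⟨hT.1.trans ht.1.le, ht.2.trans ht₁1⟩
    have hz0 : z ≠ 0 := hmem z hz.le hz1.le
    have hpos : 0 < ‖Ψ T z‖ := norm_pos_iff.2 (hΨ.map_ne_zero hz0)
    have hin := hsupp t ⟨ht.1.le, ht.2.trans htd1⟩ ht01.2 z ⟨hΨ.map_ne_zero hz0, hz1⟩ hdef
    have hsq : DifferentiableAt ℝ (fun z => ‖Ψ T z‖ ^ 2) z := (hΨ.differentiableAt hz0).norm_sq ℝ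
    -- The weight is differentiated as a function of μ², because it is the derivative of μ² along X
    -- that is explicit.
    have hg : HasDerivAt (fun s : ℝ => (√s ^ 3)⁻¹)
        (-(3 * √(‖Ψ T z‖ ^ 2) ^ 2 * (1 / (2 * √(‖Ψ T z‖ ^ 2)))) / (√(‖Ψ T z‖ ^ 2) ^ 3) ^ 2)
        (‖Ψ T z‖ ^ 2) := by
      have h1 := ((Real.hasDerivAt_sqrt (x := ‖Ψ T z‖ ^ 2) (by positivity)).fun_pow 3).fun_inv
        (by rw [Real.sqrt_sq hpos.le]; positivity)
      exact h1.congr_deriv (by norm_num)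
    have hwd := hg.comp_hasFDerivAt z hsq.hasFDerivAt
    have hwd' : HasFDerivAt (fun z => (‖Ψ T z‖ ^ 3)⁻¹)
        ((-(3 * √(‖Ψ T z‖ ^ 2) ^ 2 * (1 / (2 * √(‖Ψ T z‖ ^ 2)))) / (√(‖Ψ T z‖ ^ 2) ^ 3) ^ 2) •
          fderiv ℝ (fun z => ‖Ψ T z‖ ^ 2) z) z := by
      refine hwd.congr_of_eventuallyEq (Eventually.of_forall fun z => ?_)
      simp only [Function.comp_apply, Real.sqrt_sq (norm_nonneg _)]
    refine ⟨0, hasDerivAt_const t _, hwd'.differentiableAt, ?_⟩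
    rw [hwd'.fderiv]
    simp only [_root_.smul_apply, smul_eq_mul, Real.sqrt_sq hpos.le]
    rw [hF.fderiv_normSq_pullback hT ht01 ⟨hΨ.map_ne_zero hz0, hz1.le⟩]
    set φ := theta (Ψ t) ((Ψ t).symm (Ψ T z)) (v t) with hφ
    set μ := ‖Ψ T z‖ with hμ
    have e1 : -(3 * μ ^ 2 * (1 / (2 * μ))) / (μ ^ 3) ^ 2 * (2 * μ ^ 2 * (φ.re * (1 - μ ^ 2)))
        = (μ ^ 3)⁻¹ * (-(3 * (φ.re * (1 - μ ^ 2)))) := by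
      field_simp
    rw [e1]
    -- For small μ the net rate is even negative; elsewhere growth ≤ C and −3 Re φ (1 − μ²) ≤ 3C,
    -- which accounts for the constant 4C + 1.
    have key : hF.growth T t z - 3 * (φ.re * (1 - μ ^ 2)) < 4 * C + 1 := by
      by_cases hzd : μ < min d0 ε
      · obtain ⟨-, n2, n3, n4⟩ := hnear t ht01 (by
          rw [abs_of_nonneg (by linarith [ht.1])]
          linarith [ht.2]) z hz0 (hzd.trans_le (min_le_left _ _))
        have hμε : μ < ε := hzd.trans_le (min_le_right _ _)
        rw [growth, ← hφ]
        set A := ‖fderiv ℝ (VectorField.pullback ℝ (Ψ T) (X t)) z‖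
        set E := ‖pullEnd (Ψ T) (Jt t) z - stdJ n‖
        have p1 : μ * ‖φ‖ ≤ B + ε := by
          have := norm_add_le (φ - theta (Ψ T) z (v T)) (theta (Ψ T) z (v T))
          rw [sub_add_cancel] at this
          have h2 := mul_le_mul_of_nonneg_left this hpos.le
          linarith [hBb z hz0]
        have p2 : c - ε ≤ μ * φ.re := by
          have h2 := (abs_le.1 (Complex.abs_re_le_norm (φ - theta (Ψ T) z (v T)))).1
          rw [Complex.sub_re] at h2
          have h3 := mul_le_mul_of_nonneg_left h2 hpos.le
          linarith [hcone z hz0 hin]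
        have p3 : μ * φ.re ≤ B + ε :=
          (mul_le_mul_of_nonneg_left (Complex.re_le_norm φ) hpos.le).trans p1
        have p4 : μ * ‖φ‖ * E ≤ (B + 1) * ε :=
          mul_le_mul (by linarith) n3.le (norm_nonneg _) (by linarith)
        have p5 : μ * φ.re * μ ^ 2 ≤ (B + 1) * ε := by
          have h1 : μ ^ 2 ≤ ε := by
            calc μ ^ 2 = μ * μ := sq μ
              _ ≤ ε * 1 := mul_le_mul hμε.le hz1.le hpos.le hεpos.le
              _ = ε := mul_one ε
          exact mul_le_mul (by linarith) h1 (sq_nonneg _) (by linarith)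
        have p6 : μ * (2 * A + 2 * φ.re + 2 * ‖φ‖ * E - 3 * (φ.re * (1 - μ ^ 2))) < 0 := by
          linarith
        have p7 := (pos_iff_neg_of_mul_neg p6).1 hpos
        linarith
      · obtain ⟨f1, -, f3⟩ := hfar t ht01 z (not_lt.1 hzd) hz1
        have h1 : -(φ.re * (1 - μ ^ 2)) ≤ C := by
          have h2 : -φ.re ≤ ‖φ‖ := (neg_le_abs _).trans (Complex.abs_re_le_norm φ)
          have h3 : 0 ≤ 1 - μ ^ 2 := by nlinarith
          calc _ = -φ.re * (1 - μ ^ 2) := by ring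
            _ ≤ ‖φ‖ * 1 := mul_le_mul h2 (by nlinarith) h3 (norm_nonneg _)
            _ ≤ C := by rw [mul_one]; exact f3
        linarith
    have hw' : 0 < (μ ^ 3)⁻¹ := hw
    calc _ = (μ ^ 3)⁻¹ * (hF.growth T t z - 3 * (φ.re * (1 - μ ^ 2)) - (4 * C + 1)) := by ring
      _ < 0 := mul_neg_of_pos_of_neg hw' (by linarith)

/-- Continuity method: the set of times without defect is closed because J_t is continuous in t, and
open to the right by the short-time result. -/
lemma standardOnZ (h0 : StandardOnZ (Jt 0)) : ∀ t ∈ Icc (0 : ℝ) 1, StandardOnZ (Jt t) := by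
  have hz : ∀ t ∈ Icc (0 : ℝ) 1, (∀ y ∈ puncturedOpenBall n, defect (Jt t) y = 0) →
      StandardOnZ (Jt t) := fun t ht h =>
    standardOnZ_of_defect h (hF.contDiffOn_J ht).continuousOn (hF.complexStructure t ht).sq
  set s : Set ℝ := {t | ∀ y ∈ puncturedOpenBall n, defect (Jt t) y = 0} with hs
  have hclosed : IsClosed (s ∩ Icc 0 1) := by
    rw [isClosed_iff_clusterPt]
    intro t ht
    have ht01 : t ∈ Icc (0 : ℝ) 1 :=
      isClosed_Icc.closure_subset_iff.2 inter_subset_right (mem_closure_iff_clusterPt.2 ht)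
    refine ⟨fun y hy => ?_, ht01⟩
    have hc : ContinuousWithinAt (fun t => defect (Jt t) y) (Icc 0 1) t := by
      have h1 : ContinuousWithinAt (fun t => Jt t y) (Icc 0 1) t :=
        hF.J_regular.contDiffOn.continuousOn.comp (f := fun t : ℝ => (t, y))
          (by fun_prop) (fun t ht => ⟨ht, puncturedOpenBall_subset hy⟩) t ht01
      exact (h1.clm_apply continuousWithinAt_const).sub continuousWithinAt_const
    have h2 : (𝓝[s ∩ Icc 0 1] t).NeBot := ht
    refine tendsto_nhds_unique_of_eventuallyEq (l := 𝓝[s ∩ Icc 0 1] t) (hc.mono inter_subset_right).tendsto tendsto_const_nhds ?_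
    filter_upwards [self_mem_nhdsWithin] with t ht using ht.1 y hy
  have hsub : Icc (0 : ℝ) 1 ⊆ s := by
    refine hclosed.Icc_subset_of_forall_mem_nhdsWithin (fun y hy => ?_) fun t ht => ?_
    · have := h0 y (puncturedOpenBall_subset hy) 1
      rw [one_smul, mul_one] at this
      rw [defect, this, sub_self]
    · have ht01 : t ∈ Icc (0 : ℝ) 1 := ⟨ht.2.1, ht.2.2.le⟩
      obtain ⟨δ, hδ, h⟩ := hF.defect_eq_zero ht01 (hz t ht01 ht.1)
      filter_upwards [Ioo_mem_nhdsGT (show t < min (t + δ) 1 from lt_min (by linarith) ht.2.2)] with r hr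
      exact h r ⟨hr.1.le, hr.2.le.trans (min_le_left _ _)⟩ (hr.2.le.trans (min_le_right _ _))
  exact fun t ht => hz t ht (hsub ht)

end IsSpecialFamily

/-! ### Concatenation of homotopies of complex structures -/

section Homotopy

variable {n : ℕ}

lemma goodSet_Icc_prod_blowDom (i : Fin n) : GoodSet (Icc (0 : ℝ) 1 ×ˢ blowDom i) := by
  obtain ⟨e, h1, h2, h3⟩ := exists_blowDom_diffeo i
  have hpre : Icc (0 : ℝ) 1 ×ˢ blowDom i
      = (Equiv.prodCongr (Equiv.refl ℝ) e) ⁻¹' (Icc (0 : ℝ) 1 ×ˢ {u : Cn n | ‖u i‖ ≤ 1}) := by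
    rw [h3]; rfl
  rw [hpre]
  refine GoodSet.preimage (Convex.goodSet ((convex_Icc 0 1).prod ?_) ?_) _
    (contDiff_fst.prodMk ((h1 1).comp contDiff_snd)) (contDiff_fst.prodMk ((h2 1).comp contDiff_snd))
  · have : {u : Cn n | ‖u i‖ ≤ 1} = (EuclideanSpace.proj i : Cn n →L[ℂ] ℂ).restrictScalars ℝ ⁻¹'
      Metric.closedBall 0 1 := by ext u; simp
    rw [this]
    exact (convex_closedBall _ _).linear_preimage _
  · refine ⟨(1 / 2, 0), mem_interior_iff_mem_nhds.2 (prod_mem_nhds (Icc_mem_nhds (by norm_num)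
      (by norm_num)) ?_)⟩
    have : Continuous fun u : Cn n => ‖u i‖ := (contDiff_coord (m := 0) i).continuous.norm
    filter_upwards [this.continuousAt.eventually_lt continuousAt_const
      (show ‖(0 : Cn n) i‖ < 1 by simp)] with u hu using hu.le

lemma HolderClassOn.comp_time {r : ℕ} {a : ℝ} (ha0 : 0 ≤ a) (ha : a ≤ 1) {i : Fin n} {F : Type}
    [NormedAddCommGroup F] [NormedSpace ℝ F] {G : ℝ × Cn n → F}
    (hG : HolderClassOn r a G (Icc (0 : ℝ) 1 ×ˢ blowDom i)) {φ : ℝ → ℝ} (hφ : ∀ m : ℕ, ContDiff ℝ m φ)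
    (hm : MapsTo φ (Icc 0 1) (Icc 0 1)) :
    HolderClassOn r a (fun x : ℝ × Cn n => G (φ x.1, x.2)) (Icc (0 : ℝ) 1 ×ˢ blowDom i) := by
  have hS := goodSet_Icc_prod_blowDom i
  have h : ∀ m : ℕ, ContDiff ℝ m fun x : ℝ × Cn n => (φ x.1, x.2) := fun m =>
    ((hφ m).comp contDiff_fst).prodMk contDiff_snd
  exact hG.comp_of_lip ha0 ha hS hS r (g := fun x : ℝ × Cn n => (φ x.1, x.2))
    (of_contDiffOn ha hS r (by exact_mod_cast (h (r + 1)).contDiffOn))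
    (fun x hx => hS.lip _ x hx (by exact_mod_cast (h 1).contDiffAt.contDiffWithinAt))
    fun x hx => ⟨hm hx.1, hx.2⟩

lemma pullEnd_congr {F : Cn n → Cn n} {J J' : EndField n} {u : Cn n} (h : J (F u) = J' (F u)) :
    pullEnd F J u = pullEnd F J' u := by
  rw [pullEnd, pullEnd, h]

lemma blowChart_mem {i : Fin n} {u : Cn n} (hu : u ∈ blowDom i) (hi : u i ≠ 0) :
    blowChart i u ∈ puncturedBall n := by
  refine ⟨fun h => hi ?_, hu⟩
  have := congrArg (fun z : Cn n => z i) h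
  simpa [blowChart] using this

/-- Families which agree at the junction can be concatenated smoothly. -/
lemma FamilyClassOnBlowUp.trans {r : ℕ} {a : ℝ} (ha0 : 0 ≤ a) (ha : a ≤ 1) {K L : ℝ → EndField n}
    (hK : FamilyClassOnBlowUp r a K) (hL : FamilyClassOnBlowUp r a L)
    (hKL : ∀ z ∈ puncturedBall n, K 1 z = L 0 z) {T : ℝ} (hT : T ∈ Icc (0 : ℝ) 1) :
    FamilyClassOnBlowUp r a fun s => if s ≤ 1 / 2 then K (Real.smoothTransition (3 * s)) else
      L (T * Real.smoothTransition (3 * s - 2)) := by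
  intro i
  obtain ⟨G, hG, hGK⟩ := hK i
  obtain ⟨H, hH, hHL⟩ := hL i
  have hS := goodSet_Icc_prod_blowDom i
  have hst : ∀ x, Real.smoothTransition x ∈ Icc (0 : ℝ) 1 := fun x =>
    ⟨Real.smoothTransition.nonneg x, Real.smoothTransition.le_one x⟩
  have hφ1 : MapsTo (fun s => Real.smoothTransition (3 * s)) (Icc 0 1) (Icc 0 1) := fun s _ => hst _
  have hφ2 : MapsTo (fun s => T * Real.smoothTransition (3 * s - 2)) (Icc 0 1) (Icc 0 1) := fun s _ =>
    ⟨mul_nonneg hT.1 (hst _).1, mul_le_one₀ hT.2 (hst _).1 (hst _).2⟩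
  have h0 : MapsTo (fun _ : ℝ => (0 : ℝ)) (Icc 0 1) (Icc 0 1) := fun s _ => ⟨le_rfl, zero_le_one⟩
  have c1 := hG.comp_time ha0 ha (fun m => Real.smoothTransition.contDiff.comp (by fun_prop)) hφ1
  have c2 := hH.comp_time ha0 ha
    (fun m => contDiff_const.mul (Real.smoothTransition.contDiff.comp (by fun_prop))) hφ2
  have c3 := (hH.comp_time ha0 ha (fun m => contDiff_const) h0).clm ha hS
    (-ContinuousLinearMap.id ℝ (Cn n →L[ℝ] Cn n))
  -- The extension is the sum G(φ₁) + H(φ₂) − H(0), regular without any gluing. For s ≤ 1/2 the last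
  -- two terms cancel since φ₂ = 0; for s > 1/2 one has φ₁ = 1, and G(1) = H(0) off the divisor by
  -- the matching hypothesis.
  refine ⟨_, HolderClassOn.add hS.unique r (HolderClassOn.add hS.unique r c1 c2) c3, ?_⟩
  intro s hs u hu hi
  have hmem := blowChart_mem hu hi
  simp only [_root_.neg_apply, ContinuousLinearMap.id_apply, Function.comp_apply]
  split_ifs with h
  · rw [Real.smoothTransition.zero_of_nonpos (x := 3 * s - 2) (by linarith), mul_zero,
      add_neg_cancel_right]
    exact hGK _ (hst _) u hu hi
  · rw [Real.smoothTransition.one_of_one_le (x := 3 * s) (by linarith), hGK 1 (by simp) u hu hi,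
      hHL 0 (by simp) u hu hi, pullEnd_congr (hKL _ hmem), add_neg_eq_iff_eq_add, add_comm]
    rw [hHL _ (hφ2 hs) u hu hi]

lemma ClassOnBlowUp.of_le {r s : ℕ} {a : ℝ} (ha : a ≤ 1) (hrs : r ≤ s) {J : EndField n}
    (hJ : ClassOnBlowUp s a J) : ClassOnBlowUp r a J := fun i =>
  let ⟨G, hG, h⟩ := hJ i
  ⟨G, hG.of_le ha goodSet_blowDom hrs, h⟩

lemma IsComplexStructure.of_le {r s : ℕ} {a : ℝ} (ha : a ≤ 1) (hrs : r ≤ s) {J : EndField n}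
    (hJ : IsComplexStructure s a J) : IsComplexStructure r a J :=
  ⟨hJ.regular.of_le ha hrs, hJ.sq, hJ.integrable⟩

/-- L-complex structures are preserved along families of complex structures that are standard on `𝓩`
and leave `𝓗` invariant. -/
lemma IsLStructure.of_family {r : ℕ} {a : ℝ} (ha0 : 0 ≤ a) (ha : a ≤ 1) {J : EndField n}
    (hJ : IsLStructure r a J) {Jt : ℝ → EndField n} (hJt : FamilyClassOnBlowUp r a Jt)
    (h0 : ∀ z ∈ puncturedBall n, Jt 0 z = J z)
    (h : ∀ t ∈ Icc (0 : ℝ) 1, IsComplexStructure r a (Jt t) ∧ StandardOnZ (Jt t) ∧ PreservesH (Jt t))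
    {T : ℝ} (hT : T ∈ Icc (0 : ℝ) 1) : IsLStructure r a (Jt T) := by
  obtain ⟨K, hK, hK0, hK1, hKs⟩ := hJ.homotopy
  obtain ⟨h1, h2, h3⟩ := h T hT
  have hst : ∀ x, Real.smoothTransition x ∈ Icc (0 : ℝ) 1 := fun x =>
    ⟨Real.smoothTransition.nonneg x, Real.smoothTransition.le_one x⟩
  refine ⟨h1, h2, h3, _, hK.trans ha0 ha hJt (fun z hz => (hK1 z hz).trans (h0 z hz).symm) hT,
    fun z hz => ?_, fun z _ => ?_, fun s _ => ?_⟩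
  · rw [if_pos (by norm_num), mul_zero, Real.smoothTransition.zero, hK0 z hz]
  · rw [if_neg (by norm_num), Real.smoothTransition.one_of_one_le (by norm_num), mul_one]
  · split_ifs
    · exact hKs _ (hst _)
    · exact h _ ⟨mul_nonneg hT.1 (hst _).1, mul_le_one₀ hT.2 (hst _).1 (hst _).2⟩

end Homotopy

/-- Families of special fields with explicit functions `Ỹ^α` are fundamental pairs. -/
theorem IsSpecialFamily.isFundamentalPair {n k : ℕ} {a b : ℝ} {J : EndField n} {Jt : ℝ → EndField n}
    {X : ℝ → VField n} {v : ℝ → Cn n} {Ψ : ℝ → Cn n ≃ Cn n} {σ : ℝ → Cn n → ℝ}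
    {Y : ℝ → (i : Fin n) → Aff i × ℂ → {j : Fin n // j ≠ i} → ℂ}
    (hF : IsSpecialFamily k a b Jt X v Ψ σ Y) (hJ : IsNormalForm k a J)
    (hv : HolderClassOn 1 b v (Icc 0 1)) (hJt : FamilyClassOnBlowUp (k - 1) a Jt)
    (hX : HolderClassOn 1 b (fun q : ℝ × Cn n => X q.1 q.2) (Icc (0 : ℝ) 1 ×ˢ puncturedBall n))
    (h0 : ∀ z ∈ puncturedBall n, Jt 0 z = J z) : IsFundamentalPair k a b J Jt X v Ψ := by
  have hk := hF.two_le
  have hZ := hF.standardOnZ fun z hz c => by rw [h0 z hz, hJ.standardOnZ z hz c]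
  refine ⟨hv, hF.guide_ne_zero, hF.J_regular, hX, fun t ht => ⟨?_, (hF.complexStructure t ht).regular⟩,
    hF.circular, fun t ht => (hF.circular t ht).special_isQuasiRegular hF.a_nonneg hF.a_le (by omega)
      (hF.special t ht), h0, hF.evolution⟩
  exact hJ.of_family hF.a_nonneg hF.a_le hJt h0 (fun s hs =>
    ⟨(hF.complexStructure s hs).of_le hF.a_le (Nat.sub_le k 1), hZ s hs, hF.preservesH s hs⟩) ht

end


theorem mainTheorem8 (n k : ℕ) (hn : 2 ≤ n) (hk : 2 ≤ k) (a b : ℝ)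
    (ha : 0 < a) (ha' : a < 1) (hb : 0 < b) (hb' : b < 1)
    (J : EndField n) (hJ : IsNormalForm k a J) :
    -- quasi-regular fields with vanishing `𝓩`-part of `𝓛_X J` on `𝓩` are the special fields
    (∀ (Ψ : Cn n ≃ Cn n) (v : Cn n) (X : VField n), IsCircularRep k a J Ψ →
      ((IsQuasiRegular k a Ψ v X ∧ LieDerZZVanishes J X) ↔
        ∃ (σ : Cn n → ℝ) (Y : (i : Fin n) → Aff i × ℂ → {j : Fin n // j ≠ i} → ℂ),
          IsSpecial k a Ψ v σ Y X)) ∧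
    -- the fields of a fundamental pair are special, with the explicit functions `Ỹ^α`
    (∀ (Jt : ℝ → EndField n) (X : ℝ → VField n) (v : ℝ → Cn n) (Ψ : ℝ → Cn n ≃ Cn n),
      IsFundamentalPair k a b J Jt X v Ψ →
        ∀ t ∈ Icc (0 : ℝ) 1,
          (∃ (σ : Cn n → ℝ) (Y : (i : Fin n) → Aff i × ℂ → {j : Fin n // j ≠ i} → ℂ),
            IsSpecial k a (Ψ t) (v t) σ Y (X t) ∧
            ∀ i, ∀ p ∈ polarDom (Ψ t) i, ∀ α,
              Y i p α = explicitY (Ψ t) i (Jt t) (v t) σ p α) ∧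
          ZbarCondition (Jt t) (X t)) ∧
    -- conversely
    (∀ (Jt : ℝ → EndField n) (X : ℝ → VField n) (v : ℝ → Cn n) (Ψ : ℝ → Cn n ≃ Cn n)
      (σ : ℝ → Cn n → ℝ)
      (Y : ℝ → (i : Fin n) → Aff i × ℂ → {j : Fin n // j ≠ i} → ℂ),
      HolderClassOn 1 b v (Icc 0 1) →
      (∀ t ∈ Icc (0 : ℝ) 1, v t ≠ 0) →
      FamilyClassOnBlowUp 1 b Jt →
      FamilyClassOnBlowUp (k - 1) a Jt →
      HolderClassOn 1 b (fun q : ℝ × Cn n => X q.1 q.2) (Icc (0 : ℝ) 1 ×ˢ puncturedBall n) →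
      (∀ m : ℕ, m ≤ k + 1 →
        ContinuousOn (fun q : ℝ × Cn n => iteratedFDeriv ℝ m (Ψ q.1) q.2)
          (Icc (0 : ℝ) 1 ×ˢ {0}ᶜ)) →
      (∀ t ∈ Icc (0 : ℝ) 1, IsComplexStructure k a (Jt t) ∧ PreservesH (Jt t)) →
      (∀ t ∈ Icc (0 : ℝ) 1, IsCircularRep k a (Jt t) (Ψ t)) →
      (∀ t ∈ Icc (0 : ℝ) 1, IsSpecial k a (Ψ t) (v t) (σ t) (Y t) (X t)) →
      (∀ t ∈ Icc (0 : ℝ) 1, ∀ i, ∀ p ∈ polarDom (Ψ t) i, ∀ α,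
        Y t i p α = explicitY (Ψ t) i (Jt t) (v t) (σ t) p α) →
      (∀ t ∈ Icc (0 : ℝ) 1, ZbarCondition (Jt t) (X t)) →
      SolvesEvolution J Jt X →
      IsFundamentalPair k a b J Jt X v Ψ) := by
  refine ⟨fun Ψ v X hΨ => hJ.quasiRegular_iff_special hk ha.le ha'.le hΨ,
    fun Jt X v Ψ hF t ht => hF.special hk ha.le ha'.le ht, ?_⟩
  intro Jt X v Ψ σ Y hv hv0 hJ1 hJk hX hΨr hJs hΨ hsp hY hZ hE
  have hF : IsSpecialFamily k a b Jt X v Ψ σ Y :=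
    ⟨hk, ha.le, ha'.le, hv.continuousOn, hv0, hJ1, by exact_mod_cast hX.contDiffOn, hΨr,
      fun t ht => (hJs t ht).1, fun t ht => (hJs t ht).2, hΨ, hsp, hY, hZ, hE.2⟩
  exact hF.isFundamentalPair hJ hv hJk hX hE.1
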